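/- **Conventions.** $X$ is a real or complex Banach space, $r\in\mathbb N\cup\{\infty\}$ if $X$ is real and $r=\omega$ if $X$ is complex ($\mathbb N<\infty<\omega$). For an open set $O$, $C^k_b(O)$ denotes the $C^k$ maps whose derivatives of all (finite) orders $\le k$ are bounded on $O$; $C^\omega_b(O)$ denotes the bounded complex analytic maps. The spectrum $\sigma$ of an operator on a real space is that of its complexification; for $\Lambda,\Gamma\subset\mathbb C$, $\Lambda\Gamma=\{\lambda\gamma\}$, $\Lambda^n=\Lambda\cdots\Lambda$ and $\Lambda^0=\{1\}$; $B_1^{\mathbb C}$ is the open unit disc. A local semiflow on $X$ is a map $\varphi:\mathcal D\to X$, with $\mathcal D\subset[0,\infty)\times X$ relatively open and $\{0\}\times X\subset\mathcal D$, such that $\varphi_0=\mathrm{id}$ and $\varphi_t\circ\varphi_s=\varphi_{t+s}$ wherever both sides are defined; $\mathcal D_t=\{x:(t,x)\in\mathcal D\}$. A fixed point $0$ is Lyapunov stable if for every $\varepsilon>0$ there is $\delta>0$ such that $|x|<\delta$ implies that $\varphi_t(x)$ is defined and $|\varphi_t(x)|<\varepsilon$ for all $t\ge0$. **Hypotheses.**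 (A.1) $\varphi$ is a local semiflow on $X$ with Lyapunov stable fixed point $0$, and there is an open neighbourhood $O$ of $0$ such that, for each fixed $t\ge 0$, $\varphi_t$ is of class $C^r_b$ on $\mathcal D_t\cap O$. (A.2) $X=X_0\oplus X_1$ with closed subspaces $X_0,X_1$ (inclusions $\imath_i$, projections $\widetilde P_i:X\to X_i$). The family $t\mapsto D\varphi_t(0)$ is a strongly continuous semigroup with generator $G$, $X_0\subset\mathrm{dom}(G)$, and $D\varphi_t(0)X_1\subset X_1$ for all $t\ge0$. There are $\tau>0$ and an integer $\ell$ with $1\le\ell<r$ such that, with $A=D\varphi_\tau(0)$ and $A_i=\widetilde P_iA\imath_i$, $$\sigma(A)\subset B_1^{\mathbb C},\qquad \sigma(A_0^{-1})\,\sigma(A)^{\ell+1}\subset B_1^{\mathbb C},\qquad \sigma(A_0)^{n-j}\sigma(A_1)^j\cap\sigma(A_0)=\emptyset\quad(2\le n\le\ell,\ 1\le j\le n).$$ ($A_0$ is automatically invertible.) For $0\le i\le\ell+1$, $(t,x_0)\mapsto D^i(\varphi_t\circ\imath_0)(x_0)$ is jointly continuous at every point of $[0,\infty)\times\{0\}$.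 (A.3) (optional) $\sigma(A_0)^n\cap\sigma(A_0)=\emptyset$ for $2\le n\le\ell$. **Solutions.** A $C^k_b$ solution $(\vartheta,\pi)$ consists of open neighbourhoods $V\subset U$ of $0$ in $X$, a $C^k_b$ map $\pi:U\to X_0$ with $\pi(0)=0$, $D\pi(0)|_{X_0}\in\mathrm{Aut}(X_0)$ and $\ker D\pi(0)=X_1$, and for each $t\ge0$ a map $\vartheta_t:\pi(V)\to\pi(U)$ that is a $C^k_b$ diffeomorphism onto its image, such that $\vartheta$ satisfies the semiflow property on $\pi(V)$ and, for all $t\ge0$, $\varphi_t$ is defined on $V$, $\varphi_t(V)\subset U$ and $$\pi\circ\varphi_t=\vartheta_t\circ\pi\quad\text{on }V .$$ A local flow extending $\vartheta$ is a map $\Theta:\mathcal D^\vartheta\to X_0$ on an open set $\mathcal D^\vartheta\subset\mathbb R\times X_0$ that contains $[0,\infty)\times\pi(V)$ and all $(-t,\vartheta_t(y))$ with $t\ge0$, $y\in\pi(V)$, with $\Theta_t=\vartheta_t$ on $\pi(V)$ for $t\ge0$, $\Theta_0=\mathrm{id}$, and $\Theta_{t+s}=\Theta_t\circ\Theta_s$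 for all $s,t\in\mathbb R$ wherever both sides are defined. **Theorem.** Suppose (A.1) and (A.2). (i) There is a $C^r_b$ solution $(\vartheta,\pi)$, with $\pi$ a submersion on $U$, such that: * if the restriction of $\varphi$ to $\mathcal D\cap([0,\infty)\times X_0)$ is jointly $C^k$ for some $0\le k\le r$ (for complex $X$, jointly $C^k$ in the sense of real calculus), then $\vartheta$ extends to a jointly $C^k$ local flow; * if $r\in\mathbb N\cup\{\infty\}$, $X_0$ is finite dimensional and $t\mapsto\varphi_t(x_0)$ is continuous for every $x_0\in X_0$, then $\vartheta$ extends to a jointly $C^r$ local flow. If (A.3) holds, then there is a $C^r_b$ solution $(\vartheta,\pi)$, with $\pi$ a submersion on $U$, in which $\vartheta$ is (the restriction of) a group $\mathbb R\to\mathrm{Aut}(X_0)$ of operators, with the same joint smoothness on $\mathbb R\times X_0$ under the same assumptions. (ii) Let $\ell+1\le k\le r$ ($k=\omega$ if $r=\omega$) and let $(\vartheta,\pi)$, $(\tilde\vartheta,\tilde\pi)$ be two $C^k_b$ solutions. Then there is a local $C^k_b$ diffeomorphism $\theta$ of $X_0$ at $0$, $\theta(0)=0$, unique as a germ at $0$,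 such that near $0$ $$\tilde\pi=\theta\circ\pi,\qquad \tilde\vartheta_t=\theta\circ\vartheta_t\circ\theta^{-1}\quad\text{for all }t\ge0,$$ the latter on one neighbourhood of $0$ for all $t\ge0$. If $\vartheta$ and $\tilde\vartheta$ are extended to local flows, the conjugacy also holds for every $t\in\mathbb R$, on a neighbourhood of $0$ that may depend on $t$. If (A.3) holds and all $\vartheta_t$ and $\tilde\vartheta_t$, $t\ge0$, are linear, then $\theta$ is linear near $0$. -/

import Mathlib

open Set Filter Topology
open scoped ContDiff Pointwise TensorProduct

noncomputable section

/-! ### Spectra -/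

/-- The spectrum, as a subset of `ℂ`, of a bounded operator `A` on a real or complex Banach space.
If the scalar field is real (`RCLike.I = 0`), it is the spectrum of the complexification
`ℂ ⊗ A` of `A` on `ℂ ⊗ E` (by the bounded inverse theorem, `ℂ ⊗ A - z` has a bounded inverse
iff it is bijective, so the algebraic spectrum is the usual one).
If the scalar field is complex, it is the usual spectrum in the algebra of bounded operators,
with `z : ℂ` read as the scalar `re z + im z * I`. -/
def cSpectrum (𝕜 : Type*) [RCLike 𝕜] {E : Type*} [NormedAddCommGroup E] [NormedSpace ℝ E]
    [NormedSpace 𝕜 E] [IsScalarTower ℝ 𝕜 E] (A : E →L[𝕜] E) : Set ℂ :=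
  {z : ℂ |
    ((RCLike.I : 𝕜) = 0 ∧
      z ∈ spectrum ℂ
        (LinearMap.baseChange ℂ ((A : E →ₗ[𝕜] E).restrictScalars ℝ) :
          Module.End ℂ (ℂ ⊗[ℝ] E))) ∨
    ((RCLike.I : 𝕜) ≠ 0 ∧ ((z.re : 𝕜) + (z.im : 𝕜) * RCLike.I) ∈ spectrum 𝕜 A)}

/-- The diagonal block `P̃ ∘ A ∘ ι : p → p` of `A` with respect to the splitting `p ⊕ q`. -/
def diagBlock {𝕜 : Type*} [RCLike 𝕜] {E : Type*} [NormedAddCommGroup E] [NormedSpace 𝕜 E]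
    {p q : Submodule 𝕜 E} (h : p.IsTopCompl q) (A : E →L[𝕜] E) : p →L[𝕜] p :=
  (p.projectionOntoL q h) ∘L A ∘L p.subtypeL

/-! ### The classes `C^k_b` -/

/-- `f` is of class `C^k_b` on the open set `O`: it is `C^k` and its derivatives of order `≤ k`
are bounded on `O`; for `k = ω`, `f` is analytic and bounded on `O`. -/
def CbOn (𝕜 : Type*) [RCLike 𝕜] {E F : Type*} [NormedAddCommGroup E] [NormedSpace 𝕜 E]
    [NormedAddCommGroup F] [NormedSpace 𝕜 F] (k : WithTop ℕ∞) (f : E → F) (O : Set E) : Prop :=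
  ContDiffOn 𝕜 k f O ∧
    ∀ i : ℕ, (i : WithTop ℕ∞) ≤ k → (k = ω → i = 0) →
      ∃ C : ℝ, ∀ x ∈ O, ‖iteratedFDeriv 𝕜 i f x‖ ≤ C

/-- `f` is a `C^k_b` diffeomorphism of (an open neighbourhood of) `S` onto its image, the image
being open and the inverse being of class `C^k_b` as well. If `S` is open this says that
`f : S → f(S)` is a `C^k_b` diffeomorphism between open sets. -/
def IsCbDiffeoOn (𝕜 : Type*) [RCLike 𝕜] {E : Type*} [NormedAddCommGroup E] [NormedSpace 𝕜 E]
    (k : WithTop ℕ∞) (f : E → E) (S : Set E) : Prop :=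
  ∃ N : Set E, IsOpen N ∧ S ⊆ N ∧ CbOn 𝕜 k f N ∧ IsOpen (f '' N) ∧
    ∃ g : E → E, CbOn 𝕜 k g (f '' N) ∧ ∀ x ∈ N, g (f x) = x

/-! ### Semiflows and semigroups -/

/-- `φ` is a local semiflow on `X` with domain `D`, a relatively open subset of `[0,∞) × X`
containing `{0} × X`; the semiflow identities hold wherever both sides are defined.
Values of `φ` off `D` are irrelevant. -/
structure IsLocalSemiflow {X : Type*} [TopologicalSpace X] (D : Set (ℝ × X)) (φ : ℝ → X → X) :
    Prop where
  relOpen : ∃ G : Set (ℝ × X), IsOpen G ∧ D = G ∩ (Ici (0 : ℝ) ×ˢ univ)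
  zero_mem : ∀ x, ((0 : ℝ), x) ∈ D
  map_zero : ∀ x, φ 0 x = x
  map_add : ∀ s t x, (s, x) ∈ D → (t, φ s x) ∈ D → (t + s, x) ∈ D →
    φ (t + s) x = φ t (φ s x)

/-- `0` is a Lyapunov stable fixed point: orbits that start close to `0` exist for all times
`t ≥ 0` and stay close to `0`. -/
structure IsLyapunovStableZero {X : Type*} [NormedAddCommGroup X] (D : Set (ℝ × X))
    (φ : ℝ → X → X) : Prop where
  fixed : ∀ t, 0 ≤ t → (t, (0 : X)) ∈ D ∧ φ t 0 = 0
  stable : ∀ ε > 0, ∃ δ > 0, ∀ x : X, ‖x‖ < δ → ∀ t, 0 ≤ t → (t, x) ∈ D ∧ ‖φ t x‖ < ε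

/-- `T` (restricted to `t ≥ 0`) is a strongly continuous semigroup of bounded operators. -/
structure IsC0Semigroup {𝕜 : Type*} [RCLike 𝕜] {X : Type*} [NormedAddCommGroup X]
    [NormedSpace 𝕜 X] (T : ℝ → X →L[𝕜] X) : Prop where
  map_zero : T 0 = ContinuousLinearMap.id 𝕜 X
  map_add : ∀ s t, 0 ≤ s → 0 ≤ t → T (t + s) = (T t) ∘L (T s)
  strongCont : ∀ x, Tendsto (fun t => T t x) (𝓝[>] 0) (𝓝 x)

/-- The domain of the infinitesimal generator `G x = lim_{t ↓ 0} (T t x - x) / t`. -/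
def generatorDomain {𝕜 : Type*} [RCLike 𝕜] {X : Type*} [NormedAddCommGroup X]
    [NormedSpace ℝ X] [NormedSpace 𝕜 X] (T : ℝ → X →L[𝕜] X) : Set X :=
  {x | ∃ y : X, Tendsto (fun t : ℝ => t⁻¹ • (T t x - x)) (𝓝[>] 0) (𝓝 y)}

/-! ### Solutions of the invariance equation -/

/-- `(ϑ, π)` is a `C^k_b` solution, over the open neighbourhoods `V ⊆ U` of `0`, of the invariance
equation `π ∘ φ_t = ϑ_t ∘ π` (`t ≥ 0`), with `π(0) = 0`, `Dπ(0)|_{X₀}` an automorphism of `X₀`,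
and with the fibres of `π` tangent to `X₁` at `0`. Each `ϑ_t : π(V) → π(U)` is a `C^k_b`
diffeomorphism onto its image and `ϑ` has the semiflow property on `π(V)`. -/
structure IsSolution {𝕜 : Type*} [RCLike 𝕜] {X : Type*} [NormedAddCommGroup X]
    [NormedSpace 𝕜 X] (X0 X1 : Submodule 𝕜 X) (D : Set (ℝ × X)) (φ : ℝ → X → X)
    (k : WithTop ℕ∞) (U V : Set X) (π : X → X0) (ϑ : ℝ → X0 → X0) : Prop where
  isOpen_U : IsOpen U
  isOpen_V : IsOpen V
  zero_mem : (0 : X) ∈ V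
  subset : V ⊆ U
  smooth : CbOn 𝕜 k π U
  map_zero : π 0 = 0
  deriv_aut : ∃ C : X0 ≃L[𝕜] X0, (fderiv 𝕜 π 0) ∘L X0.subtypeL = (C : X0 →L[𝕜] X0)
  tangent : ∀ x, fderiv 𝕜 π 0 x = 0 ↔ x ∈ X1
  mapsTo : ∀ t, 0 ≤ t → ∀ x ∈ V, (t, x) ∈ D ∧ φ t x ∈ U
  commutes : ∀ t, 0 ≤ t → ∀ x ∈ V, π (φ t x) = ϑ t (π x)
  diffeo : ∀ t, 0 ≤ t → IsCbDiffeoOn 𝕜 k (ϑ t) (π '' V)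
  flow_zero : ∀ y ∈ π '' V, ϑ 0 y = y
  flow_add : ∀ s t, 0 ≤ s → 0 ≤ t → ∀ y ∈ π '' V, ϑ s y ∈ π '' V → ϑ (t + s) y = ϑ t (ϑ s y)

/-- `π` is a submersion on `U`: its derivative is onto with complemented kernel. -/
def IsSubmersionOn {𝕜 : Type*} [RCLike 𝕜] {E F : Type*} [NormedAddCommGroup E]
    [NormedSpace 𝕜 E] [NormedAddCommGroup F] [NormedSpace 𝕜 F] (π : E → F) (U : Set E) : Prop :=
  ∀ x ∈ U, Function.Surjective (fderiv 𝕜 π x) ∧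
    (LinearMap.ker (fderiv 𝕜 π x : E →ₗ[𝕜] F)).ClosedComplemented

/-- `Θ`, with open domain `E ⊆ ℝ × Y`, is a local flow which extends the local semiflow `ϑ` on `S`:
`E` contains `[0,∞) × S` as well as all `(-t, ϑ_t y)` with `t ≥ 0`, `y ∈ S`, and the flow
identities hold for all positive and negative times, wherever both sides are defined. -/
structure IsLocalFlowExtension {Y : Type*} [TopologicalSpace Y] (S : Set Y) (ϑ : ℝ → Y → Y)
    (E : Set (ℝ × Y)) (Θ : ℝ → Y → Y) : Prop where
  isOpen : IsOpen E
  forward : ∀ t, 0 ≤ t → ∀ y ∈ S, (t, y) ∈ E ∧ Θ t y = ϑ t y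
  backward : ∀ t, 0 ≤ t → ∀ y ∈ S, (-t, ϑ t y) ∈ E
  map_zero : ∀ y, ((0 : ℝ), y) ∈ E → Θ 0 y = y
  map_add : ∀ s t y, (s, y) ∈ E → (t, Θ s y) ∈ E → (t + s, y) ∈ E → Θ (t + s) y = Θ t (Θ s y)

end

/-!
Why the theorem is true.

*Reduction to one map.* The family of differentials `Dφ_t(0)` restricts on `X₀`, modulo `X₁`, to a
norm continuous semigroup, hence to a group `exp(tG)` of automorphisms. It suffices to find, for the
single map `F = φ_τ` with `A = DF(0)` and `A₀ = exp(τG)`, a germ `π : X → X₀` tangent to the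
projection along `X₁`, and a map `h` of `X₀`, with `π ∘ F = h ∘ π` (`exists_semiconjugacy`). The
spectral radius formula, applied to `A` and `A₀⁻¹`, turns the spectral hypotheses into `‖Aⁿ‖ → 0`
and `‖A₀⁻ⁿ‖ ‖Aⁿ‖^(ℓ+1) → 0` (`tendsto_norm_pow_zero`, `tendsto_gap`).

*Existence.* The equation is first solved up to terms of order `ℓ + 1` by polynomials `π` and `h`.
In degree `n` this is a Sylvester equation for `n`-linear maps; splitting the arguments along
`X₀ ⊕ X₁`, the blocks with at least one argument from `X₁` are solvable by the nonresonance
condition, and the remaining block is absorbed into `h` (`BlockNonresonant`,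
`exists_multilinear_solution`). If there are no resonances on `X₀` either, nothing has to be
absorbed, and `h = A₀` is linear. The error being flat of order `ℓ + 1`, the sequence
`h⁻ⁿ ∘ π ∘ Fⁿ` then converges by the gap condition. Derivatives of higher order are obtained by
induction: the derivative of the limit solves an equation of the same type for the tangent map.

*Uniqueness.* Two semiconjugacies `π` and `π'` with the same tangent spaces of the fibres differ by
a change of coordinates in `X₀` (`semiconjugacy_unique`): their Taylor polynomials do, by
nonresonance, and flat differences are killed by the gap condition. Applied to two solutions, this
is the second part of the theorem. Applied to `π` and `π ∘ φ_t`, it yields the reduced maps `ϑ_t`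
with `π ∘ φ_t = ϑ_t ∘ π` (`IsSlowFibration.eventually_fibre`). As orbits tend to `0` and `h` is
injective, this holds on one neighbourhood of `0` for all `t ≥ 0` (`fibre_invariant`). The germs
`ϑ_t` commute with `h`; if `h` is linear and there are no resonances on `X₀`, then they are linear
(`eventuallyEq_linear_of_commute`).

*Extension to a flow.* The reduced maps are `C¹`-close to `exp(tG)`, so they are diffeomorphisms of
the forward invariant set `P` of all orbits from a small ball, and `ϑ_a(P)` is a neighbourhood of `0`
for some `a > 0` (`ReducedFlow.exists_injSemiflow`). The local flow maps `ϑ_a(z)` to `ϑ_{t+a}(z)`; it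
inherits joint smoothness for positive times (`InjSemiflow.localFlow_contDiffOn`). In finite
dimensions, the derivatives of `ϑ_t` are bounded uniformly in `t` on some interval, by Baire's
theorem, so time averages of `ϑ` are smooth. Since an average `I` close to the identity satisfies
`I(ϑ_t(y)) = ∫ χ(s - t) ϑ_s(y) ds`, the semiflow is jointly smooth (`contDiffOn_joint`).

*Bounds.* The classes `C^r_b` are treated through all finite orders `≤ r` simultaneously (`CbNat`);
over the complex numbers, Cauchy's estimates show that smooth bounded maps are analytic with bounded
derivatives on smaller balls.
-/

/-! ### Spectra of operators on real and complex Banach spaces -/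

namespace SlowFoliation

noncomputable section

section Complexification

variable (E : Type*) [NormedAddCommGroup E] [NormedSpace ℝ E]

/-- The complexification of a real normed space `E`, realized as the space of real-linear maps
`ℂ → E` with the operator norm; a complex number acts by precomposition with multiplication, so
that the norm is compatible with the complex scalars. -/
def Cplx : Type _ := ℂ →L[ℝ] E

instance : NormedAddCommGroup (Cplx E) := inferInstanceAs (NormedAddCommGroup (ℂ →L[ℝ] E))

instance [CompleteSpace E] : CompleteSpace (Cplx E) :=
  inferInstanceAs (CompleteSpace (ℂ →L[ℝ] E))

variable {E}

/-- A real-linear map `ℂ → E` as an element of the complexification. -/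
def Cplx.of (f : ℂ →L[ℝ] E) : Cplx E := f

/-- An element of the complexification as a real-linear map `ℂ → E`. -/
def Cplx.to (f : Cplx E) : ℂ →L[ℝ] E := f

@[simp] lemma Cplx.to_of (f : ℂ →L[ℝ] E) : (Cplx.of f).to = f := rfl
@[simp] lemma Cplx.to_add (f g : Cplx E) : (f + g).to = f.to + g.to := rfl
@[simp] lemma Cplx.to_zero : (0 : Cplx E).to = 0 := rfl
lemma Cplx.norm_to (f : Cplx E) : ‖f.to‖ = ‖f‖ := rfl

lemma Cplx.ext {f g : Cplx E} (h : ∀ w, f.to w = g.to w) : f = g :=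
  ContinuousLinearMap.ext h

instance : SMul ℂ (Cplx E) :=
  ⟨fun z f => Cplx.of (f.to ∘L (ContinuousLinearMap.mul ℝ ℂ z))⟩

@[simp] lemma Cplx.to_smul (z : ℂ) (f : Cplx E) (w : ℂ) : (z • f).to w = f.to (z * w) := rfl

instance : Module ℂ (Cplx E) where
  one_smul f := Cplx.ext fun w => by simp
  mul_smul a b f := Cplx.ext fun w => by simp only [Cplx.to_smul]; congr 1; ring
  smul_zero a := Cplx.ext fun w => by simp
  smul_add a f g := Cplx.ext fun w => by simp
  add_smul a b f := Cplx.ext fun w => by simp [add_mul]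
  zero_smul f := Cplx.ext fun w => by simp

instance : NormedSpace ℂ (Cplx E) where
  norm_smul_le z f := by
    refine ContinuousLinearMap.opNorm_le_bound (z • f).to (by positivity) fun w => ?_
    rw [Cplx.to_smul]
    refine (f.to.le_opNorm _).trans (le_of_eq ?_)
    rw [norm_mul, Cplx.norm_to]; ring

end Complexification

section LeftMultiplication

variable {R : Type*} [NormedRing R] [NormedAlgebra ℝ R]

/-- The action of an element of a real Banach algebra on the complexification of that algebra by
left multiplication. -/
def leftMulC (a : R) : Cplx R →L[ℂ] Cplx R :=
  LinearMap.mkContinuous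
    { toFun := fun f => Cplx.of ((ContinuousLinearMap.mul ℝ R a) ∘L f.to)
      map_add' := fun f g => Cplx.ext fun w => by simp
      map_smul' := fun z f => Cplx.ext fun w => by simp } ‖a‖ (fun f => by
      refine ContinuousLinearMap.opNorm_le_bound _ (by positivity) fun w => ?_
      calc ‖a * f.to w‖ ≤ ‖a‖ * (‖f.to‖ * ‖w‖) :=
            (norm_mul_le _ _).trans (by gcongr; exact f.to.le_opNorm w)
        _ = ‖a‖ * ‖f‖ * ‖w‖ := by rw [Cplx.norm_to]; ring)

@[simp] lemma leftMulC_apply (a : R) (f : Cplx R) (w : ℂ) : (leftMulC a f).to w = a * f.to w := rfl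

lemma leftMulC_mul (a b : R) : leftMulC (a * b) = leftMulC a * leftMulC b := by
  ext f; exact Cplx.ext fun w => by simp [mul_assoc]

lemma leftMulC_add (a b : R) : leftMulC (a + b) = leftMulC a + leftMulC b := by
  ext f; exact Cplx.ext fun w => by simp [add_mul]

lemma leftMulC_one : leftMulC (1 : R) = 1 := by
  ext f; exact Cplx.ext fun w => by simp

/-- Left multiplication on the complexification, as a homomorphism of rings. -/
def leftMulCHom : R →+* (Cplx R →L[ℂ] Cplx R) where
  toFun := leftMulC
  map_one' := leftMulC_one
  map_mul' := leftMulC_mul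
  map_zero' := by ext f; exact Cplx.ext fun w => by simp
  map_add' := leftMulC_add

@[simp] lemma leftMulCHom_apply (a : R) (f : Cplx R) (w : ℂ) :
    (leftMulCHom a f).to w = a * f.to w := rfl

lemma leftMulCHom_real (x : ℝ) : leftMulCHom (algebraMap ℝ R x) = algebraMap ℂ _ (x : ℂ) := by
  ext f
  refine Cplx.ext fun w => ?_
  rw [leftMulCHom_apply, Algebra.algebraMap_eq_smul_one, ContinuousLinearMap.algebraMap_apply,
    Cplx.to_smul, smul_mul_assoc, one_mul]
  rw [← Complex.real_smul, map_smul]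

lemma norm_leftMulC_le (a : R) : ‖leftMulCHom a‖ ≤ ‖a‖ :=
  (leftMulC a).opNorm_le_bound (norm_nonneg _) fun f => by
    refine ContinuousLinearMap.opNorm_le_bound _ (by positivity) fun w => ?_
    calc ‖a * f.to w‖ ≤ ‖a‖ * (‖f.to‖ * ‖w‖) :=
          (norm_mul_le _ _).trans (by gcongr; exact f.to.le_opNorm w)
      _ = ‖a‖ * ‖f‖ * ‖w‖ := by rw [Cplx.norm_to]; ring

/-- The constant map `w ↦ re w • b`. -/
def reConst (b : R) : Cplx R := Cplx.of (Complex.reCLM.smulRight b)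

@[simp] lemma reConst_apply (b : R) (w : ℂ) : (reConst b).to w = w.re • b := rfl

lemma norm_le_norm_leftMulC (a : R) : ‖a‖ ≤ ‖leftMulCHom a‖ * ‖(1 : R)‖ := by
  have h1 : ‖(leftMulCHom a (reConst 1)).to 1‖ = ‖a‖ := by simp
  have h2 : ‖reConst (1 : R)‖ ≤ ‖(1 : R)‖ := by
    refine ContinuousLinearMap.opNorm_le_bound _ (by positivity) fun w => ?_
    change ‖w.re • (1 : R)‖ ≤ _
    rw [norm_smul, mul_comm]
    gcongr
    exact Complex.abs_re_le_norm w
  calc ‖a‖ = ‖(leftMulCHom a (reConst 1)).to 1‖ := h1.symm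
    _ ≤ ‖(leftMulCHom a (reConst 1)).to‖ * ‖(1 : ℂ)‖ := ContinuousLinearMap.le_opNorm _ _
    _ ≤ ‖leftMulCHom a‖ * ‖reConst (1 : R)‖ := by
        rw [norm_one, mul_one, Cplx.norm_to]; exact ContinuousLinearMap.le_opNorm _ _
    _ ≤ _ := by gcongr

/-- Left multiplication reflects units. -/
lemma isUnit_of_leftMulC {a : R} (h : IsUnit (leftMulCHom a)) : IsUnit a := by
  obtain ⟨u, hu⟩ := h
  set b := ((↑u⁻¹ : Cplx R →L[ℂ] Cplx R) (reConst 1)).to 1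
  have hab : a * b = 1 := by
    have : leftMulCHom a ((↑u⁻¹ : Cplx R →L[ℂ] Cplx R) (reConst 1)) = reConst 1 := by
      rw [← hu, ← mul_apply_eq_comp, Units.mul_inv]; rfl
    have := congrArg (fun f => Cplx.to f 1) this
    simpa using this
  have h1 : leftMulCHom b * leftMulCHom a = 1 := by
    have h2 : leftMulCHom a * leftMulCHom b = 1 := by rw [← map_mul, hab, map_one]
    rw [← hu] at h2 ⊢
    rw [← Units.inv_eq_of_mul_eq_one_right h2, Units.inv_mul]
  have hba : b * a = 1 := by
    have := congrArg (fun f : Cplx R →L[ℂ] Cplx R => (f (reConst 1)).to 1) h1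
    simpa [← map_mul] using this
  exact ⟨⟨a, b, hab, hba⟩, rfl⟩

end LeftMultiplication

section Characters

variable {𝕜 : Type*} [RCLike 𝕜] {R : Type*} [NormedRing R] [NormedAlgebra 𝕜 R] [CompleteSpace R]

/-- Characters of commutative subalgebras: an element of a commutative subalgebra,
if it is not invertible in the ambient Banach algebra, is annihilated by a complex character which
does not vanish on the invertible elements. The character is obtained by Gelfand theory in the
double commutant of the subalgebra acting on the complexified algebra. -/
theorem exists_character (A : Subalgebra 𝕜 R) (hcommA : ∀ a ∈ A, ∀ b ∈ A, a * b = b * a)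
    (x : A) (hx : ¬ IsUnit (x : R)) :
    ∃ χ : A →+* ℂ,
      (∀ c : 𝕜, χ (algebraMap 𝕜 _ c) = (RCLike.re c : ℂ) + (RCLike.im c : ℂ) * Complex.I) ∧
      χ x = 0 ∧ ∀ y : A, IsUnit (y : R) → χ y ≠ 0 := by
  let : NormedAlgebra ℝ R := NormedAlgebra.restrictScalars ℝ 𝕜 R
  have hscal : ∀ r : ℝ, algebraMap ℝ R r = algebraMap 𝕜 R (r : 𝕜) := fun r => rfl
  set S' : Set (Cplx R →L[ℂ] Cplx R) := leftMulCHom '' (A : Set R) with hS'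
  have hcommS' : ∀ a ∈ S', ∀ b ∈ S', a * b = b * a := by
    rintro _ ⟨a, ha, rfl⟩ _ ⟨b, hb, rfl⟩
    rw [← map_mul, ← map_mul, hcommA a ha b hb]
  set C : Subalgebra ℂ (Cplx R →L[ℂ] Cplx R) :=
    Subalgebra.centralizer ℂ (Set.centralizer S') with hC
  have hSC : ∀ a ∈ S', a ∈ C := fun a ha => Set.subset_centralizer_centralizer ha
  have hcommC : ∀ a b : C, a * b = b * a := fun a b =>
    Subtype.ext (Set.centralizer_centralizer_comm_of_comm hcommS' _ a.2 _ b.2)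
  let : NormedCommRing C := { (inferInstance : NormedRing C) with mul_comm := hcommC }
  have hclosed : IsClosed (C : Set (Cplx R →L[ℂ] Cplx R)) := Set.isClosed_centralizer _
  have : CompleteSpace C := hclosed.completeSpace_coe
  -- inclusion of the real algebra in the commutative complex Banach algebra
  let ι : A →+* C :=
    { toFun := fun a => ⟨leftMulCHom (a : R), hSC _ ⟨a, a.2, rfl⟩⟩
      map_one' := Subtype.ext (map_one _)
      map_mul' := fun a b => Subtype.ext (map_mul _ _ _)
      map_zero' := Subtype.ext (map_zero _)
      map_add' := fun a b => Subtype.ext (map_add _ _ _) }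
  have hιu : ∀ y : A, IsUnit (y : R) → IsUnit (ι y) := by
    intro y hy
    obtain ⟨u, hu⟩ := hy.map leftMulCHom
    have hmem : (↑u⁻¹ : Cplx R →L[ℂ] Cplx R) ∈ C := by
      intro g hg
      have h1 := (ι y).2 g hg
      change g * leftMulCHom (y : R) = leftMulCHom (y : R) * g at h1
      rw [← hu] at h1
      rw [Units.mul_inv_eq_iff_eq_mul, mul_assoc, h1, ← mul_assoc, Units.inv_mul, one_mul]
    refine ⟨⟨ι y, ⟨_, hmem⟩, Subtype.ext ?_, Subtype.ext ?_⟩, rfl⟩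
    · change leftMulCHom (y : R) * (↑u⁻¹ : Cplx R →L[ℂ] Cplx R) = 1
      rw [← hu, Units.mul_inv]
    · change (↑u⁻¹ : Cplx R →L[ℂ] Cplx R) * leftMulCHom (y : R) = 1
      rw [← hu, Units.inv_mul]
  have hnot : ¬ IsUnit (ι x) := by
    intro h
    exact hx (isUnit_of_leftMulC (h.map C.val))
  obtain ⟨f, hf⟩ := WeakDual.CharacterSpace.exists_apply_eq_zero hnot
  let F : C →ₐ[ℂ] ℂ := WeakDual.CharacterSpace.toAlgHom f
  let χ₀ : A →+* ℂ := (F : C →+* ℂ).comp ι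
  have hχ₀x : χ₀ x = 0 := hf
  have hχ₀u : ∀ y : A, IsUnit (y : R) → χ₀ y ≠ 0 := fun y hy => ((hιu y hy).map F).ne_zero
  have hreal : ∀ r : ℝ, χ₀ (algebraMap 𝕜 A (r : 𝕜)) = r := by
    intro r
    have : ι (algebraMap 𝕜 A (r : 𝕜)) = algebraMap ℂ C (r : ℂ) := by
      refine Subtype.ext ?_
      change leftMulCHom (algebraMap 𝕜 R (r : 𝕜)) = algebraMap ℂ _ (r : ℂ)
      rw [← hscal, leftMulCHom_real]
    change F (ι _) = _
    rw [this, AlgHom.commutes]; rfl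
  have hdecomp : ∀ c : 𝕜, χ₀ (algebraMap 𝕜 A c) = (RCLike.re c : ℂ) +
      (RCLike.im c : ℂ) * χ₀ (algebraMap 𝕜 A RCLike.I) := by
    intro c
    conv_lhs => rw [← RCLike.re_add_im c]
    rw [map_add, map_mul, map_add, map_mul, hreal, hreal]
  rcases RCLike.I_mul_I (K := 𝕜) with hI | hI
  · refine ⟨χ₀, fun c => ?_, hχ₀x, hχ₀u⟩
    have him : RCLike.im c = 0 := by
      have := RCLike.im_eq_zero hI c
      exact this
    rw [hdecomp, him]; simp
  · have hsq : χ₀ (algebraMap 𝕜 A RCLike.I) * χ₀ (algebraMap 𝕜 A RCLike.I) = -1 := by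
      rw [← map_mul, ← map_mul, hI, map_neg, map_one, map_neg, map_one]
    have : χ₀ (algebraMap 𝕜 A RCLike.I) = Complex.I ∨
        χ₀ (algebraMap 𝕜 A RCLike.I) = -Complex.I := by
      apply sq_eq_sq_iff_eq_or_eq_neg.mp
      rw [sq, hsq, Complex.I_sq]
    rcases this with h | h
    · exact ⟨χ₀, fun c => by rw [hdecomp, h], hχ₀x, hχ₀u⟩
    · refine ⟨(starRingEnd ℂ).comp χ₀, fun c => ?_, ?_, fun y hy => ?_⟩
      · rw [RingHom.comp_apply, hdecomp, h]; simp
      · rw [RingHom.comp_apply, hχ₀x, map_zero]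
      · rw [RingHom.comp_apply]
        exact (map_ne_zero _).2 (hχ₀u y hy)

end Characters

section Spectrum

variable {𝕜 : Type*} [RCLike 𝕜] {E : Type*} [NormedAddCommGroup E] [NormedSpace ℝ E]
  [NormedSpace 𝕜 E] [IsScalarTower ℝ 𝕜 E]

/-- The real quadratic polynomial with roots `z` and `conj z`, evaluated at an operator. -/
def quadAt {R : Type*} [Ring R] [Algebra 𝕜 R] (A : R) (z : ℂ) : R :=
  (A - algebraMap 𝕜 R (z.re : 𝕜)) * (A - algebraMap 𝕜 R (z.re : 𝕜)) +
    algebraMap 𝕜 R (z.im : 𝕜) * algebraMap 𝕜 R (z.im : 𝕜)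

/-- An element of the complexification `ℂ ⊗ E` has a real and an imaginary part. -/
lemma exists_re_im (E : Type*) [AddCommGroup E] [Module ℝ E] (ζ : ℂ ⊗[ℝ] E) :
    ∃ u v : E, ζ = (1 : ℂ) ⊗ₜ u + Complex.I ⊗ₜ v := by
  induction ζ using TensorProduct.induction_on with
  | zero => exact ⟨0, 0, by simp⟩
  | tmul z e =>
    refine ⟨z.re • e, z.im • e, ?_⟩
    rw [← TensorProduct.smul_tmul, ← TensorProduct.smul_tmul, ← TensorProduct.add_tmul]
    congr 1
    apply Complex.ext <;> simp
  | add x y hx hy =>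
    obtain ⟨u, v, rfl⟩ := hx
    obtain ⟨u', v', rfl⟩ := hy
    exact ⟨u + u', v + v', by simp only [TensorProduct.tmul_add]; abel⟩

lemma re_im_injective {E : Type*} [AddCommGroup E] [Module ℝ E] {u v u' v' : E}
    (h : (1 : ℂ) ⊗ₜ[ℝ] u + Complex.I ⊗ₜ[ℝ] v = (1 : ℂ) ⊗ₜ[ℝ] u' + Complex.I ⊗ₜ[ℝ] v') :
    u = u' ∧ v = v' := by
  have h1 := congrArg ((TensorProduct.lid ℝ E : ℝ ⊗[ℝ] E →ₗ[ℝ] E) ∘ₗ (Complex.reLm.rTensor E)) h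
  have h2 := congrArg ((TensorProduct.lid ℝ E : ℝ ⊗[ℝ] E →ₗ[ℝ] E) ∘ₗ (Complex.imLm.rTensor E)) h
  simp at h1 h2
  exact ⟨h1, h2⟩

lemma re_im_eq_zero {E : Type*} [AddCommGroup E] [Module ℝ E] {u v : E}
    (h : (1 : ℂ) ⊗ₜ[ℝ] u + Complex.I ⊗ₜ[ℝ] v = 0) : u = 0 ∧ v = 0 :=
  re_im_injective (u' := 0) (v' := 0) (by rw [h]; simp)

lemma isUnit_quadAt_of_notMem [CompleteSpace E] (hI : (RCLike.I : 𝕜) = 0) {A : E →L[𝕜] E} {z : ℂ}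
    (hz : z ∉ cSpectrum 𝕜 A) : IsUnit (quadAt (𝕜 := 𝕜) A z) := by
  have hz' : z ∉ spectrum ℂ
        (LinearMap.baseChange ℂ ((A : E →ₗ[𝕜] E).restrictScalars ℝ) :
          Module.End ℂ (ℂ ⊗[ℝ] E)) := fun h => hz (Or.inl ⟨hI, h⟩)
  rw [spectrum.notMem_iff, Module.End.isUnit_iff] at hz'
  obtain ⟨hinj, hsurj⟩ := hz'
  set L := (algebraMap ℂ (Module.End ℂ (ℂ ⊗[ℝ] E)) z -
    LinearMap.baseChange ℂ ((A : E →ₗ[𝕜] E).restrictScalars ℝ)) with hL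
  have hre : ∀ (r : ℝ) (u : E), (algebraMap 𝕜 (E →L[𝕜] E) (r : 𝕜)) u = r • u := by
    intro r u
    rw [ContinuousLinearMap.algebraMap_apply, ← algebraMap_smul 𝕜 r u]
  have hLapp : ∀ u v : E, L ((1 : ℂ) ⊗ₜ u + Complex.I ⊗ₜ v) =
      (1 : ℂ) ⊗ₜ[ℝ] (z.re • u - z.im • v - A u) + Complex.I ⊗ₜ[ℝ] (z.im • u + z.re • v - A v) := by
    intro u v
    have e1 : z ⊗ₜ[ℝ] u = (1 : ℂ) ⊗ₜ[ℝ] (z.re • u) + Complex.I ⊗ₜ[ℝ] (z.im • u) := by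
      rw [← TensorProduct.smul_tmul, ← TensorProduct.smul_tmul, ← TensorProduct.add_tmul]
      congr 1; apply Complex.ext <;> simp
    have e2 : (z * Complex.I) ⊗ₜ[ℝ] v =
        (1 : ℂ) ⊗ₜ[ℝ] (-(z.im • v)) + Complex.I ⊗ₜ[ℝ] (z.re • v) := by
      rw [← neg_smul, ← TensorProduct.smul_tmul, ← TensorProduct.smul_tmul,
        ← TensorProduct.add_tmul]
      congr 1; apply Complex.ext <;> simp
    simp only [hL, LinearMap.sub_apply, map_add, Module.algebraMap_end_apply,
      TensorProduct.smul_tmul', smul_eq_mul, mul_one, LinearMap.baseChange_tmul, e1, e2,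
      LinearMap.restrictScalars_apply, ContinuousLinearMap.coe_coe, TensorProduct.tmul_sub,
      TensorProduct.tmul_add, TensorProduct.tmul_neg]
    abel
  have hAr : ∀ (r : ℝ) (u : E), A (r • u) = r • A u := fun r u =>
    (A.restrictScalars ℝ).map_smul r u
  have hQ : ∀ u, quadAt (𝕜 := 𝕜) A z u =
      A (A u - z.re • u) - z.re • (A u - z.re • u) + z.im • z.im • u := by
    intro u
    simp only [quadAt, add_apply, mul_apply_eq_comp,
      sub_apply, hre]
  have hbij : Function.Bijective (quadAt (𝕜 := 𝕜) A z : E →L[𝕜] E) := by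
    constructor
    · rw [injective_iff_map_eq_zero]
      intro e he
      rw [hQ] at he
      have h0 : L ((1 : ℂ) ⊗ₜ (A e - z.re • e) + Complex.I ⊗ₜ (z.im • e)) = 0 := by
        rw [hLapp]
        have : z.re • (A e - z.re • e) - z.im • z.im • e - A (A e - z.re • e) = 0 := by
          rw [← neg_eq_zero, ← he]; abel
        rw [this, hAr, smul_sub, smul_comm z.re z.im]
        simp
      have h1 := hinj (h0.trans (map_zero L).symm)
      have h2 := re_im_eq_zero h1
      have h3 : L ((1 : ℂ) ⊗ₜ e + Complex.I ⊗ₜ (0 : E)) = 0 := by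
        rw [hLapp, h2.2]
        have : z.re • e - A e = 0 := by rw [← neg_eq_zero, ← h2.1]; abel
        simp [this]
      have h4 := hinj (h3.trans (map_zero L).symm)
      exact (re_im_eq_zero h4).1
    · have key : ∀ e, ∃ u v, quadAt (𝕜 := 𝕜) A z u = A e - z.re • e ∧
          quadAt (𝕜 := 𝕜) A z v = z.im • e ∧ (z.im = 0 → A u - z.re • u = e) := by
        intro e
        obtain ⟨ζ, hζ⟩ := hsurj ((1 : ℂ) ⊗ₜ (-e))
        obtain ⟨u, v, rfl⟩ := exists_re_im E ζ
        rw [hLapp] at hζ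
        obtain ⟨h1, h2⟩ := re_im_injective (u' := -e) (v' := (0 : E)) (by simpa using hζ)
        have h1' : A u - z.re • u = e - z.im • v := by
          rw [← neg_inj, neg_sub, neg_sub, ← sub_eq_zero]
          rw [← sub_eq_zero] at h1
          rw [← h1]; abel
        have h2' : A v - z.re • v = z.im • u := by
          rw [← sub_eq_zero, ← neg_eq_zero, ← h2]; abel
        refine ⟨u, v, ?_, ?_, fun h => by rw [h1', h]; simp⟩
        · rw [hQ, h1', map_sub, hAr, ← h2', smul_sub, smul_sub, smul_comm z.re z.im v]
          abel
        · rw [hQ, h2', hAr]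
          have : A u = e - z.im • v + z.re • u := by rw [← h1']; abel
          rw [this, smul_add, smul_sub, smul_comm z.re z.im u]; abel
      intro e
      by_cases hy : z.im = 0
      · obtain ⟨u, -, -, -, hu⟩ := key e
        obtain ⟨u', -, hu', -, -⟩ := key u
        exact ⟨u', by rw [hu', hu hy]⟩
      · obtain ⟨-, v, -, hv, -⟩ := key (z.im⁻¹ • e)
        exact ⟨v, by rw [hv, smul_smul, mul_inv_cancel₀ hy, one_smul]⟩
  rw [ContinuousLinearMap.isUnit_iff_bijective]
  exact hbij

lemma isUnit_sub_of_notMem (hI : (RCLike.I : 𝕜) ≠ 0) {A : E →L[𝕜] E} {z : ℂ}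
    (hz : z ∉ cSpectrum 𝕜 A) :
    IsUnit (A - algebraMap 𝕜 (E →L[𝕜] E) ((z.re : 𝕜) + (z.im : 𝕜) * RCLike.I)) := by
  have hz' : ((z.re : 𝕜) + (z.im : 𝕜) * RCLike.I) ∉ spectrum 𝕜 A := fun h => hz (Or.inr ⟨hI, h⟩)
  rw [spectrum.notMem_iff] at hz'
  rw [← IsUnit.neg_iff, neg_sub]
  exact hz'

variable [CompleteSpace E]

/-- The value of a character at (the image under an action `Φ` of) an operator lies in the
spectrum of the operator. The action may reverse products. -/
lemma character_mem_cSpectrum {R : Type*} [NormedRing R] [NormedAlgebra 𝕜 R]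
    {A : Subalgebra 𝕜 R} {χ : A →+* ℂ}
    (hχ : ∀ c : 𝕜, χ (algebraMap 𝕜 _ c) = (RCLike.re c : ℂ) + (RCLike.im c : ℂ) * Complex.I)
    (hχu : ∀ y : A, IsUnit (y : R) → χ y ≠ 0)
    (Φ : (E →L[𝕜] E) →ₗ[𝕜] R) (h1 : Φ 1 = 1)
    (hmul : ∀ S T, S * T = T * S → Φ (S * T) = Φ S * Φ T) (B : E →L[𝕜] E) (y : A)
    (hy : (y : R) = Φ B) : χ y ∈ cSpectrum 𝕜 B := by
  have hu : ∀ S, IsUnit S → IsUnit (Φ S) := by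
    rintro _ ⟨u, rfl⟩
    refine ⟨⟨Φ u, Φ ↑u⁻¹, ?_, ?_⟩, rfl⟩
    · rw [← hmul _ _ (by simp), Units.mul_inv, h1]
    · rw [← hmul _ _ (by simp), Units.inv_mul, h1]
  have hc : ∀ c : 𝕜, Φ (algebraMap 𝕜 _ c) = algebraMap 𝕜 R c := by
    intro c
    rw [Algebra.algebraMap_eq_smul_one, map_smul, h1, ← Algebra.algebraMap_eq_smul_one]
  by_contra hz
  set z := χ y
  by_cases hI : (RCLike.I : 𝕜) = 0
  · have h := hu _ (isUnit_quadAt_of_notMem hI hz)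
    have hq : Φ (quadAt (𝕜 := 𝕜) B z) = ((quadAt (𝕜 := 𝕜) y z : A) : R) := by
      have hcomm : (algebraMap 𝕜 (E →L[𝕜] E) (z.im : 𝕜)) * (algebraMap 𝕜 _ (z.im : 𝕜)) =
        (algebraMap 𝕜 _ (z.im : 𝕜)) * (algebraMap 𝕜 _ (z.im : 𝕜)) := rfl
      simp only [quadAt, map_add, hmul _ _ rfl, map_sub, hc]
      simp [hy]
    rw [hq] at h
    apply hχu _ h
    simp only [quadAt, map_add, map_mul, map_sub, hχ]
    have e1 : (z - (z.re : ℂ)) = z.im * Complex.I := by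
      apply Complex.ext <;> simp
    simp only [RCLike.ofReal_re, RCLike.ofReal_im, Complex.ofReal_zero, zero_mul, add_zero]
    change (z - (z.re : ℂ)) * (z - (z.re : ℂ)) + z.im * z.im = 0
    rw [e1]
    linear_combination (z.im : ℂ) ^ 2 * Complex.I_mul_I
  · have h := hu _ (isUnit_sub_of_notMem hI hz)
    set c := (z.re : 𝕜) + (z.im : 𝕜) * RCLike.I with hcdef
    have hq : Φ (B - algebraMap 𝕜 _ c) = ((y - algebraMap 𝕜 A c : A) : R) := by
      rw [map_sub, hc]; simp [hy]
    rw [hq] at h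
    apply hχu _ h
    have him : (RCLike.im (RCLike.I : 𝕜) : ℝ) = 1 := RCLike.I_eq_zero_or_im_I_eq_one.resolve_left hI
    rw [map_sub, hχ]
    have hre : RCLike.re c = z.re := by simp [hcdef]
    have him : RCLike.im c = z.im := by simp [hcdef, him]
    rw [hre, him]
    change z - _ = 0
    rw [Complex.re_add_im, sub_self]

lemma mem_cSpectrum_or_of_not_isUnit {A : E →L[𝕜] E} {z : ℂ}
    (h : ¬ IsUnit (quadAt (𝕜 := 𝕜) A z)) :
    z ∈ cSpectrum 𝕜 A ∨ (starRingEnd ℂ) z ∈ cSpectrum 𝕜 A := by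
  by_contra! hz
  by_cases hI : (RCLike.I : 𝕜) = 0
  · exact h (isUnit_quadAt_of_notMem hI hz.1)
  · have h1 := isUnit_sub_of_notMem hI hz.1
    have h2 := isUnit_sub_of_notMem hI hz.2
    apply h
    have hII : (RCLike.I : 𝕜) * RCLike.I = -1 := (RCLike.I_mul_I (K := 𝕜)).resolve_left hI
    have hII' : algebraMap 𝕜 (E →L[𝕜] E) RCLike.I * algebraMap 𝕜 (E →L[𝕜] E) RCLike.I = -1 := by
      rw [← map_mul, hII]; simp
    convert h1.mul h2 using 1
    simp only [Complex.conj_re, Complex.conj_im, quadAt, map_add, map_mul, map_neg]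
    have c1 := Algebra.commutes (R := 𝕜) (RCLike.I : 𝕜) A
    have c2 := Algebra.commutes (R := 𝕜) (z.re : 𝕜) A
    have c3 := Algebra.commutes (R := 𝕜) (z.im : 𝕜) A
    have c4 := Algebra.commutes (R := 𝕜) (RCLike.I : 𝕜) (algebraMap 𝕜 (E →L[𝕜] E) (z.re : 𝕜))
    have c5 := Algebra.commutes (R := 𝕜) (RCLike.I : 𝕜) (algebraMap 𝕜 (E →L[𝕜] E) (z.im : 𝕜))
    have c6 := Algebra.commutes (R := 𝕜) (z.im : 𝕜) (algebraMap 𝕜 (E →L[𝕜] E) (z.re : 𝕜))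
    set x := algebraMap 𝕜 (E →L[𝕜] E) (z.re : 𝕜)
    set y := algebraMap 𝕜 (E →L[𝕜] E) (z.im : 𝕜)
    set i := algebraMap 𝕜 (E →L[𝕜] E) (RCLike.I : 𝕜)
    have e : y * y = - (y * i * (y * i)) := by
      calc y * y = - (y * y * (i * i)) := by rw [hII']; simp
        _ = _ := by rw [mul_assoc y i, ← mul_assoc i y i, c5]; noncomm_ring
    rw [e]
    have c7 : (y * i) * A = A * (y * i) := by rw [mul_assoc, c1, ← mul_assoc, c3, mul_assoc]
    have c8 : (y * i) * x = x * (y * i) := by rw [mul_assoc, c4, ← mul_assoc, c6, mul_assoc]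
    set w := y * i
    have : (A - (x + w)) * (A - (x + -y * i)) = (A - (x + w)) * (A - (x - w)) := by
      congr 2; simp [w, sub_eq_add_neg]
    rw [this]
    have : (A - (x + w)) * (A - (x - w)) = (A - x) * (A - x) + -(w * w) +
        ((A * w - w * A) - (x * w - w * x)) := by noncomm_ring
    rw [this, c7, c8]; simp

/-- Gelfand's formula in a real Banach algebra: `‖a ^ n‖ ^ (1 / n)` converges to the modulus of a
complex number `z` such that the real quadratic polynomial with the roots `z` and `conj z` is not
invertible at `a`. -/
theorem exists_not_isUnit_quadAt {R : Type*} [NormedRing R] [NormedAlgebra ℝ R] [CompleteSpace R]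
    [NormOneClass R] (A : R) :
    ∃ z : ℂ, ¬ IsUnit (quadAt (𝕜 := ℝ) A z) ∧
      Tendsto (fun n : ℕ => ‖A ^ n‖ ^ (1 / n : ℝ)) atTop (𝓝 ‖z‖) := by
  set a := leftMulCHom A with ha
  have hnorm : ∀ n : ℕ, ‖A ^ n‖ = ‖a ^ n‖ := by
    intro n
    rw [ha, ← map_pow]
    refine le_antisymm ?_ ?_
    · exact (norm_le_norm_leftMulC _).trans (by simp)
    · exact norm_leftMulC_le _
  have : Nontrivial (Cplx R →L[ℂ] Cplx R) := by
    refine ⟨⟨a ^ 0, 0, fun h => ?_⟩⟩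
    have := hnorm 0
    rw [h, pow_zero, norm_zero, norm_one] at this
    exact one_ne_zero this
  obtain ⟨z, hz, hzr⟩ := spectrum.exists_nnnorm_eq_spectralRadius a
  have hlim := spectrum.pow_norm_pow_one_div_tendsto_nhds_spectralRadius a
  rw [← hzr] at hlim
  have hlim2 : Tendsto (fun n : ℕ => ‖A ^ n‖ ^ (1 / n : ℝ)) atTop (𝓝 ‖z‖) := by
    have h := (ENNReal.tendsto_toReal (ENNReal.coe_ne_top)).comp hlim
    simp only [ENNReal.coe_toReal, coe_nnnorm] at h
    refine h.congr fun n => ?_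
    rw [Function.comp_apply, ENNReal.toReal_ofReal (by positivity), hnorm]
  have hnu : ¬ IsUnit (quadAt (𝕜 := ℝ) A z) := by
    intro h
    have h' := h.map leftMulCHom
    have hz' : (a - algebraMap ℂ _ z) * (a - algebraMap ℂ _ ((starRingEnd ℂ) z)) =
        leftMulCHom (quadAt (𝕜 := ℝ) A z) := by
      have hr : ∀ r : ℝ, leftMulCHom (algebraMap ℝ R r) =
          algebraMap ℂ (Cplx R →L[ℂ] Cplx R) (r : ℂ) := fun r =>
        leftMulCHom_real r
      simp only [quadAt, map_add, map_mul, map_sub, RCLike.ofReal_real_eq_id, id, hr, ← ha]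
      have c2 := Algebra.commutes (R := ℂ) z a
      have hs : algebraMap ℂ (Cplx R →L[ℂ] Cplx R) z +
          algebraMap ℂ _ ((starRingEnd ℂ) z) = algebraMap ℂ _ (z.re : ℂ) + algebraMap ℂ _ (z.re : ℂ) := by
        rw [← map_add, ← map_add]; congr 1; apply Complex.ext <;> simp
      have hp : algebraMap ℂ (Cplx R →L[ℂ] Cplx R) z *
          algebraMap ℂ _ ((starRingEnd ℂ) z) = algebraMap ℂ _ (z.re : ℂ) * algebraMap ℂ _ (z.re : ℂ) +
            algebraMap ℂ _ (z.im : ℂ) * algebraMap ℂ _ (z.im : ℂ) := by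
        rw [← map_mul, ← map_mul, ← map_mul, ← map_add]; congr 1; apply Complex.ext <;> simp; ring
      have c3 := Algebra.commutes (R := ℂ) (z.re : ℂ) a
      generalize algebraMap ℂ (Cplx R →L[ℂ] Cplx R) z = Z at *
      generalize algebraMap ℂ (Cplx R →L[ℂ] Cplx R) ((starRingEnd ℂ) z) = W at *
      generalize algebraMap ℂ (Cplx R →L[ℂ] Cplx R) (z.re : ℂ) = x at *
      generalize algebraMap ℂ (Cplx R →L[ℂ] Cplx R) (z.im : ℂ) = y at *
      calc (a - Z) * (a - W) = a * a - (Z * a + a * W) + Z * W := by noncomm_ring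
        _ = a * a - a * (Z + W) + Z * W := by rw [c2]; noncomm_ring
        _ = a * a - (x * a + a * x) + (x * x + y * y) := by rw [hs, hp, c3]; noncomm_ring
        _ = _ := by noncomm_ring
    rw [← hz'] at h'
    have hcomm : Commute (a - algebraMap ℂ _ z) (a - algebraMap ℂ _ ((starRingEnd ℂ) z)) := by
      apply Commute.sub_left
      · exact (Commute.refl a).sub_right (Algebra.commutes _ _).symm
      · exact (Algebra.commutes _ _)
    have := (hcomm.isUnit_mul_iff.1 h').1
    rw [← IsUnit.neg_iff, neg_sub] at this
    exact hz this
  exact ⟨z, hnu, hlim2⟩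

/-- Gelfand's formula for the spectrum of the complexification: `‖A ^ n‖ ^ (1 / n)` converges to
the modulus of a spectral value. -/
theorem tendsto_norm_pow_rpow (A : E →L[𝕜] E) [Nontrivial E] :
    ∃ z ∈ cSpectrum 𝕜 A, Tendsto (fun n : ℕ => ‖A ^ n‖ ^ (1 / n : ℝ)) atTop (𝓝 ‖z‖) := by
  let _ : NormedAlgebra ℝ (E →L[𝕜] E) := NormedAlgebra.restrictScalars ℝ 𝕜 (E →L[𝕜] E)
  obtain ⟨z, hnu, hlim⟩ := exists_not_isUnit_quadAt A
  rcases mem_cSpectrum_or_of_not_isUnit (A := A) (z := z) hnu with h | h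
  · exact ⟨z, h, hlim⟩
  · exact ⟨_, h, by rwa [RCLike.norm_conj]⟩

lemma tendsto_zero_of_rpow {f : ℕ → ℝ} (hf : ∀ n, 0 ≤ f n) {ρ : ℝ} (hρ : ρ < 1)
    (h : Tendsto (fun n : ℕ => f n ^ (1 / n : ℝ)) atTop (𝓝 ρ)) : Tendsto f atTop (𝓝 0) := by
  obtain ⟨q, hq1, hq2⟩ := exists_between hρ
  have hq0 : 0 ≤ q := (ge_of_tendsto' h fun n => Real.rpow_nonneg (hf n) _).trans hq1.le
  refine squeeze_zero' (Eventually.of_forall hf) ?_ (tendsto_pow_atTop_nhds_zero_of_lt_one hq0 hq2)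
  filter_upwards [h.eventually (gt_mem_nhds hq1), eventually_gt_atTop 0] with n hn hn0
  calc f n = (f n ^ (1 / n : ℝ)) ^ n := by
        rw [one_div, Real.rpow_inv_natCast_pow (hf n) hn0.ne']
    _ ≤ q ^ n := pow_le_pow_left₀ (Real.rpow_nonneg (hf n) _) hn.le n

/-- By the spectral radius formula, the powers of an operator with spectrum in the open unit disc
tend to `0`. -/
theorem tendsto_norm_pow_zero (A : E →L[𝕜] E) (hA : cSpectrum 𝕜 A ⊆ Metric.ball (0 : ℂ) 1) :
    Tendsto (fun n : ℕ => ‖A ^ n‖) atTop (𝓝 0) := by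
  rcases subsingleton_or_nontrivial E with h | h
  · refine tendsto_const_nhds.congr fun n => ?_
    rw [Subsingleton.elim (A ^ n) 0, norm_zero]
  · obtain ⟨z, hz, hlim⟩ := tendsto_norm_pow_rpow A
    exact tendsto_zero_of_rpow (fun n => norm_nonneg _) (by simpa using hA hz) hlim

/-- The spectral form of the domination of `B` by `A^m`: by the spectral radius formula, the product
of norms decays like the product of two points of the spectra. -/
theorem tendsto_gap {F : Type*} [NormedAddCommGroup F] [NormedSpace ℝ F] [NormedSpace 𝕜 F]
    [IsScalarTower ℝ 𝕜 F] [CompleteSpace F] (A : E →L[𝕜] E) (B : F →L[𝕜] F) {m : ℕ} (hm : m ≠ 0)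
    (h : cSpectrum 𝕜 B * cSpectrum 𝕜 A ^ m ⊆ Metric.ball (0 : ℂ) 1) :
    Tendsto (fun n : ℕ => ‖B ^ n‖ * ‖A ^ n‖ ^ m) atTop (𝓝 0) := by
  rcases subsingleton_or_nontrivial E with hE | hE
  · refine tendsto_const_nhds.congr fun n => ?_
    rw [Subsingleton.elim (A ^ n) 0, norm_zero, zero_pow hm, mul_zero]
  rcases subsingleton_or_nontrivial F with hF | hF
  · refine tendsto_const_nhds.congr fun n => ?_
    rw [Subsingleton.elim (B ^ n) 0, norm_zero, zero_mul]
  obtain ⟨z, hz, hlimz⟩ := tendsto_norm_pow_rpow A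
  obtain ⟨w, hw, hlimw⟩ := tendsto_norm_pow_rpow B
  refine tendsto_zero_of_rpow (fun n => by positivity) (ρ := ‖w‖ * ‖z‖ ^ m) ?_ ?_
  · have := h (Set.mul_mem_mul hw (Set.pow_mem_pow hz))
    simpa using this
  · refine (hlimw.mul (hlimz.pow m)).congr fun n => ?_
    rw [Real.mul_rpow (norm_nonneg _) (by positivity), ← Real.rpow_natCast, ← Real.rpow_mul
      (norm_nonneg _), mul_comm (1 / n : ℝ), Real.rpow_mul (norm_nonneg _), Real.rpow_natCast]

end Spectrum

/-! ### Sylvester operators on spaces of multilinear maps -/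

section Sylvester

variable {𝕜 : Type*} [RCLike 𝕜] {ι : Type*} [Fintype ι] [DecidableEq ι]
  {E : ι → Type*} [∀ i, NormedAddCommGroup (E i)] [∀ i, NormedSpace ℝ (E i)]
  [∀ i, NormedSpace 𝕜 (E i)] [∀ i, IsScalarTower ℝ 𝕜 (E i)] [∀ i, CompleteSpace (E i)]
  {Z : Type*} [NormedAddCommGroup Z] [NormedSpace ℝ Z] [NormedSpace 𝕜 Z] [IsScalarTower ℝ 𝕜 Z]
  [CompleteSpace Z]

/-- The Sylvester operator `q ↦ q ∘ (B i)ᵢ - C ∘ q` on multilinear maps. -/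
def sylvester {E : ι → Type*} [∀ i, NormedAddCommGroup (E i)] [∀ i, NormedSpace 𝕜 (E i)]
    {Z : Type*} [NormedAddCommGroup Z] [NormedSpace 𝕜 Z]
    (B : ∀ i, E i →L[𝕜] E i) (C : Z →L[𝕜] Z) :
    ContinuousMultilinearMap 𝕜 E Z →L[𝕜] ContinuousMultilinearMap 𝕜 E Z :=
  ContinuousMultilinearMap.compContinuousLinearMapL B -
    ContinuousLinearMap.compContinuousMultilinearMapL 𝕜 E Z Z C

/-- Actions `Φ i` and `Ψ` of operators on a Banach algebra: if the images of `B i` and `C` commute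
and no product of spectral values of the `B i` is a spectral value of `C`, then the difference of
the product of the images of the `B i` and of the image of `C` is invertible, since characters
separate the joint spectrum. The products over subsets are recorded by `t`. -/
theorem isUnit_prod_sub {R : Type*} [NormedRing R] [NormedAlgebra 𝕜 R] [CompleteSpace R]
    (B : ∀ i, E i →L[𝕜] E i) (C : Z →L[𝕜] Z)
    (Φ : ∀ i, (E i →L[𝕜] E i) →ₗ[𝕜] R) (Ψ : (Z →L[𝕜] Z) →ₗ[𝕜] R)
    (hΦ1 : ∀ i, Φ i 1 = 1) (hΨ1 : Ψ 1 = 1)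
    (hΦmul : ∀ i X Y, X * Y = Y * X → Φ i (X * Y) = Φ i X * Φ i Y)
    (hΨmul : ∀ X Y, X * Y = Y * X → Ψ (X * Y) = Ψ X * Ψ Y)
    (hcomm1 : ∀ i j, Φ i (B i) * Φ j (B j) = Φ j (B j) * Φ i (B i))
    (hcomm2 : ∀ i, Φ i (B i) * Ψ C = Ψ C * Φ i (B i))
    (t : Finset ι → R) (ht0 : t ∅ = 1) (ht : ∀ i s, i ∉ s → t (insert i s) = Φ i (B i) * t s)
    (h : ∀ z : ι → ℂ, (∀ i, z i ∈ cSpectrum 𝕜 (B i)) → ∏ i, z i ∉ cSpectrum 𝕜 C) :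
    IsUnit (t Finset.univ - Ψ C) := by
  set S : Set R := insert (Ψ C) (Set.range fun i => Φ i (B i)) with hS
  have hcommS : ∀ a ∈ S, ∀ b ∈ S, a * b = b * a := by
    rintro a (rfl | ⟨i, rfl⟩) b (rfl | ⟨j, rfl⟩)
    · rfl
    · exact (hcomm2 j).symm
    · exact hcomm2 i
    · exact hcomm1 i j
  obtain ⟨A, hA⟩ : ∃ A, A = Algebra.adjoin 𝕜 S := ⟨_, rfl⟩
  have hcommA : ∀ a ∈ A, ∀ b ∈ A, a * b = b * a := by
    intro a ha b hb
    have := Algebra.adjoin_le_centralizer_centralizer 𝕜 S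
    rw [hA] at ha hb
    exact Set.centralizer_centralizer_comm_of_comm hcommS _ (this ha) _ (this hb)
  have hSA : ∀ a ∈ S, a ∈ A := fun a ha => hA ▸ Algebra.subset_adjoin ha
  let y : ι → A := fun i => ⟨Φ i (B i), hSA _ (Or.inr ⟨i, rfl⟩)⟩
  let c : A := ⟨Ψ C, hSA _ (Or.inl rfl)⟩
  have hprod : ∀ s : Finset ι, ∃ u : A, (u : R) = t s ∧
      ∀ χ : A →+* ℂ, χ u = ∏ i ∈ s, χ (y i) := by
    intro s
    induction s using Finset.induction_on with
    | empty => exact ⟨1, by simp [ht0], fun χ => by simp⟩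
    | insert i s hi ih =>
      obtain ⟨u, hu, hχ⟩ := ih
      refine ⟨y i * u, ?_, fun χ => by rw [map_mul, hχ, Finset.prod_insert hi]⟩
      change Φ i (B i) * (u : R) = _
      rw [hu, ht i s hi]
  obtain ⟨u, hu, hχu'⟩ := hprod Finset.univ
  by_contra hnu
  rw [← hu] at hnu
  obtain ⟨χ, hχ, hχ0, hχu⟩ := exists_character A hcommA (u - c) hnu
  rw [map_sub, hχu', sub_eq_zero] at hχ0
  refine h (fun i => χ (y i)) (fun i => ?_) ?_
  · exact character_mem_cSpectrum hχ hχu (Φ i) (hΦ1 i) (hΦmul i) (B i) (y i) rfl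
  · rw [hχ0]
    exact character_mem_cSpectrum hχ hχu Ψ hΨ1 hΨmul C c rfl

open ContinuousMultilinearMap in
/-- If no product of spectral values of the `B i` is a spectral value of `C`, the Sylvester
operator is invertible: composition with a single `B i` and composition with `C` all commute. -/
theorem isUnit_sylvester (B : ∀ i, E i →L[𝕜] E i) (C : Z →L[𝕜] Z)
    (h : ∀ z : ι → ℂ, (∀ i, z i ∈ cSpectrum 𝕜 (B i)) → ∏ i, z i ∉ cSpectrum 𝕜 C) :
    IsUnit (sylvester B C) := by
  let M := ContinuousMultilinearMap 𝕜 E Z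
  let T : (∀ i, E i →L[𝕜] E i) → (M →L[𝕜] M) := fun f => compContinuousLinearMapL f
  have hTmul : ∀ f g, T f * T g = T (fun i => g i * f i) := by
    intro f g; ext q v; rfl
  let Φ : ∀ i, (E i →L[𝕜] E i) →ₗ[𝕜] (M →L[𝕜] M) := fun i =>
    (compContinuousLinearMapContinuousMultilinear 𝕜 E E Z).toMultilinearMap.toLinearMap
      (fun j => 1) i
  have hΦ : ∀ i X, Φ i X = T (Function.update (fun j => 1) i X) := fun i X => rfl
  let Ψ : (Z →L[𝕜] Z) →ₗ[𝕜] (M →L[𝕜] M) :=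
    (ContinuousLinearMap.compContinuousMultilinearMapL 𝕜 E Z Z : _ →ₗ[𝕜] _)
  have hT1 : T (fun j => 1) = 1 := by ext q v; rfl
  have main := isUnit_prod_sub (R := M →L[𝕜] M) B C Φ Ψ ?_ (by ext q v; rfl) ?_
    (fun X Y _ => by ext q v; rfl) ?_ (fun i => by ext q v; rfl)
    (fun s => T (s.piecewise B (fun j => 1))) (by simp only [Finset.piecewise_empty]; exact hT1)
    ?_ h
  · rw [Finset.piecewise_univ] at main
    exact main
  · intro i
    rw [hΦ, ← hT1]; congr 1
    exact Function.update_eq_self i (fun j => (1 : E j →L[𝕜] E j))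
  · intro i X Y hXY
    rw [hΦ, hΦ, hΦ, hTmul, hXY]
    congr 1
    funext j
    by_cases hj : j = i
    · subst hj; simp
    · simp [hj]
  · intro i j
    by_cases hij : i = j
    · subst hij; rfl
    rw [hΦ, hΦ, hTmul, hTmul]
    congr 1
    funext k
    by_cases hk : k = i
    · subst hk; simp [hij]
    · by_cases hk' : k = j
      · subst hk'; simp [hk]
      · simp [hk, hk']
  · intro i s hi
    rw [hΦ, hTmul]
    congr 1
    funext j
    by_cases hj : j = i
    · subst hj; simp [hi]
    · simp [hj, Finset.piecewise]

end Sylvester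

section Blocks

variable {𝕜 : Type*} [RCLike 𝕜] {X : Type*} [NormedAddCommGroup X] [NormedSpace 𝕜 X]
  {X0 X1 : Submodule 𝕜 X} {n : ℕ}

/-- The factors of the block of multilinear maps indexed by `S`: the arguments with index in `S`
are taken from `X1`, the others from `X0`. -/
def blockSpace (X0 X1 : Submodule 𝕜 X) (S : Finset (Fin n)) (i : Fin n) : Submodule 𝕜 X :=
  if i ∈ S then X1 else X0

lemma blockSpace_isTopCompl (hX : X0.IsTopCompl X1) (S : Finset (Fin n)) (i : Fin n) :
    (blockSpace X0 X1 S i).IsTopCompl (blockSpace X1 X0 S i) := by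
  unfold blockSpace
  split_ifs
  · exact hX.symm
  · exact hX

lemma blockSpace_mem {S : Finset (Fin n)} {i : Fin n} (hi : i ∈ S) :
    blockSpace X0 X1 S i = X1 := if_pos hi

lemma blockSpace_notMem {S : Finset (Fin n)} {i : Fin n} (hi : i ∉ S) :
    blockSpace X0 X1 S i = X0 := if_neg hi

/-- The diagonal blocks of `A` on the factors of the block indexed by `S`. -/
def blockOp (hX : X0.IsTopCompl X1) (A : X →L[𝕜] X) (S : Finset (Fin n)) (i : Fin n) :
    blockSpace X0 X1 S i →L[𝕜] blockSpace X0 X1 S i :=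
  diagBlock (blockSpace_isTopCompl hX S i) A

variable {Z : Type*} [NormedAddCommGroup Z] [NormedSpace 𝕜 Z]

/-- Nonresonance of the blocks of multilinear maps with at least `m` arguments from `X1`: the
Sylvester operators of these blocks are invertible. -/
def BlockNonresonant (hX : X0.IsTopCompl X1) (A : X →L[𝕜] X) (C : Z →L[𝕜] Z) (n m : ℕ) : Prop :=
  ∀ S : Finset (Fin n), m ≤ S.card →
    IsUnit (sylvester (blockOp hX A S) C)

/-- The cohomological equation for multilinear maps can be solved up to the blocks with less than
`m` arguments from `X1`. As `A` is block triangular, the blocks are treated in decreasing order of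
the number of arguments from `X1`. -/
theorem exists_multilinear_solution (hX : X0.IsTopCompl X1) {A : X →L[𝕜] X}
    (hA : ∀ x ∈ X1, A x ∈ X1) {C : Z →L[𝕜] Z} {m : ℕ} (hnr : BlockNonresonant hX A C n m)
    (R : ContinuousMultilinearMap 𝕜 (fun _ : Fin n => X) Z) :
    ∃ q : ContinuousMultilinearMap 𝕜 (fun _ : Fin n => X) Z, ∀ S : Finset (Fin n), m ≤ S.card →
      ∀ v : Fin n → X, (∀ i, v i ∈ blockSpace X0 X1 S i) →
        q (fun i => A (v i)) - C (q v) + R v = 0 := by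
  suffices h : ∀ d : ℕ, ∃ q : ContinuousMultilinearMap 𝕜 (fun _ : Fin n => X) Z,
      ∀ S : Finset (Fin n), m ≤ S.card → n + 1 ≤ S.card + d →
      ∀ v : Fin n → X, (∀ i, v i ∈ blockSpace X0 X1 S i) →
        q (fun i => A (v i)) - C (q v) + R v = 0 by
    obtain ⟨q, hq⟩ := h (n + 1)
    exact ⟨q, fun S hS => hq S hS (by omega)⟩
  intro d
  induction d with
  | zero =>
    refine ⟨0, fun S _ hS => ?_⟩
    have := Finset.card_le_univ S
    simp only [Fintype.card_fin] at this
    omega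
  | succ d ih =>
    obtain ⟨q, hq⟩ := ih
    have hsol : ∀ S : Finset (Fin n), ∃ u : ContinuousMultilinearMap 𝕜
        (fun i => blockSpace X0 X1 S i) Z, m ≤ S.card → ∀ w : ∀ i, blockSpace X0 X1 S i,
        u (fun i => blockOp hX A S i (w i)) - C (u w) =
          - (q (fun i => A (w i)) - C (q fun i => (w i : X)) + R fun i => (w i : X)) := by
      intro S
      by_cases hS : m ≤ S.card
      · obtain ⟨U, hU⟩ := hnr S hS
        let inc : ∀ i, blockSpace X0 X1 S i →L[𝕜] X := fun i => (blockSpace X0 X1 S i).subtypeL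
        let r := - ((q.compContinuousLinearMap fun _ => A).compContinuousLinearMap inc -
          C.compContinuousMultilinearMap (q.compContinuousLinearMap inc) +
          R.compContinuousLinearMap inc)
        refine ⟨U⁻¹.val r, fun _ w => ?_⟩
        have h1 : U.val (U⁻¹.val r) = r := by
          rw [← mul_apply_eq_comp, Units.mul_inv]; rfl
        rw [hU] at h1
        exact congrArg (fun g => g w) h1
      · exact ⟨0, fun h => absurd h hS⟩
    choose u hu using hsol
    let pr : ∀ (S : Finset (Fin n)) (i : Fin n), X →L[𝕜] blockSpace X0 X1 S i := fun S i =>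
      (blockSpace X0 X1 S i).projectionOntoL _ (blockSpace_isTopCompl hX S i)
    let F := Finset.univ.filter fun S : Finset (Fin n) => S.card + d = n ∧ m ≤ S.card
    refine ⟨q + ∑ S ∈ F, (u S).compContinuousLinearMap (pr S), ?_⟩
    intro S' hmS' hcard v hv
    have hAv : ∀ i ∈ S', A (v i) ∈ X1 := fun i hi => hA _ (by
      have := hv i; rwa [blockSpace_mem hi] at this)
    have hother : ∀ S ∈ F, S ≠ S' → ∀ v' : Fin n → X, (∀ i ∈ S', v' i ∈ X1) →
        (u S).compContinuousLinearMap (pr S) v' = 0 := by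
      intro S hS hne v' hv'
      have hSc : S.card + d = n := (Finset.mem_filter.1 hS).2.1
      obtain ⟨i, hi, hi'⟩ : ∃ i ∈ S', i ∉ S := by
        by_contra! hsub
        exact hne (Finset.eq_of_subset_of_card_le hsub (by omega)).symm
      rw [ContinuousMultilinearMap.compContinuousLinearMap_apply]
      refine (u S).map_coord_zero i ?_
      have : v' i ∈ blockSpace X1 X0 S i := by rw [blockSpace_notMem hi']; exact hv' i hi
      exact (Submodule.projectionOntoL_apply_eq_zero_iff _).2 this
    have hv1 : ∀ i ∈ S', v i ∈ X1 := fun i hi => by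
      have := hv i; rwa [blockSpace_mem hi] at this
    have hsplit : (q + ∑ S ∈ F, (u S).compContinuousLinearMap (pr S)) (fun i => A (v i)) -
        C ((q + ∑ S ∈ F, (u S).compContinuousLinearMap (pr S)) v) + R v =
        (q (fun i => A (v i)) - C (q v) + R v) +
        ∑ S ∈ F, ((u S).compContinuousLinearMap (pr S) (fun i => A (v i)) -
          C ((u S).compContinuousLinearMap (pr S) v)) := by
      simp only [add_apply, sum_apply, map_add,
        map_sum, Finset.sum_sub_distrib]
      abel
    rw [hsplit]
    by_cases hmem : S' ∈ F
    · rw [Finset.sum_eq_single S' (fun S hS hne => by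
        rw [hother S hS hne _ hAv, hother S hS hne _ hv1, map_zero, sub_zero])
        (fun h => absurd hmem h)]
      let w : ∀ i, blockSpace X0 X1 S' i := fun i => ⟨v i, hv i⟩
      have hw : ∀ i, pr S' i (v i) = w i := fun i =>
        Submodule.projectionOntoL_apply_left _ (w i)
      have hBw : ∀ i, pr S' i (A (v i)) = blockOp hX A S' i (w i) := fun i => rfl
      have := hu S' hmS' w
      simp only [ContinuousMultilinearMap.compContinuousLinearMap_apply, hw, hBw]
      rw [this]
      exact add_neg_cancel _
    · rw [Finset.sum_eq_zero (fun S hS => by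
        have hne : S ≠ S' := fun h => hmem (h ▸ hS)
        rw [hother S hS hne _ hAv, hother S hS hne _ hv1, map_zero, sub_zero]), add_zero]
      refine hq S' hmS' ?_ v hv
      simp only [F, Finset.mem_filter, Finset.mem_univ, true_and, not_and_or] at hmem
      omega

/-- Uniqueness in the cohomological equation for multilinear maps which vanish on `X0`. -/
theorem multilinear_eq_zero (hX : X0.IsTopCompl X1) {A : X →L[𝕜] X}
    (hA : ∀ x ∈ X1, A x ∈ X1) {C : Z →L[𝕜] Z} (hnr : BlockNonresonant hX A C n 1)
    (q : ContinuousMultilinearMap 𝕜 (fun _ : Fin n => X) Z)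
    (h0 : ∀ v : Fin n → X, (∀ i, v i ∈ X0) → q v = 0)
    (hq : ∀ S : Finset (Fin n), 1 ≤ S.card →
      ∀ v : Fin n → X, (∀ i, v i ∈ blockSpace X0 X1 S i) → q (fun i => A (v i)) = C (q v)) :
    q = 0 := by
  have h : ∀ (d : ℕ) (S : Finset (Fin n)), n ≤ S.card + d →
      ∀ v : Fin n → X, (∀ i, v i ∈ blockSpace X0 X1 S i) → q v = 0 := by
    intro d
    induction d with
    | zero => ?_
    | succ d ih => ?_
    all_goals
      intro S hS v hv
      rcases Finset.eq_empty_or_nonempty S with rfl | hne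
      · exact h0 v fun i => by have := hv i; rwa [blockSpace_notMem (by simp)] at this
      have hS1 : 1 ≤ S.card := hne.card_pos
      obtain ⟨U, hU⟩ := hnr S hS1
      let inc : ∀ i, blockSpace X0 X1 S i →L[𝕜] X := fun i => (blockSpace X0 X1 S i).subtypeL
      have hker : U.val (q.compContinuousLinearMap inc) = 0 := by
        rw [hU]
        ext w
        change q (fun i => (blockOp hX A S i (w i) : X)) - C (q fun i => (w i : X)) = 0
        rw [sub_eq_zero, ← hq S hS1 _ (fun i => (w i).2)]
        let a : Fin n → X := fun i => (blockOp hX A S i (w i) : X)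
        let b : Fin n → X := fun i => A (w i) - a i
        have hb : ∀ i, b i ∈ blockSpace X1 X0 S i := by
          intro i
          rw [← Submodule.projectionOntoL_apply_eq_zero_iff (blockSpace_isTopCompl hX S i), map_sub,
            sub_eq_zero]
          exact (Submodule.projectionOntoL_apply_left (blockSpace_isTopCompl hX S i)
            (blockOp hX A S i (w i))).symm
        have hbS : ∀ i ∈ S, b i = 0 := by
          intro i hi
          have hb' := hb i
          rw [blockSpace_mem hi] at hb'
          have h1 : A (w i) ∈ X1 := hA _ ((blockSpace_mem hi).le (w i).2)
          have h2 : a i ∈ X1 := (blockSpace_mem hi).le (blockOp hX A S i (w i)).2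
          exact Submodule.disjoint_def.1 hX.isCompl.disjoint _ hb' (sub_mem h1 h2)
        have hab : (fun i => A (w i)) = a + b := by funext i; simp [b]
        rw [hab, ContinuousMultilinearMap.map_add_univ, Finset.sum_eq_single Finset.univ]
        · simp [a]
        · intro T _ hT
          by_cases hTS : ∃ i, i ∉ T ∧ i ∈ S
          · obtain ⟨i, hiT, hiS⟩ := hTS
            exact q.map_coord_zero i (by simp [hiT, hbS i hiS])
          · push Not at hTS
            obtain ⟨j, hj⟩ : ∃ j, j ∉ T := by
              by_contra! h; exact hT (Finset.eq_univ_iff_forall.2 h)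
            have hlt : S.card < (S ∪ Tᶜ).card := Finset.card_lt_card <|
              (Finset.ssubset_iff_of_subset Finset.subset_union_left).2 ⟨j, by simp [hj], hTS j hj⟩
            have hmem : ∀ i, T.piecewise a b i ∈ blockSpace X0 X1 (S ∪ Tᶜ) i := by
              intro i
              by_cases hi : i ∈ T
              · have : blockSpace X0 X1 (S ∪ Tᶜ) i = blockSpace X0 X1 S i := by
                  simp [blockSpace, hi]
                rw [this]
                simp only [hi, Finset.piecewise_eq_of_mem]
                exact (blockOp hX A S i (w i)).2
              · rw [blockSpace_mem (by simp [hi])]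
                simp only [hi, not_false_eq_true, Finset.piecewise_eq_of_notMem]
                have := hb i
                rwa [blockSpace_notMem (hTS i hi)] at this
            first
            | exact ih (S ∪ Tᶜ) (by omega) _ hmem
            | exfalso
              have := Finset.card_le_univ (S ∪ Tᶜ)
              simp only [Fintype.card_fin] at this
              omega
        · exact fun h => absurd (Finset.mem_univ _) h
      have hz : q.compContinuousLinearMap inc = 0 := by
        have := congrArg (fun g => U⁻¹.val g) hker
        simp only [map_zero] at this
        rwa [← mul_apply_eq_comp, Units.inv_mul] at this
      exact congrArg (fun g => g (fun i => (⟨v i, hv i⟩ : blockSpace X0 X1 S i))) hz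
  ext v
  let P0 := X0.projectionL X1 hX
  let P1 := X1.projectionL X0 hX.symm
  have hv : v = (fun i => P1 (v i)) + (fun i => P0 (v i)) := by
    funext i
    have := congrArg (fun L : X →L[𝕜] X => L (v i)) (Submodule.projectionL_add_projectionL_eq_id hX)
    simp only [add_apply, ContinuousLinearMap.id_apply] at this
    rw [Pi.add_apply, add_comm]; exact this.symm
  rw [hv, ContinuousMultilinearMap.map_add_univ]
  refine Finset.sum_eq_zero fun T _ => h n T (by omega) _ fun i => ?_
  by_cases hi : i ∈ T
  · rw [blockSpace_mem hi]
    simp only [hi, Finset.piecewise_eq_of_mem]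
    exact Submodule.projectionL_apply_mem _ _
  · rw [blockSpace_notMem hi]
    simp only [hi, not_false_eq_true, Finset.piecewise_eq_of_notMem]
    exact Submodule.projectionL_apply_mem _ _

end Blocks

section Nonresonance

variable {𝕜 : Type*} [RCLike 𝕜] {X : Type*} [NormedAddCommGroup X] [NormedSpace ℝ X]
  [NormedSpace 𝕜 X] [IsScalarTower ℝ 𝕜 X] [CompleteSpace X]
  {X0 X1 : Submodule 𝕜 X}
  {Z : Type*} [NormedAddCommGroup Z] [NormedSpace ℝ Z] [NormedSpace 𝕜 Z] [IsScalarTower ℝ 𝕜 Z]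
  [CompleteSpace Z]

lemma completeSpace_of_isTopCompl {X : Type*} [NormedAddCommGroup X] [NormedSpace 𝕜 X]
    [CompleteSpace X] {X0 X1 : Submodule 𝕜 X} (hX : X0.IsTopCompl X1) : CompleteSpace X0 :=
  hX.isClosed.completeSpace_coe

/-- The spectral nonresonance conditions imply the invertibility of the Sylvester operators on the
blocks: a block with `j` arguments from `X₁` has the spectral factors `σ(A₀)^(n-j) σ(A₁)^j`. -/
lemma blockNonresonant_of_spectrum (hX : X0.IsTopCompl X1) (A : X →L[𝕜] X) (C : Z →L[𝕜] Z)
    (n m : ℕ) (h : ∀ j, m ≤ j → j ≤ n →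
      (cSpectrum 𝕜 (diagBlock hX A) ^ (n - j) * cSpectrum 𝕜 (diagBlock hX.symm A) ^ j) ∩
        cSpectrum 𝕜 C = ∅) : BlockNonresonant hX A C n m := by
  intro S hS
  have : ∀ i, CompleteSpace (blockSpace X0 X1 S i) := fun i =>
    completeSpace_of_isTopCompl (blockSpace_isTopCompl hX S i)
  refine isUnit_sylvester _ _ fun z hz hC => ?_
  have hcard : S.card ≤ n := by simpa using Finset.card_le_univ S
  have hgen : ∀ (Y Y' : Submodule 𝕜 X) (hY : Y.IsTopCompl Y'),
      (Y = X0 → Y' = X1 → cSpectrum 𝕜 (diagBlock hY A) = cSpectrum 𝕜 (diagBlock hX A)) ∧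
      (Y = X1 → Y' = X0 → cSpectrum 𝕜 (diagBlock hY A) = cSpectrum 𝕜 (diagBlock hX.symm A)) := by
    intro Y Y' hY
    constructor <;> (rintro rfl rfl; rfl)
  have hz1 : ∀ i ∈ S, z i ∈ cSpectrum 𝕜 (diagBlock hX.symm A) := by
    intro i hi
    rw [← (hgen _ _ (blockSpace_isTopCompl hX S i)).2 (blockSpace_mem hi) (blockSpace_mem hi)]
    exact hz i
  have hz0 : ∀ i ∈ Sᶜ, z i ∈ cSpectrum 𝕜 (diagBlock hX A) := by
    intro i hi
    have hi : i ∉ S := by simpa using hi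
    rw [← (hgen _ _ (blockSpace_isTopCompl hX S i)).1 (blockSpace_notMem hi) (blockSpace_notMem hi)]
    exact hz i
  have hmem : ∏ i, z i ∈ cSpectrum 𝕜 (diagBlock hX A) ^ (n - S.card) *
      cSpectrum 𝕜 (diagBlock hX.symm A) ^ S.card := by
    rw [← Finset.prod_compl_mul_prod S]
    refine Set.mul_mem_mul ?_ ?_
    · have := Set.finsetProd_mem_finsetProd Sᶜ (fun _ => cSpectrum 𝕜 (diagBlock hX A)) z hz0
      rwa [Finset.prod_const, Finset.card_compl, Fintype.card_fin] at this
    · have := Set.finsetProd_mem_finsetProd S (fun _ => cSpectrum 𝕜 (diagBlock hX.symm A)) z hz1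
      rwa [Finset.prod_const] at this
  exact Set.notMem_empty _ ((h S.card hS hcard).subset ⟨hmem, hC⟩)

end Nonresonance

/-! ### Jets at the origin -/

open Asymptotics

universe u

section Differences

variable {𝕜 : Type*} [RCLike 𝕜] {E F : Type u} [NormedAddCommGroup E] [NormedSpace 𝕜 E]
  [NormedAddCommGroup F] [NormedSpace 𝕜 F]

/-- The iterated finite difference of `f` with increments `v 0, …, v (n - 1)`. -/
def finDiff {E F : Type*} [AddCommGroup E] [AddCommGroup F] :
    ∀ n : ℕ, (Fin n → E) → (E → F) → E → F
  | 0, _, f, x => f x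
  | n + 1, v, f, x =>
    finDiff n (Fin.init v) f (x + v (Fin.last n)) - finDiff n (Fin.init v) f x

lemma norm_finDiff_le {n : ℕ} (v : Fin n → E) {f : E → F} {R C : ℝ}
    (hf : ∀ y, ‖y‖ ≤ R → ‖f y‖ ≤ C) (x : E) (hx : ‖x‖ + ∑ i, ‖v i‖ ≤ R) :
    ‖finDiff n v f x‖ ≤ 2 ^ n * C := by
  induction n generalizing x with
  | zero => simpa [finDiff] using hf x (by simpa using hx)
  | succ n ih =>
    rw [Fin.sum_univ_castSucc] at hx
    have h1 := ih (Fin.init v) (x + v (Fin.last n)) (by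
      have := norm_add_le x (v (Fin.last n))
      simp only [Fin.init]
      linarith)
    have h2 := ih (Fin.init v) x (by
      have := norm_nonneg (v (Fin.last n))
      simp only [Fin.init]
      linarith)
    calc _ ≤ _ := norm_sub_le _ _
      _ ≤ 2 ^ (n + 1) * C := by rw [pow_succ]; linarith

lemma hasFDerivAt_finDiff {n : ℕ} (v : Fin n → E) {f : E → F} {R : ℝ}
    (hf : ∀ y, ‖y‖ < R → DifferentiableAt 𝕜 f y) (x : E) (hx : ‖x‖ + ∑ i, ‖v i‖ < R) :
    HasFDerivAt (finDiff n v f) (finDiff n v (fderiv 𝕜 f) x) x := by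
  induction n generalizing x with
  | zero => exact (hf x (by simpa using hx)).hasFDerivAt
  | succ n ih =>
    rw [Fin.sum_univ_castSucc] at hx
    have h1 := ih (Fin.init v) (x + v (Fin.last n)) (by
      have := norm_add_le x (v (Fin.last n))
      simp only [Fin.init]
      linarith)
    have h2 := ih (Fin.init v) x (by
      have := norm_nonneg (v (Fin.last n))
      simp only [Fin.init]
      linarith)
    have h3 := h1.comp x ((hasFDerivAt_id x).add_const (v (Fin.last n)))
    rw [ContinuousLinearMap.comp_id] at h3
    exact h3.sub h2

/-- Iterated difference quotients converge to the iterated derivative, without any symmetry of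
the latter being needed. -/
lemma finDiff_approx [NormedSpace ℝ E] (n : ℕ) {f : E → F}
    (hf : ContDiffAt 𝕜 n f 0) (v : Fin n → E)
    {ε : ℝ} (hε : 0 < ε) : ∃ δ > 0, ∀ t : 𝕜, ‖t‖ < δ → ∀ x : E, ‖x‖ < δ →
      ‖finDiff n (fun i => t • v i) f x - t ^ n • iteratedFDeriv 𝕜 n f 0 v‖ ≤ ε * ‖t‖ ^ n := by
  induction n generalizing F ε with
  | zero =>
    obtain ⟨δ, hδ, h⟩ := Metric.continuousAt_iff.1 hf.continuousAt ε hε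
    refine ⟨δ, hδ, fun t _ x hx => ?_⟩
    have := (h (by simpa using hx)).le
    rw [dist_eq_norm] at this
    simpa [finDiff] using this
  | succ n ih =>
    have hd : ∀ᶠ y in 𝓝 (0 : E), DifferentiableAt 𝕜 f y := by
      have : ContDiffAt 𝕜 1 f 0 := hf.of_le (by exact_mod_cast Nat.le_add_left 1 n)
      filter_upwards [this.eventually (by simp)] with y hy
      exact hy.differentiableAt (by simp)
    obtain ⟨R, hR, hd⟩ := Metric.eventually_nhds_iff.1 hd
    have hf' : ContDiffAt 𝕜 n (fderiv 𝕜 f) 0 :=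
      hf.fderiv_right (m := (n : WithTop ℕ∞)) (by norm_cast)
    set c : ℝ := ‖v (Fin.last n)‖ + 1
    have hc : 0 < c := by positivity
    obtain ⟨δ, hδ, h⟩ := ih hf' (Fin.init v) (div_pos hε hc)
    set s : ℝ := 1 + ∑ i, ‖v i‖
    have hs : 1 ≤ s := le_add_of_nonneg_right (Finset.sum_nonneg fun i _ => norm_nonneg _)
    refine ⟨min δ R / (2 * s), by positivity, fun t ht x hx => ?_⟩
    rw [lt_div_iff₀ (by positivity)] at ht hx
    have hvl : ‖v (Fin.last n)‖ ≤ s - 1 := by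
      simpa [s] using Finset.single_le_sum (f := fun i => ‖v i‖)
        (fun i _ => norm_nonneg _) (Finset.mem_univ (Fin.last n))
    have hsum : ∑ i, ‖v (Fin.castSucc i)‖ + ‖v (Fin.last n)‖ = s - 1 := by
      simp [s, Fin.sum_univ_castSucc]
    set w : Fin n → E := fun i => t • Fin.init v i
    have hw : ∑ i, ‖w i‖ = ‖t‖ * ∑ i, ‖v (Fin.castSucc i)‖ := by
      simp [w, norm_smul, Finset.mul_sum, Fin.init]
    set k := finDiff n w f
    set L := t ^ n • iteratedFDeriv 𝕜 n (fderiv 𝕜 f) 0 (Fin.init v)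
    have hball : ∀ y ∈ Metric.ball (0 : E) (min δ R / 2),
        HasFDerivWithinAt (fun z => k z - L z) (finDiff n w (fderiv 𝕜 f) y - L)
          (Metric.ball (0 : E) (min δ R / 2)) y := by
      intro y hy
      refine ((hasFDerivAt_finDiff w (R := R) (fun z hz => hd (by simpa using hz)) y ?_).sub
        L.hasFDerivAt).hasFDerivWithinAt
      rw [mem_ball_zero_iff] at hy
      have h1 : ∑ i, ‖w i‖ ≤ ‖t‖ * s := by
        rw [hw]
        gcongr
        have := norm_nonneg (v (Fin.last n))
        linarith
      have := min_le_right δ R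
      linarith
    have hx0 : ‖x‖ < min δ R / 2 := by nlinarith [norm_nonneg x]
    have hx1 : ‖x + t • v (Fin.last n)‖ < min δ R / 2 := by
      calc _ ≤ ‖x‖ + ‖t‖ * ‖v (Fin.last n)‖ := (norm_add_le _ _).trans_eq (by rw [norm_smul])
        _ ≤ ‖x‖ + ‖t‖ * (s - 1) := by gcongr
        _ < _ := by
          rcases le_total ‖x‖ ‖t‖ with h | h <;> nlinarith [norm_nonneg x, norm_nonneg t]
    have ht0 : ‖t‖ < δ := by nlinarith [norm_nonneg t, min_le_left δ R]
    have key := (convex_ball (0 : E) (min δ R / 2)).norm_image_sub_le_of_norm_hasFDerivWithin_le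
      (𝕜 := 𝕜) (C := ε / c * ‖t‖ ^ n) hball (fun y hy => by
        refine h t ht0 y ?_
        rw [mem_ball_zero_iff] at hy
        have := min_le_left δ R
        linarith) (mem_ball_zero_iff.2 hx0) (mem_ball_zero_iff.2 hx1)
    have hk : finDiff (n + 1) (fun i => t • v i) f x
        = k (x + t • v (Fin.last n)) - k x := rfl
    rw [hk, iteratedFDeriv_succ_apply_right]
    have e : k (x + t • v (Fin.last n)) - k x -
        t ^ (n + 1) • (iteratedFDeriv 𝕜 n (fderiv 𝕜 f) 0 (Fin.init v)) (v (Fin.last n))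
        = k (x + t • v (Fin.last n)) - L (x + t • v (Fin.last n)) - (k x - L x) := by
      simp only [map_add, map_smul, L, smul_apply, pow_succ, smul_smul]
      rw [mul_comm (t ^ n)]
      abel
    have e2 : (fun i => v i) (Fin.last n) = v (Fin.last n) := rfl
    rw [e]
    refine key.trans ?_
    rw [add_sub_cancel_left, norm_smul]
    calc ε / c * ‖t‖ ^ n * (‖t‖ * ‖v (Fin.last n)‖)
        ≤ ε / c * ‖t‖ ^ n * (‖t‖ * c) := by gcongr; simp [c]
      _ = ε * ‖t‖ ^ (n + 1) := by rw [pow_succ]; field_simp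

/-- A function of class `C^n` which is `o(‖x‖ ^ n)` at `0` has vanishing `n`-th derivative. -/
lemma iteratedFDeriv_eq_zero_of_isLittleO [NormedSpace ℝ E] {n : ℕ}
    {f : E → F} (hf : ContDiffAt 𝕜 n f 0) (h : f =o[𝓝 0] fun x => ‖x‖ ^ n) :
    iteratedFDeriv 𝕜 n f 0 = 0 := by
  ext v
  rw [zero_apply, ← norm_le_zero_iff]
  refine le_of_forall_pos_le_add fun ε hε => ?_
  rw [zero_add]
  set s : ℝ := 1 + ∑ i, ‖v i‖
  have hs : 1 ≤ s := le_add_of_nonneg_right (Finset.sum_nonneg fun i _ => norm_nonneg _)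
  obtain ⟨δ, hδ, h1⟩ := finDiff_approx n hf v (half_pos hε)
  obtain ⟨R, hR, h2⟩ := Metric.eventually_nhds_iff.1
    (h.bound (show 0 < ε / 2 / (2 ^ n * s ^ n) by positivity))
  obtain ⟨t, ht0, ht⟩ := NormedField.exists_norm_lt 𝕜 (show 0 < min δ (R / s) by positivity)
  have htR : ‖t‖ * s < R := (lt_div_iff₀ (by positivity)).1 (ht.trans_le (min_le_right _ _))
  have h3 := h1 t (ht.trans_le (min_le_left _ _)) 0 (by simpa using hδ)
  have h4 := norm_finDiff_le (fun i => t • v i) (f := f) (R := ‖t‖ * s)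
    (C := ε / 2 / (2 ^ n * s ^ n) * (‖t‖ * s) ^ n) (fun y hy => by
      refine (h2 (by simpa using hy.trans_lt htR)).trans ?_
      simp only [norm_pow, norm_norm]
      gcongr) 0 (by
      simp only [norm_zero, zero_add, norm_smul, ← Finset.mul_sum]
      gcongr
      simp [s])
  have h5 : 2 ^ n * (ε / 2 / (2 ^ n * s ^ n) * (‖t‖ * s) ^ n) = ε / 2 * ‖t‖ ^ n := by
    rw [mul_pow]; field_simp
  rw [h5] at h4
  have h6 : ‖t‖ ^ n * ‖iteratedFDeriv 𝕜 n f 0 v‖ ≤ ‖t‖ ^ n * ε := by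
    rw [← norm_pow, ← norm_smul, norm_pow]
    calc _ = ‖finDiff n (fun i => t • v i) f 0 -
          (finDiff n (fun i => t • v i) f 0 - t ^ n • iteratedFDeriv 𝕜 n f 0 v)‖ := by
            rw [sub_sub_cancel]
      _ ≤ _ := norm_sub_le _ _
      _ ≤ ε / 2 * ‖t‖ ^ n + ε / 2 * ‖t‖ ^ n := add_le_add h4 h3
      _ = _ := by ring
  exact le_of_mul_le_mul_left h6 (by positivity)

lemma iteratedFDeriv_eq_zero_of_isBigO [NormedSpace ℝ E] {n : ℕ}
    {f : E → F} (hf : ContDiffAt 𝕜 n f 0) (h : f =O[𝓝 0] fun x => ‖x‖ ^ n) {i : ℕ}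
    (hi : i < n) : iteratedFDeriv 𝕜 i f 0 = 0 :=
  iteratedFDeriv_eq_zero_of_isLittleO (hf.of_le (by exact_mod_cast hi.le))
    (h.trans_isLittleO ((isLittleO_pow_pow hi).comp_tendsto (by
      simpa using (continuous_norm.tendsto (0 : E)))))

end Differences

section Local

variable {𝕜 : Type*} [RCLike 𝕜] {E F G H : Type*} [NormedAddCommGroup E] [NormedSpace 𝕜 E]
  [NormedAddCommGroup F] [NormedSpace 𝕜 F] [NormedAddCommGroup G] [NormedSpace 𝕜 G]
  [NormedAddCommGroup H] [NormedSpace 𝕜 H]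

lemma natCast_ne_infty (n : ℕ) : (n : WithTop ℕ∞) ≠ ∞ := by simp

lemma natCast_le_infty (n : ℕ) : (n : WithTop ℕ∞) ≤ ∞ := by exact_mod_cast le_top

lemma exists_isOpen_contDiffOn {n : ℕ} {f : E → F} {x : E} (hf : ContDiffAt 𝕜 n f x) :
    ∃ u, IsOpen u ∧ x ∈ u ∧ ContDiffOn 𝕜 n f u := by
  obtain ⟨u, hu, ho, hx⟩ := eventually_nhds_iff.1 (hf.eventually (by simp))
  exact ⟨u, ho, hx, fun y hy => (hu y hy).contDiffWithinAt⟩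

lemma iteratedFDeriv_comp_clm {n : ℕ} {f : E → F} (L : G →L[𝕜] E) {x : G}
    (hf : ContDiffAt 𝕜 n f (L x)) {i : ℕ} (hi : i ≤ n) :
    iteratedFDeriv 𝕜 i (fun y => f (L y)) x =
      (iteratedFDeriv 𝕜 i f (L x)).compContinuousLinearMap fun _ => L := by
  obtain ⟨u, ho, hx, hu⟩ := exists_isOpen_contDiffOn hf
  have ho' := ho.preimage L.continuous
  have := L.iteratedFDerivWithin_comp_right hu ho.uniqueDiffOn ho'.uniqueDiffOn hx
    (i := i) (by exact_mod_cast hi)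
  rwa [iteratedFDerivWithin_of_isOpen i ho hx, iteratedFDerivWithin_of_isOpen i ho' hx] at this

lemma norm_iteratedFDeriv_bilinear_le {n : ℕ} {f : E → F} {g : E → G} {x : E}
    (B : F →L[𝕜] G →L[𝕜] H) (hf : ContDiffAt 𝕜 n f x) (hg : ContDiffAt 𝕜 n g x) {i : ℕ}
    (hi : i ≤ n) :
    ‖iteratedFDeriv 𝕜 i (fun x => B (f x) (g x)) x‖ ≤
      ‖B‖ * ∑ k ∈ Finset.range (i + 1), (i.choose k : ℝ) *
        ‖iteratedFDeriv 𝕜 k f x‖ * ‖iteratedFDeriv 𝕜 (i - k) g x‖ := by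
  obtain ⟨u, ho, hx, hu⟩ := exists_isOpen_contDiffOn hf
  obtain ⟨v, ho', hx', hv⟩ := exists_isOpen_contDiffOn hg
  have hw := ho.inter ho'
  have := B.norm_iteratedFDerivWithin_le_of_bilinear (hu.mono inter_subset_left)
    (hv.mono inter_subset_right) hw.uniqueDiffOn (x := x) ⟨hx, hx'⟩ (n := i)
    (by exact_mod_cast hi)
  simpa only [iteratedFDerivWithin_of_isOpen _ hw (show x ∈ u ∩ v from ⟨hx, hx'⟩)] using this

end Local

section Taylor

variable {𝕜 : Type*} [RCLike 𝕜] {E F : Type u} [NormedAddCommGroup E] [NormedSpace 𝕜 E]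
  [NormedAddCommGroup F] [NormedSpace 𝕜 F]

/-- Integration of an estimate for the derivative from `0`. -/
lemma isBigO_of_fderiv [NormedSpace ℝ E] {n : ℕ} {f : E → F}
    (hf : ∀ᶠ x in 𝓝 0, DifferentiableAt 𝕜 f x)
    (h0 : f 0 = 0) (h : fderiv 𝕜 f =O[𝓝 0] fun x => ‖x‖ ^ n) :
    f =O[𝓝 0] fun x => ‖x‖ ^ (n + 1) := by
  obtain ⟨C, hC⟩ := h.bound
  obtain ⟨R, hR, hC⟩ := Metric.eventually_nhds_iff.1 (hf.and hC)
  refine IsBigO.of_bound C (Metric.eventually_nhds_iff.2 ⟨R, hR, fun x hx => ?_⟩)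
  have key := (convex_closedBall (0 : E) ‖x‖).norm_image_sub_le_of_norm_fderiv_le (𝕜 := 𝕜)
    (f := f) (C := C * ‖x‖ ^ n) (x := 0) (y := x) (fun y hy => ?_) (fun y hy => ?_)
    (by simp) (by simp)
  · simpa [h0, pow_succ, mul_assoc] using key
  · rw [mem_closedBall_zero_iff] at hy
    rw [dist_zero_right] at hx
    exact (hC (by simpa using hy.trans_lt hx)).1
  · rw [mem_closedBall_zero_iff] at hy
    rw [dist_zero_right] at hx
    have h1 := (hC (y := y) (by simpa using hy.trans_lt hx)).2
    have hC0 : 0 ≤ C ∨ fderiv 𝕜 f y = 0 := by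
      by_contra! hh
      have h2 : 0 < ‖fderiv 𝕜 f y‖ := norm_pos_iff.2 hh.2
      have h3 : 0 ≤ ‖‖y‖ ^ n‖ := norm_nonneg _
      nlinarith
    rcases hC0 with hC0 | h0'
    · refine h1.trans ?_
      simp only [norm_pow, norm_norm]
      gcongr
    · rcases le_or_gt 0 C with hC0 | hC0
      · rw [h0', norm_zero]; positivity
      · rw [h0', norm_zero] at h1 ⊢
        -- a negative constant forces `x = 0` or `n = 0`, and the latter is excluded at `y`
        have hx1 := (hC (y := x) (by simpa using hx)).2
        have h2 : 0 ≤ C * ‖‖x‖ ^ n‖ := (norm_nonneg _).trans hx1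
        simpa using h2

/-- Taylor's formula for a function vanishing to order `n` at `0`: its leading term is
homogeneous of degree `n`. -/
lemma exists_leading_term [NormedSpace ℝ E] (n : ℕ) {f : E → F}
    (hf : ContDiffAt 𝕜 (n + 1 : ℕ) f 0)
    (h : ∀ i < n, iteratedFDeriv 𝕜 i f 0 = 0) :
    ∃ q : ContinuousMultilinearMap 𝕜 (fun _ : Fin n => E) F,
      (fun x => f x - q fun _ => x) =O[𝓝 0] fun x => ‖x‖ ^ (n + 1) := by
  induction n generalizing F with
  | zero =>
    refine ⟨ContinuousMultilinearMap.constOfIsEmpty 𝕜 _ (f 0), ?_⟩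
    simpa using (hf.differentiableAt (by simp)).hasFDerivAt.isBigO_sub.norm_right
  | succ n ih =>
    have hf' : ContDiffAt 𝕜 (n + 1 : ℕ) (fderiv 𝕜 f) 0 :=
      hf.fderiv_right (m := ((n + 1 : ℕ) : WithTop ℕ∞)) (by norm_cast)
    obtain ⟨Q, hQ⟩ := ih hf' (fun i hi => by
      ext v w
      have := congrArg (fun q => q (Fin.snoc (α := fun _ => E) v w)) (h (i + 1) (by omega))
      simpa [iteratedFDeriv_succ_apply_right] using this)
    refine ⟨((n + 1 : ℕ) : 𝕜)⁻¹ • Q.uncurryRight, ?_⟩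
    have hf0 : f 0 = 0 := by
      have := congrArg (fun q => q fun _ => 0) (h 0 (by omega))
      simpa using this
    have hd : ∀ᶠ x in 𝓝 (0 : E), DifferentiableAt 𝕜 f x := by
      have : ContDiffAt 𝕜 1 f 0 := hf.of_le (by exact_mod_cast Nat.le_add_left 1 (n + 1))
      filter_upwards [this.eventually (by simp)] with y hy
      exact hy.differentiableAt (by simp)
    obtain ⟨C, hC0, hC⟩ := hQ.exists_nonneg
    obtain ⟨R, hR, hC⟩ := Metric.eventually_nhds_iff.1 (hd.and hC.bound)
    refine IsBigO.of_bound C (Metric.eventually_nhds_iff.2 ⟨R, hR, fun x hx => ?_⟩)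
    rw [dist_zero_right] at hx
    -- the estimate along the segment from `0` to `x`
    have key := (convex_closedBall (0 : 𝕜) 1).norm_image_sub_le_of_norm_hasDerivWithin_le
      (f := fun t : 𝕜 => f (t • x) - t ^ (n + 1) •
        (((n + 1 : ℕ) : 𝕜)⁻¹ • Q.uncurryRight fun _ => x))
      (f' := fun t : 𝕜 => (fderiv 𝕜 f (t • x) - Q fun _ => t • x) x)
      (C := C * ‖x‖ ^ (n + 1) * ‖x‖) (x := 0) (y := 1) (fun t ht => ?_) (fun t ht => ?_)
      (by simp) (by simp)
    · simpa [hf0, pow_succ, mul_assoc] using key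
    · rw [mem_closedBall_zero_iff] at ht
      have ht' : ‖t • x‖ < R := by
        rw [norm_smul]; nlinarith [norm_nonneg x]
      have h1 : HasDerivAt (fun t : 𝕜 => f (t • x)) (fderiv 𝕜 f (t • x) x) t := by
        have := (hC (y := t • x) (by simpa using ht')).1.hasFDerivAt.comp_hasDerivAt t
          ((hasDerivAt_id t).smul_const x)
        simpa [Function.comp_def] using this
      have h2 := ((hasDerivAt_pow (n + 1) t).smul_const
        (((n + 1 : ℕ) : 𝕜)⁻¹ • Q.uncurryRight fun _ => x))
      refine ((h1.sub h2).congr_deriv ?_).hasDerivWithinAt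
      have hn : ((n : 𝕜) + 1) ≠ 0 := by exact_mod_cast Nat.succ_ne_zero n
      rw [ContinuousMultilinearMap.map_smul_univ]
      simp only [Finset.prod_const, Finset.card_univ, Fintype.card_fin, sub_apply, smul_apply,
        smul_smul, ContinuousMultilinearMap.uncurryRight_apply, Nat.add_sub_cancel]
      congr 2
      push_cast
      field_simp
    · rw [mem_closedBall_zero_iff] at ht
      have ht' : ‖t • x‖ < R := by
        rw [norm_smul]; nlinarith [norm_nonneg x]
      refine (ContinuousLinearMap.le_opNorm _ _).trans ?_
      gcongr
      refine (hC (y := t • x) (by simpa using ht')).2.trans ?_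
      rw [norm_smul]
      simp only [norm_pow, norm_mul, norm_norm]
      gcongr
      exact mul_le_of_le_one_left (norm_nonneg _) ht

end Taylor

section Flat

variable {𝕜 : Type*} [RCLike 𝕜] {E F G H : Type u} [NormedAddCommGroup E] [NormedSpace 𝕜 E]
  [NormedAddCommGroup F] [NormedSpace 𝕜 F] [NormedAddCommGroup G] [NormedSpace 𝕜 G]
  [NormedAddCommGroup H] [NormedSpace 𝕜 H]

/-- `f` is of class `C^j` at `0` and its derivatives of order `i ≤ j` are `O(‖x‖ ^ (s - i))`,
with the exponent truncated at `0`. -/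
def FlatAt (𝕜 : Type*) [RCLike 𝕜] {E F : Type*} [NormedAddCommGroup E] [NormedSpace 𝕜 E]
    [NormedAddCommGroup F] [NormedSpace 𝕜 F] (s j : ℕ) (f : E → F) : Prop :=
  ContDiffAt 𝕜 j f 0 ∧
    ∀ i ≤ j, (fun x => iteratedFDeriv 𝕜 i f x) =O[𝓝 0] fun x => ‖x‖ ^ (s - i)

lemma FlatAt.isBigO {s j : ℕ} {f : E → F} (h : FlatAt 𝕜 s j f) :
    f =O[𝓝 0] fun x => ‖x‖ ^ s := by
  simpa using (h.2 0 (Nat.zero_le _)).norm_left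

lemma flatAt_of_contDiffAt [NormedSpace ℝ E] {s j : ℕ} {f : E → F}
    (hs : ContDiffAt 𝕜 s f 0) (hj : ContDiffAt 𝕜 j f 0)
    (h : ∀ i < s, iteratedFDeriv 𝕜 i f 0 = 0) : FlatAt 𝕜 s j f := by
  refine ⟨hj, fun i hi => ?_⟩
  obtain hsi | his := le_total s i
  · rw [Nat.sub_eq_zero_of_le hsi]
    simp only [pow_zero]
    exact ((hj.of_le (m := i) (by exact_mod_cast hi)).continuousAt_iteratedFDeriv le_rfl).isBigO_one ℝ
  · clear hi
    obtain ⟨d, rfl⟩ := Nat.exists_eq_add_of_le his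
    induction d generalizing i with
    | zero =>
      simp only [add_zero, Nat.sub_self, pow_zero] at hs ⊢
      exact (hs.continuousAt_iteratedFDeriv le_rfl).isBigO_one ℝ
    | succ d ih =>
      have hlt : (i : WithTop ℕ∞) < (i + (d + 1) : ℕ) := by exact_mod_cast (by omega)
      have h1 : (fun x => iteratedFDeriv 𝕜 (i + 1) f x) =O[𝓝 0] fun x => ‖x‖ ^ d := by
        have e : i + 1 + d = i + (d + 1) := by ring
        have := ih (i + 1) (by rwa [e]) (by rwa [e]) (by omega)
        simpa using this
      have h2 := isBigO_of_fderiv (𝕜 := 𝕜) (n := d) (f := fun x => iteratedFDeriv 𝕜 i f x) ?_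
        (h i (by omega)) ?_
      · simpa using h2
      · have h3 : ContDiffAt 𝕜 ((i + (d + 1) : ℕ)) f 0 := hs
        filter_upwards [h3.eventually (natCast_ne_infty _)] with x hx
        exact (hx.iteratedFDeriv_right (m := 1) (by exact_mod_cast (by omega))).differentiableAt
          (by simp)
      · refine h1.norm_left.congr_left (fun x => ?_) |>.of_norm_left
        rw [← norm_fderiv_iteratedFDeriv]

lemma flatAt_of_isBigO [NormedSpace ℝ E] {s j : ℕ} {f : E → F}
    (hs : ContDiffAt 𝕜 s f 0) (hj : ContDiffAt 𝕜 j f 0)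
    (h : f =O[𝓝 0] fun x => ‖x‖ ^ s) : FlatAt 𝕜 s j f :=
  flatAt_of_contDiffAt hs hj fun _ hi => iteratedFDeriv_eq_zero_of_isBigO hs h hi

lemma FlatAt.fderiv {s j : ℕ} {f : E → F} (h : FlatAt 𝕜 s (j + 1) f) :
    FlatAt 𝕜 (s - 1) j (fderiv 𝕜 f) := by
  refine ⟨h.1.fderiv_right (by norm_cast), fun i hi => ?_⟩
  have := h.2 (i + 1) (by omega)
  rw [show s - (i + 1) = s - 1 - i by omega] at this
  refine this.norm_left.congr_left (fun x => ?_) |>.of_norm_left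
  rw [← norm_iteratedFDeriv_fderiv]

lemma FlatAt.comp_clm {s j : ℕ} {f : E → F} (h : FlatAt 𝕜 s j f) (L : G →L[𝕜] E) :
    FlatAt 𝕜 s j (fun x => f (L x)) := by
  have hL : Tendsto L (𝓝 0) (𝓝 0) := by simpa using L.continuous.tendsto 0
  refine ⟨ContDiffAt.comp (0 : G) (by simpa using h.1) L.contDiff.contDiffAt, fun i hi => ?_⟩
  have h1 := (h.2 i hi).comp_tendsto hL
  have h2 : (fun x => iteratedFDeriv 𝕜 i (fun x => f (L x)) x) =O[𝓝 0]
      fun x => iteratedFDeriv 𝕜 i f (L x) := by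
    refine IsBigO.of_bound (‖L‖ ^ i) ?_
    filter_upwards [hL.eventually (h.1.eventually (by simp))] with x hx
    rw [iteratedFDeriv_comp_clm L hx hi]
    refine (ContinuousMultilinearMap.norm_compContinuousLinearMap_le _ _).trans_eq ?_
    simp [mul_comm]
  refine (h2.trans h1).trans ?_
  refine IsBigO.of_bound (‖L‖ ^ (s - i)) (Eventually.of_forall fun x => ?_)
  simp only [Function.comp, norm_pow, norm_norm, ← mul_pow]
  gcongr
  exact L.le_opNorm x

lemma flatAt_clm (j : ℕ) (L : E →L[𝕜] F) : FlatAt 𝕜 1 j L := by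
  refine ⟨L.contDiff.contDiffAt, fun i _ => ?_⟩
  match i with
  | 0 =>
    refine (IsBigO.of_bound ‖L‖ (Eventually.of_forall fun x => ?_))
    simpa using L.le_opNorm x
  | i + 1 =>
    simp only [Nat.sub_eq_zero_of_le (Nat.le_add_left 1 i), pow_zero]
    exact (((L.contDiff (n := (i + 1 : ℕ))).contDiffAt (x := 0)).continuousAt_iteratedFDeriv
      le_rfl).isBigO_one ℝ

lemma FlatAt.bilinear {s t j : ℕ} {f : E → F} {g : E → G} (hf : FlatAt 𝕜 s j f)
    (hg : FlatAt 𝕜 t j g) (B : F →L[𝕜] G →L[𝕜] H) :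
    FlatAt 𝕜 (s + t) j (fun x => B (f x) (g x)) := by
  refine ⟨(B.contDiff.contDiffAt.comp (0 : E) hf.1).clm_apply hg.1, fun i hi => ?_⟩
  have h1 : (fun x => iteratedFDeriv 𝕜 i (fun x => B (f x) (g x)) x) =O[𝓝 0]
      fun x => ∑ k ∈ Finset.range (i + 1), (i.choose k : ℝ) *
        ‖iteratedFDeriv 𝕜 k f x‖ * ‖iteratedFDeriv 𝕜 (i - k) g x‖ := by
    refine IsBigO.of_bound ‖B‖ ?_
    filter_upwards [hf.1.eventually (by simp), hg.1.eventually (by simp)] with x hx hx'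
    refine (norm_iteratedFDeriv_bilinear_le B hx hx' hi).trans (mul_le_mul_of_nonneg_left (le_abs_self _) B.opNorm_nonneg)
  refine h1.trans (IsBigO.fun_sum fun k hk => ?_)
  rw [Finset.mem_range] at hk
  have h2 := ((hf.2 k (by omega)).norm_left.const_mul_left (i.choose k : ℝ)).mul
    (hg.2 (i - k) (by omega)).norm_left
  refine h2.trans ?_
  simp only [← pow_add]
  refine IsBigO.of_bound 1 ?_
  filter_upwards [Metric.ball_mem_nhds (0 : E) one_pos] with x hx
  rw [mem_ball_zero_iff] at hx
  simp only [norm_pow, norm_norm, one_mul]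
  exact pow_le_pow_of_le_one (norm_nonneg _) hx.le (by omega)

lemma FlatAt.prodMk {s j : ℕ} {f : E → F} {g : E → G} (hf : FlatAt 𝕜 s j f)
    (hg : FlatAt 𝕜 s j g) : FlatAt 𝕜 s j (fun x => (f x, g x)) := by
  refine ⟨hf.1.prodMk hg.1, fun i hi => ?_⟩
  have := (hf.2 i hi).prod_left (hg.2 i hi)
  refine IsBigO.trans (IsBigO.of_bound 1 ?_) this
  filter_upwards [hf.1.eventually (by simp), hg.1.eventually (by simp)] with x hx hx'
  rw [iteratedFDeriv_prodMk hx hx' (by exact_mod_cast hi), one_mul,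
    ContinuousMultilinearMap.opNorm_prod]
  rfl

end Flat

/-! ### Polynomial conjugacies up to high order -/

lemma isBigO_diag_sub {𝕜 : Type*} [RCLike 𝕜] {E F G : Type*} [NormedAddCommGroup E]
    [NormedAddCommGroup F] [NormedSpace 𝕜 F] [NormedAddCommGroup G] [NormedSpace 𝕜 G] {n : ℕ} (hn : n ≠ 0)
    (q : ContinuousMultilinearMap 𝕜 (fun _ : Fin n => F) G)
    {u w : E → F} (hu : u =O[𝓝 0] fun x => ‖x‖) (hw : w =O[𝓝 0] fun x => ‖x‖)
    (huw : (fun x => u x - w x) =O[𝓝 0] fun x => ‖x‖ ^ 2) :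
    (fun x => (q fun _ => u x) - q fun _ => w x) =O[𝓝 0] fun x => ‖x‖ ^ (n + 1) := by
  obtain ⟨n, rfl⟩ := Nat.exists_eq_succ_of_ne_zero hn
  have h1 : (fun x => (q fun _ => u x) - q fun _ => w x) =O[𝓝 0]
      fun x => (‖u x‖ + ‖w x‖) ^ n * ‖u x - w x‖ := by
    refine IsBigO.of_bound (‖q‖ * (n + 1 : ℕ)) (Eventually.of_forall fun x => ?_)
    refine (q.norm_image_sub_le _ _).trans ?_
    have e : (fun _ : Fin (n + 1) => u x) - (fun _ => w x) = fun _ => u x - w x := rfl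
    rw [e, pi_norm_const, pi_norm_const, pi_norm_const, Fintype.card_fin, Nat.succ_sub_one,
      Real.norm_of_nonneg (by positivity), mul_assoc (‖q‖ * _)]
    gcongr
    exact max_le_add_of_nonneg (norm_nonneg _) (norm_nonneg _)
  have h2 : (fun x => ‖u x‖ + ‖w x‖) =O[𝓝 0] fun x : E => ‖x‖ := hu.norm_left.add hw.norm_left
  refine (h1.trans ((h2.pow n).mul huw.norm_left)).congr_right fun x => ?_
  rw [← pow_add]

lemma projectionOntoL_comp_subtypeL {𝕜 : Type*} [RCLike 𝕜] {X : Type*} [NormedAddCommGroup X]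
    [NormedSpace 𝕜 X] {X0 X1 : Submodule 𝕜 X} (hX : X0.IsTopCompl X1) :
    X0.projectionOntoL X1 hX ∘L X0.subtypeL = ContinuousLinearMap.id 𝕜 X0 := by
  ext y
  simp

lemma projectionOntoL_apply_comm {𝕜 : Type*} [RCLike 𝕜] {X : Type*} [NormedAddCommGroup X]
    [NormedSpace 𝕜 X] {X0 X1 : Submodule 𝕜 X} (hX : X0.IsTopCompl X1) {A : X →L[𝕜] X}
    (hA : ∀ x ∈ X1, A x ∈ X1) (x : X) :
    X0.projectionOntoL X1 hX (A x) = diagBlock hX A (X0.projectionOntoL X1 hX x) := by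
  have e := congrArg (fun L : X →L[𝕜] X => L x) (Submodule.projectionL_add_projectionL_eq_id hX)
  have e' : x = X0.projectionL X1 hX x + X1.projectionL X0 hX.symm x := by simpa using e.symm
  conv_lhs => rw [e', map_add, map_add]
  rw [(Submodule.projectionOntoL_apply_eq_zero_iff hX).2
    (hA _ (Submodule.projectionL_apply_mem _ _)), add_zero]
  rfl

section

variable {𝕜 : Type*} [RCLike 𝕜] {E F : Type u} [NormedAddCommGroup E] [NormedSpace 𝕜 E]
  [NormedAddCommGroup F] [NormedSpace 𝕜 F]

lemma isBigO_sub_fderiv [NormedSpace ℝ E] {f : E → F} {L : E →L[𝕜] F} (hf : ContDiffAt 𝕜 2 f 0)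
    (h0 : f 0 = 0) (hL : HasFDerivAt f L 0) :
    (fun x => f x - L x) =O[𝓝 0] fun x => ‖x‖ ^ 2 := by
  have hs : ContDiffAt 𝕜 (2 : ℕ) (fun x => f x - L x) 0 := hf.sub L.contDiff.contDiffAt
  refine (flatAt_of_contDiffAt (j := 0) hs (hs.of_le (by simp)) fun i hi => ?_).isBigO
  have hL' : HasFDerivAt (fun x => f x - L x) (0 : E →L[𝕜] F) 0 := by
    have := hL.sub L.hasFDerivAt
    rwa [sub_self] at this
  interval_cases i
  · ext; simp [h0]
  · ext v
    simp [iteratedFDeriv_succ_apply_right, hL'.fderiv]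

/-- The nonlinear part of a `C²` map has a Lipschitz constant proportional to the distance from
the origin. -/
lemma isBigO_nonlinear_part [NormedSpace ℝ E] {f : E → F} {L : E →L[𝕜] F}
    (hf : ContDiffAt 𝕜 2 f 0) (hL : HasFDerivAt f L 0) :
    (fun z : E × E => f z.1 - f z.2 - L (z.1 - z.2)) =O[𝓝 0]
      fun z => ‖z‖ * ‖z.1 - z.2‖ := by
  have hd : ContDiffAt 𝕜 1 (fderiv 𝕜 f) 0 := hf.fderiv_right (m := 1) (by norm_num)
  have hO := (hd.differentiableAt (by simp)).hasFDerivAt.isBigO_sub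
  rw [hL.fderiv] at hO
  obtain ⟨C, hC0, hC⟩ := hO.exists_nonneg
  have hd : ∀ᶠ x in 𝓝 (0 : E), DifferentiableAt 𝕜 f x := by
    filter_upwards [hf.eventually (by simp)] with y hy
    exact hy.differentiableAt (by simp)
  obtain ⟨R, hR, hC⟩ := Metric.eventually_nhds_iff.1 (hd.and hC.bound)
  refine IsBigO.of_bound C (Metric.eventually_nhds_iff.2 ⟨R, hR, fun z hz => ?_⟩)
  rw [dist_zero_right] at hz
  have key := (convex_closedBall (0 : E) ‖z‖).norm_image_sub_le_of_norm_hasFDerivWithin_le (𝕜 := 𝕜)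
    (f := fun x => f x - L x) (f' := fun x => fderiv 𝕜 f x - L)
    (C := C * ‖z‖) (x := z.2) (y := z.1) (fun y hy => ?_) (fun y hy => ?_)
    (by simpa using norm_snd_le z) (by simpa using norm_fst_le z)
  · rw [Real.norm_of_nonneg (by positivity)]
    calc _ = ‖f z.1 - L z.1 - (f z.2 - L z.2)‖ := by rw [map_sub]; congr 1; abel
      _ ≤ _ := key.trans_eq (mul_assoc _ _ _)
  · rw [mem_closedBall_zero_iff] at hy
    exact ((hC (y := y) (by simpa using hy.trans_lt hz)).1.hasFDerivAt.sub
      L.hasFDerivAt).hasFDerivWithinAt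
  · rw [mem_closedBall_zero_iff] at hy
    refine (hC (y := y) (by simpa using hy.trans_lt hz)).2.trans ?_
    rw [sub_zero]
    gcongr

lemma isBigO_diag {G : Type*} [NormedAddCommGroup G] [NormedSpace 𝕜 G] {n : ℕ}
    (q : ContinuousMultilinearMap 𝕜 (fun _ : Fin n => F) G) :
    (fun x => q fun _ => x) =O[𝓝 0] fun x => ‖x‖ ^ n := by
  refine IsBigO.of_bound ‖q‖ (Eventually.of_forall fun x => ?_)
  simpa using q.le_opNorm fun _ => x

lemma hasFDerivAt_diag_zero {n : ℕ} (hn : 2 ≤ n)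
    (q : ContinuousMultilinearMap 𝕜 (fun _ : Fin n => E) F) :
    HasFDerivAt (fun x => q fun _ => x) (0 : E →L[𝕜] F) 0 := by
  refine .of_isLittleO ?_
  have h0 : (q fun _ => 0) = 0 := q.map_coord_zero (⟨0, by omega⟩ : Fin n) rfl
  simp only [h0, sub_zero, zero_apply]
  exact (isBigO_diag q).trans_isLittleO
    (IsLittleO.of_norm_right (by
      simpa [Function.comp_def] using (isLittleO_pow_pow (𝕜 := ℝ)
        (show 1 < n by omega)).comp_tendsto
          (by simpa using continuous_norm.tendsto (0 : E) : Tendsto (‖·‖) (𝓝 (0 : E)) (𝓝 0))))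

lemma contDiff_diag {n : ℕ} {k : WithTop ℕ∞}
    (q : ContinuousMultilinearMap 𝕜 (fun _ : Fin n => E) F) :
    ContDiff 𝕜 k (fun x => q fun _ => x) :=
  q.contDiff.comp (contDiff_pi.2 fun _ => contDiff_id)

/-- Restriction of a multilinear map to the diagonal has bounded derivatives on balls. -/
lemma exists_bound_iteratedFDeriv_diag {n : ℕ}
    (q : ContinuousMultilinearMap 𝕜 (fun _ : Fin n => E) F) (R : ℝ) (i : ℕ) :
    ∃ C, ∀ x, ‖x‖ ≤ R → ‖iteratedFDeriv 𝕜 i (fun x => q fun _ => x) x‖ ≤ C := by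
  let L : E →L[𝕜] (Fin n → E) := ContinuousLinearMap.pi fun _ => ContinuousLinearMap.id 𝕜 E
  refine ⟨n.descFactorial i * ‖q‖ * max R 0 ^ (n - i) * ‖L‖ ^ i, fun x hx => ?_⟩
  have h1 : iteratedFDeriv 𝕜 i (fun x => q (L x)) x = _ :=
    iteratedFDeriv_comp_clm (n := i) L q.contDiff.contDiffAt le_rfl
  change ‖iteratedFDeriv 𝕜 i (fun x => q (L x)) x‖ ≤ _
  rw [h1]
  refine (ContinuousMultilinearMap.norm_compContinuousLinearMap_le _ _).trans ?_
  rw [Finset.prod_const, Finset.card_univ, Fintype.card_fin]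
  gcongr
  refine (q.norm_iteratedFDeriv_le i (L x)).trans ?_
  rw [Fintype.card_fin]
  gcongr
  rcases isEmpty_or_nonempty (Fin n) with h | h
  · rw [Subsingleton.elim (L x) 0, norm_zero]
    exact le_max_right _ _
  · exact (pi_norm_const x).trans_le (hx.trans (le_max_left _ _))

variable {X : Type u} [NormedAddCommGroup X] [NormedSpace ℝ X] [NormedSpace 𝕜 X]
  [IsScalarTower ℝ 𝕜 X] {X0 X1 : Submodule 𝕜 X}

/-- If the blocks of order `2, …, ℓ` with at least `m` arguments from `X1` are nonresonant, `F` is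
semiconjugate to a polynomial `h` on `X0` by a polynomial `p`, up to an error of order `ℓ + 1`.
For `m = 0` all homogeneous terms of `h` of order `≥ 2` can be removed. -/
theorem exists_polynomial_conjugacy (hX : X0.IsTopCompl X1) {F : X → X} {A : X →L[𝕜] X} {ℓ m : ℕ}
    (hℓ : 1 ≤ ℓ) (hF : ContDiffAt 𝕜 (ℓ + 1 : ℕ) F 0) (hF0 : F 0 = 0) (hFA : HasFDerivAt F A 0)
    (hA : ∀ x ∈ X1, A x ∈ X1) (hm : m ≤ 1)
    (hnr : ∀ n, 2 ≤ n → n ≤ ℓ → BlockNonresonant hX A (diagBlock hX A) n m) :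
    ∃ (p : X → X0) (h : X0 → X0), (∀ k, ContDiff 𝕜 k p) ∧ (∀ k, ContDiff 𝕜 k h) ∧
      p 0 = 0 ∧ h 0 = 0 ∧ HasFDerivAt p (X0.projectionOntoL X1 hX) 0 ∧
      HasFDerivAt h (diagBlock hX A) 0 ∧
      (∀ (R : ℝ) (i : ℕ), ∃ C, ∀ z, ‖z‖ ≤ R → ‖iteratedFDeriv 𝕜 i h z‖ ≤ C) ∧
      (m = 0 → ∀ z, h z = diagBlock hX A z) ∧
      (fun x => p (F x) - h (p x)) =O[𝓝 0] fun x => ‖x‖ ^ (ℓ + 1) := by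
  have hPA : ∀ x, X0.projectionOntoL X1 hX (A x) =
      diagBlock hX A (X0.projectionOntoL X1 hX x) := projectionOntoL_apply_comm hX hA
  have hF2 : ContDiffAt 𝕜 2 F 0 := hF.of_le (by exact_mod_cast (by omega : 2 ≤ ℓ + 1))
  have hFO : F =O[𝓝 0] fun x => ‖x‖ := by simpa [hF0] using hFA.isBigO_sub.norm_right
  have hFt : Tendsto F (𝓝 0) (𝓝 0) := by simpa [hF0] using hFA.continuousAt.tendsto
  suffices hmain : ∀ n, 1 ≤ n → n ≤ ℓ →
    ∃ (p : X → X0) (h : X0 → X0), (∀ k, ContDiff 𝕜 k p) ∧ (∀ k, ContDiff 𝕜 k h) ∧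
      p 0 = 0 ∧ h 0 = 0 ∧ HasFDerivAt p (X0.projectionOntoL X1 hX) 0 ∧
      HasFDerivAt h (diagBlock hX A) 0 ∧
      (∀ (R : ℝ) (i : ℕ), ∃ C, ∀ z, ‖z‖ ≤ R → ‖iteratedFDeriv 𝕜 i h z‖ ≤ C) ∧
      (m = 0 → ∀ z, h z = diagBlock hX A z) ∧
      (fun x => p (F x) - h (p x)) =O[𝓝 0] fun x => ‖x‖ ^ (n + 1) from hmain ℓ hℓ le_rfl
  intro n hn
  induction n, hn using Nat.le_induction with
  | base =>
    intro _
    refine ⟨X0.projectionOntoL X1 hX, diagBlock hX A, fun k => ContinuousLinearMap.contDiff _,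
      fun k => ContinuousLinearMap.contDiff _, map_zero _, map_zero _,
      ContinuousLinearMap.hasFDerivAt _, ContinuousLinearMap.hasFDerivAt _, fun R i => ?_,
      fun _ _ => rfl, ?_⟩
    · obtain ⟨C, hC⟩ := exists_bound_iteratedFDeriv_diag
        (ContinuousMultilinearMap.ofSubsingleton 𝕜 X0 X0 (0 : Fin 1) (diagBlock hX A)) R i
      exact ⟨C, hC⟩
    · simp only [← hPA, ← map_sub]
      exact ((X0.projectionOntoL X1 hX).isBigO_comp _ _).trans (isBigO_sub_fderiv hF2 hF0 hFA)
  | succ n hn ih =>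
    intro hnℓ
    obtain ⟨p, h, hp, hh, hp0, hh0, hpd, hhd, hhb, hlin, hO⟩ := ih (by omega)
    have hpt : Tendsto p (𝓝 0) (𝓝 0) := by simpa [hp0] using hpd.continuousAt.tendsto
    have hres : ContDiffAt 𝕜 (ℓ + 1 : ℕ) (fun x => p (F x) - h (p x)) 0 :=
      ((hp _).contDiffAt.comp _ hF).sub ((hh _).contDiffAt.comp _ (hp _).contDiffAt)
    obtain ⟨r, hr⟩ := exists_leading_term (n + 1)
      (hres.of_le (by exact_mod_cast (by omega : n + 1 + 1 ≤ ℓ + 1)))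
      fun i hi => iteratedFDeriv_eq_zero_of_isBigO
        (hres.of_le (by exact_mod_cast (by omega : n + 1 ≤ ℓ + 1))) hO hi
    obtain ⟨q, hq⟩ := exists_multilinear_solution hX hA (hnr (n + 1) (by omega) hnℓ) r
    -- what remains of the residual after the correction `q` of `p`
    let K : ContinuousMultilinearMap 𝕜 (fun _ : Fin (n + 1) => X) X0 :=
      (q.compContinuousLinearMap fun _ => A) -
        (diagBlock hX A).compContinuousMultilinearMap q + r
    have hK : ∀ v, K v = q (fun i => A (v i)) - diagBlock hX A (q v) + r v := fun _ => rfl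
    let H := K.compContinuousLinearMap fun _ : Fin (n + 1) => X0.subtypeL
    have hKH : ∀ x, (K fun _ => x) = H fun _ => X0.projectionOntoL X1 hX x := by
      intro x
      have e : (fun _ : Fin (n + 1) => x) = (fun _ => X1.projectionL X0 hX.symm x) +
          fun _ => X0.projectionL X1 hX x := by
        funext i
        have := congrArg (fun L : X →L[𝕜] X => L x) (Submodule.projectionL_add_projectionL_eq_id hX)
        simpa [add_comm] using this.symm
      rw [e, K.map_add_univ, Finset.sum_eq_single ∅]
      · rw [Finset.piecewise_empty]
        rfl
      · intro S _ hS
        refine hq S (hm.trans (Finset.card_pos.2 (Finset.nonempty_iff_ne_empty.2 hS))) _ fun i => ?_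
        by_cases hi : i ∈ S
        · rw [Finset.piecewise_eq_of_mem _ _ _ hi, blockSpace_mem hi]
          exact Submodule.projectionL_apply_mem _ _
        · rw [Finset.piecewise_eq_of_notMem _ _ _ hi, blockSpace_notMem hi]
          exact Submodule.projectionL_apply_mem _ _
      · simp
    have hQ0 : (q fun _ => 0) = 0 := q.map_coord_zero (0 : Fin (n + 1)) rfl
    have hH0 : (H fun _ => 0) = 0 := H.map_coord_zero (0 : Fin (n + 1)) rfl
    have hpd' : HasFDerivAt (fun x => p x + q fun _ => x) (X0.projectionOntoL X1 hX) 0 := by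
      have := hpd.add (hasFDerivAt_diag_zero (by omega) q)
      rwa [add_zero] at this
    have hhd' : HasFDerivAt (fun z => h z + H fun _ => z) (diagBlock hX A) 0 := by
      have := hhd.add (hasFDerivAt_diag_zero (by omega) H)
      rwa [add_zero] at this
    have hp' : ∀ k, ContDiff 𝕜 k (fun x => p x + q fun _ => x) :=
      fun k => (hp k).add (contDiff_diag q)
    refine ⟨fun x => p x + q fun _ => x, fun z => h z + H fun _ => z, hp',
      fun k => (hh k).add (contDiff_diag H), by simp only [hp0, hQ0, add_zero],
      by simp only [hh0, hH0, add_zero], hpd', hhd', fun R i => ?_, fun hm0 z => ?_, ?_⟩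
    · obtain ⟨C, hC⟩ := hhb R i
      obtain ⟨C', hC'⟩ := exists_bound_iteratedFDeriv_diag H R i
      refine ⟨C + C', fun z hz => ?_⟩
      have e : (fun z => h z + H fun _ => z) = h + (fun z => H fun _ => z) := rfl
      rw [e, iteratedFDeriv_add_apply ((hh i).contDiffAt) (contDiff_diag H).contDiffAt]
      exact (norm_add_le _ _).trans (add_le_add (hC z hz) (hC' z hz))
    · have : (H fun _ => z) = 0 := by
        have := hq ∅ (by simp [hm0]) (fun _ => (z : X))
          (fun i => by rw [blockSpace_notMem (by simp)]; exact z.2)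
        exact this
      simp only [this, add_zero, hlin hm0]
    · have h1 : (fun x => (q fun _ => F x) - q fun _ => A x) =O[𝓝 0]
          fun x => ‖x‖ ^ (n + 1 + 1) :=
        isBigO_diag_sub (by omega) q hFO (by simpa using (A.isBigO_id (𝓝 0)).norm_right)
          (isBigO_sub_fderiv hF2 hF0 hFA)
      have h2 : (fun x => h (p x + q fun _ => x) - h (p x) - diagBlock hX A (q fun _ => x))
          =O[𝓝 0] fun x => ‖x‖ ^ (n + 1 + 1) := by
        have hO1 := isBigO_nonlinear_part ((hh 2).contDiffAt) hhd
        have ht : Tendsto (fun x => (p x + q fun _ => x, p x)) (𝓝 0) (𝓝 0) := by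
          have ht1 : Tendsto (fun x => p x + q fun _ => x) (𝓝 0) (𝓝 0) := by
            simpa [hp0, hQ0] using hpd'.continuousAt.tendsto
          exact ht1.prodMk_nhds hpt
        have hO2 := hO1.comp_tendsto ht
        simp only [Function.comp_def, add_sub_cancel_left] at hO2
        refine hO2.trans ?_
        have hO3 : (fun x => (p x + q fun _ => x, p x)) =O[𝓝 0] fun x => ‖x‖ :=
          (by simpa [hp0, hQ0] using hpd'.isBigO_sub.norm_right :
            (fun x => p x + q fun _ => x) =O[𝓝 0] fun x => ‖x‖).prod_left
          (by simpa [hp0] using hpd.isBigO_sub.norm_right)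
        refine (hO3.norm_left.mul (isBigO_diag q).norm_left).congr_right fun x => by ring
      have h3 : (fun x => (H fun _ => p x + q fun _ => x) -
          H fun _ => X0.projectionOntoL X1 hX x) =O[𝓝 0] fun x => ‖x‖ ^ (n + 1 + 1) :=
        isBigO_diag_sub (by omega) H
          (by simpa [hp0, hQ0] using hpd'.isBigO_sub.norm_right)
          (by simpa using ((X0.projectionOntoL X1 hX).isBigO_id (𝓝 0)).norm_right)
          (isBigO_sub_fderiv (hp' 2).contDiffAt (by simp [hp0, hQ0]) hpd')
      refine (((hr.add h1).sub h2).sub h3).congr_left fun x => ?_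
      rw [← hKH x, hK]
      beta_reduce
      abel

end

/-! ### Semiconjugacies as limits of iterates -/

section Iterates

/-- The iterates `g^n ∘ p ∘ F^n` of a map `p` under `π ↦ g ∘ π ∘ F`. -/
def semiIter {E Z : Type*} (g : Z → Z) (p : E → Z) (F : E → E) : ℕ → E → Z
  | 0, x => p x
  | n + 1, x => g (semiIter g p F n (F x))

/-- The data for the construction of a semiconjugacy by iteration of `π ↦ g ∘ π ∘ F` from `p`:
`F` contracts to `0` with factor `α`, `g` has Lipschitz constant `β`, and `p` solves the
equation `p = g ∘ p ∘ F` up to an error of order `s`, where `β * α ^ s < 1`. -/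
structure IterData (𝕜 : Type*) [RCLike 𝕜] {E Z : Type*} [NormedAddCommGroup E] [NormedSpace 𝕜 E]
    [NormedAddCommGroup Z] [NormedSpace 𝕜 Z] (F : E → E) (g : Z → Z) (p : E → Z) (α β : ℝ)
    (s j : ℕ) : Prop where
  α_nonneg : 0 ≤ α
  α_lt : α < 1
  β_nonneg : 0 ≤ β
  gap : β * α ^ s < 1
  s_pos : 1 ≤ s
  smooth_F : ContDiffAt 𝕜 j F 0
  F_zero : F 0 = 0
  F_le : ∀ᶠ x in 𝓝 0, ‖F x‖ ≤ α * ‖x‖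
  smooth_g : ContDiffAt 𝕜 ∞ g 0
  g_lip : ∀ᶠ z : Z × Z in 𝓝 0, ‖g z.1 - g z.2‖ ≤ β * ‖z.1 - z.2‖
  smooth_p : ContDiffAt 𝕜 ∞ p 0
  p_zero : p 0 = 0
  flat : FlatAt 𝕜 s j (fun x => p x - g (p (F x)))

variable {𝕜 : Type*} [RCLike 𝕜] {E Z : Type u} [NormedAddCommGroup E] [NormedSpace 𝕜 E]
    [NormedAddCommGroup Z] [NormedSpace 𝕜 Z] {F : E → E} {g : Z → Z} {p : E → Z} {α β : ℝ}
    {s j : ℕ}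

/-- Near `0` the iterates stay in a given neighbourhood of `0` and their increments decay
geometrically. -/
lemma IterData.exists_geometric (h : IterData 𝕜 F g p α β s j) {u : Set Z} (hu : u ∈ 𝓝 0) :
    ∃ δ > 0, ∃ C, 0 ≤ C ∧ ∀ x, ‖x‖ < δ → ‖F x‖ ≤ α * ‖x‖ ∧
      ∀ n, semiIter g p F n x ∈ u ∧
        ‖semiIter g p F n x - p x‖ ≤ C * ‖x‖ ^ s ∧
        ‖semiIter g p F (n + 1) x - semiIter g p F n x‖ ≤ C * (β * α ^ s) ^ n * ‖x‖ ^ s := by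
  have hβ := h.β_nonneg
  have hα := h.α_nonneg
  have hκ0 : 0 ≤ β * α ^ s := by positivity
  have hκ := h.gap
  obtain ⟨ρ, hρ, hg⟩ := Metric.eventually_nhds_iff.1 h.g_lip
  obtain ⟨ρ', hρ', hu⟩ := Metric.mem_nhds_iff.1 hu
  obtain ⟨C, hC0, hC⟩ := h.flat.isBigO.exists_nonneg
  set K := C / (1 - β * α ^ s)
  have hK0 : 0 ≤ K := div_nonneg hC0 (by linarith)
  have hCK : C ≤ K := by
    rw [le_div_iff₀ (by linarith)]
    nlinarith
  have hpt : Tendsto (fun x => ‖p x‖ + K * ‖x‖ ^ s) (𝓝 0) (𝓝 0) := by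
    have h1 : Tendsto (fun x => ‖p x‖) (𝓝 0) (𝓝 0) := by
      simpa [h.p_zero] using h.smooth_p.continuousAt.norm.tendsto
    have h2 : Tendsto (fun x : E => K * ‖x‖ ^ s) (𝓝 0) (𝓝 0) := by
      have h3 : Continuous fun x : E => K * ‖x‖ ^ s := by fun_prop
      have h4 : K * ‖(0 : E)‖ ^ s = 0 := by
        rw [norm_zero, zero_pow (show s ≠ 0 by have := h.s_pos; omega), mul_zero]
      exact h4 ▸ h3.tendsto 0
    simpa using h1.add h2
  obtain ⟨δ, hδ, hd⟩ := Metric.eventually_nhds_iff.1 ((h.F_le.and hC.bound).and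
    (hpt.eventually (gt_mem_nhds (lt_min hρ hρ'))))
  simp only [dist_zero_right] at hd hg
  have hsmall : ∀ x, ‖x‖ < δ → ∀ z, ‖z - p x‖ ≤ K * ‖x‖ ^ s → ‖z‖ < min ρ ρ' := by
    intro x hx z hz
    calc ‖z‖ ≤ ‖p x‖ + ‖z - p x‖ := by
          rw [add_comm]; simpa using norm_add_le (z - p x) (p x)
      _ ≤ ‖p x‖ + K * ‖x‖ ^ s := by gcongr
      _ < _ := (hd hx).2
  have hF : ∀ x, ‖x‖ < δ → ‖F x‖ < δ ∧ ‖F x‖ ≤ α * ‖x‖ := fun x hx =>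
    ⟨(hd hx).1.1.trans_lt ((mul_le_of_le_one_left (norm_nonneg x) h.α_lt.le).trans_lt hx),
      (hd hx).1.1⟩
  have hgeo : ∀ n, C * (∑ i ∈ Finset.range n, (β * α ^ s) ^ i) ≤ K := by
    intro n
    rw [le_div_iff₀ (by linarith), mul_assoc, geom_sum_mul_neg]
    exact mul_le_of_le_one_right hC0 (sub_le_self _ (by positivity))
  have main : ∀ n x, ‖x‖ < δ →
      ‖semiIter g p F n x - p x‖ ≤
          C * (∑ i ∈ Finset.range n, (β * α ^ s) ^ i) * ‖x‖ ^ s ∧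
        ‖semiIter g p F (n + 1) x - semiIter g p F n x‖ ≤ C * (β * α ^ s) ^ n * ‖x‖ ^ s := by
    intro n
    induction n with
    | zero =>
      intro x hx
      refine ⟨by simp [semiIter], ?_⟩
      have := (hd hx).1.2
      rw [norm_sub_rev]
      simpa [semiIter] using this
    | succ n ih =>
      intro x hx
      have h1 : ‖semiIter g p F (n + 1) x - p x‖ ≤
          C * (∑ i ∈ Finset.range (n + 1), (β * α ^ s) ^ i) * ‖x‖ ^ s := by
        obtain ⟨h1, h2⟩ := ih x hx
        rw [Finset.sum_range_succ]
        calc _ = ‖(semiIter g p F (n + 1) x - semiIter g p F n x) +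
              (semiIter g p F n x - p x)‖ := by rw [sub_add_sub_cancel]
          _ ≤ _ := (norm_add_le _ _).trans (add_le_add h2 h1)
          _ = _ := by ring
      refine ⟨h1, ?_⟩
      obtain ⟨hFx, hFx'⟩ := hF x hx
      obtain ⟨h2, h3⟩ := ih (F x) hFx
      have h4 : ‖semiIter g p F (n + 1) (F x) - p (F x)‖ ≤ K * ‖F x‖ ^ s := by
        have h5 : ‖semiIter g p F (n + 1) (F x) - p (F x)‖ ≤
            C * (∑ i ∈ Finset.range (n + 1), (β * α ^ s) ^ i) * ‖F x‖ ^ s := by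
          rw [Finset.sum_range_succ]
          calc _ = ‖(semiIter g p F (n + 1) (F x) - semiIter g p F n (F x)) +
                (semiIter g p F n (F x) - p (F x))‖ := by rw [sub_add_sub_cancel]
            _ ≤ _ := (norm_add_le _ _).trans (add_le_add h3 h2)
            _ = _ := by ring
        exact h5.trans (by gcongr; exact hgeo _)
      have h6 := hsmall _ hFx _ h4
      have h7 := hsmall _ hFx _ (h2.trans (by gcongr; exact hgeo _))
      have h8 := hg (y := (semiIter g p F (n + 1) (F x), semiIter g p F n (F x))) (by
        rw [Prod.norm_def]
        exact max_lt (h6.trans_le (min_le_left _ _)) (h7.trans_le (min_le_left _ _)))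
      calc ‖semiIter g p F (n + 1 + 1) x - semiIter g p F (n + 1) x‖
          ≤ β * ‖semiIter g p F (n + 1) (F x) - semiIter g p F n (F x)‖ := h8
        _ ≤ β * (C * (β * α ^ s) ^ n * ‖F x‖ ^ s) := by gcongr
        _ ≤ β * (C * (β * α ^ s) ^ n * (α * ‖x‖) ^ s) := by gcongr
        _ = _ := by ring
  refine ⟨δ, hδ, K, hK0, fun x hx => ⟨(hF x hx).2, fun n => ?_⟩⟩
  have h1 : ‖semiIter g p F n x - p x‖ ≤ K * ‖x‖ ^ s :=
    (main n x hx).1.trans (by gcongr; exact hgeo _)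
  refine ⟨hu ?_, h1, (main n x hx).2.trans (by gcongr)⟩
  rw [mem_ball_zero_iff]
  exact (hsmall x hx _ h1).trans_le (min_le_right _ _)

/-- The iterates converge, uniformly near `0`. -/
lemma IterData.exists_limit [CompleteSpace Z] (h : IterData 𝕜 F g p α β s j) :
    ∃ π : E → Z, ∃ δ > 0, TendstoUniformlyOn (semiIter g p F) π atTop (Metric.ball 0 δ) ∧
      (fun x => π x - p x) =O[𝓝 0] fun x => ‖x‖ ^ s := by
  obtain ⟨δ, hδ, C, hC0, hd⟩ := h.exists_geometric univ_mem
  have hκ0 : 0 ≤ β * α ^ s := mul_nonneg h.β_nonneg (pow_nonneg h.α_nonneg _)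
  set δ' := min δ 1
  have hst : ∀ x, ‖x‖ < δ' → ∀ n, dist (semiIter g p F n x) (semiIter g p F (n + 1) x) ≤
      C * (β * α ^ s) ^ n := by
    intro x hx n
    rw [dist_comm, dist_eq_norm]
    refine ((hd x (hx.trans_le (min_le_left _ _))).2 n).2.2.trans
      (mul_le_of_le_one_right (by positivity) ?_)
    exact pow_le_one₀ (norm_nonneg _) (hx.le.trans (min_le_right _ _))
  have hlim : ∀ x, ∃ a, ‖x‖ < δ' → Tendsto (fun n => semiIter g p F n x) atTop (𝓝 a) := by
    intro x
    by_cases hx : ‖x‖ < δ'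
    · obtain ⟨a, ha⟩ := cauchySeq_tendsto_of_complete
        (cauchySeq_of_le_geometric _ _ h.gap (hst x hx))
      exact ⟨a, fun _ => ha⟩
    · exact ⟨0, fun h' => (hx h').elim⟩
  choose π hπ using hlim
  refine ⟨π, δ', by positivity, ?_, ?_⟩
  · rw [Metric.tendstoUniformlyOn_iff]
    intro ε hε
    have h1 : Tendsto (fun n => C * (β * α ^ s) ^ n / (1 - β * α ^ s)) atTop (𝓝 0) := by
      simpa using ((tendsto_pow_atTop_nhds_zero_of_lt_one hκ0 h.gap).const_mul C).div_const
        (1 - β * α ^ s)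
    filter_upwards [h1.eventually (gt_mem_nhds hε)] with n hn x hx
    rw [mem_ball_zero_iff] at hx
    rw [dist_comm]
    exact (dist_le_of_le_geometric_of_tendsto _ _ h.gap (hst x hx) (hπ x hx) n).trans_lt hn
  · refine IsBigO.of_bound C (Metric.eventually_nhds_iff.2 ⟨δ', by positivity, fun x hx => ?_⟩)
    rw [dist_zero_right] at hx
    rw [norm_pow, norm_norm]
    exact le_of_tendsto ((hπ x hx).sub_const (p x)).norm
      (Eventually.of_forall fun n => ((hd x (hx.trans_le (min_le_left _ _))).2 n).2.1)

/-- Solutions of `π = g ∘ π ∘ F` are determined by their Taylor polynomial of order `s - 1`. -/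
lemma IterData.eventuallyEq (h : IterData 𝕜 F g p α β s j) {π π' : E → Z}
    (hπ : ∀ᶠ x in 𝓝 0, π x = g (π (F x))) (hπ' : ∀ᶠ x in 𝓝 0, π' x = g (π' (F x)))
    (hc : Tendsto π (𝓝 0) (𝓝 0)) (hc' : Tendsto π' (𝓝 0) (𝓝 0))
    (hO : (fun x => π x - π' x) =O[𝓝 0] fun x => ‖x‖ ^ s) : π =ᶠ[𝓝 0] π' := by
  have hβ := h.β_nonneg
  have hα := h.α_nonneg
  obtain ⟨C, hC0, hC⟩ := hO.exists_nonneg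
  have hFc : Tendsto F (𝓝 0) (𝓝 0) := by simpa [h.F_zero] using h.smooth_F.continuousAt.tendsto
  have hpair : Tendsto (fun x => (π (F x), π' (F x))) (𝓝 0) (𝓝 0) :=
    (hc.comp hFc).prodMk_nhds (hc'.comp hFc)
  obtain ⟨δ, hδ, hd⟩ := Metric.eventually_nhds_iff.1
    ((h.F_le.and hC.bound).and ((hπ.and hπ').and (hpair.eventually h.g_lip)))
  simp only [dist_zero_right, norm_pow, norm_norm] at hd
  have main : ∀ n x, ‖x‖ < δ → ‖π x - π' x‖ ≤ C * (β * α ^ s) ^ n * ‖x‖ ^ s := by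
    intro n
    induction n with
    | zero => intro x hx; simpa using (hd hx).1.2
    | succ n ih =>
      intro x hx
      obtain ⟨⟨h1, -⟩, ⟨h2, h3⟩, h4⟩ := hd hx
      have hFx : ‖F x‖ < δ :=
        h1.trans_lt ((mul_le_of_le_one_left (norm_nonneg x) h.α_lt.le).trans_lt hx)
      rw [h2, h3]
      calc _ ≤ β * ‖π (F x) - π' (F x)‖ := h4
        _ ≤ β * (C * (β * α ^ s) ^ n * (α * ‖x‖) ^ s) := by
          gcongr
          exact (ih _ hFx).trans (by gcongr)
        _ = _ := by ring
  refine Metric.eventually_nhds_iff.2 ⟨δ, hδ, fun x hx => ?_⟩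
  rw [dist_zero_right] at hx
  have hlim : Tendsto (fun n => C * (β * α ^ s) ^ n * ‖x‖ ^ s) atTop (𝓝 0) := by
    simpa using ((tendsto_pow_atTop_nhds_zero_of_lt_one (mul_nonneg hβ (pow_nonneg hα s))
      h.gap).const_mul C).mul_const (‖x‖ ^ s)
  have := ge_of_tendsto' hlim fun n => main n x hx
  exact sub_eq_zero.1 (norm_le_zero_iff.1 this)

end Iterates

section Tangent

variable {𝕜 : Type*} [RCLike 𝕜] {A B C W : Type u} [NormedAddCommGroup A] [NormedSpace 𝕜 A]
  [NormedAddCommGroup B] [NormedSpace 𝕜 B] [NormedAddCommGroup C] [NormedSpace 𝕜 C]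
  [NormedAddCommGroup W] [NormedSpace 𝕜 W]

/-- The tangent map of `f`, acting on points together with a family of tangent vectors
parametrized linearly by `W`. -/
def tangentMap (𝕜 : Type*) [RCLike 𝕜] {A B : Type*} (W : Type*) [NormedAddCommGroup A]
    [NormedSpace 𝕜 A] [NormedAddCommGroup B] [NormedSpace 𝕜 B] [NormedAddCommGroup W]
    [NormedSpace 𝕜 W] (f : A → B) (z : A × (W →L[𝕜] A)) : B × (W →L[𝕜] B) :=
  (f z.1, (fderiv 𝕜 f z.1).comp z.2)

lemma tangentMap_comp {f : B → C} {k : A → B} {z : A × (W →L[𝕜] A)}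
    (hf : DifferentiableAt 𝕜 f (k z.1)) (hk : DifferentiableAt 𝕜 k z.1) :
    tangentMap 𝕜 W (fun x => f (k x)) z = tangentMap 𝕜 W f (tangentMap 𝕜 W k z) := by
  have : fderiv 𝕜 (fun x => f (k x)) z.1 = _ := fderiv_comp z.1 hf hk
  simp only [tangentMap, this]
  rfl

lemma contDiffAt_tangentMap {n m : WithTop ℕ∞} {f : A → B} (hf : ContDiffAt 𝕜 n f 0)
    (hmn : m + 1 ≤ n) : ContDiffAt 𝕜 m (tangentMap 𝕜 W f) 0 := by
  have h1 : ContDiffAt 𝕜 m f 0 := hf.of_le (le_self_add.trans hmn)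
  have h2 : ContDiffAt 𝕜 m (fderiv 𝕜 f) 0 := hf.fderiv_right hmn
  refine ContDiffAt.prodMk (ContDiffAt.comp (0 : A × (W →L[𝕜] A)) h1 contDiffAt_fst) ?_
  exact ContDiffAt.clm_comp (ContDiffAt.comp (0 : A × (W →L[𝕜] A)) h2 contDiffAt_fst)
    contDiffAt_snd

lemma tangentMap_le {f : A → B} (hf : ContDiffAt 𝕜 1 f 0) {c c' : ℝ} (hc : 0 ≤ c) (hcc : c < c')
    (hle : ∀ᶠ x in 𝓝 0, ‖f x - f 0‖ ≤ c * ‖x‖) :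
    ∀ᶠ z in 𝓝 0, ‖tangentMap 𝕜 W f z - tangentMap 𝕜 W f 0‖ ≤ c' * ‖z‖ := by
  have h1 : ‖fderiv 𝕜 f 0‖ ≤ c := (hf.differentiableAt (by simp)).hasFDerivAt.le_of_lip' hc
    (by simpa using hle)
  have h2 : ContinuousAt (fderiv 𝕜 f) 0 :=
    (hf.fderiv_right (m := 0) (by simp)).continuousAt
  have h3 : ∀ᶠ x in 𝓝 0, ‖fderiv 𝕜 f x‖ < c' :=
    h2.norm.eventually (gt_mem_nhds (h1.trans_lt hcc))
  have ht : Tendsto (Prod.fst : A × (W →L[𝕜] A) → A) (𝓝 0) (𝓝 0) := continuous_fst.tendsto 0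
  filter_upwards [ht.eventually hle, ht.eventually h3] with z hz hz'
  have e : tangentMap 𝕜 W f z - tangentMap 𝕜 W f 0 =
      (f z.1 - f 0, (fderiv 𝕜 f z.1).comp z.2) := by
    simp [tangentMap]
  have hc' : 0 ≤ c' := hc.trans hcc.le
  rw [e, Prod.norm_def]
  refine max_le (hz.trans ?_) ((ContinuousLinearMap.opNorm_comp_le _ _).trans ?_)
  · gcongr
    exact norm_fst_le z
  · gcongr
    exact norm_snd_le z

lemma tangentMap_lipschitz {f : A → B} (hf : ContDiffAt 𝕜 (1 + 1 : ℕ) f 0) {c c' : ℝ} (hc : 0 ≤ c)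
    (hcc : c < c') (hle : ∀ᶠ x in 𝓝 0, ‖f x - f 0‖ ≤ c * ‖x‖) :
    ∀ᶠ z : (A × (W →L[𝕜] A)) × (A × (W →L[𝕜] A)) in 𝓝 0,
      ‖tangentMap 𝕜 W f z.1 - tangentMap 𝕜 W f z.2‖ ≤ c' * ‖z.1 - z.2‖ := by
  obtain ⟨d, hcd, hdc⟩ := exists_between hcc
  have h1 : ContDiffAt 𝕜 1 (tangentMap 𝕜 W f) 0 := contDiffAt_tangentMap hf (by norm_num)
  have h2 : ‖fderiv 𝕜 (tangentMap 𝕜 W f) 0‖ ≤ d :=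
    (h1.differentiableAt (by simp)).hasFDerivAt.le_of_lip' (hc.trans hcd.le)
      (by simpa using tangentMap_le (hf.of_le (by norm_num)) hc hcd hle)
  obtain ⟨s, hs, hL⟩ := (h1.hasStrictFDerivAt (by simp)).exists_lipschitzOnWith_of_nnnorm_lt
    ⟨c', hc.trans hcc.le⟩ (by exact_mod_cast h2.trans_lt hdc)
  filter_upwards [prod_mem_nhds hs hs] with z hz
  exact hL.norm_sub_le hz.1 hz.2

lemma FlatAt.tangentMap {s j : ℕ} (hs : 1 ≤ s) {f : A → B} (h : FlatAt 𝕜 s (j + 1) f) :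
    FlatAt 𝕜 s j (tangentMap 𝕜 W f) := by
  have h1 : FlatAt 𝕜 s j f := ⟨h.1.of_le (by norm_cast; omega), fun i hi => h.2 i (by omega)⟩
  refine (h1.comp_clm (ContinuousLinearMap.fst 𝕜 A (W →L[𝕜] A))).prodMk ?_
  have := (h.fderiv.comp_clm (ContinuousLinearMap.fst 𝕜 A (W →L[𝕜] A))).bilinear
    (flatAt_clm j (ContinuousLinearMap.snd 𝕜 A (W →L[𝕜] A))) (ContinuousLinearMap.compL 𝕜 W A B)
  rwa [Nat.sub_add_cancel hs] at this

lemma FlatAt.congr {s j : ℕ} {f f' : A → B} (h : FlatAt 𝕜 s j f) (hf : f =ᶠ[𝓝 0] f') :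
    FlatAt 𝕜 s j f' :=
  ⟨h.1.congr_of_eventuallyEq hf.symm, fun i hi => (h.2 i hi).congr' (hf.iteratedFDeriv 𝕜 i)
    EventuallyEq.rfl⟩

variable {E Z : Type u} [NormedAddCommGroup E] [NormedSpace 𝕜 E]
    [NormedAddCommGroup Z] [NormedSpace 𝕜 Z] {F : E → E} {g : Z → Z} {p : E → Z} {α β : ℝ}
    {s j : ℕ}

lemma ContDiffAt.eventually_differentiableAt {n : ℕ} {f : A → B} {x : A}
    (hf : ContDiffAt 𝕜 (n + 1 : ℕ) f x) : ∀ᶠ y in 𝓝 x, DifferentiableAt 𝕜 f y := by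
  filter_upwards [hf.eventually (natCast_ne_infty _)] with y hy
  exact hy.differentiableAt (by simp)

lemma IterData.g_zero (h : IterData 𝕜 F g p α β s j) : g 0 = 0 := by
  have h1 := h.flat.isBigO.eq_zero_imp.self_of_nhds
  have hs : s ≠ 0 := by have := h.s_pos; omega
  simpa [h.F_zero, h.p_zero, hs] using h1

lemma IterData.tangent (h : IterData 𝕜 F g p α β s (j + 1)) :
    ∃ α' β', IterData 𝕜 (tangentMap 𝕜 E F) (tangentMap 𝕜 E g) (tangentMap 𝕜 E p) α' β' s j := by
  obtain ⟨ε, hε, h1, h2⟩ : ∃ ε > 0, α + ε < 1 ∧ (β + ε) * (α + ε) ^ s < 1 := by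
    have c1 : Tendsto (fun ε : ℝ => α + ε) (𝓝[>] 0) (𝓝 α) := by
      have : Continuous fun ε : ℝ => α + ε := by fun_prop
      simpa using (this.tendsto 0).mono_left nhdsWithin_le_nhds
    have c2 : Tendsto (fun ε : ℝ => (β + ε) * (α + ε) ^ s) (𝓝[>] 0) (𝓝 (β * α ^ s)) := by
      have : Continuous fun ε : ℝ => (β + ε) * (α + ε) ^ s := by fun_prop
      simpa using (this.tendsto 0).mono_left nhdsWithin_le_nhds
    obtain ⟨ε, ⟨h1, h2⟩, hε⟩ := ((c1.eventually (gt_mem_nhds h.α_lt)).and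
      (c2.eventually (gt_mem_nhds h.gap)) |>.and self_mem_nhdsWithin).exists
    exact ⟨ε, hε, h1, h2⟩
  have hF1 : ContDiffAt 𝕜 1 F 0 := h.smooth_F.of_le (by exact_mod_cast Nat.le_add_left 1 j)
  have hg0 := h.g_zero
  have hg' : ∀ᶠ z in 𝓝 0, ‖g z - g 0‖ ≤ β * ‖z‖ := by
    have ht : Tendsto (fun z : Z => (z, (0 : Z))) (𝓝 0) (𝓝 0) :=
      (continuous_id.prodMk continuous_const).tendsto 0
    simpa using ht.eventually h.g_lip
  refine ⟨α + ε, β + ε, ⟨by linarith [h.α_nonneg], h1, by linarith [h.β_nonneg], h2, h.s_pos,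
    contDiffAt_tangentMap h.smooth_F (by norm_cast), ?_, ?_,
    contDiffAt_tangentMap h.smooth_g (by simp), ?_,
    contDiffAt_tangentMap h.smooth_p (by simp), ?_, ?_⟩⟩
  · simp [tangentMap, h.F_zero]
  · have := tangentMap_le (W := E) hF1 h.α_nonneg (lt_add_of_pos_right α hε)
      (by simpa [h.F_zero] using h.F_le)
    simpa [tangentMap, h.F_zero] using this
  · exact tangentMap_lipschitz
      (h.smooth_g.of_le (natCast_le_infty _)) h.β_nonneg
      (lt_add_of_pos_right β hε) hg'
  · simp [tangentMap, h.p_zero]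
  · refine (FlatAt.tangentMap (W := E) h.s_pos h.flat).congr ?_
    have hFt : Tendsto F (𝓝 0) (𝓝 0) := by simpa [h.F_zero] using h.smooth_F.continuousAt.tendsto
    have hpt : Tendsto p (𝓝 0) (𝓝 0) := by simpa [h.p_zero] using h.smooth_p.continuousAt.tendsto
    have dF := ContDiffAt.eventually_differentiableAt h.smooth_F
    have dp := ContDiffAt.eventually_differentiableAt
      (h.smooth_p.of_le (natCast_le_infty (0 + 1)))
    have dg := ContDiffAt.eventually_differentiableAt
      (h.smooth_g.of_le (natCast_le_infty (0 + 1)))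
    have ht : Tendsto (Prod.fst : E × (E →L[𝕜] E) → E) (𝓝 0) (𝓝 0) := continuous_fst.tendsto 0
    filter_upwards [ht.eventually (dp.and dF), ht.eventually (hFt.eventually dp),
      ht.eventually ((hpt.comp hFt).eventually dg)] with z hz hz' hz''
    have d1 : DifferentiableAt 𝕜 (fun x => p (F x)) z.1 := hz'.comp _ hz.2
    have e : tangentMap 𝕜 E (fun x => p x - g (p (F x))) z =
        tangentMap 𝕜 E p z - tangentMap 𝕜 E (fun x => g (p (F x))) z := by
      have : fderiv 𝕜 (fun x => p x - g (p (F x))) z.1 =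
          fderiv 𝕜 p z.1 - fderiv 𝕜 (fun x => g (p (F x))) z.1 :=
        fderiv_sub hz.1 (DifferentiableAt.comp z.1 (g := g) (f := fun x => p (F x)) hz'' d1)
      simp only [tangentMap, this, ContinuousLinearMap.sub_comp]
      rfl
    rw [e, tangentMap_comp (f := g) (k := fun x => p (F x)) hz'' d1,
      tangentMap_comp (f := p) (k := F) hz' hz.2]

/-- Near `0` the iterates of the tangent data are the tangent maps of the iterates. -/
lemma IterData.semiIter_tangent (h : IterData 𝕜 F g p α β s (j + 1)) :
    ∃ δ > 0, ∀ x, ‖x‖ < δ → ∀ n, DifferentiableAt 𝕜 (semiIter g p F n) x ∧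
      ∀ Ξ : E →L[𝕜] E, semiIter (tangentMap 𝕜 E g) (tangentMap 𝕜 E p) (tangentMap 𝕜 E F) n (x, Ξ) =
        tangentMap 𝕜 E (semiIter g p F n) (x, Ξ) := by
  have dF := ContDiffAt.eventually_differentiableAt h.smooth_F
  have dp := ContDiffAt.eventually_differentiableAt
    (h.smooth_p.of_le (natCast_le_infty (0 + 1)))
  have dg := ContDiffAt.eventually_differentiableAt
    (h.smooth_g.of_le (natCast_le_infty (0 + 1)))
  obtain ⟨δ₁, hδ₁, C, -, hd₁⟩ := h.exists_geometric dg
  obtain ⟨δ₂, hδ₂, hd₂⟩ := Metric.eventually_nhds_iff.1 (dF.and dp)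
  simp only [dist_zero_right] at hd₂
  refine ⟨min δ₁ δ₂, lt_min hδ₁ hδ₂, fun x hx n => ?_⟩
  induction n generalizing x with
  | zero =>
    exact ⟨(hd₂ (hx.trans_le (min_le_right _ _))).2, fun Ξ => rfl⟩
  | succ n ih =>
    have hx1 := hx.trans_le (min_le_left _ _)
    have hFx : ‖F x‖ < min δ₁ δ₂ := ((hd₁ x hx1).1).trans_lt
      ((mul_le_of_le_one_left (norm_nonneg x) h.α_lt.le).trans_lt hx)
    obtain ⟨i1, i2⟩ := ih (F x) hFx
    have d1 : DifferentiableAt 𝕜 F x := (hd₂ (hx.trans_le (min_le_right _ _))).1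
    have d2 : DifferentiableAt 𝕜 g (semiIter g p F n (F x)) :=
      ((hd₁ (F x) (hFx.trans_le (min_le_left _ _))).2 n).1
    have d3 : DifferentiableAt 𝕜 (fun x => semiIter g p F n (F x)) x := i1.comp _ d1
    refine ⟨DifferentiableAt.comp x (g := g) d2 d3, fun Ξ => ?_⟩
    have e := tangentMap_comp (W := E) (f := g) (k := fun x => semiIter g p F n (F x))
      (z := (x, Ξ)) d2 d3
    have e' := tangentMap_comp (W := E) (f := semiIter g p F n) (k := F) (z := (x, Ξ)) i1 d1
    change tangentMap 𝕜 E g (semiIter _ _ _ n (tangentMap 𝕜 E F (x, Ξ))) =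
      tangentMap 𝕜 E (fun x => g (semiIter g p F n (F x))) (x, Ξ)
    rw [e, e']
    congr 1
    exact i2 _

/-- Pointwise limits of the iterates inherit the regularity of `F`. The derivatives of the
iterates are read off from the iterates of the tangent data, which converge uniformly. -/
theorem IterData.contDiffAt_limit {E Z : Type u} [NormedAddCommGroup E] [NormedSpace 𝕜 E]
    [NormedAddCommGroup Z] [NormedSpace 𝕜 Z] [CompleteSpace Z] {F : E → E} {g : Z → Z} {p : E → Z}
    {α β : ℝ} {s j : ℕ} (h : IterData 𝕜 F g p α β s j) {π : E → Z}
    (hπ : ∀ᶠ x in 𝓝 0, Tendsto (fun n => semiIter g p F n x) atTop (𝓝 (π x))) :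
    ContDiffAt 𝕜 j π 0 := by
  obtain ⟨π₁, δ₁, hδ₁, hu, -⟩ := h.exists_limit
  have hππ : π₁ =ᶠ[𝓝 0] π := by
    filter_upwards [hπ, Metric.ball_mem_nhds 0 hδ₁] with x hx hx'
    exact tendsto_nhds_unique (hu.tendsto_at hx') hx
  refine ContDiffAt.congr_of_eventuallyEq ?_ hππ.symm
  clear hππ hπ π
  induction j generalizing E Z α β δ₁ with
  | zero =>
    obtain ⟨uF, huF, cF⟩ := contDiffAt_zero.1 h.smooth_F
    obtain ⟨up, hup, cp⟩ := contDiffAt_zero.1 (h.smooth_p.of_le zero_le)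
    obtain ⟨ug, hug, cg⟩ := contDiffAt_zero.1 (h.smooth_g.of_le zero_le)
    obtain ⟨δ₂, hδ₂, C, -, hd⟩ := h.exists_geometric hug
    obtain ⟨δ₃, hδ₃, hb⟩ := Metric.mem_nhds_iff.1 (inter_mem huF hup)
    set δ := min δ₁ (min δ₂ δ₃)
    have hδ : 0 < δ := by positivity
    have hFm : MapsTo F (Metric.ball 0 δ) (Metric.ball 0 δ) := by
      intro x hx
      rw [mem_ball_zero_iff] at hx ⊢
      exact ((hd x (hx.trans_le ((min_le_right _ _).trans (min_le_left _ _)))).1).trans_lt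
        ((mul_le_of_le_one_left (norm_nonneg x) h.α_lt.le).trans_lt hx)
    have hsub : Metric.ball (0 : E) δ ⊆ uF ∩ up :=
      (Metric.ball_subset_ball ((min_le_right _ _).trans (min_le_right _ _))).trans hb
    have hc : ∀ n, ContinuousOn (semiIter g p F n) (Metric.ball 0 δ) := by
      intro n
      induction n with
      | zero => exact cp.mono (hsub.trans inter_subset_right)
      | succ n ih =>
        refine cg.comp (ih.comp (cF.mono (hsub.trans inter_subset_left)) hFm) fun x hx => ?_
        have := hFm hx
        rw [mem_ball_zero_iff] at this
        exact ((hd (F x) (this.trans_le ((min_le_right _ _).trans (min_le_left _ _)))).2 n).1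
    refine contDiffAt_zero.2 ⟨Metric.ball 0 δ, Metric.ball_mem_nhds 0 hδ, ?_⟩
    exact (hu.mono (Metric.ball_subset_ball (min_le_left _ _))).continuousOn
      (Eventually.of_forall hc).frequently
  | succ j ih =>
    obtain ⟨α', β', ht⟩ := h.tangent
    obtain ⟨π₂, δ₂, hδ₂, hu₂, -⟩ := ht.exists_limit
    obtain ⟨δ₃, hδ₃, hd⟩ := h.semiIter_tangent
    have hc := ih ht π₂ δ₂ hδ₂ hu₂
    obtain ⟨δ₄, hδ₄, hc⟩ := Metric.eventually_nhds_iff.1 (hc.eventually (natCast_ne_infty _))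
    obtain ⟨ε, hε0, hε⟩ := NormedField.exists_norm_lt 𝕜 (show 0 < min δ₂ δ₄ by positivity)
    set J : E →L[𝕜] E := ε • ContinuousLinearMap.id 𝕜 E
    have hJ : ‖J‖ < min δ₂ δ₄ := by
      refine lt_of_le_of_lt (J.opNorm_le_bound (norm_nonneg ε) fun v => ?_) hε
      exact (norm_smul ε v).le
    rw [Nat.cast_add, Nat.cast_one, contDiffAt_succ_iff_hasFDerivAt]
    refine ⟨fun x => ε⁻¹ • (π₂ (x, J)).2, ⟨Metric.ball 0 (min δ₁ (min δ₂ δ₃)),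
      Metric.ball_mem_nhds 0 (by positivity), fun x hx => ?_⟩, ?_⟩
    · have hmaps : ∀ y ∈ Metric.ball (0 : E) (min δ₁ (min δ₂ δ₃)),
          (y, J) ∈ Metric.ball (0 : E × (E →L[𝕜] E)) δ₂ := by
        intro y hy
        rw [mem_ball_zero_iff] at hy ⊢
        exact max_lt (hy.trans_le ((min_le_right _ _).trans (min_le_left _ _)))
          (hJ.trans_le (min_le_left _ _))
      have hunif : TendstoUniformlyOn (fun n y => ε⁻¹ • (semiIter (tangentMap 𝕜 E g)
          (tangentMap 𝕜 E p) (tangentMap 𝕜 E F) n (y, J)).2)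
          (fun y => ε⁻¹ • (π₂ (y, J)).2) atTop (Metric.ball 0 (min δ₁ (min δ₂ δ₃))) := by
        have h1 : TendstoUniformlyOn (fun n y => semiIter (tangentMap 𝕜 E g)
            (tangentMap 𝕜 E p) (tangentMap 𝕜 E F) n (y, J)) (fun y => π₂ (y, J)) atTop
            (Metric.ball 0 (min δ₁ (min δ₂ δ₃))) :=
          (hu₂.comp fun y => (y, J)).mono hmaps
        have h2 : UniformContinuous fun z : Z × (E →L[𝕜] Z) => ε⁻¹ • z.2 :=
          (uniformContinuous_const_smul ε⁻¹).comp uniformContinuous_snd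
        exact h2.comp_tendstoUniformlyOn h1
      refine hasFDerivAt_of_tendstoUniformlyOn (𝕜 := 𝕜) Metric.isOpen_ball hunif
        (fun n y hy => ?_) (fun y hy => (hu.mono (Metric.ball_subset_ball
          (min_le_left _ _))).tendsto_at hy) hx
      rw [mem_ball_zero_iff] at hy
      obtain ⟨d1, d2⟩ := hd y (hy.trans_le ((min_le_right _ _).trans (min_le_right _ _))) n
      rw [d2 J]
      convert d1.hasFDerivAt using 1
      ext v
      simp [tangentMap, J, smul_smul, inv_mul_cancel₀ (norm_pos_iff.1 hε0)]
    · have h1 : ContDiffAt 𝕜 j π₂ ((0 : E), J) := hc (by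
        rw [dist_zero_right]
        exact max_lt (by simpa using hδ₄) (hJ.trans_le (min_le_right _ _)))
      have h2 : ContDiffAt 𝕜 j (fun x : E => (x, J)) 0 := contDiffAt_id.prodMk contDiffAt_const
      have h3 : ContDiffAt 𝕜 j (fun x => π₂ (x, J)) 0 := ContDiffAt.comp (0 : E) h1 h2
      exact h3.snd.const_smul ε⁻¹

end Tangent

/-! ### Germs of semiconjugacies: existence -/

section

variable {𝕜 : Type*} [RCLike 𝕜] {E F : Type*} [NormedAddCommGroup E] [NormedSpace 𝕜 E]
  [NormedAddCommGroup F] [NormedSpace 𝕜 F]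

lemma exists_local_inverse [CompleteSpace E] {n : WithTop ℕ∞} (hn : n ≠ 0) {f : E → F}
    {e : E ≃L[𝕜] F} (hf : ContDiffAt 𝕜 n f 0) (hd : HasFDerivAt f (e : E →L[𝕜] F) 0)
    (h0 : f 0 = 0) :
    ∃ g : F → E, g 0 = 0 ∧ ContDiffAt 𝕜 n g 0 ∧ HasFDerivAt g (e.symm : F →L[𝕜] E) 0 ∧
      (∀ᶠ x in 𝓝 0, g (f x) = x) ∧ ∀ᶠ y in 𝓝 0, f (g y) = y := by
  have hs := hf.hasStrictFDerivAt' hd hn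
  refine ⟨hf.localInverse hd hn, ?_, ?_, ?_, hs.eventually_left_inverse, ?_⟩
  · have := hf.localInverse_apply_image hd hn
    rwa [h0] at this
  · have := hf.to_localInverse hd hn
    rwa [h0] at this
  · have := hs.to_localInverse.hasFDerivAt
    rwa [h0] at this
  · have := hs.eventually_right_inverse
    rwa [h0] at this

lemma eventually_norm_le {f : E → F} {L : E →L[𝕜] F} (hL : HasFDerivAt f L 0) (h0 : f 0 = 0)
    {α : ℝ} (hα : ‖L‖ < α) : ∀ᶠ x in 𝓝 0, ‖f x‖ ≤ α * ‖x‖ := by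
  filter_upwards [(hasFDerivAt_iff_isLittleO_nhds_zero.1 hL).bound (sub_pos.2 hα)] with x hx
  simp only [zero_add, h0, sub_zero] at hx
  calc ‖f x‖ = ‖(f x - L x) + L x‖ := by rw [sub_add_cancel]
    _ ≤ (α - ‖L‖) * ‖x‖ + ‖L‖ * ‖x‖ := (norm_add_le _ _).trans (add_le_add hx (L.le_opNorm x))
    _ = _ := by ring

lemma eventually_lipschitz {f : E → F} {L : E →L[𝕜] F} (hf : ContDiffAt 𝕜 1 f 0)
    (hL : HasFDerivAt f L 0) {β : ℝ} (hβ : ‖L‖ < β) :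
    ∀ᶠ z : E × E in 𝓝 0, ‖f z.1 - f z.2‖ ≤ β * ‖z.1 - z.2‖ := by
  obtain ⟨s, hs, hL⟩ := (hf.hasStrictFDerivAt' hL (by simp)).exists_lipschitzOnWith_of_nnnorm_lt
    ⟨β, (norm_nonneg _).trans hβ.le⟩ (by exact_mod_cast hβ)
  filter_upwards [prod_mem_nhds hs hs] with z hz
  exact hL.norm_sub_le hz.1 hz.2

lemma hasFDerivAt_iterate {f : E → E} {L : E →L[𝕜] E} (hL : HasFDerivAt f L 0) (h0 : f 0 = 0)
    (n : ℕ) : HasFDerivAt f^[n] (L ^ n) 0 := by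
  exact hL.iterate h0 n

lemma iterate_zero_of_fixed {E : Type*} [Zero E] {f : E → E} (h0 : f 0 = 0) (n : ℕ) :
    f^[n] 0 = 0 := Function.iterate_fixed h0 n

lemma contDiffAt_iterate {f : E → E} {k : WithTop ℕ∞} (hf : ContDiffAt 𝕜 k f 0) (h0 : f 0 = 0)
    (n : ℕ) : ContDiffAt 𝕜 k f^[n] 0 := by
  induction n with
  | zero => exact contDiffAt_id
  | succ n ih =>
    rw [Function.iterate_succ']
    exact ContDiffAt.comp 0 (by rwa [iterate_zero_of_fixed h0]) ih

lemma semiIter_eq {E Z : Type*} (g : Z → Z) (p : E → Z) (F : E → E) (n : ℕ) (x : E) :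
    semiIter g p F n x = g^[n] (p (F^[n] x)) := by
  induction n generalizing x with
  | zero => rfl
  | succ n ih => rw [semiIter, ih, Function.iterate_succ_apply', Function.iterate_succ_apply]

/-- A sequence of the form `b n * a n ^ s` tending to `0` can be made small together with
`a n`, with room to spare in the factors. -/
lemma exists_gap_margin {a b : ℕ → ℝ} {s : ℕ} (ha : Tendsto a atTop (𝓝 0))
    (hab : Tendsto (fun n => b n * a n ^ s) atTop (𝓝 0)) {M : ℝ} (hM : 0 < M) :
    ∃ n, ∃ ε > 0, (a n + ε) * M < 1 ∧ (b n + ε) * (a n + ε) ^ s * M < 1 := by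
  obtain ⟨n, hn1, hn2⟩ := ((ha.eventually (gt_mem_nhds (inv_pos.2 hM))).and
    (hab.eventually (gt_mem_nhds (inv_pos.2 hM)))).exists
  have c1 : Tendsto (fun ε : ℝ => a n + ε) (𝓝[>] 0) (𝓝 (a n)) := by
    have : Continuous fun ε : ℝ => a n + ε := by fun_prop
    simpa using (this.tendsto 0).mono_left nhdsWithin_le_nhds
  have c2 : Tendsto (fun ε : ℝ => (b n + ε) * (a n + ε) ^ s) (𝓝[>] 0) (𝓝 (b n * a n ^ s)) := by
    have : Continuous fun ε : ℝ => (b n + ε) * (a n + ε) ^ s := by fun_prop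
    simpa using (this.tendsto 0).mono_left nhdsWithin_le_nhds
  obtain ⟨ε, ⟨h1, h2⟩, hε⟩ := ((c1.eventually (gt_mem_nhds hn1)).and
    (c2.eventually (gt_mem_nhds hn2)) |>.and self_mem_nhdsWithin).exists
  exact ⟨n, ε, hε, by rwa [← lt_div_iff₀ hM, one_div], by rwa [← lt_div_iff₀ hM, one_div]⟩

/-- If `p = g ∘ p ∘ F` up to order `s`, then the same holds for the iterates of `g` and `F`. -/
lemma isBigO_semiIter {g : F → F} {p : E → F} {f : E → E} {s : ℕ} (hf0 : f 0 = 0)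
    (hfO : f =O[𝓝 0] fun x => ‖x‖) (hfc : ContinuousAt f 0)
    (hg : ∃ β : ℝ, ∀ᶠ z : F × F in 𝓝 0, ‖g z.1 - g z.2‖ ≤ β * ‖z.1 - z.2‖)
    (hgc : ContinuousAt g 0) (hg0 : g 0 = 0) (hpc : ContinuousAt p 0) (hp0 : p 0 = 0)
    (h : (fun x => p x - g (p (f x))) =O[𝓝 0] fun x => ‖x‖ ^ s) (n : ℕ) :
    (fun x => p x - semiIter g p f n x) =O[𝓝 0] fun x => ‖x‖ ^ s := by
  have hft : Tendsto f (𝓝 0) (𝓝 0) := by simpa [hf0] using hfc.tendsto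
  have hpt : Tendsto p (𝓝 0) (𝓝 0) := by simpa [hp0] using hpc.tendsto
  have hgt : Tendsto g (𝓝 0) (𝓝 0) := by simpa [hg0] using hgc.tendsto
  have hst : ∀ n, Tendsto (semiIter g p f n) (𝓝 0) (𝓝 0) := by
    intro n
    induction n with
    | zero => exact hpt
    | succ n ih => exact hgt.comp (ih.comp hft)
  induction n with
  | zero => simpa [semiIter] using isBigO_zero _ _
  | succ n ih =>
    obtain ⟨β, hβ⟩ := hg
    have h1 : (fun x => g (p (f x)) - g (semiIter g p f n (f x))) =O[𝓝 0]
        fun x => ‖x‖ ^ s := by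
      have h2 := (((hpt.comp hft).prodMk_nhds ((hst n).comp hft))).eventually hβ
      have h3 : (fun x => g (p (f x)) - g (semiIter g p f n (f x))) =O[𝓝 0]
          fun x => p (f x) - semiIter g p f n (f x) := IsBigO.of_bound β h2
      exact h3.trans ((ih.comp_tendsto hft).trans (by
        simpa [Function.comp_def] using hfO.norm_left.pow s))
    refine (h.add h1).congr_left fun x => ?_
    rw [sub_add_sub_cancel]
    rfl

end

section

variable {𝕜 : Type*} [RCLike 𝕜] {X : Type u} [NormedAddCommGroup X] [NormedSpace ℝ X]
  [NormedSpace 𝕜 X] [IsScalarTower ℝ 𝕜 X] [CompleteSpace X] {X0 X1 : Submodule 𝕜 X}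

/-- Under the spectral gap and nonresonance conditions, the germ of `F` at `0` is semiconjugate
to the germ of a map `h` of `X0` with all derivatives bounded on balls, by a map `π` which is as
smooth as `F`. -/
theorem exists_semiconjugacy (hX : X0.IsTopCompl X1) {F : X → X} {A : X →L[𝕜] X} {ℓ m : ℕ}
    (hℓ : 1 ≤ ℓ) (hF : ContDiffAt 𝕜 (ℓ + 1 : ℕ) F 0) (hF0 : F 0 = 0) (hFA : HasFDerivAt F A 0)
    (hA : ∀ x ∈ X1, A x ∈ X1) (hm : m ≤ 1)
    (hnr : ∀ n, 2 ≤ n → n ≤ ℓ → BlockNonresonant hX A (diagBlock hX A) n m)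
    (e : X0 ≃L[𝕜] X0) (he : (e : X0 →L[𝕜] X0) = diagBlock hX A)
    (hA0 : Tendsto (fun n => ‖A ^ n‖) atTop (𝓝 0))
    (hgap : Tendsto (fun n => ‖(e.symm : X0 →L[𝕜] X0) ^ n‖ * ‖A ^ n‖ ^ (ℓ + 1)) atTop (𝓝 0)) :
    ∃ (π : X → X0) (h : X0 → X0), (∀ j : ℕ, ContDiffAt 𝕜 j F 0 → ContDiffAt 𝕜 j π 0) ∧
      π 0 = 0 ∧ HasFDerivAt π (X0.projectionOntoL X1 hX) 0 ∧
      (∀ k, ContDiff 𝕜 k h) ∧ h 0 = 0 ∧ HasFDerivAt h (e : X0 →L[𝕜] X0) 0 ∧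
      (∀ (R : ℝ) (i : ℕ), ∃ C, ∀ z, ‖z‖ ≤ R → ‖iteratedFDeriv 𝕜 i h z‖ ≤ C) ∧
      (m = 0 → ∀ z, h z = e z) ∧ ∀ᶠ x in 𝓝 0, π (F x) = h (π x) := by
  have : CompleteSpace X0 := completeSpace_of_isTopCompl hX
  obtain ⟨p, h, hp, hh, hp0, hh0, hpd, hhd, hhb, hlin, hO⟩ :=
    exists_polynomial_conjugacy hX hℓ hF hF0 hFA hA hm hnr
  rw [← he] at hhd hlin
  obtain ⟨g, hg0, hg, hgd, hgh, hhg⟩ := exists_local_inverse (n := ∞) (by simp)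
    (hh ∞).contDiffAt hhd hh0
  have hg1 : ContDiffAt 𝕜 1 g 0 := hg.of_le (by exact_mod_cast le_top)
  have hgc : ContinuousAt g 0 := hg.continuousAt
  have hgt : Tendsto g (𝓝 0) (𝓝 0) := by simpa [hg0] using hgc.tendsto
  have hpt : Tendsto p (𝓝 0) (𝓝 0) := by simpa [hp0] using hpd.continuousAt.tendsto
  have hht : Tendsto h (𝓝 0) (𝓝 0) := by simpa [hh0] using hhd.continuousAt.tendsto
  have hFt : Tendsto F (𝓝 0) (𝓝 0) := by simpa [hF0] using hFA.continuousAt.tendsto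
  have hFO : F =O[𝓝 0] fun x => ‖x‖ := by simpa [hF0] using hFA.isBigO_sub.norm_right
  have hgl := eventually_lipschitz hg1 hgd (lt_add_one _)
  have hO1 : (fun x => p x - g (p (F x))) =O[𝓝 0] fun x => ‖x‖ ^ (ℓ + 1) := by
    have h1 := ((hht.comp hpt).prodMk_nhds (hpt.comp hFt)).eventually hgl
    have h2 : (fun x => p x - g (p (F x))) =O[𝓝 0] fun x => h (p x) - p (F x) := by
      refine IsBigO.of_bound (‖(e.symm : X0 →L[𝕜] X0)‖ + 1) ?_
      filter_upwards [h1, hpt.eventually hgh] with x hx hx'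
      simp only [Function.comp, hx'] at hx
      exact hx
    exact h2.trans ((isBigO_norm_left.1 (hO.norm_left.congr_left fun x => norm_sub_rev _ _)))
  -- an iterate for which the gap condition holds for the norms
  obtain ⟨N, ε, hε, hα1, hgap1⟩ := exists_gap_margin hA0 hgap one_pos
  rw [mul_one] at hα1 hgap1
  have hFN := hasFDerivAt_iterate hFA hF0 N
  have hgN := hasFDerivAt_iterate hgd hg0 N
  have hF0N := iterate_zero_of_fixed hF0 N
  have hg0N := iterate_zero_of_fixed hg0 N
  have hgN1 := contDiffAt_iterate hg hg0 N
  have hONx := isBigO_semiIter hF0 hFO hFA.continuousAt ⟨_, hgl⟩ hgc hg0 hpd.continuousAt hp0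
    hO1 N
  simp only [semiIter_eq] at hONx
  have hdata : ∀ j : ℕ, ContDiffAt 𝕜 j F 0 →
      IterData 𝕜 F^[N] g^[N] p (‖A ^ N‖ + ε) (‖(e.symm : X0 →L[𝕜] X0) ^ N‖ + ε) (ℓ + 1) j := by
    intro j hj
    have hres : ∀ i : ℕ, ContDiffAt 𝕜 i F 0 →
        ContDiffAt 𝕜 i (fun x => p x - g^[N] (p (F^[N] x))) 0 := by
      intro i hi
      refine (hp i).contDiffAt.sub (ContDiffAt.comp (g := g^[N]) (f := fun x => p (F^[N] x)) 0 ?_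
        (ContDiffAt.comp (0 : X) (hp i).contDiffAt (contDiffAt_iterate hi hF0 N)))
      rw [hF0N, hp0]
      exact hgN1.of_le (natCast_le_infty i)
    exact ⟨by positivity, hα1, by positivity, hgap1, by omega, contDiffAt_iterate hj hF0 N, hF0N,
      eventually_norm_le hFN hF0N (lt_add_of_pos_right _ hε), hgN1,
      eventually_lipschitz (hgN1.of_le (by exact_mod_cast le_top)) hgN
        (lt_add_of_pos_right _ hε), (hp ∞).contDiffAt, hp0,
      flatAt_of_isBigO (hres _ hF) (hres _ hj) hONx⟩
  have hd := hdata _ hF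
  obtain ⟨π, δ, hδ, hu, hπO⟩ := hd.exists_limit
  have hπlim : ∀ᶠ x in 𝓝 0, Tendsto (fun n => semiIter g^[N] p F^[N] n x) atTop (𝓝 (π x)) := by
    filter_upwards [Metric.ball_mem_nhds 0 hδ] with x hx
    exact hu.tendsto_at hx
  have hπs : ∀ j : ℕ, ContDiffAt 𝕜 j F 0 → ContDiffAt 𝕜 j π 0 := fun j hj =>
    (hdata j hj).contDiffAt_limit hπlim
  have hπ0 : π 0 = 0 := by
    have := hπO.eq_zero_imp.self_of_nhds
    simpa [hp0] using this
  have hπd : HasFDerivAt π (X0.projectionOntoL X1 hX) 0 := by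
    have h1 : HasFDerivAt (fun x => π x - p x) (0 : X →L[𝕜] X0) 0 := by
      refine .of_isLittleO ?_
      simp only [hπ0, hp0, sub_zero, zero_apply]
      refine hπO.trans_isLittleO (IsLittleO.of_norm_right ?_)
      simpa [Function.comp_def] using (isLittleO_pow_pow (𝕜 := ℝ)
        (show 1 < ℓ + 1 by omega)).comp_tendsto
          (by simpa using continuous_norm.tendsto (0 : X) : Tendsto (‖·‖) (𝓝 (0 : X)) (𝓝 0))
    simpa [Pi.add_def] using h1.add hpd
  have hπt : Tendsto π (𝓝 0) (𝓝 0) := by simpa [hπ0] using hπd.continuousAt.tendsto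
  have hFNt : Tendsto F^[N] (𝓝 0) (𝓝 0) := by simpa [hF0N] using hFN.continuousAt.tendsto
  have hgNt : Tendsto g^[N] (𝓝 0) (𝓝 0) := by simpa [hg0N] using hgN.continuousAt.tendsto
  have hfix : ∀ᶠ x in 𝓝 0, π x = g^[N] (π (F^[N] x)) := by
    have hcg : ∀ᶠ z in 𝓝 0, ContinuousAt g^[N] z := by
      filter_upwards [(hgN1.of_le (natCast_le_infty 1)).eventually (natCast_ne_infty 1)] with z hz
      exact hz.continuousAt
    filter_upwards [hπlim, hFNt.eventually hπlim, (hπt.comp hFNt).eventually hcg]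
      with x hx hx' hx''
    exact tendsto_nhds_unique (hx.comp (tendsto_add_atTop_nat 1))
      ((hx''.tendsto).comp hx')
  -- `g ∘ π ∘ F` solves the same equation, hence coincides with `π`
  have hfix1 : π =ᶠ[𝓝 0] fun x => g (π (F x)) := by
    refine hd.eventuallyEq hfix ?_ hπt (hgt.comp (hπt.comp hFt)) ?_
    · filter_upwards [hFt.eventually hfix] with x hx
      rw [hx, ← Function.iterate_succ_apply' g, ← Function.iterate_succ_apply F,
        Function.iterate_succ_apply g, Function.iterate_succ_apply' F]
    · have h1 : (fun x => g (p (F x)) - g (π (F x))) =O[𝓝 0] fun x => ‖x‖ ^ (ℓ + 1) := by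
        have h2 := ((hpt.comp hFt).prodMk_nhds (hπt.comp hFt)).eventually hgl
        have h3 : (fun x => g (p (F x)) - g (π (F x))) =O[𝓝 0]
            fun x => π (F x) - p (F x) := by
          refine IsBigO.of_bound (‖(e.symm : X0 →L[𝕜] X0)‖ + 1) ?_
          filter_upwards [h2] with x hx
          rw [norm_sub_rev (π (F x))]
          exact hx
        exact h3.trans ((hπO.comp_tendsto hFt).trans (by
          simpa [Function.comp_def] using hFO.norm_left.pow (ℓ + 1)))
      refine ((hπO.add hO1).add h1).congr_left fun x => ?_
      abel
  refine ⟨π, h, hπs, hπ0, hπd, hh, hh0, hhd, hhb, hlin, ?_⟩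
  filter_upwards [hfix1, (hπt.comp hFt).eventually hhg] with x hx hx'
  rw [hx]
  exact hx'.symm

end

/-! ### Germs of semiconjugacies: uniqueness -/

section

lemma eventually_iterate_semiconj {E Z : Type*} [TopologicalSpace E] [Zero E]
    {F : E → E} {h : Z → Z} {π : E → Z} (hF : Tendsto F (𝓝 0) (𝓝 0))
    (hπ : ∀ᶠ x in 𝓝 0, π (F x) = h (π x)) (n : ℕ) :
    ∀ᶠ x in 𝓝 0, π (F^[n] x) = h^[n] (π x) := by
  induction n with
  | zero => exact Eventually.of_forall fun x => rfl
  | succ n ih =>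
    filter_upwards [hπ, hF.eventually ih] with x hx hx'
    rw [Function.iterate_succ_apply, Function.iterate_succ_apply, hx', hx]

lemma eventually_iterate_inverse {Z : Type*} [TopologicalSpace Z] [Zero Z]
    {h g : Z → Z} (hh : Tendsto h (𝓝 0) (𝓝 0)) (hg : ∀ᶠ z in 𝓝 0, g (h z) = z) (n : ℕ) :
    ∀ᶠ z in 𝓝 0, g^[n] (h^[n] z) = z := by
  induction n with
  | zero => exact Eventually.of_forall fun x => rfl
  | succ n ih =>
    filter_upwards [hg, hh.eventually ih] with x hx hx'
    rw [Function.iterate_succ_apply' g, Function.iterate_succ_apply h, hx', hx]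

end

section

variable {𝕜 : Type*} [RCLike 𝕜] {X : Type u} [NormedAddCommGroup X] [NormedSpace ℝ X]
  [NormedSpace 𝕜 X] [IsScalarTower ℝ 𝕜 X] {X0 X1 : Submodule 𝕜 X}

/-- The difference of two semiconjugacies which are the identity on `X0` vanishes to order
`ℓ + 1`: the derivatives of orders `2, …, ℓ` vanish successively by nonresonance. -/
theorem semiconjugacy_sub_isBigO (hX : X0.IsTopCompl X1) {F : X → X} {A : X →L[𝕜] X} {ℓ : ℕ}
    (hℓ : 1 ≤ ℓ) (hF : ContDiffAt 𝕜 (ℓ + 1 : ℕ) F 0) (hF0 : F 0 = 0) (hFA : HasFDerivAt F A 0)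
    (hA : ∀ x ∈ X1, A x ∈ X1)
    (hnr : ∀ n, 2 ≤ n → n ≤ ℓ → BlockNonresonant hX A (diagBlock hX A) n 1)
    {π π' : X → X0} (hπ : ContDiffAt 𝕜 (ℓ + 1 : ℕ) π 0) (hπ' : ContDiffAt 𝕜 (ℓ + 1 : ℕ) π' 0)
    (hπd : HasFDerivAt π (X0.projectionOntoL X1 hX) 0)
    (hπd' : HasFDerivAt π' (X0.projectionOntoL X1 hX) 0)
    (hπι : ∀ᶠ y : X0 in 𝓝 0, π y = y) (hπι' : ∀ᶠ y : X0 in 𝓝 0, π' y = y)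
    (hπF : ∀ᶠ x in 𝓝 0, π (F x) = π (F (π x : X)))
    (hπF' : ∀ᶠ x in 𝓝 0, π' (F x) = π' (F (π' x : X))) :
    (fun x => π' x - π x) =O[𝓝 0] fun x => ‖x‖ ^ (ℓ + 1) := by
  set P := X0.projectionOntoL X1 hX
  have hπ0 : π 0 = 0 := by simpa using hπι.self_of_nhds
  have hπ0' : π' 0 = 0 := by simpa using hπι'.self_of_nhds
  have hF2 : ContDiffAt 𝕜 2 F 0 := hF.of_le (by exact_mod_cast (by omega : 2 ≤ ℓ + 1))
  have hπ2 : ContDiffAt 𝕜 2 π 0 := hπ.of_le (by exact_mod_cast (by omega : 2 ≤ ℓ + 1))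
  have hπ2' : ContDiffAt 𝕜 2 π' 0 := hπ'.of_le (by exact_mod_cast (by omega : 2 ≤ ℓ + 1))
  have hFt : Tendsto F (𝓝 0) (𝓝 0) := by simpa [hF0] using hFA.continuousAt.tendsto
  have hπt : Tendsto π (𝓝 0) (𝓝 0) := by simpa [hπ0] using hπd.continuousAt.tendsto
  have hπt' : Tendsto π' (𝓝 0) (𝓝 0) := by simpa [hπ0'] using hπd'.continuousAt.tendsto
  have hιt : Tendsto ((↑) : X0 → X) (𝓝 0) (𝓝 0) := X0.subtypeL.continuous.tendsto' 0 0 rfl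
  -- the reduced map of `π'` and its linear part
  set h' : X0 → X0 := fun y => π' (F y)
  have hh2 : ContDiffAt 𝕜 2 h' 0 := by
    have h1 : ContDiffAt 𝕜 2 (fun y : X0 => F y) 0 :=
      ContDiffAt.comp (0 : X0) (f := X0.subtypeL) (by simpa using hF2)
        X0.subtypeL.contDiff.contDiffAt
    exact ContDiffAt.comp (0 : X0) (by simpa [hF0] using hπ2') h1
  have hhd : HasFDerivAt h' (diagBlock hX A) 0 := by
    have h1 : HasFDerivAt (fun y : X0 => F y) (A ∘L X0.subtypeL) 0 :=
      HasFDerivAt.comp (0 : X0) (f := X0.subtypeL) (by simpa using hFA) X0.subtypeL.hasFDerivAt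
    exact HasFDerivAt.comp (0 : X0) (by simpa [hF0] using hπd') h1
  set w : X → X0 := fun x => π' x - π x
  have hw : ContDiffAt 𝕜 (ℓ + 1 : ℕ) w 0 := hπ'.sub hπ
  have hwd : HasFDerivAt w (0 : X →L[𝕜] X0) 0 := by
    have := hπd'.sub hπd
    rwa [sub_self] at this
  have hwι : (fun y : X0 => w y) =ᶠ[𝓝 0] fun _ => 0 := by
    filter_upwards [hπι, hπι'] with y hy hy'
    simp [w, hy, hy']
  suffices hmain : ∀ n, 1 ≤ n → n ≤ ℓ → w =O[𝓝 0] fun x => ‖x‖ ^ (n + 1) from hmain ℓ hℓ le_rfl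
  intro n hn
  induction n, hn using Nat.le_induction with
  | base =>
    intro _
    have := isBigO_sub_fderiv (hw.of_le (by exact_mod_cast (by omega : 2 ≤ ℓ + 1)))
      (by simp [w, hπ0, hπ0']) hwd
    simpa using this
  | succ n hn ih =>
    intro hnℓ
    have hwn := ih (by omega)
    have hw' : ContDiffAt 𝕜 (n + 1 : ℕ) w 0 :=
      hw.of_le (by exact_mod_cast (by omega : n + 1 ≤ ℓ + 1))
    have hw'' : ContDiffAt 𝕜 (n + 1 + 1 : ℕ) w 0 :=
      hw.of_le (by exact_mod_cast (by omega : n + 1 + 1 ≤ ℓ + 1))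
    have hlow : ∀ i < n + 1, iteratedFDeriv 𝕜 i w 0 = 0 := fun i hi =>
      iteratedFDeriv_eq_zero_of_isBigO hw' hwn hi
    obtain ⟨q, hq⟩ := exists_leading_term (n + 1) hw'' hlow
    have hcomp : ∀ {u v : X → X}, u =O[𝓝 0] (fun x => ‖x‖) → v =O[𝓝 0] (fun x => ‖x‖) →
        Tendsto u (𝓝 0) (𝓝 0) → Tendsto v (𝓝 0) (𝓝 0) →
        (fun x => u x - v x) =O[𝓝 0] (fun x => ‖x‖ ^ 2) →
        (fun x => w (u x) - w (v x)) =O[𝓝 0] fun x => ‖x‖ ^ (n + 1 + 1) := by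
      intro u v hu hv hut hvt huv
      have h1 := (hq.comp_tendsto hut).trans (by
        simpa [Function.comp_def] using hu.norm_left.pow (n + 1 + 1))
      have h2 := (hq.comp_tendsto hvt).trans (by
        simpa [Function.comp_def] using hv.norm_left.pow (n + 1 + 1))
      refine ((h1.sub h2).add (isBigO_diag_sub (by omega) q hu hv huv)).congr_left fun x => ?_
      simp only [Function.comp]
      abel
    have hPO : P =O[𝓝 0] fun x => ‖x‖ := (P.isBigO_id (𝓝 0)).norm_right
    have hPt : Tendsto P (𝓝 0) (𝓝 0) := P.continuous.tendsto' 0 0 (map_zero P)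
    have hFO : F =O[𝓝 0] fun x => ‖x‖ := by simpa [hF0] using hFA.isBigO_sub.norm_right
    have hπO : π =O[𝓝 0] fun x => ‖x‖ := by simpa [hπ0] using hπd.isBigO_sub.norm_right
    have hπO' : π' =O[𝓝 0] fun x => ‖x‖ := by simpa [hπ0'] using hπd'.isBigO_sub.norm_right
    have hAO : A =O[𝓝 0] fun x => ‖x‖ := (A.isBigO_id (𝓝 0)).norm_right
    have e1 := hcomp hFO hAO hFt (A.continuous.tendsto' 0 0 (map_zero A))
      (isBigO_sub_fderiv hF2 hF0 hFA)
    have hιP : HasFDerivAt (fun x => F (π x : X)) (A ∘L X0.subtypeL ∘L P) 0 := by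
      have h1 : HasFDerivAt (fun x => (π x : X)) (X0.subtypeL ∘L P) 0 :=
        X0.subtypeL.hasFDerivAt.comp (0 : X) hπd
      exact HasFDerivAt.comp (0 : X) (by simpa [hπ0] using hFA) h1
    have hιP2 : ContDiffAt 𝕜 2 (fun x => F (π x : X)) 0 := by
      have h1 : ContDiffAt 𝕜 2 (fun x => (π x : X)) 0 :=
        X0.subtypeL.contDiff.contDiffAt.comp (0 : X) hπ2
      exact ContDiffAt.comp (0 : X) (by simpa [hπ0] using hF2) h1
    have e2 := hcomp (u := fun x => F (π x : X)) (v := A ∘L X0.subtypeL ∘L P)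
      (by simpa [hπ0, hF0] using hιP.isBigO_sub.norm_right)
      ((ContinuousLinearMap.isBigO_id _ (𝓝 0)).norm_right)
      (hFt.comp (hιt.comp hπt)) (ContinuousLinearMap.continuous _ |>.tendsto' 0 0 (map_zero _))
      (isBigO_sub_fderiv hιP2 (by simp [hπ0, hF0]) hιP)
    have e3 : (fun x => h' (π' x) - h' (π x) - diagBlock hX A (w x)) =O[𝓝 0]
        fun x => ‖x‖ ^ (n + 1 + 1) := by
      have h1 := (isBigO_nonlinear_part hh2 hhd).comp_tendsto (hπt'.prodMk_nhds hπt)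
      refine IsBigO.trans h1 ?_
      refine ((hπO'.prod_left hπO).norm_left.mul hwn.norm_left).congr_right fun x => ?_
      ring
    -- the equation for the terms of order `n + 1`
    have hG : (fun x => w (A x) - diagBlock hX A (w x) - w ((A ∘L X0.subtypeL ∘L P) x)) =O[𝓝 0]
        fun x => ‖x‖ ^ (n + 1 + 1) := by
      refine ((e3.sub e1).add e2).congr' ?_ EventuallyEq.rfl
      filter_upwards [hπF, hπF', hπt.eventually (hιt.eventually hπF)] with x hx hx' hx''
      simp only [w, h', hx, hx']
      abel
    have hwA : ∀ B : X →L[𝕜] X, ContDiffAt 𝕜 (n + 1 : ℕ) (fun x => w (B x)) 0 := fun B =>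
      ContDiffAt.comp (0 : X) (by simpa using hw') B.contDiff.contDiffAt
    have hwB : ContDiffAt 𝕜 (n + 1 : ℕ) (fun x => diagBlock hX A (w x)) 0 :=
      (diagBlock hX A).contDiff.contDiffAt.comp (0 : X) hw'
    have hG' := iteratedFDeriv_eq_zero_of_isLittleO (𝕜 := 𝕜) (n := n + 1) ?_ (hG.trans_isLittleO
      ((isLittleO_pow_pow (Nat.lt_succ_self _)).comp_tendsto
        (by simpa using (continuous_norm.tendsto (0 : X)))))
    · have hq0 : iteratedFDeriv 𝕜 (n + 1) w 0 = 0 := by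
        have hX0 : ∀ v : Fin (n + 1) → X, (∀ i, v i ∈ X0) →
            iteratedFDeriv 𝕜 (n + 1) w 0 v = 0 := by
          intro v hv
          have h1 := iteratedFDeriv_comp_clm (n := n + 1) (f := w) (x := 0) X0.subtypeL
            (by simpa using hw') le_rfl
          have h2 := (hwι.iteratedFDeriv 𝕜 (n + 1)).self_of_nhds
          have h3 := congrArg (fun q => q fun i => (⟨v i, hv i⟩ : X0)) (h1.symm.trans h2)
          simpa using h3
        have heq : ∀ v : Fin (n + 1) → X, iteratedFDeriv 𝕜 (n + 1) w 0 (fun i => A (v i)) -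
            diagBlock hX A (iteratedFDeriv 𝕜 (n + 1) w 0 v) -
            iteratedFDeriv 𝕜 (n + 1) w 0 (fun i => A (P (v i) : X)) = 0 := by
          intro v
          have h1 := iteratedFDeriv_comp_clm (n := n + 1) (f := w) (x := 0) A
            (by simpa using hw') le_rfl
          have h2 := iteratedFDeriv_comp_clm (n := n + 1) (f := w) (x := 0)
            (A ∘L X0.subtypeL ∘L P) (by simpa using hw') le_rfl
          have h3 : iteratedFDeriv 𝕜 (n + 1) (fun x => diagBlock hX A (w x)) 0 = _ :=
            (diagBlock hX A).iteratedFDeriv_comp_left (f := w) (x := 0) hw' (i := n + 1) le_rfl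
          have h4 := congrArg (fun q => q v) hG'
          rw [fun_iteratedFDeriv_sub_apply ((hwA A).sub hwB) (hwA _),
            fun_iteratedFDeriv_sub_apply (hwA A) hwB, h1, h2, h3] at h4
          simpa using h4
        refine multilinear_eq_zero hX hA (hnr (n + 1) (by omega) hnℓ) _ hX0 fun S hS v hv => ?_
        obtain ⟨i, hi⟩ := Finset.card_pos.1 hS
        have hvi : P (v i) = 0 := by
          have := hv i
          rw [blockSpace_mem hi] at this
          exact (Submodule.projectionOntoL_apply_eq_zero_iff hX).2 this
        have h1 := heq v
        have h2 : iteratedFDeriv 𝕜 (n + 1) w 0 (fun i => A (P (v i) : X)) = 0 :=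
          ContinuousMultilinearMap.map_coord_zero _ i (by simp [hvi])
        rw [h2, sub_zero] at h1
        exact sub_eq_zero.1 h1
      refine (flatAt_of_contDiffAt (j := 0) hw'' (hw''.of_le zero_le) fun i hi => ?_).isBigO
      rcases Nat.lt_succ_iff_lt_or_eq.1 hi with hi | rfl
      · exact hlow i hi
      · exact hq0
    · exact ((hwA A).sub hwB).sub (hwA _)

/-- A semiconjugacy which is the identity on `X0` is unique. -/
theorem semiconjugacy_unique_of_id [CompleteSpace X] (hX : X0.IsTopCompl X1) {F : X → X} {A : X →L[𝕜] X} {ℓ : ℕ}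
    (hℓ : 1 ≤ ℓ) (hF : ContDiffAt 𝕜 (ℓ + 1 : ℕ) F 0) (hF0 : F 0 = 0) (hFA : HasFDerivAt F A 0)
    (hA : ∀ x ∈ X1, A x ∈ X1)
    (hnr : ∀ n, 2 ≤ n → n ≤ ℓ → BlockNonresonant hX A (diagBlock hX A) n 1)
    (e : X0 ≃L[𝕜] X0) (he : (e : X0 →L[𝕜] X0) = diagBlock hX A)
    (hA0 : Tendsto (fun n => ‖A ^ n‖) atTop (𝓝 0))
    (hgap : Tendsto (fun n => ‖(e.symm : X0 →L[𝕜] X0) ^ n‖ * ‖A ^ n‖ ^ (ℓ + 1)) atTop (𝓝 0))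
    {π π' : X → X0} (hπ : ContDiffAt 𝕜 (ℓ + 1 : ℕ) π 0) (hπ' : ContDiffAt 𝕜 (ℓ + 1 : ℕ) π' 0)
    (hπd : HasFDerivAt π (X0.projectionOntoL X1 hX) 0)
    (hπd' : HasFDerivAt π' (X0.projectionOntoL X1 hX) 0)
    (hπι : ∀ᶠ y : X0 in 𝓝 0, π y = y) (hπι' : ∀ᶠ y : X0 in 𝓝 0, π' y = y)
    (hπF : ∀ᶠ x in 𝓝 0, π (F x) = π (F (π x : X)))
    (hπF' : ∀ᶠ x in 𝓝 0, π' (F x) = π' (F (π' x : X))) : π =ᶠ[𝓝 0] π' := by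
  have : CompleteSpace X0 := completeSpace_of_isTopCompl hX
  have hO := semiconjugacy_sub_isBigO hX hℓ hF hF0 hFA hA hnr hπ hπ' hπd hπd' hπι hπι' hπF hπF'
  have hπ0 : π 0 = 0 := by simpa using hπι.self_of_nhds
  have hπ0' : π' 0 = 0 := by simpa using hπι'.self_of_nhds
  have hF1 : ContDiffAt 𝕜 1 F 0 := hF.of_le (by exact_mod_cast (by omega : 1 ≤ ℓ + 1))
  have hFt : Tendsto F (𝓝 0) (𝓝 0) := by simpa [hF0] using hFA.continuousAt.tendsto
  have hπt : Tendsto π (𝓝 0) (𝓝 0) := by simpa [hπ0] using hπd.continuousAt.tendsto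
  have hπt' : Tendsto π' (𝓝 0) (𝓝 0) := by simpa [hπ0'] using hπd'.continuousAt.tendsto
  have hιt : Tendsto ((↑) : X0 → X) (𝓝 0) (𝓝 0) := X0.subtypeL.continuous.tendsto' 0 0 rfl
  set h : X0 → X0 := fun y => π (F y)
  set h' : X0 → X0 := fun y => π' (F y)
  have hh1 : ContDiffAt 𝕜 1 h' 0 := by
    have h1 : ContDiffAt 𝕜 1 (fun y : X0 => F y) 0 :=
      ContDiffAt.comp (0 : X0) (f := X0.subtypeL) (by simpa using hF1)
        X0.subtypeL.contDiff.contDiffAt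
    exact ContDiffAt.comp (0 : X0) (by
      simpa [hF0] using hπ'.of_le (by exact_mod_cast (by omega : 1 ≤ ℓ + 1))) h1
  have hhd : HasFDerivAt h' (e : X0 →L[𝕜] X0) 0 := by
    rw [he]
    have h1 : HasFDerivAt (fun y : X0 => F y) (A ∘L X0.subtypeL) 0 :=
      HasFDerivAt.comp (0 : X0) (f := X0.subtypeL) (by simpa using hFA) X0.subtypeL.hasFDerivAt
    exact HasFDerivAt.comp (0 : X0) (by simpa [hF0] using hπd') h1
  have hh0 : h' 0 = 0 := by simp [h', hF0, hπ0']
  have hht : Tendsto h' (𝓝 0) (𝓝 0) := by simpa [hh0] using hhd.continuousAt.tendsto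
  have hht0 : Tendsto h (𝓝 0) (𝓝 0) := hπt.comp (hFt.comp hιt)
  obtain ⟨g, hg0, hg, hgd, hgh, hhg⟩ := exists_local_inverse one_ne_zero hh1 hhd hh0
  -- constants: `π` expands by at most `K` near `0`
  set K := ‖X0.projectionOntoL X1 hX‖ + 1
  have hK : 1 ≤ K := le_add_of_nonneg_left (norm_nonneg _)
  have hπK := eventually_norm_le hπd hπ0 (lt_add_one _)
  set s := ℓ + 1
  obtain ⟨N, ε, hε, hα, hgap1⟩ := exists_gap_margin hA0 hgap
    (show 0 < K + K ^ s + 1 by positivity)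
  set α := ‖A ^ N‖ + ε
  set β := ‖(e.symm : X0 →L[𝕜] X0) ^ N‖ + ε
  have hα0 : 0 ≤ α := by positivity
  have hβ0 : 0 ≤ β := by positivity
  have hαK : α * K ≤ 1 := by
    have : α * K ≤ α * (K + K ^ s + 1) := by
      refine mul_le_mul_of_nonneg_left ?_ hα0
      have : 0 ≤ K ^ s := by positivity
      linarith
    exact this.trans hα.le
  have hα1 : α ≤ 1 := (le_mul_of_one_le_right hα0 hK).trans hαK
  set q := β * α ^ s * (1 + K ^ s)
  have hq0 : 0 ≤ q := by positivity
  have hq1 : q < 1 := lt_of_le_of_lt (mul_le_mul_of_nonneg_left (by linarith)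
    (by positivity)) hgap1
  have hFN := eventually_norm_le (hasFDerivAt_iterate hFA hF0 N) (iterate_zero_of_fixed hF0 N)
    (lt_add_of_pos_right ‖A ^ N‖ hε)
  have hgN := eventually_lipschitz (contDiffAt_iterate hg hg0 N) (hasFDerivAt_iterate hgd hg0 N)
    (lt_add_of_pos_right ‖(e.symm : X0 →L[𝕜] X0) ^ N‖ hε)
  have hFNt : Tendsto F^[N] (𝓝 0) (𝓝 0) := by
    simpa [iterate_zero_of_fixed hF0 N] using (hasFDerivAt_iterate hFA hF0 N).continuousAt.tendsto
  have hhNt : Tendsto h'^[N] (𝓝 0) (𝓝 0) := by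
    simpa [iterate_zero_of_fixed hh0 N] using (hasFDerivAt_iterate hhd hh0 N).continuousAt.tendsto
  have hitπ := eventually_iterate_semiconj (h := h) hFt hπF N
  have hitπ' := eventually_iterate_semiconj (h := h') hFt hπF' N
  have hgN' := eventually_iterate_inverse hht hgh N
  obtain ⟨C, hC0, hC⟩ := hO.exists_nonneg
  -- the difference `w` of the two maps satisfies `‖w x‖ ≤ β (‖w (F^N x)‖ + ‖w (F^N (π x))‖)`
  have hineq : ∀ᶠ x in 𝓝 0, ‖π' x - π x‖ ≤ β * (‖π' (F^[N] x) - π (F^[N] x)‖ +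
      ‖π' (F^[N] (π x : X)) - π (F^[N] (π x : X))‖) := by
    have hpair := ((hπt'.comp hFNt).prodMk_nhds (hhNt.comp hπt)).eventually hgN
    filter_upwards [hitπ, hitπ', hπt'.eventually hgN', hπt.eventually hgN',
      hπt.eventually (hιt.eventually (hitπ.and hitπ')), hπt.eventually (hπι.and hπι'), hpair]
      with x h1 h2 h3 h4 ⟨h5, h5'⟩ ⟨h6, h6'⟩ h7
    rw [h6] at h5
    rw [h6'] at h5'
    simp only [Function.comp] at h7
    rw [h2, h3, h4] at h7
    refine h7.trans (mul_le_mul_of_nonneg_left ?_ hβ0)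
    calc ‖h'^[N] (π' x) - h'^[N] (π x)‖
        = ‖(π' (F^[N] x) - π (F^[N] x)) -
          (π' (F^[N] (π x : X)) - π (F^[N] (π x : X)))‖ := by
          rw [h1, h2, h5, h5']; congr 1; abel
      _ ≤ _ := norm_sub_le _ _
  obtain ⟨δ, hδ, hd⟩ := Metric.eventually_nhds_iff.1 ((hineq.and hC.bound).and (hFN.and hπK))
  obtain ⟨δ', hδ', hd'⟩ := Metric.eventually_nhds_iff.1
    ((hπt.eventually (hιt.eventually (Metric.ball_mem_nhds 0 hδ))).and
      (Metric.ball_mem_nhds (0 : X) hδ))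
  simp only [dist_zero_right, norm_pow, norm_norm] at hd hd'
  have hstep : ∀ x, ‖x‖ < δ' → ‖F^[N] x‖ ≤ α * ‖x‖ ∧ ‖F^[N] (π x : X)‖ ≤ α * K * ‖x‖ := by
    intro x hx
    obtain ⟨h1, h2⟩ := hd' hx
    refine ⟨(hd h2).2.1, ((hd h1).2.1).trans ?_⟩
    rw [mul_assoc]
    exact mul_le_mul_of_nonneg_left (hd h2).2.2 hα0
  have main : ∀ n x, ‖x‖ < δ' → ‖π' x - π x‖ ≤ C * q ^ n * ‖x‖ ^ s := by
    intro n
    induction n with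
    | zero =>
      intro x hx
      simpa using (hd (hd' hx).2).1.2
    | succ n ih =>
      intro x hx
      obtain ⟨h1, h2⟩ := hstep x hx
      have h3 := ih (F^[N] x) (h1.trans_lt ((mul_le_of_le_one_left (norm_nonneg x) hα1).trans_lt
        hx))
      have h4 := ih (F^[N] (π x : X)) (h2.trans_lt
        ((mul_le_of_le_one_left (norm_nonneg x) hαK).trans_lt hx))
      calc ‖π' x - π x‖ ≤ _ := (hd (hd' hx).2).1.1
        _ ≤ β * (C * q ^ n * (α * ‖x‖) ^ s + C * q ^ n * (α * K * ‖x‖) ^ s) := by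
          gcongr
          · exact h3.trans (by gcongr)
          · exact h4.trans (by gcongr)
        _ = C * q ^ (n + 1) * ‖x‖ ^ s := by
          simp only [q, mul_pow, pow_succ]
          ring
  refine Metric.eventually_nhds_iff.2 ⟨δ', hδ', fun x hx => ?_⟩
  rw [dist_zero_right] at hx
  have hlim : Tendsto (fun n => C * q ^ n * ‖x‖ ^ s) atTop (𝓝 0) := by
    simpa using ((tendsto_pow_atTop_nhds_zero_of_lt_one hq0 hq1).const_mul C).mul_const (‖x‖ ^ s)
  have := ge_of_tendsto' hlim fun n => main n x hx
  exact (sub_eq_zero.1 (norm_le_zero_iff.1 this)).symm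

lemma exists_section {X : Type u} [NormedAddCommGroup X] [NormedSpace 𝕜 X] [CompleteSpace X]
    {X0 X1 : Submodule 𝕜 X} (hX : X0.IsTopCompl X1) {n : WithTop ℕ∞} (hn : n ≠ 0) {π : X → X0}
    (hπ : ContDiffAt 𝕜 n π 0) (hπ0 : π 0 = 0) {C : X0 ≃L[𝕜] X0}
    (hπd : HasFDerivAt π ((C : X0 →L[𝕜] X0) ∘L X0.projectionOntoL X1 hX) 0) :
    ∃ s : X0 → X0, s 0 = 0 ∧ ContDiffAt 𝕜 n s 0 ∧ HasFDerivAt s (C.symm : X0 →L[𝕜] X0) 0 ∧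
      (∀ᶠ y : X0 in 𝓝 0, s (π y) = y) ∧ ∀ᶠ y : X0 in 𝓝 0, π (s y : X) = y := by
  have : CompleteSpace X0 := completeSpace_of_isTopCompl hX
  refine exists_local_inverse hn (f := fun y : X0 => π y) (e := C) ?_ ?_ (by simpa using hπ0)
  · exact ContDiffAt.comp (0 : X0) (f := X0.subtypeL) (by simpa using hπ)
      X0.subtypeL.contDiff.contDiffAt
  · have h1 := HasFDerivAt.comp (0 : X0) (f := X0.subtypeL) (g := π) (by simpa using hπd)
      X0.subtypeL.hasFDerivAt
    refine h1.congr_fderiv ?_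
    rw [ContinuousLinearMap.comp_assoc, projectionOntoL_comp_subtypeL, ContinuousLinearMap.comp_id]

/-- Two semiconjugacies with the same tangent spaces `X1` of the fibres at `0` coincide up to a
change of coordinates in `X0`. -/
theorem semiconjugacy_unique [CompleteSpace X] (hX : X0.IsTopCompl X1) {F : X → X} {A : X →L[𝕜] X} {ℓ : ℕ}
    (hℓ : 1 ≤ ℓ) (hF : ContDiffAt 𝕜 (ℓ + 1 : ℕ) F 0) (hF0 : F 0 = 0) (hFA : HasFDerivAt F A 0)
    (hA : ∀ x ∈ X1, A x ∈ X1)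
    (hnr : ∀ n, 2 ≤ n → n ≤ ℓ → BlockNonresonant hX A (diagBlock hX A) n 1)
    (e : X0 ≃L[𝕜] X0) (he : (e : X0 →L[𝕜] X0) = diagBlock hX A)
    (hA0 : Tendsto (fun n => ‖A ^ n‖) atTop (𝓝 0))
    (hgap : Tendsto (fun n => ‖(e.symm : X0 →L[𝕜] X0) ^ n‖ * ‖A ^ n‖ ^ (ℓ + 1)) atTop (𝓝 0))
    {π π' : X → X0} {h h' : X0 → X0} {C C' : X0 ≃L[𝕜] X0}
    (hπ : ContDiffAt 𝕜 (ℓ + 1 : ℕ) π 0) (hπ' : ContDiffAt 𝕜 (ℓ + 1 : ℕ) π' 0)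
    (hπ0 : π 0 = 0) (hπ0' : π' 0 = 0)
    (hπd : HasFDerivAt π ((C : X0 →L[𝕜] X0) ∘L X0.projectionOntoL X1 hX) 0)
    (hπd' : HasFDerivAt π' ((C' : X0 →L[𝕜] X0) ∘L X0.projectionOntoL X1 hX) 0)
    (hπF : ∀ᶠ x in 𝓝 0, π (F x) = h (π x)) (hπF' : ∀ᶠ x in 𝓝 0, π' (F x) = h' (π' x))
    {s : X0 → X0} (hs0 : s 0 = 0) (hs : ContDiffAt 𝕜 (ℓ + 1 : ℕ) s 0)
    (hsπ : ∀ᶠ y : X0 in 𝓝 0, s (π y) = y) (hπs : ∀ᶠ y : X0 in 𝓝 0, π (s y : X) = y) :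
    ∀ᶠ x in 𝓝 0, π' x = π' (s (π x) : X) := by
  have hn : ((ℓ + 1 : ℕ) : WithTop ℕ∞) ≠ 0 := by simp
  obtain ⟨s', hs0', hs', hsd', hsπ', hπs'⟩ := exists_section hX hn hπ' hπ0' hπd'
  have hιt : Tendsto ((↑) : X0 → X) (𝓝 0) (𝓝 0) := X0.subtypeL.continuous.tendsto' 0 0 rfl
  have hFt : Tendsto F (𝓝 0) (𝓝 0) := by simpa [hF0] using hFA.continuousAt.tendsto
  -- a semiconjugacy remains one after normalization to the identity on `X0`
  have normalize : ∀ {π : X → X0} {h s : X0 → X0} {C : X0 ≃L[𝕜] X0},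
      ContDiffAt 𝕜 (ℓ + 1 : ℕ) π 0 → π 0 = 0 →
      HasFDerivAt π ((C : X0 →L[𝕜] X0) ∘L X0.projectionOntoL X1 hX) 0 →
      (∀ᶠ x in 𝓝 0, π (F x) = h (π x)) → s 0 = 0 → ContDiffAt 𝕜 (ℓ + 1 : ℕ) s 0 →
      (∀ᶠ y : X0 in 𝓝 0, s (π y) = y) → (∀ᶠ y : X0 in 𝓝 0, π (s y : X) = y) →
      ContDiffAt 𝕜 (ℓ + 1 : ℕ) (fun x => s (π x)) 0 ∧
        HasFDerivAt (fun x => s (π x)) (X0.projectionOntoL X1 hX) 0 ∧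
        ∀ᶠ x in 𝓝 0, s (π (F x)) = s (π (F (s (π x) : X))) := by
    intro π h s C hπ hπ0 hπd hπF hs0 hs hsπ hπs
    have hπt : Tendsto π (𝓝 0) (𝓝 0) := by simpa [hπ0] using hπd.continuousAt.tendsto
    have hst : Tendsto s (𝓝 0) (𝓝 0) := by simpa [hs0] using hs.continuousAt.tendsto
    have hsd : HasFDerivAt s (fderiv 𝕜 s 0) 0 := (hs.differentiableAt hn).hasFDerivAt
    refine ⟨ContDiffAt.comp (0 : X) (by rwa [hπ0]) hπ, ?_, ?_⟩
    · have h1 : HasFDerivAt (fun x => s (π x)) _ 0 :=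
        HasFDerivAt.comp (0 : X) (g := s) (by rw [hπ0]; exact hsd) hπd
      have h2 : HasFDerivAt (fun y : X0 => s (π y)) ((fderiv 𝕜 s 0) ∘L (C : X0 →L[𝕜] X0)) 0 := by
        have h3 := HasFDerivAt.comp (0 : X0) (f := X0.subtypeL) (g := fun x => s (π x))
          (by simpa using h1) X0.subtypeL.hasFDerivAt
        refine h3.congr_fderiv ?_
        rw [ContinuousLinearMap.comp_assoc, ContinuousLinearMap.comp_assoc,
          projectionOntoL_comp_subtypeL, ContinuousLinearMap.comp_id]
      have h3 : (fderiv 𝕜 s 0) ∘L (C : X0 →L[𝕜] X0) = ContinuousLinearMap.id 𝕜 X0 :=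
        h2.unique ((hasFDerivAt_id (0 : X0)).congr_of_eventuallyEq hsπ)
      rwa [← ContinuousLinearMap.comp_assoc, h3, ContinuousLinearMap.id_comp] at h1
    · have h1 : Tendsto (fun x => (s (π x) : X)) (𝓝 0) (𝓝 0) := hιt.comp (hst.comp hπt)
      filter_upwards [hπF, h1.eventually hπF, hπt.eventually hπs] with x hx hx' hx''
      rw [hx, hx', hx'']
  obtain ⟨a1, a2, a3⟩ := normalize hπ hπ0 hπd hπF hs0 hs hsπ hπs
  obtain ⟨b1, b2, b3⟩ := normalize hπ' hπ0' hπd' hπF' hs0' hs' hsπ' hπs'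
  have key := semiconjugacy_unique_of_id hX hℓ hF hF0 hFA hA hnr e he hA0 hgap a1 b1 a2 b2
    hsπ hsπ' a3 b3
  have hπt' : Tendsto π' (𝓝 0) (𝓝 0) := by simpa [hπ0'] using hπd'.continuousAt.tendsto
  filter_upwards [key, hπt'.eventually hπs'] with x hx hx'
  rw [hx, hx']

/-- Germs which commute with a nonresonant linear map are linear. -/
theorem eventuallyEq_linear_of_commute {Z : Type u} [NormedAddCommGroup Z] [NormedSpace ℝ Z]
    [NormedSpace 𝕜 Z] [IsScalarTower ℝ 𝕜 Z] [CompleteSpace Z] {ℓ : ℕ} (hℓ : 1 ≤ ℓ)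
    (e : Z ≃L[𝕜] Z) (he : Tendsto (fun n => ‖(e : Z →L[𝕜] Z) ^ n‖) atTop (𝓝 0))
    (hgap : Tendsto (fun n => ‖(e.symm : Z →L[𝕜] Z) ^ n‖ * ‖(e : Z →L[𝕜] Z) ^ n‖ ^ (ℓ + 1))
      atTop (𝓝 0))
    (hnr : ∀ n, 2 ≤ n → n ≤ ℓ →
      cSpectrum 𝕜 (e : Z →L[𝕜] Z) ^ n ∩ cSpectrum 𝕜 (e : Z →L[𝕜] Z) = ∅)
    {η : Z → Z} (hη : ContDiffAt 𝕜 (ℓ + 1 : ℕ) η 0) (hη0 : η 0 = 0) {M : Z →L[𝕜] Z}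
    (hM : HasFDerivAt η M 0) (hc : ∀ᶠ z in 𝓝 0, η (e z) = e (η z)) : η =ᶠ[𝓝 0] M := by
  have het : Tendsto e (𝓝 0) (𝓝 0) := e.continuous.tendsto' 0 0 (map_zero e)
  have hMe : ∀ z, M (e z) = e (M z) := by
    have h1 : HasFDerivAt (fun z => η (e z)) (M ∘L (e : Z →L[𝕜] Z)) 0 :=
      HasFDerivAt.comp (0 : Z) (by simpa using hM) e.hasFDerivAt
    have h2 : HasFDerivAt (fun z => e (η z)) ((e : Z →L[𝕜] Z) ∘L M) 0 :=
      HasFDerivAt.comp (0 : Z) (e : Z →L[𝕜] Z).hasFDerivAt hM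
    have h3 := h1.unique (h2.congr_of_eventuallyEq hc)
    exact fun z => congrArg (fun L : Z →L[𝕜] Z => L z) h3
  set w : Z → Z := fun z => η z - M z
  have hw : ContDiffAt 𝕜 (ℓ + 1 : ℕ) w 0 := hη.sub M.contDiff.contDiffAt
  have hwe : (fun z => w ((e : Z →L[𝕜] Z) z)) =ᶠ[𝓝 0] fun z => (e : Z →L[𝕜] Z) (w z) := by
    filter_upwards [hc] with z hz
    simp [w, hz, hMe]
  have hwd : HasFDerivAt w (0 : Z →L[𝕜] Z) 0 := by
    have := hM.sub M.hasFDerivAt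
    rwa [sub_self] at this
  have hzero : ∀ i < ℓ + 1, iteratedFDeriv 𝕜 i w 0 = 0 := by
    intro i hi
    have hwi : ContDiffAt 𝕜 i w 0 := hw.of_le (by exact_mod_cast hi.le)
    rcases Nat.lt_or_ge i 2 with h2 | h2
    · interval_cases i
      · ext; simp [w, hη0]
      · ext v
        simp [iteratedFDeriv_succ_apply_right, hwd.fderiv]
    · have h3 := iteratedFDeriv_comp_clm (n := i) (f := w) (x := 0) (e : Z →L[𝕜] Z)
        (by simpa using hwi) le_rfl
      have h4 : iteratedFDeriv 𝕜 i (fun z => (e : Z →L[𝕜] Z) (w z)) 0 = _ :=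
        (e : Z →L[𝕜] Z).iteratedFDeriv_comp_left (f := w) (x := 0) hwi (i := i) le_rfl
      have h5 := (hwe.iteratedFDeriv 𝕜 i).self_of_nhds
      rw [h3, h4, map_zero] at h5
      obtain ⟨u, hu⟩ := isUnit_sylvester (𝕜 := 𝕜) (fun _ : Fin i => (e : Z →L[𝕜] Z))
        (e : Z →L[𝕜] Z) (fun z hz hz' => by
          have hmem : ∏ j, z j ∈ cSpectrum 𝕜 (e : Z →L[𝕜] Z) ^ i := by
            simpa using Set.finsetProd_mem_finsetProd Finset.univ
              (fun _ : Fin i => cSpectrum 𝕜 (e : Z →L[𝕜] Z)) z fun j _ => hz j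
          exact (hnr i h2 (by omega)).le ⟨hmem, hz'⟩)
      have h6 : u.val (iteratedFDeriv 𝕜 i w 0) = 0 := by
        rw [hu]
        exact sub_eq_zero.2 h5
      have h7 : u⁻¹.val (u.val (iteratedFDeriv 𝕜 i w 0)) = iteratedFDeriv 𝕜 i w 0 := by
        rw [← mul_apply_eq_comp, u.inv_mul]
        rfl
      rw [← h7, h6, map_zero]
  have hO : w =O[𝓝 0] fun z => ‖z‖ ^ (ℓ + 1) :=
    (flatAt_of_contDiffAt (j := 0) hw (hw.of_le zero_le) hzero).isBigO
  obtain ⟨N, ε, hε, hα, hgap1⟩ := exists_gap_margin he hgap one_pos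
  rw [mul_one] at hα hgap1
  have hce : ∀ (f : Z ≃L[𝕜] Z) (n : ℕ) (z : Z), ((f : Z →L[𝕜] Z) ^ n) z = f^[n] z := by
    intro f n z
    rw [FunLike.coe_pow_eq_iterate]
    rfl
  have hdata : IterData 𝕜 ((e : Z →L[𝕜] Z) ^ N) ((e.symm : Z →L[𝕜] Z) ^ N) (fun _ : Z => (0 : Z))
      (‖(e : Z →L[𝕜] Z) ^ N‖ + ε) (‖(e.symm : Z →L[𝕜] Z) ^ N‖ + ε) (ℓ + 1) 0 := by
    refine ⟨by positivity, hα, by positivity, hgap1, by omega,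
      ContinuousLinearMap.contDiff _ |>.contDiffAt, map_zero _,
      eventually_norm_le (ContinuousLinearMap.hasFDerivAt _) (map_zero _)
        (lt_add_of_pos_right _ hε), ContinuousLinearMap.contDiff _ |>.contDiffAt,
      eventually_lipschitz (ContinuousLinearMap.contDiff _ |>.contDiffAt)
        (ContinuousLinearMap.hasFDerivAt _) (lt_add_of_pos_right _ hε), contDiffAt_const, rfl, ?_⟩
    simp only [map_zero, sub_zero]
    exact flatAt_of_isBigO contDiffAt_const contDiffAt_const (isBigO_zero _ _)
  have hsol : ∀ f : Z → Z, (∀ᶠ z in 𝓝 0, f (e z) = e (f z)) →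
      ∀ᶠ z in 𝓝 0, f z = ((e.symm : Z →L[𝕜] Z) ^ N) (f (((e : Z →L[𝕜] Z) ^ N) z)) := by
    intro f hf
    filter_upwards [eventually_iterate_semiconj (h := e) het hf N] with z hz
    rw [hce, hce, hz]
    exact ((e.left_inv.iterate N) (f z)).symm
  exact hdata.eventuallyEq (hsol η hc) (hsol M (Eventually.of_forall hMe))
    (by simpa [hη0] using hη.continuousAt.tendsto) (M.continuous.tendsto' 0 0 (map_zero M)) hO

end

/-! ### Calculus of maps with bounded derivatives -/

section

variable {𝕜 : Type*} [RCLike 𝕜] {E F G : Type u} [NormedAddCommGroup E] [NormedSpace 𝕜 E]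
  [NormedAddCommGroup F] [NormedSpace 𝕜 F] [NormedAddCommGroup G] [NormedSpace 𝕜 G]

lemma natCast_ne_omega (n : ℕ) : (n : WithTop ℕ∞) ≠ ω := by
  simp

lemma cbOn_nat_iff {n : ℕ} {f : E → F} {O : Set E} : CbOn 𝕜 n f O ↔
    ContDiffOn 𝕜 n f O ∧ ∀ i ≤ n, ∃ C : ℝ, ∀ x ∈ O, ‖iteratedFDeriv 𝕜 i f x‖ ≤ C := by
  refine and_congr_right fun _ => forall_congr' fun i => ?_
  rw [Nat.cast_le]
  exact ⟨fun h hi => h hi fun h' => absurd h' (natCast_ne_omega n), fun h hi _ => h hi⟩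

lemma cbOn_nat_mono {n m : ℕ} {f : E → F} {O : Set E} (hf : CbOn 𝕜 n f O) (h : m ≤ n) :
    CbOn 𝕜 m f O := by
  rw [cbOn_nat_iff] at hf ⊢
  exact ⟨hf.1.of_le (by exact_mod_cast h), fun i hi => hf.2 i (hi.trans h)⟩

lemma cbOn_of_subset {k : WithTop ℕ∞} {f : E → F} {O O' : Set E} (hf : CbOn 𝕜 k f O)
    (h : O' ⊆ O) : CbOn 𝕜 k f O' :=
  ⟨hf.1.mono h, fun i hi hi' => (hf.2 i hi hi').imp fun _ hC x hx => hC x (h hx)⟩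

lemma cbOn_congr {k : WithTop ℕ∞} {f g : E → F} {O : Set E} (hO : IsOpen O) (hf : CbOn 𝕜 k f O)
    (h : EqOn g f O) : CbOn 𝕜 k g O := by
  refine ⟨hf.1.congr h, fun i hi hi' => (hf.2 i hi hi').imp fun _ hC x hx => ?_⟩
  rw [Filter.EventuallyEq.eq_of_nhds
    (Filter.EventuallyEq.iteratedFDeriv 𝕜 (h.eventuallyEq_of_mem (hO.mem_nhds hx)) i)]
  exact hC x hx

lemma cbOn_nat_contDiffAt {n : ℕ} {f : E → F} {O : Set E} (hO : IsOpen O) (hf : CbOn 𝕜 n f O)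
    {x : E} (hx : x ∈ O) : ContDiffAt 𝕜 n f x := hf.1.contDiffAt (hO.mem_nhds hx)

lemma cbOn_zero_iff {f : E → F} {O : Set E} : CbOn 𝕜 (0 : ℕ) f O ↔
    ContinuousOn f O ∧ ∃ C : ℝ, ∀ x ∈ O, ‖f x‖ ≤ C := by
  rw [cbOn_nat_iff, Nat.cast_zero, contDiffOn_zero]
  refine and_congr_right fun _ => ⟨fun h => ?_, fun h i hi => ?_⟩
  · simpa using h 0 le_rfl
  · obtain rfl : i = 0 := by omega
    simpa using h

lemma cbOn_succ_iff {n : ℕ} {f : E → F} {O : Set E} (hO : IsOpen O) :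
    CbOn 𝕜 (n + 1 : ℕ) f O ↔ DifferentiableOn 𝕜 f O ∧ (∃ C : ℝ, ∀ x ∈ O, ‖f x‖ ≤ C) ∧
      CbOn 𝕜 n (fderiv 𝕜 f) O := by
  rw [cbOn_nat_iff, cbOn_nat_iff, Nat.cast_succ, contDiffOn_succ_iff_fderiv_of_isOpen hO]
  constructor
  · rintro ⟨⟨h1, -, h2⟩, h3⟩
    refine ⟨h1, by simpa using h3 0 (Nat.zero_le _), h2, fun i hi => ?_⟩
    simpa only [norm_iteratedFDeriv_fderiv] using h3 (i + 1) (by omega)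
  · rintro ⟨h1, h2, h3, h4⟩
    refine ⟨⟨h1, fun h => absurd h (natCast_ne_omega n), h3⟩, fun i hi => ?_⟩
    match i with
    | 0 => simpa using h2
    | i + 1 => simpa only [norm_iteratedFDeriv_fderiv] using h4 i (by omega)

lemma cbOn_bilinear {n : ℕ} {f : E → F} {g : E → G} {H : Type u} [NormedAddCommGroup H]
    [NormedSpace 𝕜 H] {O : Set E} (hO : IsOpen O) (B : F →L[𝕜] G →L[𝕜] H) (hf : CbOn 𝕜 n f O)
    (hg : CbOn 𝕜 n g O) : CbOn 𝕜 n (fun x => B (f x) (g x)) O := by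
  have hf' := cbOn_nat_iff.1 hf
  have hg' := cbOn_nat_iff.1 hg
  refine cbOn_nat_iff.2 ⟨B.isBoundedBilinearMap.contDiff.comp_contDiffOn (hf.1.prodMk hg.1),
    fun i hi => ?_⟩
  choose! C hC using hf'.2
  choose! K hK using hg'.2
  refine ⟨‖B‖ * ∑ k ∈ Finset.range (i + 1), (i.choose k : ℝ) * C k * K (i - k), fun x hx => ?_⟩
  refine (norm_iteratedFDeriv_bilinear_le B (cbOn_nat_contDiffAt hO hf hx)
    (cbOn_nat_contDiffAt hO hg hx) hi).trans ?_
  gcongr with k hk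
  · exact mul_nonneg (Nat.cast_nonneg _)
      ((norm_nonneg _).trans (hC k (by rw [Finset.mem_range] at hk; omega) x hx))
  · exact hC k (by rw [Finset.mem_range] at hk; omega) x hx
  · exact hK (i - k) (by omega) x hx

lemma cbOn_clm_comp {n : ℕ} {f : E → F} {O : Set E} (hO : IsOpen O) (L : F →L[𝕜] G)
    (hf : CbOn 𝕜 n f O) : CbOn 𝕜 n (fun x => L (f x)) O := by
  refine cbOn_nat_iff.2 ⟨L.contDiff.comp_contDiffOn hf.1, fun i hi => ?_⟩
  obtain ⟨C, hC⟩ := (cbOn_nat_iff.1 hf).2 i hi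
  refine ⟨‖L‖ * C, fun x hx => ?_⟩
  have := L.iteratedFDeriv_comp_left (cbOn_nat_contDiffAt hO hf hx) (i := i)
    (by exact_mod_cast hi)
  rw [show (fun x => L (f x)) = L ∘ f from rfl, this]
  refine (L.norm_compContinuousMultilinearMap_le _).trans ?_
  gcongr
  exact hC x hx

/-- A bounded linear map has bounded derivatives on bounded sets. -/
lemma cbOn_clm {n : ℕ} (L : E →L[𝕜] F) {O : Set E} (hO : IsOpen O) (hb : Bornology.IsBounded O) :
    CbOn 𝕜 n L O := by
  obtain ⟨R, hR⟩ := hb.exists_norm_le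
  have h0 : ∀ n : ℕ, CbOn 𝕜 n (fun _ : E => L) O := by
    intro n
    refine cbOn_nat_iff.2 ⟨contDiffOn_const, fun i _ => ?_⟩
    refine ⟨‖L‖, fun x _ => ?_⟩
    match i with
    | 0 => simp
    | i + 1 => simp [iteratedFDeriv_succ_const]
  have hbd : ∃ C : ℝ, ∀ x ∈ O, ‖L x‖ ≤ C :=
    ⟨‖L‖ * R, fun x hx => (L.le_opNorm x).trans (by gcongr; exact hR x hx)⟩
  match n with
  | 0 => exact cbOn_zero_iff.2 ⟨L.continuous.continuousOn, hbd⟩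
  | n + 1 =>
    refine (cbOn_succ_iff hO).2 ⟨L.differentiable.differentiableOn, hbd, ?_⟩
    exact cbOn_congr hO (h0 n) fun x _ => L.fderiv

lemma cbOn_comp {n : ℕ} {f : E → F} {g : F → G} {O : Set E} {Q : Set F} (hO : IsOpen O)
    (hQ : IsOpen Q) (hg : CbOn 𝕜 n g Q) (hf : CbOn 𝕜 n f O) (h : MapsTo f O Q) :
    CbOn 𝕜 n (fun x => g (f x)) O := by
  induction n generalizing G with
  | zero =>
    rw [cbOn_zero_iff] at hf hg ⊢
    obtain ⟨C, hC⟩ := hg.2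
    exact ⟨hg.1.comp hf.1 h, C, fun x hx => hC _ (h hx)⟩
  | succ n ih =>
    obtain ⟨hg1, ⟨C, hC⟩, hg3⟩ := (cbOn_succ_iff hQ).1 hg
    obtain ⟨hf1, -, hf3⟩ := (cbOn_succ_iff hO).1 hf
    refine (cbOn_succ_iff hO).2 ⟨hg1.comp hf1 h, ⟨C, fun x hx => hC _ (h hx)⟩, ?_⟩
    have h1 := ih hg3 (cbOn_nat_mono hf n.le_succ)
    refine cbOn_congr hO (cbOn_bilinear hO (ContinuousLinearMap.compL 𝕜 E F G) h1 hf3)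
      fun x hx => ?_
    exact fderiv_comp x (hg1.differentiableAt (hQ.mem_nhds (h hx)))
      (hf1.differentiableAt (hO.mem_nhds hx))

/-- The inverse of a family of uniformly invertible elements of a Banach algebra inherits bounds on
derivatives. -/
lemma cbOn_ringInverse {R : Type u} [NormedRing R] [NormedAlgebra 𝕜 R] [HasSummableGeomSeries R]
    {n : ℕ} {a : E → R} {O : Set E} (hO : IsOpen O) (ha : CbOn 𝕜 n a O) {K : ℝ}
    (hu : ∀ x ∈ O, IsUnit (a x)) (hK : ∀ x ∈ O, ‖Ring.inverse (a x)‖ ≤ K) :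
    CbOn 𝕜 n (fun x => Ring.inverse (a x)) O := by
  induction n with
  | zero =>
    rw [cbOn_zero_iff] at ha ⊢
    refine ⟨fun x hx => ?_, K, hK⟩
    obtain ⟨v, hv⟩ := hu x hx
    refine ContinuousAt.comp_continuousWithinAt (g := Ring.inverse) ?_ (ha.1 x hx)
    rw [← hv]
    exact NormedRing.inverse_continuousAt v
  | succ n ih =>
    obtain ⟨ha1, -, ha3⟩ := (cbOn_succ_iff hO).1 ha
    have hd : ∀ x ∈ O, HasFDerivAt (fun x => Ring.inverse (a x))
        (-((ContinuousLinearMap.mulLeftRight 𝕜 R (Ring.inverse (a x)) (Ring.inverse (a x))) ∘L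
          fderiv 𝕜 a x)) x := by
      intro x hx
      obtain ⟨v, hv⟩ := hu x hx
      have h1 := hasFDerivAt_ringInverse (𝕜 := 𝕜) v
      rw [hv] at h1
      have h2 := h1.comp x (ha1.differentiableAt (hO.mem_nhds hx)).hasFDerivAt
      refine h2.congr_fderiv ?_
      rw [← hv, Ring.inverse_unit, ContinuousLinearMap.neg_comp]
    refine (cbOn_succ_iff hO).2 ⟨fun x hx => (hd x hx).differentiableAt.differentiableWithinAt,
      ⟨K, hK⟩, ?_⟩
    have h1 := ih (cbOn_nat_mono ha n.le_succ)
    have h2 := cbOn_bilinear hO (ContinuousLinearMap.mulLeftRight 𝕜 R) h1 h1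
    have h3 := cbOn_bilinear hO (ContinuousLinearMap.compL 𝕜 E R R) h2 ha3
    refine cbOn_congr hO (cbOn_clm_comp hO (-ContinuousLinearMap.id 𝕜 _) h3) fun x hx => ?_
    rw [(hd x hx).fderiv]
    simp

/-- A left inverse of a map with invertible derivative is as smooth as the map. -/
lemma contDiffAt_of_leftInverse [CompleteSpace E] {n : WithTop ℕ∞} (hn : n ≠ 0)
    {f : E → F} {g : F → E} {x : E} {e : E ≃L[𝕜] F} (hf : ContDiffAt 𝕜 n f x)
    (hd : HasFDerivAt f (e : E →L[𝕜] F) x) (hg : ∀ᶠ z in 𝓝 x, g (f z) = z) :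
    ContDiffAt 𝕜 n g (f x) ∧ HasFDerivAt g (e.symm : F →L[𝕜] E) (f x) := by
  have hs : HasStrictFDerivAt f (e : E →L[𝕜] F) x := hf.hasStrictFDerivAt' hd hn
  have heq : g =ᶠ[𝓝 (f x)] hf.localInverse hd hn := by
    rw [EventuallyEq, ← hs.map_nhds_eq_of_equiv, eventually_map]
    filter_upwards [hg, hs.eventually_left_inverse] with y hy hy'
    exact hy.trans hy'.symm
  exact ⟨(hf.to_localInverse hd hn).congr_of_eventuallyEq heq,
    hs.to_localInverse.hasFDerivAt.congr_of_eventuallyEq heq⟩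

lemma isOpen_image_of_equiv [CompleteSpace E] {f : E → F} {S : Set E} (hS : IsOpen S)
    (hf : ContDiffOn 𝕜 1 f S) (hd : ∀ x ∈ S, ∃ e : E ≃L[𝕜] F, fderiv 𝕜 f x = e) :
    IsOpen (f '' S) := by
  rw [isOpen_iff_mem_nhds]
  rintro _ ⟨x, hx, rfl⟩
  obtain ⟨e, he⟩ := hd x hx
  have h1 := hf.contDiffAt (hS.mem_nhds hx)
  have h2 : HasFDerivAt f (e : E →L[𝕜] F) x := he ▸ (h1.differentiableAt one_ne_zero).hasFDerivAt
  rw [← (h1.hasStrictFDerivAt' h2 one_ne_zero).map_nhds_eq_of_equiv]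
  exact image_mem_map (hS.mem_nhds hx)

/-- The inverse of a map with bounded derivatives, whose differential is uniformly invertible, has
bounded derivatives. -/
lemma cbOn_leftInverse [CompleteSpace E] {n : ℕ} {f g : E → E} {S : Set E} (hS : IsOpen S)
    (hb : Bornology.IsBounded S) (hf : CbOn 𝕜 (n + 1 : ℕ) f S) {K : ℝ}
    (hd : ∀ x ∈ S, ∃ e : E ≃L[𝕜] E, fderiv 𝕜 f x = e ∧ ‖(e.symm : E →L[𝕜] E)‖ ≤ K)
    (hg : ∀ x ∈ S, g (f x) = x) : CbOn 𝕜 (n + 1 : ℕ) g (f '' S) := by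
  have h1S : ContDiffOn 𝕜 1 f S := hf.1.of_le (by simp)
  have hO : IsOpen (f '' S) :=
    isOpen_image_of_equiv hS h1S fun x hx => (hd x hx).imp fun e he => he.1
  have hmaps : MapsTo g (f '' S) S := by
    rintro _ ⟨x, hx, rfl⟩
    rwa [hg x hx]
  have hgd : ∀ y ∈ f '' S, HasFDerivAt g (Ring.inverse (fderiv 𝕜 f (g y))) y := by
    rintro _ ⟨x, hx, rfl⟩
    obtain ⟨e, he, -⟩ := hd x hx
    have h1 := h1S.contDiffAt (hS.mem_nhds hx)
    have h2 : HasFDerivAt f (e : E →L[𝕜] E) x :=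
      he ▸ (h1.differentiableAt one_ne_zero).hasFDerivAt
    rw [hg x hx, he, ContinuousLinearMap.ringInverse_equiv, ContinuousLinearMap.inverse_equiv]
    exact (contDiffAt_of_leftInverse one_ne_zero h1 h2
      (by filter_upwards [hS.mem_nhds hx] with z hz using hg z hz)).2
  obtain ⟨R, hR⟩ := hb.exists_norm_le
  have hbd : ∃ C : ℝ, ∀ x ∈ f '' S, ‖g x‖ ≤ C := ⟨R, fun y hy => hR _ (hmaps hy)⟩
  have hdiff : DifferentiableOn 𝕜 g (f '' S) :=
    fun y hy => (hgd y hy).differentiableAt.differentiableWithinAt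
  induction n with
  | zero =>
    refine (cbOn_succ_iff hO).2 ⟨hdiff, hbd, ?_⟩
    have h0 : CbOn 𝕜 (0 : ℕ) g (f '' S) := cbOn_zero_iff.2 ⟨hdiff.continuousOn, hbd⟩
    have h1 := cbOn_comp hO hS ((cbOn_succ_iff hS).1 hf).2.2 h0 hmaps
    refine cbOn_congr hO (cbOn_ringInverse hO h1 (K := K) ?_ ?_) fun y hy => (hgd y hy).fderiv
    all_goals
      intro y hy
      obtain ⟨e, he, hK⟩ := hd _ (hmaps hy)
      rw [he]
    · exact ⟨ContinuousLinearEquiv.toUnit e, rfl⟩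
    · rwa [ContinuousLinearMap.ringInverse_equiv, ContinuousLinearMap.inverse_equiv]
  | succ n ih =>
    refine (cbOn_succ_iff hO).2 ⟨hdiff, hbd, ?_⟩
    have h0 := ih (cbOn_nat_mono hf (by omega))
    have h1 := cbOn_comp hO hS ((cbOn_succ_iff hS).1 hf).2.2 h0 hmaps
    refine cbOn_congr hO (cbOn_ringInverse hO h1 (K := K) ?_ ?_) fun y hy => (hgd y hy).fderiv
    all_goals
      intro y hy
      obtain ⟨e, he, hK⟩ := hd _ (hmaps hy)
      rw [he]
    · exact ⟨ContinuousLinearEquiv.toUnit e, rfl⟩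
    · rwa [ContinuousLinearMap.ringInverse_equiv, ContinuousLinearMap.inverse_equiv]

/-- A map which is `C^n` at a point has bounded derivatives near that point. -/
lemma exists_cbOn_ball {n : ℕ} {f : E → F} {x : E} (hf : ContDiffAt 𝕜 n f x) :
    ∃ δ > 0, CbOn 𝕜 n f (Metric.ball x δ) := by
  obtain ⟨u, hu, hx, hc⟩ := exists_isOpen_contDiffOn hf
  have h1 : ∀ i ∈ Finset.range (n + 1), ∀ᶠ y in 𝓝 x,
      ‖iteratedFDeriv 𝕜 i f y‖ < ‖iteratedFDeriv 𝕜 i f x‖ + 1 := by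
    intro i hi
    rw [Finset.mem_range] at hi
    have hc' : ContinuousAt (iteratedFDeriv 𝕜 i f) x :=
      hf.continuousAt_iteratedFDeriv (by exact_mod_cast Nat.lt_succ_iff.1 hi)
    exact hc'.norm.eventually_lt_const (lt_add_one _)
  have h2 := (Filter.eventually_all_finset _).2 h1
  obtain ⟨δ, hδ, hb⟩ := Metric.eventually_nhds_iff_ball.1 (h2.and (hu.mem_nhds hx))
  refine ⟨δ, hδ, cbOn_nat_iff.2 ⟨hc.mono fun y hy => (hb y hy).2, fun i hi => ?_⟩⟩
  exact ⟨_, fun y hy => ((hb y hy).1 i (Finset.mem_range.2 (by omega))).le⟩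

end

/-! ### Complex smooth maps are analytic -/

section

variable {𝕜 : Type*} [RCLike 𝕜] {E F : Type*} [NormedAddCommGroup E] [NormedSpace 𝕜 E]
  [NormedAddCommGroup F] [NormedSpace 𝕜 F]

lemma norm_deriv_le_of_scalar (hI : (RCLike.I : 𝕜) ≠ 0) {g : 𝕜 → 𝕜} {ρ M : ℝ} (hρ : 0 < ρ)
    (hd : ∀ z, ‖z‖ ≤ ρ → DifferentiableAt 𝕜 g z) (hM : ∀ z, ‖z‖ ≤ ρ → ‖g z‖ ≤ M) :
    ‖deriv g 0‖ ≤ M / ρ := by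
  have him := RCLike.I_eq_zero_or_im_I_eq_one.resolve_left hI
  set κ := RCLike.complexRingEquiv him
  have hκn : ∀ z, ‖κ z‖ = ‖z‖ := (RCLike.complexLinearIsometryEquiv him).norm_map
  have hκn' : ∀ z, ‖κ.symm z‖ = ‖z‖ := fun z => by rw [← hκn, κ.apply_symm_apply]
  have hκc : Continuous κ.symm := (RCLike.complexLinearIsometryEquiv him).symm.continuous
  have key : ∀ z : ℂ, ‖z‖ ≤ ρ → HasDerivAt (fun z => κ (g (κ.symm z)))
      (κ (deriv g (κ.symm z))) z := by
    intro z hz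
    have h1 := hasDerivAt_iff_isLittleO.1 (hd (κ.symm z) (by rwa [hκn'])).hasDerivAt
    have h2 := h1.comp_tendsto hκc.continuousAt.tendsto
    refine hasDerivAt_iff_isLittleO.2 (h2.norm_norm.congr (fun w => ?_) fun w => ?_).of_norm_norm
    · rw [← hκn]
      simp
    · rw [← hκn]
      simp
  have h3 : ‖deriv (fun z => κ (g (κ.symm z))) 0‖ ≤ M / ρ := by
    refine Complex.norm_deriv_le_of_forall_mem_sphere_norm_le hρ (DifferentiableOn.diffContOnCl
      fun z hz => ?_) fun z hz => ?_
    · rw [closure_ball _ hρ.ne', mem_closedBall_zero_iff] at hz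
      exact (key z hz).differentiableAt.differentiableWithinAt
    · rw [hκn]
      exact hM _ (by rw [hκn', mem_sphere_zero_iff_norm.1 hz])
  rw [(key 0 (by simpa using hρ.le)).deriv, map_zero, hκn] at h3
  exact h3

/-- Cauchy's estimate for the differential of a complex differentiable map. -/
lemma norm_fderiv_le_of_bounded (hI : (RCLike.I : 𝕜) ≠ 0) {f : E → F} {x : E} {ρ M : ℝ}
    (hρ : 0 < ρ) (hd : ∀ z ∈ Metric.closedBall x ρ, DifferentiableAt 𝕜 f z)
    (hM : ∀ z ∈ Metric.closedBall x ρ, ‖f z‖ ≤ M) : ‖fderiv 𝕜 f x‖ ≤ M / ρ := by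
  have hM0 : 0 ≤ M := (norm_nonneg _).trans (hM x (Metric.mem_closedBall_self hρ.le))
  refine ContinuousLinearMap.opNorm_le_bound _ (by positivity) fun v => ?_
  rcases eq_or_ne v 0 with rfl | hv
  · simp
  have hv' : 0 < ‖v‖ := norm_pos_iff.2 hv
  refine NormedSpace.norm_le_dual_bound 𝕜 _ (by positivity) fun L => ?_
  have hin : ∀ z : 𝕜, ‖z‖ ≤ ρ / ‖v‖ → x + z • v ∈ Metric.closedBall x ρ := by
    intro z hz
    rw [mem_closedBall_iff_norm, add_sub_cancel_left, norm_smul]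
    exact (le_div_iff₀ hv').1 hz
  have hline : ∀ z : 𝕜, HasDerivAt (fun z : 𝕜 => x + z • v) v z := fun z => by
    simpa using ((hasDerivAt_id z).smul_const v).const_add x
  have h1 : ∀ z : 𝕜, ‖z‖ ≤ ρ / ‖v‖ →
      HasDerivAt (fun z : 𝕜 => L (f (x + z • v))) (L (fderiv 𝕜 f (x + z • v) v)) z :=
    fun z hz => L.hasFDerivAt.comp_hasDerivAt z
      ((hd _ (hin z hz)).hasFDerivAt.comp_hasDerivAt z (hline z))
  have h2 := norm_deriv_le_of_scalar hI (g := fun z : 𝕜 => L (f (x + z • v)))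
    (ρ := ρ / ‖v‖) (M := ‖L‖ * M) (by positivity) (fun z hz => (h1 z hz).differentiableAt)
    fun z hz => (L.le_opNorm _).trans (by gcongr; exact hM _ (hin z hz))
  rw [(h1 0 (by rw [norm_zero]; positivity)).deriv, zero_smul, add_zero] at h2
  refine h2.trans_eq ?_
  field_simp

/-- Cauchy's estimates for higher derivatives, on nested balls. -/
lemma norm_iteratedFDeriv_le_of_bounded (hI : (RCLike.I : 𝕜) ≠ 0) {n : ℕ} {f : E → F} {O : Set E}
    (hO : IsOpen O) (hf : ContDiffOn 𝕜 n f O) {ρ M : ℝ} (hρ : 0 < ρ) (hM : ∀ z ∈ O, ‖f z‖ ≤ M)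
    {i : ℕ} (hi : i ≤ n) {y : E} (hy : Metric.closedBall y (i * ρ) ⊆ O) :
    ‖iteratedFDeriv 𝕜 i f y‖ ≤ M / ρ ^ i := by
  induction i generalizing y with
  | zero => simpa using hM y (hy (by simp))
  | succ i ih =>
    have hsub : ∀ z ∈ Metric.closedBall y ρ, Metric.closedBall z (i * ρ) ⊆ O := by
      intro z hz w hw
      refine hy ?_
      rw [Metric.mem_closedBall] at hz hw ⊢
      push_cast
      linarith [dist_triangle w z y]
    have := norm_fderiv_le_of_bounded hI (f := iteratedFDeriv 𝕜 i f) (x := y) hρ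
      (fun z hz => ?_) fun z hz => ih (by omega) (hsub z hz)
    · rw [norm_fderiv_iteratedFDeriv] at this
      rwa [pow_succ, ← div_div]
    · have hz' : z ∈ O := hsub z hz (Metric.mem_closedBall_self (by positivity))
      exact (hf.contDiffAt (hO.mem_nhds hz')).differentiableAt_iteratedFDeriv
        (by exact_mod_cast hi)

/-- Taylor's formula, in differentiated form: the Taylor polynomials of order `k` of `f` at the
points `x + z v`, evaluated at `x + v`, have a derivative in `z` of order `k + 1`. -/
lemma hasDerivAt_taylor {k : ℕ} {f : E → F} {O : Set E} (hO : IsOpen O)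
    (hf : ContDiffOn 𝕜 (k + 1 : ℕ) f O) {x v : E} {z : 𝕜} (hz : x + z • v ∈ O) :
    HasDerivAt (fun z : 𝕜 => ∑ i ∈ Finset.range (k + 1),
        ((1 - z) ^ i / (i.factorial : 𝕜)) • iteratedFDeriv 𝕜 i f (x + z • v) fun _ => v)
      (((1 - z) ^ k / (k.factorial : 𝕜)) • iteratedFDeriv 𝕜 (k + 1) f (x + z • v) fun _ => v)
      z := by
  have hline : HasDerivAt (fun z : 𝕜 => x + z • v) v z := by
    simpa using ((hasDerivAt_id z).smul_const v).const_add x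
  have h1 : ∀ i, i ≤ k → HasDerivAt (fun z : 𝕜 => iteratedFDeriv 𝕜 i f (x + z • v) fun _ => v)
      (iteratedFDeriv 𝕜 (i + 1) f (x + z • v) fun _ => v) z := by
    intro i hi
    have hd : DifferentiableAt 𝕜 (iteratedFDeriv 𝕜 i f) (x + z • v) :=
      (hf.contDiffAt (hO.mem_nhds hz)).differentiableAt_iteratedFDeriv
        (by exact_mod_cast (by omega : i < k + 1))
    have h2 := hd.hasFDerivAt.comp_hasDerivAt z hline
    have h3 := (ContinuousMultilinearMap.apply 𝕜 (fun _ : Fin i => E) F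
      (fun _ => v)).hasFDerivAt.comp_hasDerivAt z h2
    exact h3
  induction k with
  | zero =>
    simpa using h1 0 le_rfl
  | succ k ih =>
    have h2 := ih (hf.of_le (by exact_mod_cast (by omega : k + 1 ≤ k + 1 + 1)))
      fun i hi => h1 i (by omega)
    have h3 : HasDerivAt (fun z : 𝕜 => (1 - z) ^ (k + 1) / ((k + 1).factorial : 𝕜))
        (-((1 - z) ^ k / (k.factorial : 𝕜))) z := by
      have h4 := ((((hasDerivAt_id z).const_sub 1).pow (k + 1)).div_const
        ((k + 1).factorial : 𝕜))
      refine h4.congr_deriv ?_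
      have : (k.factorial : 𝕜) ≠ 0 := by exact_mod_cast k.factorial_ne_zero
      have : (k : 𝕜) + 1 ≠ 0 := by exact_mod_cast k.succ_ne_zero
      simp only [Nat.factorial_succ, id]
      push_cast
      field_simp
    have h4 := h2.add (h3.smul (h1 (k + 1) le_rfl))
    refine (h4.congr_deriv ?_).congr_of_eventuallyEq (Eventually.of_forall fun w => ?_)
    · simp only [neg_smul]
      abel
    · simp only [Finset.sum_range_succ _ (k + 1), Pi.add_apply, Pi.smul_apply']

lemma norm_taylor_sub_le {k : ℕ} {f : E → F} {O : Set E} (hO : IsOpen O)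
    (hf : ContDiffOn 𝕜 (k + 1 : ℕ) f O) {x v : E} (hx : Metric.closedBall x ‖v‖ ⊆ O) {K : ℝ}
    (hK : ∀ y ∈ Metric.closedBall x ‖v‖, ‖iteratedFDeriv 𝕜 (k + 1) f y‖ ≤ K) :
    ‖f (x + v) - ∑ i ∈ Finset.range (k + 1),
      ((i.factorial : 𝕜)⁻¹ • iteratedFDeriv 𝕜 i f x) fun _ => v‖ ≤
      2 ^ k / k.factorial * (K * ‖v‖ ^ (k + 1)) := by
  have hin : ∀ z ∈ Metric.closedBall (0 : 𝕜) 1, x + z • v ∈ Metric.closedBall x ‖v‖ := by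
    intro z hz
    rw [mem_closedBall_zero_iff] at hz
    rw [mem_closedBall_iff_norm, add_sub_cancel_left, norm_smul]
    exact mul_le_of_le_one_left (norm_nonneg _) hz
  have h1 := Convex.norm_image_sub_le_of_norm_hasDerivWithin_le (𝕜 := 𝕜)
    (s := Metric.closedBall (0 : 𝕜) 1) (x := 0) (y := 1)
    (C := 2 ^ k / k.factorial * (K * ‖v‖ ^ (k + 1)))
    (fun z hz => (hasDerivAt_taylor hO hf (hx (hin z hz))).hasDerivWithinAt)
    (fun z hz => ?_) (convex_closedBall _ _) (by simp) (by simp)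
  · simp only [sub_self, one_smul, sub_zero, one_pow, zero_smul, add_zero, norm_one, mul_one,
      one_div] at h1
    refine le_of_eq_of_le (congrArg norm (congrArg₂ _ ?_ ?_)) h1
    · rw [Finset.sum_range_succ', Finset.sum_eq_zero]
      · simp
      · intro i _
        simp
    · rfl
  · rw [norm_smul, norm_div, norm_pow, RCLike.norm_natCast]
    gcongr
    · rw [mem_closedBall_zero_iff] at hz
      calc ‖1 - z‖ ≤ ‖(1 : 𝕜)‖ + ‖z‖ := norm_sub_le _ _
        _ ≤ 2 := by rw [norm_one]; linarith
    · refine (ContinuousMultilinearMap.le_opNorm _ _).trans ?_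
      rw [Finset.prod_const, Finset.card_univ, Fintype.card_fin]
      gcongr
      exact hK _ (hin z hz)

/-- A map of class `C^∞` over the complex scalars is analytic: by Cauchy's estimates its Taylor
series converges to it. -/
theorem contDiffOn_omega_of_infty (hI : (RCLike.I : 𝕜) ≠ 0) {f : E → F} {O : Set E}
    (hO : IsOpen O) (hf : ContDiffOn 𝕜 ∞ f O) : ContDiffOn 𝕜 ω f O := by
  refine AnalyticOn.contDiffOn (fun x hx => AnalyticAt.analyticWithinAt ?_) hO.uniqueDiffOn
  have hfn : ∀ n : ℕ, ContDiffOn 𝕜 n f O := contDiffOn_infty.1 hf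
  -- a ball of radius `2 R` on which `f` is bounded by `M`
  obtain ⟨δ, hδ, hb⟩ := Metric.eventually_nhds_iff_ball.1
    ((hf.continuousOn.continuousAt (hO.mem_nhds hx)).norm.eventually_lt_const
      (lt_add_one ‖f x‖) |>.and (hO.mem_nhds hx))
  set M := ‖f x‖ + 1
  have hM0 : 0 < M := by positivity
  obtain ⟨R, hR, hRδ⟩ : ∃ R > 0, 2 * R < δ := ⟨δ / 4, by positivity, by linarith⟩
  have hbO : Metric.ball x δ ⊆ O := fun y hy => (hb y hy).2
  have hest : ∀ (i : ℕ) (y : E), y ∈ Metric.closedBall x R →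
      ‖iteratedFDeriv 𝕜 i f y‖ ≤ M * (i / R) ^ i := by
    intro i y hy
    rcases Nat.eq_zero_or_pos i with rfl | hi
    · simpa using (hb y (Metric.closedBall_subset_ball (by linarith) hy)).1.le
    have hi' : (0 : ℝ) < i := by exact_mod_cast hi
    have := norm_iteratedFDeriv_le_of_bounded hI (O := Metric.ball x δ) (n := i) (y := y)
      Metric.isOpen_ball ((hfn i).mono hbO) (ρ := R / i) (M := M) (by positivity)
      (fun z hz => (hb z hz).1.le) le_rfl ?_
    · refine this.trans_eq ?_
      rw [div_eq_mul_inv, ← inv_pow, inv_div]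
    · rw [mul_div_cancel₀ _ hi'.ne']
      intro w hw
      rw [Metric.mem_closedBall] at hw hy
      rw [Metric.mem_ball]
      linarith [dist_triangle w y x]
  have hest' : ∀ (i : ℕ) (y : E), y ∈ Metric.closedBall x R →
      ‖iteratedFDeriv 𝕜 i f y‖ / i.factorial ≤ M * (Real.exp 1 / R) ^ i := by
    intro i y hy
    have h1 : (i : ℝ) ^ i / i.factorial ≤ Real.exp 1 ^ i := by
      rw [← Real.exp_nat_mul, mul_one]
      exact Real.pow_div_factorial_le_exp _ (Nat.cast_nonneg _) _
    calc ‖iteratedFDeriv 𝕜 i f y‖ / i.factorial ≤ M * (i / R) ^ i / i.factorial := by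
          gcongr; exact hest i y hy
      _ = M * ((i : ℝ) ^ i / i.factorial) / R ^ i := by rw [div_pow]; ring
      _ ≤ M * Real.exp 1 ^ i / R ^ i := by gcongr
      _ = _ := by rw [div_pow]; ring
  set p : FormalMultilinearSeries 𝕜 E F :=
    fun i => (i.factorial : 𝕜)⁻¹ • iteratedFDeriv 𝕜 i f x with hp
  have hpn : ∀ i, ‖p i‖ ≤ M * (Real.exp 1 / R) ^ i := by
    intro i
    refine le_of_eq_of_le ?_ (hest' i x (Metric.mem_closedBall_self hR.le))
    rw [hp, norm_smul, norm_inv, RCLike.norm_natCast, div_eq_inv_mul]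
  have he : Real.exp 1 < 2.7182818286 := Real.exp_one_lt_d9
  have he0 := Real.exp_pos 1
  have hq : ∀ v : E, ‖v‖ < R / 8 → 2 * (Real.exp 1 / R * ‖v‖) < 1 := by
    intro v hv
    have h1 : Real.exp 1 / R * ‖v‖ ≤ Real.exp 1 / R * (R / 8) := by gcongr
    have h2 : Real.exp 1 / R * (R / 8) = Real.exp 1 / 8 := by field_simp
    linarith
  refine ⟨p, ENNReal.ofReal (R / 8), ?_, by simpa using hR, ?_⟩
  · refine FormalMultilinearSeries.le_radius_of_bound p (M) (r := (R / 8).toNNReal) fun n => ?_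
    rw [Real.coe_toNNReal _ (by positivity)]
    calc ‖p n‖ * (R / 8) ^ n ≤ M * (Real.exp 1 / R) ^ n * (R / 8) ^ n := by
          gcongr; exact hpn n
      _ = M * (Real.exp 1 / 8) ^ n := by
          rw [mul_assoc, ← mul_pow]; congr 2; field_simp
      _ ≤ M * 1 := by
          gcongr
          exact pow_le_one₀ (by positivity) (by linarith)
      _ = M := mul_one M
  · intro v hv
    have hv' : ‖v‖ < R / 8 := by
      rwa [Metric.eball_ofReal, mem_ball_zero_iff] at hv
    set q := Real.exp 1 / R * ‖v‖ with hqdef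
    have hq0 : 0 ≤ q := by positivity
    have hq1 := hq v hv'
    have hterm : ∀ i, ‖p i fun _ => v‖ ≤ M * q ^ i := by
      intro i
      refine ((p i).le_opNorm _).trans ?_
      rw [Finset.prod_const, Finset.card_univ, Fintype.card_fin, hqdef, mul_pow, ← mul_assoc]
      gcongr
      exact hpn i
    rw [hasSum_iff_tendsto_nat_of_summable_norm
      (Summable.of_nonneg_of_le (fun _ => norm_nonneg _) hterm
        ((summable_geometric_of_lt_one hq0 (by linarith)).mul_left M))]
    rw [← tendsto_add_atTop_iff_nat 1, tendsto_iff_norm_sub_tendsto_zero]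
    have hlim : Tendsto (fun k : ℕ => M * (((k + 1 : ℕ) : ℝ) * (2 * q) ^ (k + 1))) atTop (𝓝 0) := by
      have := (tendsto_self_mul_const_pow_of_lt_one (r := 2 * q) (by positivity) hq1)
      simpa using ((tendsto_add_atTop_iff_nat 1).2 this).const_mul M
    refine squeeze_zero (fun _ => norm_nonneg _) (fun k => ?_) hlim
    have hsubR : Metric.closedBall x ‖v‖ ⊆ Metric.closedBall x R :=
      Metric.closedBall_subset_closedBall (by linarith)
    have h1 := norm_taylor_sub_le (k := k) hO (hfn (k + 1)) (x := x) (v := v)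
      (K := M * (Real.exp 1 / R) ^ (k + 1) * (k + 1).factorial)
      (hsubR.trans ((Metric.closedBall_subset_ball (by linarith)).trans hbO)) fun y hy => by
        rw [← div_le_iff₀ (by positivity)]
        exact hest' (k + 1) y (hsubR hy)
    rw [norm_sub_rev]
    refine h1.trans ?_
    have h2 : (2 : ℝ) ^ k / k.factorial * (M * (Real.exp 1 / R) ^ (k + 1) * (k + 1).factorial *
        ‖v‖ ^ (k + 1)) = M * (((k + 1 : ℕ) : ℝ) * (2 ^ k * q ^ (k + 1))) := by
      rw [hqdef, mul_pow, Nat.factorial_succ]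
      have : (k.factorial : ℝ) ≠ 0 := by exact_mod_cast k.factorial_ne_zero
      push_cast
      field_simp
    rw [h2, mul_pow 2 q]
    gcongr
    · norm_num
    · omega

end

/-! ### Maps with bounded derivatives of every admissible order -/

section

variable {𝕜 : Type*} [RCLike 𝕜] {E F G : Type u} [NormedAddCommGroup E] [NormedSpace 𝕜 E]
  [NormedAddCommGroup F] [NormedSpace 𝕜 F] [NormedAddCommGroup G] [NormedSpace 𝕜 G]

/-- `f` has bounded derivatives on `O` of every finite order `≤ r`. In contrast to `CbOn`, the
derivatives are required to be bounded for `r = ω`, too. -/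
def CbNat (𝕜 : Type*) [RCLike 𝕜] {E F : Type*} [NormedAddCommGroup E] [NormedSpace 𝕜 E]
    [NormedAddCommGroup F] [NormedSpace 𝕜 F] (r : WithTop ℕ∞) (f : E → F) (O : Set E) : Prop :=
  ∀ j : ℕ, (j : WithTop ℕ∞) ≤ r → CbOn 𝕜 j f O

variable {r : WithTop ℕ∞}

lemma CbNat.mono {f : E → F} {O O' : Set E} (hf : CbNat 𝕜 r f O) (h : O' ⊆ O) :
    CbNat 𝕜 r f O' := fun j hj => cbOn_of_subset (hf j hj) h

lemma CbNat.congr {f g : E → F} {O : Set E} (hO : IsOpen O) (hf : CbNat 𝕜 r f O)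
    (h : EqOn g f O) : CbNat 𝕜 r g O := fun j hj => cbOn_congr hO (hf j hj) h

lemma CbNat.comp {f : E → F} {g : F → G} {O : Set E} {Q : Set F} (hg : CbNat 𝕜 r g Q)
    (hO : IsOpen O) (hQ : IsOpen Q) (hf : CbNat 𝕜 r f O) (h : MapsTo f O Q) :
    CbNat 𝕜 r (fun x => g (f x)) O := fun j hj => cbOn_comp hO hQ (hg j hj) (hf j hj) h

lemma CbNat.contDiffAt {f : E → F} {O : Set E} (hO : IsOpen O) (hf : CbNat 𝕜 r f O) {x : E}
    (hx : x ∈ O) {j : ℕ} (hj : (j : WithTop ℕ∞) ≤ r) : ContDiffAt 𝕜 j f x :=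
  cbOn_nat_contDiffAt hO (hf j hj) hx

lemma cbNat_clm (L : E →L[𝕜] F) {O : Set E} (hO : IsOpen O) (hb : Bornology.IsBounded O) :
    CbNat 𝕜 r L O := fun _ _ => cbOn_clm L hO hb

lemma CbNat.leftInverse [CompleteSpace E] (hr : 1 ≤ r) {f g : E → E} {S : Set E} (hS : IsOpen S)
    (hb : Bornology.IsBounded S) (hf : CbNat 𝕜 r f S) {K : ℝ}
    (hd : ∀ x ∈ S, ∃ e : E ≃L[𝕜] E, fderiv 𝕜 f x = e ∧ ‖(e.symm : E →L[𝕜] E)‖ ≤ K)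
    (hg : ∀ x ∈ S, g (f x) = x) : CbNat 𝕜 r g (f '' S) := by
  intro j hj
  rcases j with _ | j
  · exact cbOn_nat_mono (n := 0 + 1) (m := 0)
      (cbOn_leftInverse hS hb (hf (0 + 1 : ℕ) (by simpa using hr)) hd hg) (Nat.zero_le _)
  · exact cbOn_leftInverse hS hb (hf (j + 1) hj) hd hg

lemma CbNat.contDiffOn (hr : (RCLike.I : 𝕜) = 0 ↔ r ≠ ω) {f : E → F} {O : Set E} (hO : IsOpen O)
    (hf : CbNat 𝕜 r f O) : ContDiffOn 𝕜 r f O := by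
  by_cases hω : r = ω
  · subst hω
    exact contDiffOn_omega_of_infty (fun h => hr.1 h rfl) hO
      (contDiffOn_infty.2 fun j => (hf j le_top).1)
  · obtain ⟨m, rfl⟩ := WithTop.ne_top_iff_exists.1 hω
    exact contDiffOn_iff_forall_nat_le.2 fun j hj => (hf j (by exact_mod_cast hj)).1

lemma CbNat.cbOn (hr : (RCLike.I : 𝕜) = 0 ↔ r ≠ ω) {f : E → F} {O : Set E} (hO : IsOpen O)
    (hf : CbNat 𝕜 r f O) : CbOn 𝕜 r f O :=
  ⟨hf.contDiffOn hr hO, fun i hi _ => (cbOn_nat_iff.1 (hf i hi)).2 i le_rfl⟩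

/-- Away from the boundary, maps of class `C^r_b` have bounded derivatives of all finite orders:
for `r = ω` this is Cauchy's estimate. -/
lemma cbNat_of_cbOn (hr : (RCLike.I : 𝕜) = 0 ↔ r ≠ ω) {f : E → F} {O O' : Set E} (hO : IsOpen O)
    (hf : CbOn 𝕜 r f O) {ρ : ℝ} (hρ : 0 < ρ) (h : ∀ y ∈ O', Metric.closedBall y ρ ⊆ O) :
    CbNat 𝕜 r f O' := by
  intro j hj
  have hsub : O' ⊆ O := fun y hy => h y hy (Metric.mem_closedBall_self hρ.le)
  refine cbOn_nat_iff.2 ⟨(hf.1.mono hsub).of_le hj, fun i hi => ?_⟩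
  have hij : (i : WithTop ℕ∞) ≤ r := le_trans (by exact_mod_cast hi) hj
  by_cases hω : r = ω
  · subst hω
    obtain ⟨M, hM⟩ := hf.2 0 le_top fun _ => rfl
    rcases Nat.eq_zero_or_pos i with rfl | hi0
    · exact ⟨M, fun x hx => hM x (hsub hx)⟩
    have hi' : (0 : ℝ) < i := by exact_mod_cast hi0
    refine ⟨M / (ρ / i) ^ i, fun y hy => ?_⟩
    refine norm_iteratedFDeriv_le_of_bounded (fun h => hr.1 h rfl) hO (hf.1.of_le le_top)
      (by positivity) (fun z hz => by simpa using hM z hz) le_rfl ?_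
    rw [mul_div_cancel₀ _ hi'.ne']
    exact h y hy
  · obtain ⟨C, hC⟩ := hf.2 i hij fun h => absurd h hω
    exact ⟨C, fun x hx => hC x (hsub hx)⟩

lemma cbNat_ball_of_cbOn (hr : (RCLike.I : 𝕜) = 0 ↔ r ≠ ω) {f : E → F} {O : Set E}
    (hO : IsOpen O) (hf : CbOn 𝕜 r f O) {δ : ℝ} (hδ : 0 < δ)
    (h : Metric.ball 0 (2 * δ) ⊆ O) : CbNat 𝕜 r f (Metric.ball 0 δ) := by
  refine cbNat_of_cbOn hr hO hf (half_pos hδ) fun y hy z hz => h ?_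
  rw [Metric.mem_closedBall] at hz
  rw [Metric.mem_ball] at hy ⊢
  linarith [dist_triangle z y 0]

/-- On a small ball around a point at which the differential is invertible, a map has an inverse,
and the differential is uniformly invertible. -/
lemma exists_inverse_ball [CompleteSpace E] {f : E → E} (hf : ContDiffAt 𝕜 1 f 0)
    {e : E ≃L[𝕜] E} (hd : HasFDerivAt f (e : E →L[𝕜] E) 0) :
    ∃ δ > 0, ∃ g : E → E, ∃ K : ℝ, (∀ x ∈ Metric.ball (0 : E) δ, g (f x) = x) ∧
      ∀ x ∈ Metric.ball (0 : E) δ, ∃ e : E ≃L[𝕜] E, fderiv 𝕜 f x = e ∧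
        ‖(e.symm : E →L[𝕜] E)‖ ≤ K := by
  have hs : HasStrictFDerivAt f (e : E →L[𝕜] E) 0 := hf.hasStrictFDerivAt' hd one_ne_zero
  have h1 : ContinuousAt (fderiv 𝕜 f) 0 := hf.continuousAt_fderiv one_ne_zero
  have hu : fderiv 𝕜 f 0 = (ContinuousLinearEquiv.toUnit e : E →L[𝕜] E) := hd.fderiv
  have h2 : ContinuousAt Ring.inverse (fderiv 𝕜 f 0) := by
    rw [hu]; exact NormedRing.inverse_continuousAt _
  have h3 : ∀ᶠ x in 𝓝 (0 : E), ‖Ring.inverse (fderiv 𝕜 f x)‖ <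
      ‖Ring.inverse (fderiv 𝕜 f 0)‖ + 1 :=
    (ContinuousAt.comp h2 h1).norm.eventually_lt_const (lt_add_one _)
  have h4 : ∀ᶠ x in 𝓝 (0 : E), IsUnit (fderiv 𝕜 f x) :=
    h1.eventually (by rw [hu]; exact Units.isOpen.mem_nhds (Units.isUnit _))
  obtain ⟨δ, hδ, hb⟩ := Metric.eventually_nhds_iff_ball.1
    (hs.eventually_left_inverse.and (h3.and h4))
  refine ⟨δ, hδ, hs.localInverse f e 0, ‖Ring.inverse (fderiv 𝕜 f 0)‖ + 1, fun x hx => (hb x hx).1, fun x hx => ?_⟩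
  obtain ⟨-, h5, v, hv⟩ := hb x hx
  refine ⟨ContinuousLinearEquiv.ofUnit v, hv.symm, ?_⟩
  rw [← hv, Ring.inverse_unit] at h5
  exact h5.le

end

/-! ### Norm continuous semigroups -/

section Semigroup

variable {𝕜 : Type*} [RCLike 𝕜] {R : Type*} [NormedRing R] [NormedAlgebra 𝕜 R] [CompleteSpace R]

/-- A norm continuous semigroup in a Banach algebra is given by the exponential function: it is
differentiable, because it differs from its averages by an invertible factor. -/
theorem exists_eq_exp_of_semigroup {a : ℝ → R} (hc : ContinuousOn a (Ici 0)) (h0 : a 0 = 1)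
    (hadd : ∀ s t, 0 ≤ s → 0 ≤ t → a (t + s) = a t * a s) :
    ∃ G : R, ∀ t : ℝ, 0 ≤ t → a t = NormedSpace.exp ((t : 𝕜) • G) := by
  let _ : NormedAlgebra ℝ R := NormedAlgebra.restrictScalars ℝ 𝕜 R
  set b : ℝ → R := fun t => a (max t 0) with hb
  have hbc : Continuous b := hc.comp_continuous (by fun_prop) fun t => mem_Ici.2 (le_max_right _ _)
  have hba : ∀ t, 0 ≤ t → b t = a t := fun t ht => by rw [hb]; simp only [max_eq_left ht]
  have hii : ∀ s t, IntervalIntegrable b MeasureTheory.volume s t :=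
    fun s t => hbc.intervalIntegrable s t
  obtain ⟨c, hc0, hcb⟩ : ∃ c > 0, ∀ s ∈ Icc 0 c, ‖b s - 1‖ ≤ 1 / 2 := by
    have : ∀ᶠ s in 𝓝 (0 : ℝ), ‖b s - 1‖ < 1 / 2 := by
      have h1 : Tendsto (fun s => ‖b s - 1‖) (𝓝 0) (𝓝 0) :=
        (hbc.sub continuous_const).norm.tendsto' 0 0 (by simp [hb, h0])
      exact h1.eventually_lt_const (by norm_num)
    obtain ⟨ε, hε, h⟩ := Metric.eventually_nhds_iff.1 this
    refine ⟨ε / 2, by positivity, fun s hs => (h ?_).le⟩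
    rw [Real.dist_eq, sub_zero, abs_of_nonneg hs.1]
    linarith [hs.2]
  set M : R := ∫ s in (0 : ℝ)..c, b s with hM
  -- the average of the semigroup over a short time is invertible
  have hMu : IsUnit (c⁻¹ • M) := by
    have h1 : ‖(∫ s in (0 : ℝ)..c, (b s - 1))‖ ≤ 1 / 2 * |c - 0| :=
      intervalIntegral.norm_integral_le_of_norm_le_const fun s hs => by
        rw [uIoc_of_le hc0.le] at hs
        exact hcb s ⟨hs.1.le, hs.2⟩
    rw [intervalIntegral.integral_sub (hii 0 c) (by simp), intervalIntegral.integral_const,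
      sub_zero, abs_of_pos hc0] at h1
    have h2 : ‖1 - c⁻¹ • M‖ < 1 := by
      have h3 : 1 - c⁻¹ • M = -(c⁻¹ • (M - c • (1 : R))) := by
        rw [smul_sub, smul_smul, inv_mul_cancel₀ hc0.ne', one_smul]; abel
      rw [h3, norm_neg, norm_smul, norm_inv, Real.norm_of_nonneg hc0.le]
      calc c⁻¹ * ‖M - c • (1 : R)‖ ≤ c⁻¹ * (1 / 2 * c) := by gcongr
        _ < 1 := by field_simp; norm_num
    have := (Units.oneSub (1 - c⁻¹ • M) h2).isUnit
    rwa [Units.val_oneSub, sub_sub_cancel] at this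
  obtain ⟨v, hv⟩ := hMu
  set N : R := c⁻¹ • (↑v⁻¹ : R) with hN
  have hMN : M * N = 1 := by
    have : M = c • (v : R) := by rw [hv, smul_smul, mul_inv_cancel₀ hc0.ne', one_smul]
    rw [this, hN, smul_mul_smul_comm, mul_inv_cancel₀ hc0.ne', one_smul, Units.mul_inv]
  set J : ℝ → R := fun t => (∫ s in (0 : ℝ)..(t + c), b s) - ∫ s in (0 : ℝ)..t, b s with hJ
  have hJM : ∀ t, 0 ≤ t → a t = J t * N := by
    intro t ht
    have h1 : J t = a t * M := by
      simp only [hJ]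
      rw [intervalIntegral.integral_interval_sub_left (hii _ _) (hii _ _), hM]
      have h3 := (ContinuousLinearMap.mul ℝ R (a t)).intervalIntegral_comp_comm (hii 0 c)
      simp only [ContinuousLinearMap.mul_apply'] at h3
      rw [← h3]
      have h2 := intervalIntegral.integral_comp_add_left (a := 0) (b := c) b t
      rw [add_zero] at h2
      rw [← h2]
      refine intervalIntegral.integral_congr fun s hs => ?_
      rw [uIcc_of_le hc0.le] at hs
      show b (t + s) = a t * b s
      rw [hba _ hs.1, hba _ (add_nonneg ht hs.1), hadd s t hs.1 ht]
    rw [h1, mul_assoc, hMN, mul_one]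
  have hJd : ∀ t, HasDerivAt J (b (t + c) - b t) t := by
    intro t
    have h1 : ∀ t, HasDerivAt (fun t => ∫ s in (0 : ℝ)..t, b s) (b t) t := fun t =>
      intervalIntegral.integral_hasDerivAt_right (hii _ _)
        (hbc.stronglyMeasurableAtFilter _ _) hbc.continuousAt
    exact (HasDerivAt.comp_add_const t c (h1 (t + c))).sub (h1 t)
  set G : R := (a c - 1) * N with hG
  have hJd' : ∀ t, 0 ≤ t → HasDerivAt (fun t => J t * N) (J t * N * G) t := by
    intro t ht
    refine ((hJd t).mul_const N).congr_deriv ?_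
    rw [← hJM t ht, hba _ ht, hba _ (by positivity), hadd c t hc0.le ht, hG, ← mul_assoc, mul_sub,
      mul_one]
  have hexp : ∀ t : ℝ, HasDerivAt (fun t : ℝ => NormedSpace.exp (t • (-G)))
      (-G * NormedSpace.exp (t • (-G))) t := fun t => hasDerivAt_exp_smul_const' (𝕂 := ℝ) (-G) t
  have hprod : ∀ t, 0 ≤ t →
      HasDerivAt (fun t => J t * N * NormedSpace.exp (t • (-G))) 0 t := by
    intro t ht
    refine ((hJd' t ht).mul (hexp t)).congr_deriv ?_
    rw [mul_assoc, neg_mul, mul_neg, add_neg_cancel]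
  refine ⟨G, fun t ht => ?_⟩
  have hconst := constant_of_has_deriv_right_zero (a := 0) (b := t)
    (fun s hs => (hprod s hs.1).continuousAt.continuousWithinAt)
    (fun s hs => (hprod s hs.1).hasDerivWithinAt) t ⟨ht, le_rfl⟩
  rw [← hJM t ht, ← hJM 0 le_rfl, h0, zero_smul, NormedSpace.exp_zero, one_mul] at hconst
  have h5 : NormedSpace.exp (t • (-G)) * NormedSpace.exp (t • G) = 1 := by
    rw [← NormedSpace.exp_add_of_commute_of_mem_ball (𝕂 := ℝ) (x := t • (-G)) (y := t • G)]
    · rw [smul_neg, neg_add_cancel, NormedSpace.exp_zero]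
    · rw [smul_neg]; exact (Commute.refl _).neg_left
    all_goals rw [NormedSpace.expSeries_radius_eq_top]; exact edist_lt_top _ _
  calc a t = a t * (NormedSpace.exp (t • (-G)) * NormedSpace.exp (t • G)) := by rw [h5, mul_one]
    _ = NormedSpace.exp (t • G) := by rw [← mul_assoc, hconst, one_mul]

lemma exp_add_smul (G : R) (s t : 𝕜) :
    NormedSpace.exp ((s + t) • G) = NormedSpace.exp (s • G) * NormedSpace.exp (t • G) := by
  rw [add_smul]
  refine NormedSpace.exp_add_of_commute_of_mem_ball (𝕂 := 𝕜)
    (((Commute.refl G).smul_left s).smul_right t) ?_ ?_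
  all_goals rw [NormedSpace.expSeries_radius_eq_top]; exact edist_lt_top _ _

lemma contDiff_exp_smul (G : R) : ContDiff 𝕜 ω fun t : 𝕜 => NormedSpace.exp (t • G) := by
  have h1 : ContDiff 𝕜 ω (NormedSpace.exp : R → R) :=
    contDiff_iff_contDiffAt.2 fun x => (NormedSpace.exp_analytic x).contDiffAt
  exact h1.comp (contDiff_id.smul contDiff_const)

end Semigroup

section Group

variable {𝕜 : Type*} [RCLike 𝕜] {Z : Type*} [NormedAddCommGroup Z] [NormedSpace 𝕜 Z]
  [CompleteSpace Z]

/-- The one-parameter group of automorphisms with generator `G`. -/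
def expGroup (G : Z →L[𝕜] Z) (t : ℝ) : Z ≃L[𝕜] Z :=
  ContinuousLinearEquiv.ofUnit
    { val := NormedSpace.exp ((t : 𝕜) • G)
      inv := NormedSpace.exp ((-t : 𝕜) • G)
      val_inv := (exp_add_smul (R := Z →L[𝕜] Z) G (t : 𝕜) (-t)).symm.trans
        (by rw [add_neg_cancel, zero_smul, NormedSpace.exp_zero])
      inv_val := (exp_add_smul (R := Z →L[𝕜] Z) G (-t : 𝕜) t).symm.trans
        (by rw [neg_add_cancel, zero_smul, NormedSpace.exp_zero]) }

lemma coe_expGroup (G : Z →L[𝕜] Z) (t : ℝ) :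
    (expGroup G t : Z →L[𝕜] Z) = NormedSpace.exp ((t : 𝕜) • G) := rfl

lemma expGroup_zero (G : Z →L[𝕜] Z) (y : Z) : expGroup G 0 y = y := by
  have : (expGroup G 0 : Z →L[𝕜] Z) = 1 := by
    rw [coe_expGroup, RCLike.ofReal_zero, zero_smul, NormedSpace.exp_zero]
  exact congrArg (fun L : Z →L[𝕜] Z => L y) this

lemma expGroup_add (G : Z →L[𝕜] Z) (s t : ℝ) (y : Z) :
    expGroup G (t + s) y = expGroup G t (expGroup G s y) := by
  have : (expGroup G (t + s) : Z →L[𝕜] Z) =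
      (expGroup G t : Z →L[𝕜] Z) * (expGroup G s : Z →L[𝕜] Z) := by
    rw [coe_expGroup, coe_expGroup, coe_expGroup, RCLike.ofReal_add]
    exact exp_add_smul (R := Z →L[𝕜] Z) G (t : 𝕜) s
  exact congrArg (fun L : Z →L[𝕜] Z => L y) this

lemma continuous_expGroup (G : Z →L[𝕜] Z) :
    Continuous fun t => (expGroup G t : Z →L[𝕜] Z) :=
  (contDiff_exp_smul (𝕜 := 𝕜) G).continuous.comp RCLike.continuous_ofReal

lemma continuous_expGroup_symm (G : Z →L[𝕜] Z) :
    Continuous fun t => ((expGroup G t).symm : Z →L[𝕜] Z) :=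
  (contDiff_exp_smul (𝕜 := 𝕜) G).continuous.comp RCLike.continuous_ofReal.neg

lemma contDiff_expGroup [NormedSpace ℝ Z] [IsScalarTower ℝ 𝕜 Z] (G : Z →L[𝕜] Z) {k : WithTop ℕ∞} :
    ContDiff ℝ k fun p : ℝ × Z => expGroup G p.1 p.2 := by
  refine ContDiff.of_le ?_ (le_top : k ≤ ω)
  have h1 : ContDiff ℝ ω fun t : 𝕜 => NormedSpace.exp (t • G) :=
    (contDiff_exp_smul (𝕜 := 𝕜) G).restrict_scalars ℝ
  have h2 : ContDiff ℝ ω fun p : (Z →L[𝕜] Z) × Z => p.1 p.2 :=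
    (isBoundedBilinearMap_apply (𝕜 := 𝕜) (E := Z) (F := Z)).contDiff.restrict_scalars ℝ
  have h3 : ContDiff ℝ ω fun t : ℝ => (t : 𝕜) := (RCLike.ofRealCLM (K := 𝕜)).contDiff
  exact h2.comp ((h1.comp (h3.comp contDiff_fst)).prodMk contDiff_snd)

end Group

/-! ### Semiflows near an attracting fixed point -/

section

variable {𝕜 : Type*} [RCLike 𝕜] {X : Type u} [NormedAddCommGroup X] [NormedSpace 𝕜 X]
  {r : WithTop ℕ∞}

/-- The restriction of a local semiflow to the ball of radius `ρ` around an asymptotically stable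
fixed point at `0`: all orbits that start in the ball are defined for all times `t ≥ 0`, and they
converge to `0` uniformly. -/
structure StableSemiflow (𝕜 : Type*) [RCLike 𝕜] {X : Type*} [NormedAddCommGroup X]
    [NormedSpace 𝕜 X] (r : WithTop ℕ∞) (φ : ℝ → X → X) (τ ρ : ℝ) : Prop where
  pos : 0 < ρ
  map_fixed : ∀ t, 0 ≤ t → φ t 0 = 0
  map_zero : ∀ x, φ 0 x = x
  map_add : ∀ s t x, 0 ≤ s → 0 ≤ t → ‖x‖ < ρ → ‖φ s x‖ < ρ → φ (t + s) x = φ t (φ s x)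
  smooth : ∀ t, 0 ≤ t → CbNat 𝕜 r (φ t) (Metric.ball 0 ρ)
  stable : ∀ ε > 0, ∃ δ > 0, ∀ x, ‖x‖ < δ → ∀ t, 0 ≤ t → ‖φ t x‖ < ε
  attract : ∀ ε > 0, ∃ n : ℕ, ∀ x, ‖x‖ < ρ → ∀ t, n * τ ≤ t → ‖φ t x‖ < ε

lemma StableSemiflow.mono {φ : ℝ → X → X} {τ ρ ρ' : ℝ} (h : StableSemiflow 𝕜 r φ τ ρ)
    (hρ : 0 < ρ') (hle : ρ' ≤ ρ) : StableSemiflow 𝕜 r φ τ ρ' where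
  pos := hρ
  map_fixed := h.map_fixed
  map_zero := h.map_zero
  map_add s t x hs ht hx hx' := h.map_add s t x hs ht (hx.trans_le hle) (hx'.trans_le hle)
  smooth t ht := (h.smooth t ht).mono (Metric.ball_subset_ball hle)
  stable := h.stable
  attract ε hε := (h.attract ε hε).imp fun _ hn x hx => hn x (hx.trans_le hle)

lemma StableSemiflow.exists_stable_le {φ : ℝ → X → X} {τ ρ : ℝ} (h : StableSemiflow 𝕜 r φ τ ρ)
    {ε : ℝ} (hε : 0 < ε) : ∃ δ > 0, δ ≤ ε ∧ ∀ x, ‖x‖ < δ → ∀ t, 0 ≤ t → ‖φ t x‖ < ε := by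
  obtain ⟨δ, hδ, h1⟩ := h.stable ε hε
  exact ⟨min δ ε, lt_min hδ hε, min_le_right _ _,
    fun x hx => h1 x (hx.trans_le (min_le_left _ _))⟩

/-- On a small ball, a stable local semiflow is defined for all times, its maps have bounded
derivatives, and it contracts the ball uniformly to `0`, since some power of the linearization is a
contraction. -/
theorem exists_stableSemiflow (hr : (RCLike.I : 𝕜) = 0 ↔ r ≠ ω) (hr1 : 1 ≤ r)
    {D : Set (ℝ × X)} {φ : ℝ → X → X} (hφ : IsLocalSemiflow D φ)
    (hstable : IsLyapunovStableZero D φ) {O : Set X} (hO : IsOpen O) (h0O : (0 : X) ∈ O)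
    (hsmooth : ∀ t, 0 ≤ t → CbOn 𝕜 r (φ t) ({x | (t, x) ∈ D} ∩ O))
    (hT : IsC0Semigroup (fun t => fderiv 𝕜 (φ t) 0)) {τ : ℝ} (hτ : 0 < τ)
    (hA : Tendsto (fun n => ‖(fderiv 𝕜 (φ τ) 0) ^ n‖) atTop (𝓝 0)) :
    ∃ ρ, StableSemiflow 𝕜 r φ τ ρ ∧ ∀ x, ‖x‖ < ρ → ∀ t, 0 ≤ t → (t, x) ∈ D := by
  obtain ⟨δ0, hδ0, hδO⟩ := Metric.isOpen_iff.1 hO 0 h0O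
  obtain ⟨δ1, hδ1, hst1⟩ := hstable.stable δ0 hδ0
  set δ := min δ0 δ1 with hδ
  have hδp : 0 < δ := lt_min hδ0 hδ1
  have hD : ∀ x, ‖x‖ < δ → ∀ t, 0 ≤ t → (t, x) ∈ D :=
    fun x hx t ht => (hst1 x (hx.trans_le (min_le_right _ _)) t ht).1
  have hst : ∀ ε > 0, ∃ δ > 0, ∀ x, ‖x‖ < δ → ∀ t, 0 ≤ t → ‖φ t x‖ < ε := fun ε hε => by
    obtain ⟨δ, hδ, h⟩ := hstable.stable ε hε
    exact ⟨δ, hδ, fun x hx t ht => (h x hx t ht).2⟩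
  have hsm : ∀ t, 0 ≤ t → CbNat 𝕜 r (φ t) (Metric.ball 0 (δ / 2)) := by
    intro t ht
    refine cbNat_ball_of_cbOn hr Metric.isOpen_ball
      (cbOn_of_subset (hsmooth t ht) (O' := Metric.ball 0 δ) fun x hx => ?_) (half_pos hδp) ?_
    · have hx' := mem_ball_zero_iff.1 hx
      exact ⟨hD x hx' t ht, hδO (Metric.ball_subset_ball (min_le_left _ _) hx)⟩
    · rw [mul_div_cancel₀ _ two_ne_zero]
  have hadd : ∀ s t x, 0 ≤ s → 0 ≤ t → ‖x‖ < δ → ‖φ s x‖ < δ → φ (t + s) x = φ t (φ s x) :=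
    fun s t x hs ht hx hx' => hφ.map_add s t x (hD x hx s hs) (hD _ hx' t ht)
      (hD x hx _ (add_nonneg ht hs))
  have hfix : ∀ t, 0 ≤ t → φ t 0 = 0 := fun t ht => (hstable.fixed t ht).2
  obtain ⟨m, hm⟩ := (hA.eventually_lt_const (show (0 : ℝ) < 1 / 2 by norm_num)).exists
  have hTm : ∀ n : ℕ, fderiv 𝕜 (φ (n * τ)) 0 = (fderiv 𝕜 (φ τ) 0) ^ n := by
    intro n
    induction n with
    | zero =>
      simp only [CharP.cast_eq_zero, zero_mul, pow_zero]
      exact hT.map_zero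
    | succ n ih =>
      have := hT.map_add (n * τ) τ (by positivity) hτ.le
      rw [Nat.cast_succ, add_one_mul, add_comm, this, ih, pow_succ']
      rfl
  have hmτ : (0 : ℝ) ≤ m * τ := by positivity
  have hd : HasFDerivAt (φ (m * τ)) ((fderiv 𝕜 (φ τ) 0) ^ m) 0 := by
    rw [← hTm]
    have h1 : ContDiffAt 𝕜 (1 : ℕ) (φ (m * τ)) 0 := (hsm _ hmτ).contDiffAt Metric.isOpen_ball
      (Metric.mem_ball_self (half_pos hδp)) (by simpa using hr1)
    exact (h1.differentiableAt (by simp)).hasFDerivAt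
  obtain ⟨δ2, hδ2, hcon⟩ := Metric.eventually_nhds_iff.1
    (eventually_norm_le hd (hfix _ hmτ) hm)
  set ρ := min (δ / 2) δ2 with hρ
  have hρp : 0 < ρ := lt_min (half_pos hδp) hδ2
  have hρδ : ρ < δ := (min_le_left _ _).trans_lt (half_lt_self hδp)
  have hit : ∀ (k : ℕ) x, ‖x‖ < ρ → ‖φ (k * (m * τ)) x‖ ≤ (1 / 2) ^ k * ‖x‖ := by
    intro k x hx
    induction k with
    | zero => simp [hφ.map_zero]
    | succ k ih =>
      have h1 : ‖φ (k * (m * τ)) x‖ < ρ := by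
        refine ih.trans_lt (lt_of_le_of_lt ?_ hx)
        exact mul_le_of_le_one_left (norm_nonneg _) (pow_le_one₀ (by norm_num) (by norm_num))
      rw [Nat.cast_succ, add_one_mul, add_comm, hadd _ _ _ (by positivity) hmτ (hx.trans hρδ)
        (h1.trans hρδ)]
      calc _ ≤ 1 / 2 * ‖φ (k * (m * τ)) x‖ :=
            hcon (by rw [dist_zero_right]; exact h1.trans_le (min_le_right _ _))
        _ ≤ 1 / 2 * ((1 / 2) ^ k * ‖x‖) := by gcongr
        _ = _ := by ring
  refine ⟨ρ, ⟨hρp, hfix, hφ.map_zero, fun s t x hs ht hx hx' => hadd s t x hs ht (hx.trans hρδ)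
    (hx'.trans hρδ), fun t ht => (hsm t ht).mono (Metric.ball_subset_ball (min_le_left _ _)),
    hst, fun ε hε => ?_⟩, fun x hx => hD x (hx.trans hρδ)⟩
  obtain ⟨δε, hδε, h1⟩ := hst ε hε
  obtain ⟨k, hk⟩ := exists_pow_lt_of_lt_one (div_pos hδε hρp) (show (1 / 2 : ℝ) < 1 by norm_num)
  refine ⟨k * m, fun x hx t ht => ?_⟩
  have hkt : (k : ℝ) * (m * τ) ≤ t := by push_cast at ht; linarith
  have h2 := hit k x hx
  have h3 : ‖φ (k * (m * τ)) x‖ < δε := by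
    refine h2.trans_lt ?_
    calc (1 / 2) ^ k * ‖x‖ ≤ (1 / 2) ^ k * ρ := by gcongr
      _ < δε := (lt_div_iff₀ hρp).1 hk
  have h4 : ‖φ (k * (m * τ)) x‖ < ρ := h2.trans_lt (lt_of_le_of_lt
    (mul_le_of_le_one_left (norm_nonneg _) (pow_le_one₀ (by norm_num) (by norm_num))) hx)
  have h5 := hadd (k * (m * τ)) (t - k * (m * τ)) x (by positivity) (by linarith) (hx.trans hρδ)
    (h4.trans hρδ)
  rw [sub_add_cancel] at h5
  rw [h5]
  exact h1 _ h3 _ (by linarith)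

/-- Two orbits of a map which eventually coincide are equal, as long as the map is injective
along them. -/
lemma eq_of_eventually_eq {Z : Type*} {h : Z → Z} {B : Set Z} (hB : InjOn h B)
    {c d : ℕ → Z} (hc : ∀ i, c (i + 1) = h (c i)) (hd : ∀ i, d (i + 1) = h (d i))
    (hcB : ∀ i, c i ∈ B) (hdB : ∀ i, d i ∈ B) {n : ℕ} (hn : c n = d n) : c 0 = d 0 := by
  induction n with
  | zero => exact hn
  | succ n ih =>
    rw [hc, hd] at hn
    exact ih (hB (hcB n) (hdB n) hn)

/-- The fibres of `π` are mapped to fibres by `φ_t`, not just near `0` but along all orbits on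
which `π` semiconjugates `φ_τ` to an injective map. -/
theorem fibre_invariant {Z : Type*} {φ : ℝ → X → X} {τ ρ : ℝ} (hτ : 0 < τ)
    (hφ : StableSemiflow 𝕜 r φ τ ρ) {π : X → Z} {h : Z → Z} {B : Set Z} (hB : InjOn h B)
    (hπB : ∀ x, ‖x‖ < ρ → π x ∈ B) (hπh : ∀ x, ‖x‖ < ρ → π (φ τ x) = h (π x))
    {t : ℝ} (ht : 0 ≤ t) {η : Z → Z} (hη : ∀ᶠ x in 𝓝 0, π (φ t x) = η (π x))
    {x x' : X} (hx : ∀ t, 0 ≤ t → ‖φ t x‖ < ρ) (hx' : ∀ t, 0 ≤ t → ‖φ t x'‖ < ρ)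
    (he : π x = π x') : π (φ t x) = π (φ t x') := by
  have hstep : ∀ {x : X}, (∀ t, 0 ≤ t → ‖φ t x‖ < ρ) → ∀ t, 0 ≤ t → ∀ i : ℕ,
      π (φ (t + (i + 1 : ℕ) * τ) x) = h (π (φ (t + i * τ) x)) := by
    intro x hx t ht i
    have hx0 : ‖x‖ < ρ := by simpa [hφ.map_zero] using hx 0 le_rfl
    have hs : 0 ≤ t + i * τ := by positivity
    rw [← hπh _ (hx _ hs), ← hφ.map_add _ _ _ hs hτ.le hx0 (hx _ hs)]
    congr 2
    push_cast
    ring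
  obtain ⟨δ, hδ, hηδ⟩ := Metric.eventually_nhds_iff.1 hη
  obtain ⟨n, hn⟩ := hφ.attract δ hδ
  have hfib : ∀ i : ℕ, π (φ (0 + i * τ) x) = π (φ (0 + i * τ) x') := by
    intro i
    induction i with
    | zero => simpa [hφ.map_zero] using he
    | succ i ih => rw [hstep hx 0 le_rfl, hstep hx' 0 le_rfl, ih]
  have hpush : ∀ {x : X}, (∀ t, 0 ≤ t → ‖φ t x‖ < ρ) →
      π (φ (t + n * τ) x) = η (π (φ (0 + n * τ) x)) := by
    intro x hx
    have hx0 : ‖x‖ < ρ := by simpa [hφ.map_zero] using hx 0 le_rfl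
    rw [zero_add, hφ.map_add _ _ _ (by positivity) ht hx0 (hx _ (by positivity))]
    exact hηδ (by rw [dist_zero_right]; exact hn x hx0 _ le_rfl)
  have := eq_of_eventually_eq hB (c := fun i : ℕ => π (φ (t + i * τ) x))
    (d := fun i : ℕ => π (φ (t + i * τ) x')) (hstep hx t ht) (hstep hx' t ht)
    (fun i => hπB _ (hx _ (by positivity))) (fun i => hπB _ (hx' _ (by positivity))) (n := n)
    (by simp only [hpush hx, hpush hx', hfib])
  simpa using this

variable {Z : Type u} [NormedAddCommGroup Z] [NormedSpace 𝕜 Z]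

/-- A semiconjugacy germ `π ∘ φ_τ = h ∘ π`, which is smooth of every admissible finite order, has
bounded derivatives of all these orders on a single ball: regularity near `0` spreads backwards
along the orbits, since `h` is invertible. -/
theorem exists_ball_cbNat [CompleteSpace Z] {φ : ℝ → X → X} {τ ρ : ℝ} (hτ : 0 < τ) (hr1 : 1 ≤ r)
    (hφ : StableSemiflow 𝕜 r φ τ ρ) {π : X → Z} {h : Z → Z} {e : Z ≃L[𝕜] Z}
    (hπ : ∀ j : ℕ, (j : WithTop ℕ∞) ≤ r → ContDiffAt 𝕜 j π 0) (hπ0 : π 0 = 0)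
    (hh : ∀ k, ContDiff 𝕜 k h) (hhd : HasFDerivAt h (e : Z →L[𝕜] Z) 0)
    (hhb : ∀ (R : ℝ) (i : ℕ), ∃ C, ∀ z, ‖z‖ ≤ R → ‖iteratedFDeriv 𝕜 i h z‖ ≤ C)
    (hπh : ∀ᶠ x in 𝓝 0, π (φ τ x) = h (π x)) :
    ∃ δ > 0, CbNat 𝕜 r π (Metric.ball 0 δ) := by
  obtain ⟨δh, hδh, g, K, hgh, hinv⟩ := exists_inverse_ball (hh 1).contDiffAt hhd
  set S := Metric.ball (0 : Z) δh with hS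
  have hhS : CbNat 𝕜 r h S := fun j hj => by
    refine cbOn_nat_iff.2 ⟨(hh j).contDiffOn, fun i _ => ?_⟩
    obtain ⟨C, hC⟩ := hhb δh i
    exact ⟨C, fun z hz => hC z (mem_ball_zero_iff.1 hz).le⟩
  have hgQ : CbNat 𝕜 r g (h '' S) :=
    hhS.leftInverse hr1 Metric.isOpen_ball Metric.isBounded_ball hinv hgh
  have hQ : IsOpen (h '' S) := isOpen_image_of_equiv Metric.isOpen_ball (hh 1).contDiffOn
    fun x hx => (hinv x hx).imp fun e he => he.1
  have hπc : ContinuousAt π 0 := (hπ 0 (by simp)).continuousAt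
  obtain ⟨δ1, hδ1, hW⟩ := Metric.eventually_nhds_iff.1
    (hπh.and (hπc.eventually (by rw [hπ0]; exact Metric.ball_mem_nhds 0 hδh)))
  obtain ⟨δ, hδ, hδle, hst⟩ := hφ.exists_stable_le (lt_min hδ1 hφ.pos)
  have hδρ : δ ≤ ρ := hδle.trans (min_le_right _ _)
  refine ⟨δ, hδ, fun j hj => ?_⟩
  obtain ⟨δj, hδj, hcj⟩ := exists_cbOn_ball (hπ j hj)
  obtain ⟨n, hn⟩ := hφ.attract δj hδj
  have key : ∀ k ≤ n, CbOn 𝕜 j (fun x => π (φ (k * τ) x)) (Metric.ball 0 δ) := by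
    intro k hk
    induction hk using Nat.decreasingInduction with
    | self =>
      refine cbOn_comp Metric.isOpen_ball Metric.isOpen_ball hcj (cbOn_of_subset
        (hφ.smooth _ (by positivity) j hj) (Metric.ball_subset_ball hδρ)) fun x hx => ?_
      rw [mem_ball_zero_iff] at hx ⊢
      exact hn x (hx.trans_le hδρ) _ le_rfl
    | of_succ k hk ih =>
      have h1 : ∀ x ∈ Metric.ball (0 : X) δ, π (φ (k * τ) x) ∈ S ∧
          π (φ ((k + 1 : ℕ) * τ) x) = h (π (φ (k * τ) x)) := by
        intro x hx
        rw [mem_ball_zero_iff] at hx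
        have h2 := hst x hx (k * τ) (by positivity)
        have h3 := hW (y := φ (k * τ) x)
          (by rw [dist_zero_right]; exact h2.trans_le (min_le_left _ _))
        refine ⟨h3.2, ?_⟩
        rw [Nat.cast_succ, add_one_mul, add_comm, hφ.map_add _ _ _ (by positivity) hτ.le
          (hx.trans_le hδρ) (h2.trans_le (min_le_right _ _)), h3.1]
      refine cbOn_congr Metric.isOpen_ball (cbOn_comp Metric.isOpen_ball hQ (hgQ j hj) ih
        fun x hx => ?_) fun x hx => ?_
      · show π (φ ((k + 1 : ℕ) * τ) x) ∈ h '' S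
        rw [(h1 x hx).2]
        exact mem_image_of_mem h (h1 x hx).1
      · show π (φ (k * τ) x) = g (π (φ ((k + 1 : ℕ) * τ) x))
        rw [(h1 x hx).2, hgh _ (h1 x hx).1]
  simpa [hφ.map_zero] using key 0 (Nat.zero_le n)

/-- If the reduced map `e` is linear, then a linear reduction of `φ_t` that is valid near `0` holds
along all orbits. -/
theorem linear_reduction {φ : ℝ → X → X} {τ ρ : ℝ} (hτ : 0 < τ)
    (hφ : StableSemiflow 𝕜 r φ τ ρ) {π : X → Z} {e : Z ≃L[𝕜] Z}
    (hπh : ∀ x, ‖x‖ < ρ → π (φ τ x) = e (π x)) {t : ℝ} (ht : 0 ≤ t) {M : Z →L[𝕜] Z}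
    (hM : ∀ z, M (e z) = e (M z)) (hη : ∀ᶠ x in 𝓝 0, π (φ t x) = M (π x))
    {x : X} (hx : ∀ t, 0 ≤ t → ‖φ t x‖ < ρ) : π (φ t x) = M (π x) := by
  have hx0 : ‖x‖ < ρ := by simpa [hφ.map_zero] using hx 0 le_rfl
  have hstep : ∀ t, 0 ≤ t → ∀ i : ℕ,
      π (φ (t + (i + 1 : ℕ) * τ) x) = e (π (φ (t + i * τ) x)) := by
    intro t ht i
    have hs : 0 ≤ t + i * τ := by positivity
    rw [← hπh _ (hx _ hs), ← hφ.map_add _ _ _ hs hτ.le hx0 (hx _ hs)]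
    congr 2
    push_cast
    ring
  obtain ⟨δ, hδ, hηδ⟩ := Metric.eventually_nhds_iff.1 hη
  obtain ⟨n, hn⟩ := hφ.attract δ hδ
  have := eq_of_eventually_eq (e.injective.injOn (s := univ))
    (c := fun i : ℕ => π (φ (t + i * τ) x))
    (d := fun i : ℕ => M (π (φ (0 + i * τ) x))) (hstep t ht)
    (fun i => by rw [hstep 0 le_rfl, hM]) (fun _ => mem_univ _) (fun _ => mem_univ _) (n := n) ?_
  · simpa [hφ.map_zero] using this
  · rw [zero_add, hφ.map_add _ _ _ (by positivity) ht hx0 (hx _ (by positivity))]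
    exact hηδ (by rw [dist_zero_right]; exact hn x hx0 _ le_rfl)

end

/-! ### Injective semiflows close to a linear group -/

section

variable {𝕜 : Type*} [RCLike 𝕜] {Z : Type u} [NormedAddCommGroup Z] [NormedSpace 𝕜 Z]
  {r : WithTop ℕ∞}

/-- `f` is a diffeomorphism of the open set `N` onto an open set; `f` and its inverse have bounded
derivatives of all finite orders `≤ r`. -/
structure IsCbNatDiffeo (𝕜 : Type*) [RCLike 𝕜] {Z : Type*} [NormedAddCommGroup Z]
    [NormedSpace 𝕜 Z] (r : WithTop ℕ∞) (f : Z → Z) (N : Set Z) : Prop where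
  smooth : CbNat 𝕜 r f N
  isOpen_image : IsOpen (f '' N)
  invertible : ∀ x ∈ N, ∃ e : Z ≃L[𝕜] Z, HasFDerivAt f (e : Z →L[𝕜] Z) x
  inverse : ∃ g : Z → Z, CbNat 𝕜 r g (f '' N) ∧ ∀ x ∈ N, g (f x) = x

lemma IsCbNatDiffeo.injOn {f : Z → Z} {N : Set Z} (h : IsCbNatDiffeo 𝕜 r f N) : InjOn f N := by
  obtain ⟨g, -, hg⟩ := h.inverse
  exact LeftInvOn.injOn hg

lemma IsCbNatDiffeo.isCbDiffeoOn (hr : (RCLike.I : 𝕜) = 0 ↔ r ≠ ω) {f : Z → Z} {N S : Set Z}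
    (h : IsCbNatDiffeo 𝕜 r f N) (hN : IsOpen N) (hS : S ⊆ N) : IsCbDiffeoOn 𝕜 r f S := by
  obtain ⟨g, hg, hgf⟩ := h.inverse
  exact ⟨N, hN, hS, h.smooth.cbOn hr hN, h.isOpen_image, g, hg.cbOn hr h.isOpen_image, hgf⟩

lemma IsCbNatDiffeo.comp {f g : Z → Z} {N : Set Z} (hN : IsOpen N)
    (hf : IsCbNatDiffeo 𝕜 r f N) (hg : IsCbNatDiffeo 𝕜 r g (f '' N)) :
    IsCbNatDiffeo 𝕜 r (fun x => g (f x)) N := by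
  have him : (fun x => g (f x)) '' N = g '' (f '' N) := (image_image g f N).symm
  obtain ⟨f', hf', hff⟩ := hf.inverse
  obtain ⟨g', hg', hgg⟩ := hg.inverse
  refine ⟨hg.smooth.comp hN hf.isOpen_image hf.smooth (mapsTo_image f N), him ▸ hg.isOpen_image,
    fun x hx => ?_, fun y => f' (g' y), ?_, fun x hx => ?_⟩
  · obtain ⟨e, he⟩ := hf.invertible x hx
    obtain ⟨e', he'⟩ := hg.invertible (f x) (mem_image_of_mem f hx)
    exact ⟨e.trans e', he'.comp x he⟩
  · rw [him]
    refine hf'.comp hg.isOpen_image hf.isOpen_image hg' ?_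
    rintro _ ⟨y, hy, rfl⟩
    rwa [hgg y hy]
  · show f' (g' (g (f x))) = x
    rw [hgg _ (mem_image_of_mem f hx), hff x hx]

variable [CompleteSpace Z]

/-- A linear map close to an automorphism is an automorphism. -/
lemma exists_equiv_of_close {a : Z ≃L[𝕜] Z} {L : Z →L[𝕜] Z} {K : ℝ} (hK : 0 < K)
    (ha : ‖(a.symm : Z →L[𝕜] Z)‖ ≤ K) (hL : ‖L - a‖ ≤ 1 / (2 * K)) :
    ∃ e : Z ≃L[𝕜] Z, L = e ∧ ‖(e.symm : Z →L[𝕜] Z)‖ ≤ 2 * K := by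
  set T : Z →L[𝕜] Z := (a.symm : Z →L[𝕜] Z) ∘L ((a : Z →L[𝕜] Z) - L) with hT
  have hTn : ‖T‖ ≤ 1 / 2 := by
    refine (ContinuousLinearMap.opNorm_comp_le _ _).trans ?_
    rw [norm_sub_rev]
    calc _ ≤ K * (1 / (2 * K)) := by gcongr
      _ = 1 / 2 := by field_simp
  set e := (ContinuousLinearEquiv.ofUnit (Units.oneSub T (by linarith))).trans a with he
  have hLe : ∀ v, e v = L v := by
    intro v
    show a (v - T v) = L v
    rw [hT]
    simp
  refine ⟨e, ContinuousLinearMap.ext fun v => (hLe v).symm,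
    ContinuousLinearMap.opNorm_le_bound _ (by positivity) fun w => ?_⟩
  obtain ⟨v, rfl⟩ := e.surjective w
  rw [ContinuousLinearEquiv.coe_coe, e.symm_apply_apply]
  have h1 : ‖v‖ ≤ ‖e v‖ * K + 1 / 2 * ‖v‖ := by
    have h2 : v = a.symm (e v) + T v := by
      show v = a.symm (a (v - T v)) + T v
      rw [a.symm_apply_apply, sub_add_cancel]
    calc ‖v‖ = ‖a.symm (e v) + T v‖ := by rw [← h2]
      _ ≤ ‖(a.symm : Z →L[𝕜] Z) (e v)‖ + ‖T v‖ := norm_add_le _ _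
      _ ≤ K * ‖e v‖ + 1 / 2 * ‖v‖ := add_le_add
          ((ContinuousLinearMap.le_opNorm _ _).trans (by gcongr))
          ((T.le_opNorm v).trans (by gcongr))
      _ = _ := by ring
  linarith

/-- A semiflow near the fixed point `0`, whose differentials are close to those of the linear group
generated by `G`, uniformly in times `t ∈ [0, 1]`. -/
structure ReducedFlow (𝕜 : Type*) [RCLike 𝕜] {Z : Type*} [NormedAddCommGroup Z]
    [NormedSpace 𝕜 Z] [CompleteSpace Z] (r : WithTop ℕ∞) (ϑ : ℝ → Z → Z) (G : Z →L[𝕜] Z)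
    (ρ : ℝ) : Prop where
  pos : 0 < ρ
  map_fixed : ∀ t, 0 ≤ t → ϑ t 0 = 0
  map_zero : ∀ y, ‖y‖ < ρ → ϑ 0 y = y
  map_add : ∀ s t y, 0 ≤ s → 0 ≤ t → ‖y‖ < ρ → ‖ϑ s y‖ < ρ → ϑ (t + s) y = ϑ t (ϑ s y)
  smooth : ∀ t, 0 ≤ t → CbNat 𝕜 r (ϑ t) (Metric.ball 0 ρ)
  stable : ∀ ε > 0, ∃ δ > 0, ∀ y, ‖y‖ < δ → ∀ t, 0 ≤ t → ‖ϑ t y‖ < ε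
  fderiv_close : ∀ ε > 0, ∃ δ > 0, ∀ t ∈ Icc (0 : ℝ) 1, ∀ y, ‖y‖ < δ →
    ‖fderiv 𝕜 (ϑ t) y - expGroup G t‖ ≤ ε

/-- A semiflow `ϑ` by injective local diffeomorphisms of the forward invariant open set `P`. -/
structure InjSemiflow (𝕜 : Type*) [RCLike 𝕜] {Z : Type*} [NormedAddCommGroup Z]
    [NormedSpace 𝕜 Z] (r : WithTop ℕ∞) (ϑ : ℝ → Z → Z) (P : Set Z) : Prop where
  isOpen : IsOpen P
  invariant : ∀ t, 0 ≤ t → MapsTo (ϑ t) P P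
  map_zero : ∀ y ∈ P, ϑ 0 y = y
  map_add : ∀ s t, 0 ≤ s → 0 ≤ t → ∀ y ∈ P, ϑ (t + s) y = ϑ t (ϑ s y)
  diffeo : ∀ t, 0 ≤ t → IsCbNatDiffeo 𝕜 r (ϑ t) P

/-- On a small ball, the maps `ϑ_t` with `0 ≤ t ≤ 1` are diffeomorphisms. -/
lemma ReducedFlow.exists_diffeo_unit {ϑ : ℝ → Z → Z} {G : Z →L[𝕜] Z} {ρ : ℝ} (hr1 : 1 ≤ r)
    (h : ReducedFlow 𝕜 r ϑ G ρ) : ∃ δ > 0, δ ≤ ρ ∧ ∀ t ∈ Icc (0 : ℝ) 1, ∀ N : Set Z, IsOpen N →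
      N ⊆ Metric.ball 0 δ → IsCbNatDiffeo 𝕜 r (ϑ t) N := by
  let _ : NormedSpace ℝ Z := NormedSpace.restrictScalars ℝ 𝕜 Z
  obtain ⟨K, hK, hKb⟩ : ∃ K > 0, ∀ t ∈ Icc (0 : ℝ) 1,
      ‖((expGroup G t).symm : Z →L[𝕜] Z)‖ ≤ K := by
    obtain ⟨K, hK⟩ := (isCompact_Icc (a := (0 : ℝ)) (b := 1)).exists_bound_of_continuousOn
      (continuous_expGroup_symm G).continuousOn
    exact ⟨max K 1, by positivity, fun t ht => (hK t ht).trans (le_max_left _ _)⟩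
  obtain ⟨δ', hδ', hcl⟩ := h.fderiv_close (1 / (2 * K)) (by positivity)
  refine ⟨min δ' ρ, lt_min hδ' h.pos, min_le_right _ _, fun t ht N hN hNδ => ?_⟩
  have hNρ : N ⊆ Metric.ball 0 ρ := hNδ.trans (Metric.ball_subset_ball (min_le_right _ _))
  have hNδ' : N ⊆ Metric.ball 0 δ' := hNδ.trans (Metric.ball_subset_ball (min_le_left _ _))
  have hinv : ∀ x ∈ Metric.ball (0 : Z) (min δ' ρ), ∃ e : Z ≃L[𝕜] Z, fderiv 𝕜 (ϑ t) x = e ∧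
      ‖(e.symm : Z →L[𝕜] Z)‖ ≤ 2 * K := fun x hx => exists_equiv_of_close hK (hKb t ht)
    (hcl t ht x ((mem_ball_zero_iff.1 hx).trans_le (min_le_left _ _)))
  have hd : ∀ x ∈ Metric.ball (0 : Z) (min δ' ρ), HasFDerivAt (ϑ t) (fderiv 𝕜 (ϑ t) x) x := by
    intro x hx
    have h1 : ContDiffAt 𝕜 (1 : ℕ) (ϑ t) x := (h.smooth t ht.1).contDiffAt Metric.isOpen_ball
      (Metric.ball_subset_ball (min_le_right _ _) hx) (by simpa using hr1)
    exact (h1.differentiableAt (by simp)).hasFDerivAt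
  have hinj : InjOn (ϑ t) (Metric.ball (0 : Z) (min δ' ρ)) := by
    intro x hx y hy hxy
    have h1 := (convex_ball (0 : Z) (min δ' ρ)).norm_image_sub_le_of_norm_hasFDerivWithin_le'
      (𝕜 := 𝕜) (f := ϑ t) (φ := (expGroup G t : Z →L[𝕜] Z)) (C := 1 / (2 * K))
      (fun z hz => (hd z hz).hasFDerivWithinAt)
      (fun z hz => hcl t ht z ((mem_ball_zero_iff.1 hz).trans_le (min_le_left _ _))) hx hy
    rw [hxy, sub_self, zero_sub, norm_neg] at h1
    have h2 : ‖y - x‖ ≤ K * ‖(expGroup G t : Z →L[𝕜] Z) (y - x)‖ := by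
      have h3 := ((expGroup G t).symm : Z →L[𝕜] Z).le_of_opNorm_le (hKb t ht)
        ((expGroup G t : Z →L[𝕜] Z) (y - x))
      simpa using h3
    have h4 : ‖y - x‖ ≤ 1 / 2 * ‖y - x‖ := by
      calc ‖y - x‖ ≤ K * (1 / (2 * K) * ‖y - x‖) := h2.trans (by gcongr)
        _ = _ := by field_simp
    have h5 : ‖y - x‖ = 0 := by linarith [norm_nonneg (y - x)]
    exact (sub_eq_zero.1 (norm_eq_zero.1 h5)).symm
  have hsm := (h.smooth t ht.1).mono hNρ
  have hg : ∀ x ∈ N, Function.invFunOn (ϑ t) N (ϑ t x) = x := fun x hx =>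
    (hinj.mono hNδ).leftInvOn_invFunOn hx
  refine ⟨hsm, isOpen_image_of_equiv hN ?_ fun x hx => (hinv x (hNδ hx)).imp fun _ he => he.1,
    fun x hx => ?_, _, hsm.leftInverse hr1 hN (Metric.isBounded_ball.subset hNρ)
      (fun x hx => hinv x (hNδ hx)) hg, hg⟩
  · simpa using (hsm (1 : ℕ) (by simpa using hr1)).1
  · obtain ⟨e, he, -⟩ := hinv x (hNδ hx)
    exact ⟨e, he ▸ hd x (hNδ hx)⟩

/-- All `ϑ_t` with `t ≥ 0` are diffeomorphisms of sets whose orbits stay in a small ball. -/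
lemma ReducedFlow.exists_diffeo {ϑ : ℝ → Z → Z} {G : Z →L[𝕜] Z} {ρ : ℝ} (hr1 : 1 ≤ r)
    (h : ReducedFlow 𝕜 r ϑ G ρ) : ∃ δ > 0, δ ≤ ρ ∧ ∀ N : Set Z, IsOpen N →
      (∀ t, 0 ≤ t → ∀ y ∈ N, ‖ϑ t y‖ < δ) → (∀ y ∈ N, ‖y‖ < δ) → ∀ t, 0 ≤ t →
        IsCbNatDiffeo 𝕜 r (ϑ t) N := by
  obtain ⟨δ, hδ, hδρ, hunit⟩ := h.exists_diffeo_unit hr1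
  refine ⟨δ, hδ, hδρ, fun N hN horb hNδ => ?_⟩
  have key : ∀ n : ℕ, ∀ t : ℝ, 0 ≤ t → t ≤ n + 1 → IsCbNatDiffeo 𝕜 r (ϑ t) N := by
    intro n
    induction n with
    | zero =>
      intro t ht ht1
      exact hunit t ⟨ht, by simpa using ht1⟩ N hN fun y hy => mem_ball_zero_iff.2 (hNδ y hy)
    | succ n ih =>
      intro t ht htn
      rcases le_total t 1 with ht1 | ht1
      · exact hunit t ⟨ht, ht1⟩ N hN fun y hy => mem_ball_zero_iff.2 (hNδ y hy)
      have h1 := ih (t - 1) (by linarith) (by push_cast at htn; linarith)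
      have h2 := hunit 1 ⟨zero_le_one, le_rfl⟩ (ϑ (t - 1) '' N) h1.isOpen_image (by
        rintro _ ⟨y, hy, rfl⟩
        exact mem_ball_zero_iff.2 (horb _ (by linarith) y hy))
      have h3 := h1.comp hN h2
      have heq : EqOn (ϑ t) (fun x => ϑ 1 (ϑ (t - 1) x)) N := by
        intro y hy
        have := h.map_add (t - 1) 1 y (by linarith) zero_le_one ((hNδ y hy).trans_le hδρ)
          ((horb _ (by linarith) y hy).trans_le hδρ)
        rwa [add_sub_cancel] at this
      obtain ⟨g, hg, hgf⟩ := h3.inverse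
      refine ⟨h3.smooth.congr hN heq, heq.image_eq ▸ h3.isOpen_image, fun x hx => ?_, g, ?_,
        fun x hx => ?_⟩
      · obtain ⟨e, he⟩ := h3.invertible x hx
        exact ⟨e, he.congr_of_eventuallyEq (heq.eventuallyEq_of_mem (hN.mem_nhds hx))⟩
      · rwa [heq.image_eq]
      · rw [heq hx]
        exact hgf x hx
  intro t ht
  obtain ⟨n, hn⟩ := exists_nat_ge t
  exact key n t ht (by linarith)

/-- The orbits of a small ball form a set `P` on which the semiflow consists of injective local
diffeomorphisms; for small `a`, the set `ϑ_a(P)` still is a neighbourhood of `0`. -/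
theorem ReducedFlow.exists_injSemiflow {ϑ : ℝ → Z → Z} {G : Z →L[𝕜] Z} {ρ : ℝ} (hr1 : 1 ≤ r)
    (h : ReducedFlow 𝕜 r ϑ G ρ) {ε : ℝ} (hε : 0 < ε) :
    ∃ P : Set Z, InjSemiflow 𝕜 r ϑ P ∧ P ⊆ Metric.ball 0 ε ∧ P ⊆ Metric.ball 0 ρ ∧
      (∃ δ > 0, Metric.ball 0 δ ⊆ P) ∧
      ∃ a > 0, ∃ δ > 0, Metric.ball 0 δ ⊆ ϑ a '' P := by
  let _ : NormedSpace ℝ Z := NormedSpace.restrictScalars ℝ 𝕜 Z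
  obtain ⟨δ, hδ, hδρ, hdif⟩ := h.exists_diffeo hr1
  obtain ⟨δ1, hδ1, hcl⟩ := h.fderiv_close (1 / 4) (by norm_num)
  have hmin : 0 < min (min δ δ1) ε := lt_min (lt_min hδ hδ1) hε
  obtain ⟨δ2, hδ2, hst⟩ := h.stable _ hmin
  set ρ' := min δ2 (min (min δ δ1) ε) with hρ'
  have hρ'p : 0 < ρ' := lt_min hδ2 hmin
  set B := Metric.ball (0 : Z) ρ' with hB
  have horb : ∀ t, 0 ≤ t → ∀ y ∈ B, ‖ϑ t y‖ < min (min δ δ1) ε := fun t ht y hy =>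
    hst y ((mem_ball_zero_iff.1 hy).trans_le (min_le_left _ _)) t ht
  have hBm : ∀ y ∈ B, ‖y‖ < min (min δ δ1) ε := fun y hy =>
    (mem_ball_zero_iff.1 hy).trans_le (min_le_right _ _)
  have hle : min (min δ δ1) ε ≤ δ := (min_le_left _ _).trans (min_le_left _ _)
  have hle1 : min (min δ δ1) ε ≤ δ1 := (min_le_left _ _).trans (min_le_right _ _)
  have hBρ : ∀ y ∈ B, ‖y‖ < ρ := fun y hy => (hBm y hy).trans_le (hle.trans hδρ)
  have horbρ : ∀ t, 0 ≤ t → ∀ y ∈ B, ‖ϑ t y‖ < ρ := fun t ht y hy =>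
    (horb t ht y hy).trans_le (hle.trans hδρ)
  have hBd : ∀ t, 0 ≤ t → IsCbNatDiffeo 𝕜 r (ϑ t) B := hdif B Metric.isOpen_ball
    (fun t ht y hy => (horb t ht y hy).trans_le hle) fun y hy => (hBm y hy).trans_le hle
  set P : Set Z := ⋃ t : Ici (0 : ℝ), ϑ t '' B with hP
  have hmem : ∀ p, p ∈ P ↔ ∃ u, 0 ≤ u ∧ ∃ y ∈ B, ϑ u y = p := by
    intro p
    simp only [hP, mem_iUnion, mem_image, Subtype.exists, mem_Ici, exists_prop]
  have hPo : IsOpen P := isOpen_iUnion fun t => (hBd t t.2).isOpen_image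
  have hBP : B ⊆ P := fun y hy => (hmem y).2 ⟨0, le_rfl, y, hy, h.map_zero y (hBρ y hy)⟩
  have hinvt : ∀ t, 0 ≤ t → MapsTo (ϑ t) P P := by
    intro t ht p hp
    obtain ⟨u, hu, y, hy, rfl⟩ := (hmem p).1 hp
    exact (hmem _).2 ⟨t + u, by positivity, y, hy,
      h.map_add u t y hu ht (hBρ y hy) (horbρ u hu y hy)⟩
  have hPm : ∀ p ∈ P, ‖p‖ < min (min δ δ1) ε := by
    intro p hp
    obtain ⟨u, hu, y, hy, rfl⟩ := (hmem p).1 hp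
    exact horb u hu y hy
  have hPρ : ∀ p ∈ P, ‖p‖ < ρ := fun p hp => (hPm p hp).trans_le (hle.trans hδρ)
  have hPd : ∀ t, 0 ≤ t → IsCbNatDiffeo 𝕜 r (ϑ t) P := hdif P hPo
    (fun t ht y hy => (hPm _ (hinvt t ht hy)).trans_le hle) fun y hy => (hPm y hy).trans_le hle
  refine ⟨P, ⟨hPo, hinvt, fun y hy => h.map_zero y (hPρ y hy), fun s t hs ht y hy =>
    h.map_add s t y hs ht (hPρ y hy) (hPρ _ (hinvt s hs hy)), hPd⟩,
    fun p hp => mem_ball_zero_iff.2 ((hPm p hp).trans_le (min_le_right _ _)),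
    fun p hp => mem_ball_zero_iff.2 (hPρ p hp), ⟨ρ', hρ'p, hBP⟩, ?_⟩
  -- for small times `a`, the map `ϑ_a` is close to the identity on `B`
  obtain ⟨a, ha, ha1, haid⟩ : ∃ a > 0, a ≤ 1 ∧
      ‖(expGroup G a : Z →L[𝕜] Z) - ContinuousLinearMap.id 𝕜 Z‖ ≤ 1 / 4 := by
    have h0 : (expGroup G 0 : Z →L[𝕜] Z) = ContinuousLinearMap.id 𝕜 Z :=
      ContinuousLinearMap.ext fun y => expGroup_zero G y
    have h1 : Tendsto (fun t => ‖(expGroup G t : Z →L[𝕜] Z) - ContinuousLinearMap.id 𝕜 Z‖)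
        (𝓝 0) (𝓝 0) :=
      ((continuous_expGroup G).sub continuous_const).norm.tendsto' 0 0 (by simp [h0])
    obtain ⟨ε', hε', h2⟩ := Metric.eventually_nhds_iff.1
      (h1.eventually_lt_const (show (0 : ℝ) < 1 / 4 by norm_num))
    refine ⟨min (ε' / 2) 1, by positivity, min_le_right _ _, (h2 ?_).le⟩
    rw [Real.dist_eq, sub_zero, abs_of_pos (by positivity)]
    exact (min_le_left _ _).trans_lt (by linarith)
  refine ⟨a, ha, ρ' / 4, by positivity, ?_⟩
  have happ : ApproximatesLinearOn (ϑ a) (ContinuousLinearMap.id 𝕜 Z) B (1 / 2) := by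
    intro x hx y hy
    refine (convex_ball (0 : Z) ρ').norm_image_sub_le_of_norm_hasFDerivWithin_le' (𝕜 := 𝕜)
      (f' := fun z => fderiv 𝕜 (ϑ a) z) (fun z hz => ?_) (fun z hz => ?_) hy hx
    · obtain ⟨e, he⟩ := (hBd a ha.le).invertible z hz
      exact he.differentiableAt.hasFDerivAt.hasFDerivWithinAt
    · calc ‖fderiv 𝕜 (ϑ a) z - ContinuousLinearMap.id 𝕜 Z‖
          = ‖(fderiv 𝕜 (ϑ a) z - expGroup G a) +
            ((expGroup G a : Z →L[𝕜] Z) - ContinuousLinearMap.id 𝕜 Z)‖ := by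
            rw [sub_add_sub_cancel]
        _ ≤ 1 / 4 + 1 / 4 := (norm_add_le _ _).trans (add_le_add
            (hcl a ⟨ha.le, ha1⟩ z ((hBm z hz).trans_le hle1)) haid)
        _ = ((1 / 2 : NNReal) : ℝ) := by norm_num
  have hsurj := happ.surjOn_closedBall_of_nonlinearRightInverse
    (⟨id, 1, fun y => by simp, fun y => rfl⟩ :
      (ContinuousLinearMap.id 𝕜 Z).NonlinearRightInverse) (ε := ρ' / 2) (b := 0) (by positivity)
    (Metric.closedBall_subset_ball (by linarith))
  intro y hy
  have hy' := mem_ball_zero_iff.1 hy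
  rw [h.map_fixed a ha.le] at hsurj
  obtain ⟨x, hx, rfl⟩ := hsurj (a := y) (by
    rw [mem_closedBall_zero_iff]
    refine hy'.le.trans (le_of_eq ?_)
    norm_num
    ring)
  exact mem_image_of_mem _ (hBP (Metric.closedBall_subset_ball (by linarith) hx))

end

/-! ### Extension of injective semiflows to local flows -/

section

variable {𝕜 : Type*} [RCLike 𝕜] {Z : Type u} [NormedAddCommGroup Z] [NormedSpace 𝕜 Z]
  {r : WithTop ℕ∞}

/-- Backward continuation is unique: if orbits starting at `z` and `v` meet at the times `a` and
`c`, they agree at all positive times, after the time shift by `a - c`. -/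
lemma InjSemiflow.eq_of_meet {ϑ : ℝ → Z → Z} {P : Set Z} (h : InjSemiflow 𝕜 r ϑ P) {a c t : ℝ}
    (ha : 0 ≤ a) (hc : 0 ≤ c) {z v : Z} (hz : z ∈ P) (hv : v ∈ P) (he : ϑ a z = ϑ c v)
    (hta : -a ≤ t) (htc : -c ≤ t) : ϑ (t + a) z = ϑ (t + c) v := by
  rcases le_total 0 t with ht | ht
  · rw [h.map_add a t ha ht z hz, h.map_add c t hc ht v hv, he]
  · have h1 := h.map_add (t + a) (-t) (by linarith) (by linarith) z hz
    have h2 := h.map_add (t + c) (-t) (by linarith) (by linarith) v hv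
    rw [neg_add_cancel_left] at h1 h2
    exact (h.diffeo (-t) (by linarith)).injOn (h.invariant _ (by linarith) hz)
      (h.invariant _ (by linarith) hv) (by rw [← h1, ← h2, he])

/-- The domain of the local flow generated by an injective semiflow `ϑ` on `P`: a point in
`ϑ_a(P)` can be moved backwards up to the time `-a`. -/
def flowDomain (ϑ : ℝ → Z → Z) (P : Set Z) : Set (ℝ × Z) :=
  {p | ∃ a, 0 < a ∧ -a < p.1 ∧ ∃ z ∈ P, ϑ a z = p.2}

open Classical in
/-- The local flow generated by an injective semiflow `ϑ` on `P`: it maps `ϑ_a(z)` to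
`ϑ_{t+a}(z)`, if `t + a > 0`. -/
def localFlow (ϑ : ℝ → Z → Z) (P : Set Z) (t : ℝ) (y : Z) : Z :=
  if h : ∃ q : ℝ × Z, 0 < q.1 ∧ -q.1 < t ∧ q.2 ∈ P ∧ ϑ q.1 q.2 = y then
    ϑ (t + h.choose.1) h.choose.2
  else y

lemma InjSemiflow.localFlow_eq {ϑ : ℝ → Z → Z} {P : Set Z} (h : InjSemiflow 𝕜 r ϑ P) {a t : ℝ}
    (ha : 0 < a) (hta : -a < t) {z : Z} (hz : z ∈ P) :
    localFlow ϑ P t (ϑ a z) = ϑ (t + a) z := by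
  have hex : ∃ q : ℝ × Z, 0 < q.1 ∧ -q.1 < t ∧ q.2 ∈ P ∧ ϑ q.1 q.2 = ϑ a z :=
    ⟨(a, z), ha, hta, hz, rfl⟩
  rw [localFlow, dif_pos hex]
  obtain ⟨h1, h2, h3, h4⟩ := hex.choose_spec
  exact h.eq_of_meet h1.le ha.le h3 hz h4 h2.le hta.le

/-- Near `(t, ϑ_a(z))`, the local flow is the semiflow at time `t + a` composed with the smooth local
inverse of `ϑ_a`. -/
lemma InjSemiflow.localFlow_contDiffOn [NormedSpace ℝ Z] [IsScalarTower ℝ 𝕜 Z]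
    (hr : (RCLike.I : 𝕜) = 0 ↔ r ≠ ω) {ϑ : ℝ → Z → Z} {P : Set Z} (h : InjSemiflow 𝕜 r ϑ P)
    {k : WithTop ℕ∞} (hk : k ≤ r)
    (hϑ : ContDiffOn ℝ k (fun p : ℝ × Z => ϑ p.1 p.2) (Ioi 0 ×ˢ P)) :
    ContDiffOn ℝ k (fun p : ℝ × Z => localFlow ϑ P p.1 p.2) (flowDomain ϑ P) := by
  rintro ⟨t, y⟩ ⟨a, ha, hta, z, hz, hzy⟩
  refine ContDiffAt.contDiffWithinAt ?_
  have hd := h.diffeo a ha.le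
  obtain ⟨g, hg, hgϑ⟩ := hd.inverse
  have hW : IsOpen (Ioi (-a) ×ˢ (ϑ a '' P)) := isOpen_Ioi.prod hd.isOpen_image
  have hgc : ContDiffOn ℝ k g (ϑ a '' P) :=
    ((hg.contDiffOn hr hd.isOpen_image).of_le hk).restrict_scalars ℝ
  have hc : ContDiffOn ℝ k (fun p : ℝ × Z => ϑ (p.1 + a) (g p.2)) (Ioi (-a) ×ˢ (ϑ a '' P)) := by
    refine hϑ.comp (f := fun p : ℝ × Z => (p.1 + a, g p.2))
      ((contDiff_fst.add contDiff_const).contDiffOn.prodMk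
        (hgc.comp contDiff_snd.contDiffOn fun p hp => hp.2)) ?_
    rintro ⟨s, _⟩ ⟨hs, x, hx, rfl⟩
    refine ⟨?_, ?_⟩
    · have : -a < s := hs
      show 0 < s + a
      linarith
    · show g (ϑ a x) ∈ P
      rwa [hgϑ x hx]
  have hmem : (t, y) ∈ Ioi (-a) ×ˢ (ϑ a '' P) := ⟨hta, z, hz, hzy⟩
  refine (hc.contDiffAt (hW.mem_nhds hmem)).congr_of_eventuallyEq ?_
  filter_upwards [hW.mem_nhds hmem]
  rintro ⟨s, _⟩ ⟨hs, x, hx, rfl⟩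
  show localFlow ϑ P s (ϑ a x) = ϑ (s + a) (g (ϑ a x))
  rw [h.localFlow_eq ha hs hx, hgϑ x hx]

/-- An injective semiflow extends to a local flow. -/
theorem InjSemiflow.isLocalFlowExtension {ϑ : ℝ → Z → Z} {P : Set Z}
    (h : InjSemiflow 𝕜 r ϑ P) {a : ℝ} (ha : 0 < a) {S : Set Z} (hS : S ⊆ ϑ a '' P) :
    IsLocalFlowExtension S ϑ (flowDomain ϑ P) (localFlow ϑ P) where
  isOpen := by
    have : flowDomain ϑ P = ⋃ a : Ioi (0 : ℝ), Ioi (-(a : ℝ)) ×ˢ (ϑ a '' P) := by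
      ext ⟨t, y⟩
      simp only [flowDomain, mem_ofPred_eq, mem_iUnion, mem_prod, mem_image, Subtype.exists,
        mem_Ioi, exists_prop]
    rw [this]
    exact isOpen_iUnion fun a => isOpen_Ioi.prod (h.diffeo a (le_of_lt a.2)).isOpen_image
  forward t ht y hy := by
    obtain ⟨z, hz, rfl⟩ := hS hy
    refine ⟨⟨a, ha, by simp only; linarith, z, hz, rfl⟩, ?_⟩
    rw [h.localFlow_eq ha (by linarith) hz, h.map_add a t ha.le ht z hz]
  backward t ht y hy := by
    obtain ⟨z, hz, rfl⟩ := hS hy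
    exact ⟨t + a, by positivity, by simp only; linarith, z, hz, h.map_add a t ha.le ht z hz⟩
  map_zero := by
    rintro _ ⟨b, hb, hb0, z, hz, rfl⟩
    rw [h.localFlow_eq hb hb0 hz, zero_add]
  map_add := by
    rintro s t _ ⟨b, hb, hbs, z, hz, rfl⟩ ⟨c, hc, hct, v, hv, hcv⟩ ⟨d, hd, hdt, w, hw, hwz⟩
    simp only at hbs hct hdt hcv hwz
    rw [h.localFlow_eq hb hbs hz] at hcv
    rw [h.localFlow_eq hb hbs hz, ← hcv, h.localFlow_eq hc hct hv, ← hwz,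
      h.localFlow_eq hd hdt hw]
    -- both `z` and `w` represent the initial point, and `v` the point reached at time `s`
    rcases le_total d b with hdb | hdb
    · have h1 := h.eq_of_meet (a := d) (c := b) (t := t + s) hd.le hb.le hw hz hwz hdt.le
        (by linarith)
      have h2 := h.eq_of_meet (a := c) (c := s + b) (t := t) hc.le (by linarith) hv hz hcv hct.le
        (by linarith)
      rw [h1, h2]
      congr 1
      ring
    · have h0 : ϑ (s + d) w = ϑ c v := by
        rw [hcv]
        exact h.eq_of_meet hd.le hb.le hw hz hwz (by linarith) hbs.le
      have h2 := h.eq_of_meet (a := s + d) (c := c) (t := t) (by linarith) hc.le hw hv h0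
        (by linarith) hct.le
      rw [← h2]
      congr 1
      ring

end

/-! ### Uniform bounds on derivatives and integrals with parameters -/

open MeasureTheory

section Bounds

variable {E F : Type u} [NormedAddCommGroup E] [NormedSpace ℝ E] [NormedAddCommGroup F]
  [NormedSpace ℝ F]

lemma norm_finDiff_le_of_iteratedFDeriv {n : ℕ} (v : Fin n → E) {f : E → F} {R C : ℝ}
    (hf : ContDiffOn ℝ n f (Metric.ball 0 R))
    (hC : ∀ y, ‖y‖ < R → ‖iteratedFDeriv ℝ n f y‖ ≤ C) (x : E) (hx : ‖x‖ + ∑ i, ‖v i‖ < R) :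
    ‖finDiff n v f x‖ ≤ C * ∏ i, ‖v i‖ := by
  induction n generalizing F x with
  | zero => simpa [finDiff] using hC x (by simpa using hx)
  | succ n ih =>
    have hdd : ContDiffOn ℝ 1 f (Metric.ball 0 R) := hf.of_le (by exact_mod_cast n.succ_pos)
    have hd : ∀ y, ‖y‖ < R → DifferentiableAt ℝ f y := fun y hy =>
      (hdd.contDiffAt (Metric.isOpen_ball.mem_nhds (mem_ball_zero_iff.2 hy))).differentiableAt
        one_ne_zero
    have hf' : ContDiffOn ℝ n (fderiv ℝ f) (Metric.ball 0 R) :=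
      hf.fderiv_of_isOpen Metric.isOpen_ball (by norm_cast)
    rw [Fin.sum_univ_castSucc] at hx
    set S := ∑ i : Fin n, ‖v (Fin.castSucc i)‖ with hS
    have hbd : ∀ z ∈ Metric.ball (0 : E) (R - S),
        ‖finDiff n (Fin.init v) (fderiv ℝ f) z‖ ≤ C * ∏ i, ‖Fin.init v i‖ := fun z hz => by
      refine ih (Fin.init v) hf' (fun y hy => ?_) z ?_
      · rw [norm_iteratedFDeriv_fderiv]
        exact hC y hy
      · rw [mem_ball_zero_iff] at hz
        show ‖z‖ + S < R
        linarith
    have hder : ∀ z ∈ Metric.ball (0 : E) (R - S), HasFDerivWithinAt (finDiff n (Fin.init v) f)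
        (finDiff n (Fin.init v) (fderiv ℝ f) z) (Metric.ball (0 : E) (R - S)) z := fun z hz => by
      refine (hasFDerivAt_finDiff (𝕜 := ℝ) (Fin.init v) (R := R) hd z ?_).hasFDerivWithinAt
      rw [mem_ball_zero_iff] at hz
      show ‖z‖ + S < R
      linarith
    have h1 := (convex_ball (0 : E) (R - S)).norm_image_sub_le_of_norm_hasFDerivWithin_le
      (𝕜 := ℝ) hder hbd (x := x) (y := x + v (Fin.last n))
      (by rw [mem_ball_zero_iff]; have := norm_nonneg (v (Fin.last n)); linarith)
      (by rw [mem_ball_zero_iff]; have := norm_add_le x (v (Fin.last n)); linarith)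
    rw [add_sub_cancel_left] at h1
    refine h1.trans_eq ?_
    rw [Fin.prod_univ_castSucc, mul_assoc]
    rfl

/-- Bounds on derivatives are inherited by pointwise limits: they can be expressed by finite
differences. -/
lemma norm_iteratedFDeriv_zero_le_of_tendsto {ι : Type*} {l : Filter ι} [l.NeBot] {n : ℕ}
    {f : ι → E → F} {g : E → F} {R C : ℝ} (hR : 0 < R)
    (hf : ∀ k, ContDiffOn ℝ n (f k) (Metric.ball 0 R))
    (hC : ∀ k y, ‖y‖ < R → ‖iteratedFDeriv ℝ n (f k) y‖ ≤ C)
    (hg : ContDiffAt ℝ n g 0)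
    (hlim : ∀ y, ‖y‖ < R → Tendsto (fun k => f k y) l (𝓝 (g y))) :
    ‖iteratedFDeriv ℝ n g 0‖ ≤ C := by
  have hC0 : 0 ≤ C := by
    obtain ⟨k⟩ := l.nonempty_of_neBot
    exact (norm_nonneg _).trans (hC k 0 (by simpa using hR))
  have hfd : ∀ (m : ℕ) (v : Fin m → E) (x : E), ‖x‖ + ∑ i, ‖v i‖ < R →
      Tendsto (fun k => finDiff m v (f k) x) l (𝓝 (finDiff m v g x)) := by
    intro m
    induction m with
    | zero => exact fun v x hx => hlim x (by simpa using hx)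
    | succ m ih =>
      intro v x hx
      rw [Fin.sum_univ_castSucc] at hx
      refine (ih (Fin.init v) _ ?_).sub (ih (Fin.init v) _ ?_)
      · have := norm_add_le x (v (Fin.last m))
        simp only [Fin.init]
        linarith
      · have := norm_nonneg (v (Fin.last m))
        simp only [Fin.init]
        linarith
  refine ContinuousMultilinearMap.opNorm_le_bound hC0 fun v => ?_
  refine le_of_forall_pos_le_add fun ε hε => ?_
  obtain ⟨δ, hδ, h1⟩ := finDiff_approx (𝕜 := ℝ) n hg v hε
  set s : ℝ := 1 + ∑ i, ‖v i‖ with hs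
  have hs1 : 1 ≤ s := le_add_of_nonneg_right (Finset.sum_nonneg fun i _ => norm_nonneg _)
  obtain ⟨t, ht0, ht⟩ := exists_between (show 0 < min δ (R / s) by positivity)
  have htn : ‖t‖ = t := Real.norm_of_nonneg ht0.le
  have hcube : ‖(0 : E)‖ + ∑ i, ‖t • v i‖ < R := by
    simp only [norm_zero, zero_add, norm_smul, ← Finset.mul_sum, htn]
    calc t * ∑ i, ‖v i‖ ≤ t * s := by gcongr; linarith
      _ < R := (lt_div_iff₀ (by positivity)).1 (ht.trans_le (min_le_right _ _))
  have h2 : ‖finDiff n (fun i => t • v i) g 0‖ ≤ C * ∏ i, ‖t • v i‖ :=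
    le_of_tendsto (hfd n (fun i => t • v i) 0 hcube).norm (Eventually.of_forall fun k =>
      norm_finDiff_le_of_iteratedFDeriv _ (hf k) (hC k) 0 hcube)
  have h3 := h1 t (htn.trans_lt (ht.trans_le (min_le_left _ _))) 0 (by simpa using hδ)
  have hprod : ∏ i, ‖t • v i‖ = t ^ n * ∏ i, ‖v i‖ := by
    simp only [norm_smul, htn, Finset.prod_mul_distrib, Finset.prod_const, Finset.card_univ,
      Fintype.card_fin]
  rw [hprod] at h2
  rw [htn] at h3
  have h4 : t ^ n * ‖iteratedFDeriv ℝ n g 0 v‖ ≤ t ^ n * (C * ∏ i, ‖v i‖ + ε) := by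
    calc t ^ n * ‖iteratedFDeriv ℝ n g 0 v‖ = ‖t ^ n • iteratedFDeriv ℝ n g 0 v‖ := by
          rw [norm_smul, norm_pow, htn]
      _ = ‖finDiff n (fun i => t • v i) g 0 -
          (finDiff n (fun i => t • v i) g 0 - t ^ n • iteratedFDeriv ℝ n g 0 v)‖ := by
            rw [sub_sub_cancel]
      _ ≤ C * (t ^ n * ∏ i, ‖v i‖) + ε * t ^ n :=
          (norm_sub_le _ _).trans (add_le_add h2 h3)
      _ = _ := by ring
  exact le_of_mul_le_mul_left h4 (by positivity)

lemma norm_iteratedFDeriv_le_of_tendsto {ι : Type*} {l : Filter ι} [l.NeBot] {n : ℕ}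
    {f : ι → E → F} {g : E → F} {O : Set E} {C : ℝ} (hO : IsOpen O)
    (hf : ∀ k, ContDiffOn ℝ n (f k) O) (hC : ∀ k, ∀ y ∈ O, ‖iteratedFDeriv ℝ n (f k) y‖ ≤ C)
    (hg : ContDiffOn ℝ n g O) (hlim : ∀ y ∈ O, Tendsto (fun k => f k y) l (𝓝 (g y)))
    {x : E} (hx : x ∈ O) : ‖iteratedFDeriv ℝ n g x‖ ≤ C := by
  obtain ⟨R, hR, hRO⟩ := Metric.isOpen_iff.1 hO x hx
  have hmem : ∀ y, ‖y‖ < R → x + y ∈ O := fun y hy => hRO (by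
    rwa [mem_ball_iff_norm, add_sub_cancel_left])
  have htr : ∀ h : E → F, ∀ y, iteratedFDeriv ℝ n (fun y => h (x + y)) y =
      iteratedFDeriv ℝ n h (x + y) := fun h y => iteratedFDeriv_comp_add_left n x y
  have := norm_iteratedFDeriv_zero_le_of_tendsto (l := l) (f := fun k y => f k (x + y))
    (g := fun y => g (x + y)) (n := n) hR (C := C) (fun k => ?_) (fun k y hy => ?_) ?_
    fun y hy => hlim _ (hmem y hy)
  · simpa only [htr, add_zero] using this
  · exact (hf k).comp (contDiff_const.add contDiff_id).contDiffOn
      fun y hy => hmem y (mem_ball_zero_iff.1 hy)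
  · rw [htr]
    exact hC k _ (hmem y hy)
  · refine ContDiffAt.comp (0 : E) (g := g) ?_ (contDiff_const.add contDiff_id).contDiffAt
    simpa using hg.contDiffAt (hO.mem_nhds hx)

/-- Baire's theorem: a family of smooth maps that depends continuously on `t`, in the pointwise
sense, has uniformly bounded derivatives for `t` in some interval. -/
theorem exists_interval_bound [FiniteDimensional ℝ E] {n : ℕ} {f : ℝ → E → F} {P : Set E}
    (hP : IsOpen P) {a b : ℝ} (hab : a < b) (hf : ∀ t ∈ Icc a b, ContDiffOn ℝ n (f t) P)
    (hc : ∀ y ∈ P, ContinuousOn (fun t => f t y) (Icc a b)) {y0 : E} {R : ℝ}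
    (hR : Metric.closedBall y0 R ⊆ P) :
    ∃ c d, a < c ∧ c < d ∧ d < b ∧ ∃ C : ℝ, ∀ t ∈ Icc c d, ∀ i ≤ n, ∀ y ∈ Metric.ball y0 R,
      ‖iteratedFDeriv ℝ i (f t) y‖ ≤ C := by
  set K : ℕ → Set ℝ := fun m => {t | t ∈ Icc a b ∧ ∀ i ≤ n, ∀ y ∈ Metric.ball y0 R,
    ‖iteratedFDeriv ℝ i (f t) y‖ ≤ m} with hK
  have hBP : Metric.ball y0 R ⊆ P := Metric.ball_subset_closedBall.trans hR
  have hfi : ∀ t ∈ Icc a b, ∀ i ≤ n, ContDiffOn ℝ i (f t) (Metric.ball y0 R) :=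
    fun t ht i hi => ((hf t ht).mono hBP).of_le (by exact_mod_cast hi)
  have hKc : ∀ m, IsClosed (K m) := by
    intro m
    refine IsSeqClosed.isClosed fun t t' ht htt' => ?_
    have ht'm : t' ∈ Icc a b := isClosed_Icc.mem_of_tendsto htt'
      (Eventually.of_forall fun k => (ht k).1)
    refine ⟨ht'm, fun i hi y hy => ?_⟩
    refine norm_iteratedFDeriv_le_of_tendsto (l := atTop) (f := fun k => f (t k)) (g := f t')
      Metric.isOpen_ball (fun k => hfi _ (ht k).1 i hi) (fun k y hy => (ht k).2 i hi y hy)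
      (hfi _ ht'm i hi) (fun y hy => ?_) hy
    exact ((hc y (hBP hy)) t' ht'm).tendsto.comp (tendsto_nhdsWithin_iff.2
      ⟨htt', Eventually.of_forall fun k => (ht k).1⟩)
  have hcover : ∀ t ∈ Icc a b, ∃ m, t ∈ K m := by
    intro t ht
    have h1 : ∀ i, i ≤ n → ∃ C : ℝ, ∀ y ∈ Metric.closedBall y0 R,
        ‖iteratedFDeriv ℝ i (f t) y‖ ≤ C := fun i hi =>
      (isCompact_closedBall y0 R).exists_bound_of_continuousOn
        fun y hy => (((hf t ht).contDiffAt (hP.mem_nhds (hR hy))).continuousAt_iteratedFDeriv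
          (by exact_mod_cast hi)).continuousWithinAt
    choose! C hC using h1
    obtain ⟨m, hm⟩ := exists_nat_ge (∑ i ∈ Finset.range (n + 1), |C i|)
    refine ⟨m, ht, fun i hi y hy => ?_⟩
    refine (hC i hi y (Metric.ball_subset_closedBall hy)).trans ((le_abs_self _).trans
      (le_trans ?_ hm))
    exact Finset.single_le_sum (f := fun i => |C i|) (fun i _ => abs_nonneg _)
      (Finset.mem_range.2 (by omega))
  have hdense := IsGδ.univ.dense_iUnion_interior_of_closed dense_univ
    (f := fun m => (Ioo a b)ᶜ ∪ K m) (fun m => isOpen_Ioo.isClosed_compl.union (hKc m))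
    fun t _ => by
      by_cases ht : t ∈ Ioo a b
      · obtain ⟨m, hm⟩ := hcover t (Ioo_subset_Icc_self ht)
        exact mem_iUnion.2 ⟨m, Or.inr hm⟩
      · exact mem_iUnion.2 ⟨0, Or.inl ht⟩
  obtain ⟨t, htab, ht⟩ := hdense.exists_mem_open isOpen_Ioo (nonempty_Ioo.2 hab)
  obtain ⟨m, hm⟩ := mem_iUnion.1 htab
  obtain ⟨δ, hδ, hball⟩ := Metric.isOpen_iff.1 (isOpen_interior.inter isOpen_Ioo) t ⟨hm, ht⟩
  have hin : ∀ s ∈ Icc (t - δ / 2) (t + δ / 2), s ∈ Ioo a b ∧ s ∈ K m := by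
    intro s hs
    have h1 := hball (show s ∈ Metric.ball t δ by
      rw [Real.ball_eq_Ioo]; exact ⟨by linarith [hs.1], by linarith [hs.2]⟩)
    exact ⟨h1.2, (interior_subset h1.1).resolve_left fun h => h h1.2⟩
  refine ⟨t - δ / 2, t + δ / 2, (hin _ ⟨le_rfl, by linarith⟩).1.1, by linarith,
    (hin _ ⟨by linarith, le_rfl⟩).1.2, m, fun s hs => (hin s hs).2.2⟩

end Bounds

section Integral

variable {α : Type*} [MeasurableSpace α] {μ : Measure α} {W F : Type u} [NormedAddCommGroup W]
  [NormedSpace ℝ W] [FiniteDimensional ℝ W] [NormedAddCommGroup F] [NormedSpace ℝ F]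

lemma aestronglyMeasurable_fderiv {K : α → W → F} {Ω : Set W} (hΩ : IsOpen Ω) {T : Set α}
    (hT : ∀ᵐ s ∂μ, s ∈ T) (hd : ∀ s ∈ T, ∀ z ∈ Ω, DifferentiableAt ℝ (K s) z)
    (hm : ∀ z ∈ Ω, AEStronglyMeasurable (fun s => K s z) μ) {z : W} (hz : z ∈ Ω) :
    AEStronglyMeasurable (fun s => fderiv ℝ (K s) z) μ := by
  have hv : ∀ v, AEStronglyMeasurable (fun s => fderiv ℝ (K s) z v) μ := by
    intro v
    have hline : Tendsto (fun h : ℝ => z + h • v) (𝓝[≠] 0) (𝓝 z) := by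
      have : Continuous fun h : ℝ => z + h • v := by fun_prop
      exact (this.tendsto' 0 z (by simp)).mono_left nhdsWithin_le_nhds
    have h0 : ∀ᶠ h : ℝ in 𝓝[≠] 0, z + h • v ∈ Ω := hline.eventually (hΩ.mem_nhds hz)
    obtain ⟨h, hh, hlim⟩ : ∃ h : ℕ → ℝ, (∀ k, z + h k • v ∈ Ω) ∧ Tendsto h atTop (𝓝[≠] 0) := by
      obtain ⟨h, hh⟩ := exists_seq_tendsto (𝓝[≠] (0 : ℝ))
      obtain ⟨N, hN⟩ := eventually_atTop.1 (hh.eventually h0)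
      exact ⟨fun k => h (k + N), fun k => hN _ (by omega),
        hh.comp (tendsto_add_atTop_nat N)⟩
    refine aestronglyMeasurable_of_tendsto_ae atTop
      (f := fun k s => (h k)⁻¹ • (K s (z + h k • v) - K s z))
      (fun k => ((hm _ (hh k)).sub (hm z hz)).const_smul _) ?_
    filter_upwards [hT] with s hs
    have h1 : HasLineDerivAt ℝ (K s) (fderiv ℝ (K s) z v) z v :=
      (hd s hs z hz).hasFDerivAt.hasLineDerivAt v
    exact h1.tendsto_slope_zero.comp hlim
  set b := Module.finBasis ℝ W
  have hsum : ∀ L : W →L[ℝ] F, L = ∑ i, ContinuousLinearMap.smulRightL ℝ W F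
      (LinearMap.toContinuousLinearMap (b.coord i)) (L (b i)) := by
    intro L
    ext w
    have := congrArg L (b.sum_repr w)
    rw [map_sum] at this
    simpa [sum_apply] using this.symm
  have : (fun s => fderiv ℝ (K s) z) = fun s => ∑ i, ContinuousLinearMap.smulRightL ℝ W F
      (LinearMap.toContinuousLinearMap (b.coord i)) (fderiv ℝ (K s) z (b i)) :=
    funext fun s => hsum _
  rw [this]
  refine Finset.aestronglyMeasurable_fun_sum _ fun i _ => ?_
  exact (ContinuousLinearMap.continuous _).comp_aestronglyMeasurable (hv (b i))

/-- Differentiation under the integral sign, for finitely many derivatives. -/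
theorem contDiffOn_integral [IsFiniteMeasure μ] {n : ℕ} {K : α → W → F} {Ω : Set W}
    (hΩ : IsOpen Ω) {T : Set α} (hT : ∀ᵐ s ∂μ, s ∈ T) (hC : ∀ s ∈ T, ContDiffOn ℝ n (K s) Ω)
    (hb : ∀ i ≤ n, ∃ C : ℝ, ∀ s ∈ T, ∀ z ∈ Ω, ‖iteratedFDeriv ℝ i (K s) z‖ ≤ C)
    (hm : ∀ z ∈ Ω, AEStronglyMeasurable (fun s => K s z) μ) :
    ContDiffOn ℝ n (fun z => ∫ s, K s z ∂μ) Ω := by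
  induction n generalizing F with
  | zero =>
    obtain ⟨C, hC'⟩ := hb 0 le_rfl
    rw [Nat.cast_zero, contDiffOn_zero]
    refine continuousOn_of_dominated (bound := fun _ => C) hm (fun z hz => ?_)
      (integrable_const C) ?_
    · filter_upwards [hT] with s hs
      simpa using hC' s hs z hz
    · filter_upwards [hT] with s hs using (hC s hs).continuousOn
  | succ n ih =>
    have hd : ∀ s ∈ T, ∀ z ∈ Ω, DifferentiableAt ℝ (K s) z := fun s hs z hz =>
      ((hC s hs).contDiffAt (hΩ.mem_nhds hz)).differentiableAt (by simp)
    have hm' : ∀ z ∈ Ω, AEStronglyMeasurable (fun s => fderiv ℝ (K s) z) μ := fun z hz =>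
      aestronglyMeasurable_fderiv hΩ hT hd hm hz
    obtain ⟨C0, hC0⟩ := hb 0 (Nat.zero_le _)
    obtain ⟨C1, hC1⟩ := hb 1 (by omega)
    have hder : ∀ z ∈ Ω,
        HasFDerivAt (fun z => ∫ s, K s z ∂μ) (∫ s, fderiv ℝ (K s) z ∂μ) z := by
      intro z hz
      refine hasFDerivAt_integral_of_dominated_of_fderiv_le (𝕜 := ℝ) (hΩ.mem_nhds hz)
        (F := fun z s => K s z) (F' := fun z s => fderiv ℝ (K s) z) (bound := fun _ => C1)
        (by filter_upwards [hΩ.mem_nhds hz] with w hw using hm w hw) ?_ (hm' z hz) ?_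
        (integrable_const C1) ?_
      · refine Integrable.of_bound (hm z hz) C0 ?_
        filter_upwards [hT] with s hs
        simpa using hC0 s hs z hz
      · filter_upwards [hT] with s hs w hw
        have := hC1 s hs w hw
        rwa [norm_iteratedFDeriv_one] at this
      · filter_upwards [hT] with s hs w hw using (hd s hs w hw).hasFDerivAt
    rw [Nat.cast_succ, contDiffOn_succ_iff_fderiv_of_isOpen hΩ]
    refine ⟨fun z hz => (hder z hz).differentiableAt.differentiableWithinAt,
      fun h => absurd h (natCast_ne_omega n), ?_⟩
    refine (ih (K := fun s => fderiv ℝ (K s)) (fun s hs => ?_) (fun i hi => ?_) hm').congr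
      fun z hz => (hder z hz).fderiv
    · exact (hC s hs).fderiv_of_isOpen hΩ (by norm_cast)
    · obtain ⟨C, hC'⟩ := hb (i + 1) (by omega)
      exact ⟨C, fun s hs z hz => by rw [norm_iteratedFDeriv_fderiv]; exact hC' s hs z hz⟩

end Integral

/-! ### Joint smoothness of finite dimensional semiflows -/

section Average

variable {Z : Type u} [NormedAddCommGroup Z] [NormedSpace ℝ Z] [FiniteDimensional ℝ Z]

/-- Time averages with a smooth weight are jointly smooth. -/
theorem contDiffOn_timeAverage {n : ℕ} {f : ℝ → Z → Z} {B : Set Z} (hB : IsOpen B) {c d C : ℝ}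
    {χ : ℝ → ℝ} (hχ : ContDiff ℝ n χ) (hχc : HasCompactSupport χ)
    (hf : ∀ s ∈ Icc c d, ContDiffOn ℝ n (f s) B)
    (hC : ∀ s ∈ Icc c d, ∀ i ≤ n, ∀ y ∈ B, ‖iteratedFDeriv ℝ i (f s) y‖ ≤ C)
    (hc : ∀ y ∈ B, ContinuousOn (fun s => f s y) (Icc c d)) :
    ContDiffOn ℝ n (fun p : ℝ × Z => ∫ s in Icc c d, χ (s - p.1) • f s p.2)
      ((univ : Set ℝ) ×ˢ B) := by
  have hΩ : IsOpen ((univ : Set ℝ) ×ˢ B) := isOpen_univ.prod hB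
  have hX : ∀ s, ContDiff ℝ n fun p : ℝ × Z => χ (s - p.1) := fun s =>
    hχ.comp (contDiff_const.sub contDiff_fst)
  have hY : ∀ s ∈ Icc c d, ContDiffOn ℝ n (fun p : ℝ × Z => f s p.2) ((univ : Set ℝ) ×ˢ B) :=
    fun s hs => (hf s hs).comp contDiff_snd.contDiffOn fun p hp => hp.2
  refine contDiffOn_integral hΩ (T := Icc c d) (ae_restrict_mem measurableSet_Icc)
    (fun s hs => (hX s).contDiffOn.smul (hY s hs)) (fun i hi => ?_) fun p hp => ?_
  · have h1 : ∀ k, k ≤ n → ∃ D : ℝ, ∀ s, ∀ p : ℝ × Z,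
        ‖iteratedFDeriv ℝ k (fun p : ℝ × Z => χ (s - p.1)) p‖ ≤ D := by
      intro k hk
      have hk' : (k : WithTop ℕ∞) ≤ n := by exact_mod_cast hk
      obtain ⟨D, hD⟩ := (hχc.iteratedFDeriv (𝕜 := ℝ) k).exists_bound_of_continuous
        (hχ.continuous_iteratedFDeriv hk')
      set L : ℝ × Z →L[ℝ] ℝ := -ContinuousLinearMap.fst ℝ ℝ Z with hL
      refine ⟨D * ‖L‖ ^ k, fun s p => ?_⟩
      have h2 : iteratedFDeriv ℝ k (fun q : ℝ × Z => χ (s - q.1)) p =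
          (iteratedFDeriv ℝ k (fun u => χ (s + u)) (L p)).compContinuousLinearMap fun _ => L :=
        L.iteratedFDeriv_comp_right (n := n) (f := fun u => χ (s + u))
          (hχ.comp (contDiff_const.add contDiff_id)) p hk'
      rw [h2]
      refine (ContinuousMultilinearMap.norm_compContinuousLinearMap_le _ _).trans ?_
      rw [Finset.prod_const, Finset.card_univ, Fintype.card_fin,
        iteratedFDeriv_comp_add_left]
      gcongr
      exact hD _
    choose! D hD using h1
    refine ⟨∑ k ∈ Finset.range (i + 1), (i.choose k : ℝ) * |D k| *
      (|C| * ‖ContinuousLinearMap.snd ℝ ℝ Z‖ ^ (i - k)), fun s hs p hp => ?_⟩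
    have h3 := norm_iteratedFDerivWithin_smul_le (𝕜 := ℝ) (hX s).contDiffOn (hY s hs)
      hΩ.uniqueDiffOn hp (n := i) (by exact_mod_cast hi)
    simp only [iteratedFDerivWithin_of_isOpen _ hΩ hp] at h3
    refine h3.trans (Finset.sum_le_sum fun k hk => ?_)
    rw [Finset.mem_range] at hk
    gcongr
    · exact (hD k (by omega) s p).trans (le_abs_self _)
    · have h4 := iteratedFDeriv_comp_clm (ContinuousLinearMap.snd ℝ ℝ Z) (f := f s) (n := n)
        (x := p) ((hf s hs).contDiffAt (hB.mem_nhds hp.2)) (i := i - k) (by omega)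
      refine (congrArg norm h4).trans_le ?_
      refine (ContinuousMultilinearMap.norm_compContinuousLinearMap_le _ _).trans ?_
      rw [Finset.prod_const, Finset.card_univ, Fintype.card_fin]
      gcongr
      exact (hC s hs _ (by omega) _ hp.2).trans (le_abs_self _)
  · refine ContinuousOn.aestronglyMeasurable ?_ measurableSet_Icc
    exact (hχ.continuous.comp (continuous_id.sub continuous_const)).continuousOn.smul (hc _ hp.2)

end Average

section Joint

variable {Z : Type u} [NormedAddCommGroup Z] [NormedSpace ℝ Z] [FiniteDimensional ℝ Z]

/-- Near `(0, y₀)`, a semiflow of `C^n` maps is jointly `C^n` for `t > 0`: a time average `I` of the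
semiflow is a local diffeomorphism, and `I ∘ ϑ_t` is the same average over a shifted time window,
which depends smoothly on `t`. -/
theorem exists_contDiffOn_joint {n : ℕ} (hn : n ≠ 0) {ϑ : ℝ → Z → Z} {P : Set Z}
    (hP : IsOpen P) (h0 : ∀ y ∈ P, ϑ 0 y = y)
    (hadd : ∀ s t, 0 ≤ s → 0 ≤ t → ∀ y ∈ P, ϑ (t + s) y = ϑ t (ϑ s y))
    (hs : ∀ t, 0 ≤ t → ContDiffOn ℝ n (ϑ t) P)
    (hc : ∀ y ∈ P, ContinuousOn (fun t => ϑ t y) (Ici 0)) {t0 : ℝ} (ht0 : 0 < t0)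
    (hcl : ∀ t ∈ Icc 0 t0, ∀ y ∈ P, ‖fderiv ℝ (ϑ t) y - ContinuousLinearMap.id ℝ Z‖ ≤ 1 / 2)
    {y0 : Z} (hy0 : y0 ∈ P) :
    ∃ w > 0, ∃ δ > 0, Metric.ball y0 δ ⊆ P ∧
      ContDiffOn ℝ n (fun p : ℝ × Z => ϑ p.1 p.2) (Ioo 0 w ×ˢ Metric.ball y0 δ) := by
  have hcs : CompleteSpace Z := FiniteDimensional.complete ℝ Z
  obtain ⟨R, hR, hRP⟩ := Metric.nhds_basis_closedBall.mem_iff.1 (hP.mem_nhds hy0)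
  set B := Metric.ball y0 R with hB
  have hBP : B ⊆ P := Metric.ball_subset_closedBall.trans hRP
  have hBo : IsOpen B := Metric.isOpen_ball
  obtain ⟨c, d, hc0, hcd, hdt, C, hC⟩ := exists_interval_bound (n := n) (f := ϑ) hP ht0
    (fun t ht => hs t ht.1) (fun y hy => (hc y hy).mono Icc_subset_Ici_self) hRP
  set w := (d - c) / 4 with hw
  have hw0 : 0 < w := by rw [hw]; linarith
  let b : ContDiffBump ((c + d) / 2) := ⟨w / 2, w, by linarith, by linarith⟩
  set χ : ℝ → ℝ := b.normed volume with hχ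
  have hχs : ContDiff ℝ n χ := by exact_mod_cast b.contDiff_normed (n := (n : ℕ∞))
  have hχ0 : ∀ u, χ u ≠ 0 → u ∈ Ioo (c + w) (d - w) := by
    intro u hu
    have h1 : u ∈ Function.support χ := hu
    rw [hχ, b.support_normed_eq, Real.ball_eq_Ioo] at h1
    have h2 : (c + d) / 2 - w < u ∧ u < (c + d) / 2 + w := h1
    rw [hw] at h2 ⊢
    exact ⟨by linarith [h2.1], by linarith [h2.2]⟩
  -- the time window may be shifted by less than `w`
  have hwin : ∀ t y, |t| < w → ∫ s in Icc c d, χ (s - t) • ϑ s y = ∫ s, χ (s - t) • ϑ s y := by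
    intro t y ht
    refine setIntegral_eq_integral_of_forall_compl_eq_zero fun s hs => ?_
    by_contra h
    have h1 := hχ0 _ (left_ne_zero_of_smul h)
    rw [abs_lt] at ht
    exact hs ⟨by linarith [h1.1], by linarith [h1.2]⟩
  set I : Z → Z := fun y => ∫ s in Icc c d, χ (s - 0) • ϑ s y with hI
  have hJ := contDiffOn_timeAverage (f := ϑ) hBo hχs b.hasCompactSupport_normed
    (fun s hs' => (hs s (hc0.le.trans hs'.1)).mono hBP) hC
    (fun y hy => (hc y (hBP hy)).mono fun s hs' => hc0.le.trans hs'.1)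
  have hIs : ContDiffOn ℝ n I B :=
    hJ.comp (g := fun p : ℝ × Z => ∫ s in Icc c d, χ (s - p.1) • ϑ s p.2)
      (f := fun y => ((0 : ℝ), y)) (contDiff_const.prodMk contDiff_id).contDiffOn
      fun y hy => ⟨mem_univ _, hy⟩
  have hshift : ∀ t y, 0 ≤ t → t < w → y ∈ P →
      ∫ s in Icc c d, χ (s - t) • ϑ s y = I (ϑ t y) := by
    intro t y ht htw hy
    rw [hwin t y (by rwa [abs_of_nonneg ht]), hI]
    simp only
    rw [hwin 0 (ϑ t y) (by simpa using hw0),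
      ← integral_add_right_eq_self (μ := volume) (fun s => χ (s - t) • ϑ s y) t]
    refine integral_congr_ae (Eventually.of_forall fun s => ?_)
    simp only [add_sub_cancel_right, sub_zero]
    by_cases h : χ s = 0
    · simp [h]
    · rw [hadd t s ht (by linarith [(hχ0 s h).1]) y hy]
  -- `ϑ_t - id` is Lipschitz with constant `1 / 2` for small `t`
  have hlip : ∀ t ∈ Icc 0 t0, ∀ y ∈ B, ∀ y' ∈ B,
      ‖ϑ t y' - y' - (ϑ t y - y)‖ ≤ 1 / 2 * ‖y' - y‖ := by
    intro t ht y hy y' hy'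
    refine (convex_ball y0 R).norm_image_sub_le_of_norm_hasFDerivWithin_le (𝕜 := ℝ)
      (f := fun y => ϑ t y - y)
      (f' := fun y => fderiv ℝ (ϑ t) y - ContinuousLinearMap.id ℝ Z) (fun z hz => ?_)
      (fun z hz => hcl t ht z (hBP hz)) hy hy'
    refine HasFDerivAt.hasFDerivWithinAt (HasFDerivAt.fun_sub ?_ (hasFDerivAt_id z))
    exact (((hs t ht.1).contDiffAt (hP.mem_nhds (hBP hz))).differentiableAt
      (by exact_mod_cast hn)).hasFDerivAt
  have hint : ∀ y ∈ B, Integrable (fun s => χ (s - 0) • ϑ s y) (volume.restrict (Icc c d)) := by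
    intro y hy
    refine ContinuousOn.integrableOn_Icc ?_
    exact (hχs.continuous.comp (continuous_id.sub continuous_const)).continuousOn.smul
      ((hc _ (hBP hy)).mono fun s hs' => hc0.le.trans hs'.1)
  have hmass : ∀ z : Z, ∫ s in Icc c d, χ (s - 0) • z = z := by
    intro z
    rw [setIntegral_eq_integral_of_forall_compl_eq_zero fun s hs => ?_]
    · simpa using b.integral_normed_smul volume z
    · by_contra h
      have h1 := hχ0 _ (left_ne_zero_of_smul h)
      rw [sub_zero] at h1
      exact hs ⟨by linarith [h1.1], by linarith [h1.2]⟩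
  have hintc : ∀ z : Z, Integrable (fun s => χ (s - 0) • z) (volume.restrict (Icc c d)) := by
    intro z
    refine ContinuousOn.integrableOn_Icc ?_
    exact (hχs.continuous.comp (continuous_id.sub continuous_const)).continuousOn.smul
      continuousOn_const
  have hIlip : ∀ y ∈ B, ∀ y' ∈ B, ‖I y' - y' - (I y - y)‖ ≤ 1 / 2 * ‖y' - y‖ := by
    intro y hy y' hy'
    have h1 : I y' - y' - (I y - y) =
        ∫ s in Icc c d, χ (s - 0) • (ϑ s y' - y' - (ϑ s y - y)) := by
      simp only [smul_sub]
      have i1 := hint y hy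
      have i2 := hint y' hy'
      have i3 := hintc y
      have i4 := hintc y'
      have e1 := integral_sub (i2.sub i4) (i1.sub i3)
      simp only [Pi.sub_apply] at e1
      rw [e1, integral_sub i2 i4, integral_sub i1 i3,
        hmass, hmass]
    have h2 : ∫ s in Icc c d, χ (s - 0) = 1 := by
      rw [setIntegral_eq_integral_of_forall_compl_eq_zero fun s hs => ?_]
      · simpa using b.integral_normed (μ := volume)
      · by_contra h
        have h1 := hχ0 _ h
        rw [sub_zero] at h1
        exact hs ⟨by linarith [h1.1], by linarith [h1.2]⟩
    rw [h1]
    calc ‖∫ s in Icc c d, χ (s - 0) • (ϑ s y' - y' - (ϑ s y - y))‖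
        ≤ ∫ s in Icc c d, χ (s - 0) * (1 / 2 * ‖y' - y‖) := by
          refine norm_integral_le_of_norm_le ?_ ?_
          · refine ContinuousOn.integrableOn_Icc ?_
            exact ((hχs.continuous.comp (continuous_id.sub continuous_const)).mul
              continuous_const).continuousOn
          · filter_upwards [ae_restrict_mem measurableSet_Icc] with s hs'
            have hp : 0 ≤ χ (s - 0) := b.nonneg_normed _
            rw [norm_smul, Real.norm_of_nonneg hp]
            gcongr
            exact hlip s ⟨hc0.le.trans hs'.1, hs'.2.trans hdt.le⟩ y hy y' hy'
      _ = 1 / 2 * ‖y' - y‖ := by rw [integral_mul_const, h2, one_mul]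
  have hinj : InjOn I B := by
    intro y hy y' hy' he
    have h1 := hIlip y hy y' hy'
    rw [he, sub_sub_sub_cancel_left, norm_sub_rev] at h1
    have : ‖y' - y‖ ≤ 0 := by linarith
    exact (sub_eq_zero.1 (norm_le_zero_iff.1 this)).symm
  have hg : ∀ y ∈ B, ContDiffAt ℝ n (Function.invFunOn I B) (I y) := by
    intro y hy
    have hIa : ContDiffAt ℝ n I y := hIs.contDiffAt (hBo.mem_nhds hy)
    have hId : HasFDerivAt I (fderiv ℝ I y) y :=
      (hIa.differentiableAt (by exact_mod_cast hn)).hasFDerivAt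
    have h1 : ‖fderiv ℝ I y - ContinuousLinearMap.id ℝ Z‖ ≤ 1 / 2 := by
      refine (hId.fun_sub (hasFDerivAt_id y)).le_of_lip' (by norm_num) ?_
      filter_upwards [hBo.mem_nhds hy] with y' hy' using hIlip y hy y' hy'
    obtain ⟨e, he, -⟩ := exists_equiv_of_close (𝕜 := ℝ) (a := ContinuousLinearEquiv.refl ℝ Z)
      (L := fderiv ℝ I y) one_pos ContinuousLinearMap.norm_id_le (by simpa using h1)
    rw [he] at hId
    refine (contDiffAt_of_leftInverse (by exact_mod_cast hn) hIa hId ?_).1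
    filter_upwards [hBo.mem_nhds hy] with z hz using hinj.leftInvOn_invFunOn hz
  -- for small times, `ϑ_t` stays in the ball on which `I` is injective
  obtain ⟨w1, hw1, hcw⟩ : ∃ w1 > 0, ∀ t, 0 ≤ t → t < w1 → ‖ϑ t y0 - y0‖ < R / 2 := by
    have h1 := (hc y0 hy0 0 self_mem_Ici).tendsto
    rw [h0 y0 hy0] at h1
    obtain ⟨w1, hw1, h2⟩ := Metric.mem_nhdsWithin_iff.1
      (h1 (Metric.ball_mem_nhds y0 (half_pos hR)))
    refine ⟨w1, hw1, fun t ht htw => ?_⟩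
    have := h2 (show t ∈ Metric.ball 0 w1 ∩ Ici 0 from
      ⟨by rwa [mem_ball_zero_iff, Real.norm_of_nonneg ht], ht⟩)
    exact mem_ball_iff_norm.1 this
  refine ⟨min (min w w1) t0, by positivity, R / 4, by positivity,
    (Metric.ball_subset_ball (by linarith)).trans hBP, ?_⟩
  have hstay : ∀ t y, 0 < t → t < min (min w w1) t0 → y ∈ Metric.ball y0 (R / 4) →
      ϑ t y ∈ B := by
    intro t y ht htw hy
    rw [lt_min_iff, lt_min_iff] at htw
    have hyB : y ∈ B := Metric.ball_subset_ball (by linarith) hy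
    have h1 := hlip t ⟨ht.le, htw.2.le⟩ y0 (Metric.mem_ball_self hR) y hyB
    have h2 := hcw t ht.le htw.1.2
    rw [mem_ball_iff_norm] at hy ⊢
    calc ‖ϑ t y - y0‖ = ‖(ϑ t y - y - (ϑ t y0 - y0)) + (y - y0) + (ϑ t y0 - y0)‖ := by
          congr 1; abel
      _ ≤ ‖ϑ t y - y - (ϑ t y0 - y0)‖ + ‖y - y0‖ + ‖ϑ t y0 - y0‖ := norm_add₃_le
      _ < R := by linarith
  have heq : ∀ p ∈ Ioo 0 (min (min w w1) t0) ×ˢ Metric.ball y0 (R / 4), ϑ p.1 p.2 =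
      Function.invFunOn I B (∫ s in Icc c d, χ (s - p.1) • ϑ s p.2) := by
    rintro ⟨t, y⟩ ⟨ht, hy⟩
    rw [hshift t y ht.1.le (ht.2.trans_le ((min_le_left _ _).trans (min_le_left _ _)))
      (hBP (Metric.ball_subset_ball (by linarith) hy))]
    exact (hinj.leftInvOn_invFunOn (hstay t y ht.1 ht.2 hy)).symm
  refine ContDiffOn.congr (fun p hp => ContDiffAt.contDiffWithinAt ?_) heq
  obtain ⟨t, y⟩ := p
  have hy' : y ∈ B := Metric.ball_subset_ball (by linarith) hp.2
  refine ContDiffAt.comp (t, y) (g := Function.invFunOn I B) ?_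
    (hJ.contDiffAt ((isOpen_univ.prod hBo).mem_nhds ⟨mem_univ _, hy'⟩))
  have h5 := hg _ (hstay t y hp.1.1 hp.1.2 hp.2)
  rwa [← hshift t y hp.1.1.le
    (hp.1.2.trans_le ((min_le_left _ _).trans (min_le_left _ _))) (hBP hy')] at h5

/-- A continuous semiflow of `C^n` maps on a finite dimensional space is jointly `C^n`. -/
theorem contDiffOn_joint {n : ℕ} (hn : n ≠ 0) {ϑ : ℝ → Z → Z} {P : Set Z}
    (hP : IsOpen P) (h0 : ∀ y ∈ P, ϑ 0 y = y)
    (hadd : ∀ s t, 0 ≤ s → 0 ≤ t → ∀ y ∈ P, ϑ (t + s) y = ϑ t (ϑ s y))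
    (hinv : ∀ t, 0 ≤ t → MapsTo (ϑ t) P P)
    (hs : ∀ t, 0 ≤ t → ContDiffOn ℝ n (ϑ t) P)
    (hc : ∀ y ∈ P, ContinuousOn (fun t => ϑ t y) (Ici 0)) {t0 : ℝ} (ht0 : 0 < t0)
    (hcl : ∀ t ∈ Icc 0 t0, ∀ y ∈ P, ‖fderiv ℝ (ϑ t) y - ContinuousLinearMap.id ℝ Z‖ ≤ 1 / 2) :
    ContDiffOn ℝ n (fun p : ℝ × Z => ϑ p.1 p.2) (Ioi 0 ×ˢ P) := by
  rintro ⟨t, y⟩ ⟨ht, hy⟩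
  rw [mem_Ioi] at ht
  obtain ⟨w, hw, δ, hδ, hδP, h1⟩ := exists_contDiffOn_joint hn hP h0 hadd hs hc ht0 hcl hy
  obtain ⟨u, hu0, hu⟩ := exists_between (lt_min hw ht)
  rw [lt_min_iff] at hu
  have hb : 0 ≤ t - u := by linarith
  set Ω := Ioo (t - u) (t - u + w) ×ˢ Metric.ball y δ with hΩ
  have hΩo : IsOpen Ω := isOpen_Ioo.prod Metric.isOpen_ball
  have hmem : (t, y) ∈ Ω := ⟨⟨by simpa using hu0, by simp only; linarith [hu.1]⟩,
    Metric.mem_ball_self hδ⟩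
  have h2 : ContDiffOn ℝ n (fun p : ℝ × Z => ϑ (p.1 - (t - u)) p.2) Ω :=
    h1.comp (g := fun p : ℝ × Z => ϑ p.1 p.2) (f := fun p : ℝ × Z => (p.1 - (t - u), p.2))
      ((contDiff_fst.sub contDiff_const).prodMk contDiff_snd).contDiffOn
      fun p hp => ⟨⟨by simpa using hp.1.1, by have := hp.1.2; simp only; linarith⟩, hp.2⟩
  have h3 : ContDiffOn ℝ n (fun p : ℝ × Z => ϑ (t - u) (ϑ (p.1 - (t - u)) p.2)) Ω :=
    (hs _ hb).comp h2 fun p hp => hinv _ (by linarith [hp.1.1]) (hδP hp.2)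
  have h4 : ContDiffOn ℝ n (fun p : ℝ × Z => ϑ p.1 p.2) Ω := by
    refine h3.congr fun p hp => ?_
    rw [← hadd _ _ (by linarith [hp.1.1]) hb _ (hδP hp.2)]
    congr 1
    ring
  exact (h4.contDiffAt (hΩo.mem_nhds hmem)).contDiffWithinAt

end Joint

/-! ### The fibration and the reduced semiflow -/

variable {𝕜 : Type*} [RCLike 𝕜] {X : Type u} [NormedAddCommGroup X]
  [NormedSpace 𝕜 X] {X0 X1 : Submodule 𝕜 X} {r : WithTop ℕ∞}

/-- The linear conditions under which `X₀` is a slow direction of the contraction `A`: its diagonal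
block `e` is invertible, `e⁻¹` is dominated by `A^{ℓ+1}`, and there are no resonances of order `≤ ℓ`
between `X₀` and the terms that involve the fast directions `X₁`. -/
structure SlowSplitting (hX : X0.IsTopCompl X1) (A : X →L[𝕜] X) (e : X0 ≃L[𝕜] X0) (ℓ : ℕ) :
    Prop where
  invariant : ∀ x ∈ X1, A x ∈ X1
  block : (e : X0 →L[𝕜] X0) = diagBlock hX A
  decay : Tendsto (fun n => ‖A ^ n‖) atTop (𝓝 0)
  gap : Tendsto (fun n => ‖(e.symm : X0 →L[𝕜] X0) ^ n‖ * ‖A ^ n‖ ^ (ℓ + 1)) atTop (𝓝 0)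
  nonresonant : ∀ n, 2 ≤ n → n ≤ ℓ → BlockNonresonant hX A (diagBlock hX A) n 1

/-- A map `π` whose fibres are permuted by `φ_τ`, inducing the map `h` on the base `X₀`, together
with a section `s` of `π` with values in `X₀`. -/
structure IsSlowFibration (hX : X0.IsTopCompl X1) (r : WithTop ℕ∞) (φ : ℝ → X → X) (τ : ℝ)
    (π : X → X0) (h s : X0 → X0) (ρ δ : ℝ) : Prop where
  pos : 0 < δ
  smooth : CbNat 𝕜 r π (Metric.ball 0 ρ)
  map_zero : π 0 = 0
  hasFDerivAt : HasFDerivAt π (X0.projectionOntoL X1 hX) 0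
  transverse : ∀ x, ‖x‖ < ρ → ∃ C : X0 ≃L[𝕜] X0, (fderiv 𝕜 π x) ∘L X0.subtypeL = C
  injective : ∃ B, InjOn h B ∧ ∀ x, ‖x‖ < ρ → π x ∈ B
  semiconj : ∀ x, ‖x‖ < ρ → π (φ τ x) = h (π x)
  section_smooth : CbNat 𝕜 r s (Metric.ball 0 δ)
  section_zero : s 0 = 0
  section_hasFDerivAt : HasFDerivAt s (ContinuousLinearMap.id 𝕜 X0) 0
  section_right : ∀ y, ‖y‖ < δ → ‖s y‖ < ρ ∧ π (s y : X) = y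
  section_left : ∀ᶠ y : X0 in 𝓝 0, s (π y) = y

/-- A map `f` with invertible derivative at `0` is a diffeomorphism of a small ball. -/
lemma exists_isCbNatDiffeo_ball {Z : Type u} [NormedAddCommGroup Z] [NormedSpace 𝕜 Z]
    [CompleteSpace Z] (hr1 : 1 ≤ r) {f : Z → Z} {ρ : ℝ} (hρ : 0 < ρ)
    (hf : CbNat 𝕜 r f (Metric.ball 0 ρ)) {e : Z ≃L[𝕜] Z}
    (hd : HasFDerivAt f (e : Z →L[𝕜] Z) 0) :
    ∃ δ > 0, δ ≤ ρ ∧ IsCbNatDiffeo 𝕜 r f (Metric.ball 0 δ) := by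
  have hf1 : ContDiffAt 𝕜 1 f 0 := by
    have := hf.contDiffAt Metric.isOpen_ball (Metric.mem_ball_self hρ) (j := 1)
      (by simpa using hr1)
    simpa using this
  obtain ⟨δ, hδ, g, K, hg, hinv⟩ := exists_inverse_ball hf1 hd
  have hSδ : Metric.ball (0 : Z) (min δ ρ) ⊆ Metric.ball 0 δ :=
    Metric.ball_subset_ball (min_le_left _ _)
  have hfS := hf.mono (Metric.ball_subset_ball (min_le_right δ ρ))
  have hf1S : ContDiffOn 𝕜 1 f (Metric.ball 0 (min δ ρ)) := by
    simpa using (hfS (1 : ℕ) (by simpa using hr1)).1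
  refine ⟨min δ ρ, lt_min hδ hρ, min_le_right _ _, hfS,
    isOpen_image_of_equiv Metric.isOpen_ball hf1S
      fun x hx => (hinv x (hSδ hx)).imp fun e he => he.1, fun x hx => ?_, g,
    hfS.leftInverse hr1 Metric.isOpen_ball Metric.isBounded_ball (fun x hx => hinv x (hSδ hx))
      fun x hx => hg x (hSδ hx), fun x hx => hg x (hSδ hx)⟩
  obtain ⟨e', he', -⟩ := hinv x (hSδ hx)
  refine ⟨e', he' ▸ DifferentiableAt.hasFDerivAt ?_⟩
  exact (hf1S.contDiffAt (Metric.isOpen_ball.mem_nhds hx)).differentiableAt one_ne_zero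

/-- The local inverse of the restriction of `π` to `X₀` is a section of `π`. -/
theorem exists_section_ball [CompleteSpace X0] (hX : X0.IsTopCompl X1) (hr1 : 1 ≤ r) {π : X → X0}
    {ρ : ℝ} (hρ : 0 < ρ) (hπ : CbNat 𝕜 r π (Metric.ball 0 ρ)) (hπ0 : π 0 = 0) {C : X0 ≃L[𝕜] X0}
    (hπd : HasFDerivAt π ((C : X0 →L[𝕜] X0) ∘L X0.projectionOntoL X1 hX) 0) :
    ∃ (s : X0 → X0) (δ : ℝ), 0 < δ ∧ CbNat 𝕜 r s (Metric.ball 0 δ) ∧ s 0 = 0 ∧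
      HasFDerivAt s (C.symm : X0 →L[𝕜] X0) 0 ∧
      (∀ y, ‖y‖ < δ → ‖s y‖ < ρ ∧ π (s y : X) = y) ∧ ∀ᶠ y : X0 in 𝓝 0, s (π y) = y := by
  have hπι : CbNat 𝕜 r (fun y : X0 => π y) (Metric.ball 0 ρ) :=
    hπ.comp Metric.isOpen_ball Metric.isOpen_ball
      (cbNat_clm X0.subtypeL Metric.isOpen_ball Metric.isBounded_ball) fun y hy => by
        rw [mem_ball_zero_iff] at hy ⊢
        exact hy
  have hπιd : HasFDerivAt (fun y : X0 => π y) (C : X0 →L[𝕜] X0) 0 := by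
    have h1 : HasFDerivAt (fun y : X0 => π y)
        (((C : X0 →L[𝕜] X0) ∘L X0.projectionOntoL X1 hX) ∘L X0.subtypeL) 0 :=
      HasFDerivAt.comp (0 : X0) (g := π) (f := X0.subtypeL) (by simpa using hπd)
        X0.subtypeL.hasFDerivAt
    rwa [ContinuousLinearMap.comp_assoc, projectionOntoL_comp_subtypeL] at h1
  obtain ⟨δ1, hδ1, hδ1ρ, hdif⟩ := exists_isCbNatDiffeo_ball hr1 hρ hπι hπιd
  obtain ⟨s, hsS, hsπ⟩ := hdif.inverse
  have h0S : (0 : X0) ∈ Metric.ball (0 : X0) δ1 := Metric.mem_ball_self hδ1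
  obtain ⟨δ, hδ, hδim⟩ := Metric.isOpen_iff.1 hdif.isOpen_image 0 ⟨0, h0S, by simpa using hπ0⟩
  have hs0 : s 0 = 0 := by
    have := hsπ 0 h0S
    simpa [hπ0] using this
  have hsleft : ∀ᶠ y : X0 in 𝓝 0, s (π y) = y := by
    filter_upwards [Metric.ball_mem_nhds (0 : X0) hδ1] with y hy using hsπ y hy
  refine ⟨s, δ, hδ, hsS.mono hδim, hs0, ?_, fun y hy => ?_, hsleft⟩
  · have h1 : ContDiffAt 𝕜 1 (fun y : X0 => π y) 0 := by
      have := hπι.contDiffAt Metric.isOpen_ball (Metric.mem_ball_self hρ) (j := 1)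
        (by simpa using hr1)
      simpa using this
    have := (contDiffAt_of_leftInverse one_ne_zero h1 hπιd hsleft).2
    simpa [hπ0] using this
  · obtain ⟨x, hx, hxy⟩ := hδim (mem_ball_zero_iff.2 hy)
    have h2 : s y = x := by rw [← hxy]; exact hsπ x hx
    rw [h2]
    exact ⟨(mem_ball_zero_iff.1 hx).trans_le hδ1ρ, hxy⟩

/-- The germ of a semiconjugacy between `φ_τ` and a map `h` of `X₀` defines a fibration of a whole
ball. If all resonances are excluded (`m = 0`), then `h` is linear. -/
theorem exists_isSlowFibration [NormedSpace ℝ X] [IsScalarTower ℝ 𝕜 X] [CompleteSpace X]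
    {hX : X0.IsTopCompl X1} {φ : ℝ → X → X} {τ ρ : ℝ}
    (hτ : 0 < τ) {ℓ : ℕ} (hℓ : 1 ≤ ℓ) (hr : ((ℓ + 1 : ℕ) : WithTop ℕ∞) ≤ r)
    (hφ : StableSemiflow 𝕜 r φ τ ρ) {A : X →L[𝕜] X} (hA : HasFDerivAt (φ τ) A 0)
    {e : X0 ≃L[𝕜] X0} (hs : SlowSplitting hX A e ℓ) {m : ℕ} (hm : m ≤ 1)
    (hnr : ∀ n, 2 ≤ n → n ≤ ℓ → BlockNonresonant hX A (diagBlock hX A) n m) :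
    ∃ (π : X → X0) (h s : X0 → X0) (ρ' δ : ℝ), 0 < ρ' ∧ ρ' ≤ ρ ∧
      IsSlowFibration hX r φ τ π h s ρ' δ ∧ (m = 0 → ∀ z, h z = e z) := by
  have hc0 : CompleteSpace X0 := completeSpace_of_isTopCompl hX
  have hr1 : (1 : WithTop ℕ∞) ≤ r := le_trans (by exact_mod_cast Nat.le_add_left 1 ℓ) hr
  have hsm : ∀ j : ℕ, (j : WithTop ℕ∞) ≤ r → ContDiffAt 𝕜 j (φ τ) 0 := fun j hj =>
    (hφ.smooth τ hτ.le).contDiffAt Metric.isOpen_ball (Metric.mem_ball_self hφ.pos) hj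
  obtain ⟨π, h, hπj, hπ0, hπd, hh, hh0, hhd, hhb, hlin, hπh⟩ := exists_semiconjugacy hX hℓ
    (hsm _ hr) (hφ.map_fixed τ hτ.le) hA hs.invariant hm hnr e hs.block hs.decay hs.gap
  obtain ⟨δ1, hδ1, hπs⟩ := exists_ball_cbNat hτ hr1 hφ (fun j hj => hπj j (hsm j hj)) hπ0 hh hhd
    hhb hπh
  obtain ⟨δh, hδh, g, K, hgh, -⟩ := exists_inverse_ball (hh 1).contDiffAt hhd
  have hπ1 : ContDiffAt 𝕜 1 π 0 := by
    have := hπj 1 (hsm 1 (by simpa using hr1))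
    simpa using this
  have hsub : Tendsto (fun x => ‖(fderiv 𝕜 π x) ∘L X0.subtypeL -
      ((ContinuousLinearEquiv.refl 𝕜 X0 : X0 ≃L[𝕜] X0) : X0 →L[𝕜] X0)‖) (𝓝 0) (𝓝 0) := by
    have h1 : ContinuousAt (fderiv 𝕜 π) 0 :=
      (hπ1.fderiv_right (m := 0) (by simp)).continuousAt
    have h2 : ContinuousAt (fun x => ‖(fderiv 𝕜 π x) ∘L X0.subtypeL -
      ((ContinuousLinearEquiv.refl 𝕜 X0 : X0 ≃L[𝕜] X0) : X0 →L[𝕜] X0)‖) 0 :=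
      ((h1.clm_comp continuousAt_const).sub continuousAt_const).norm
    have h3 : (fderiv 𝕜 π 0) ∘L X0.subtypeL =
        ((ContinuousLinearEquiv.refl 𝕜 X0 : X0 ≃L[𝕜] X0) : X0 →L[𝕜] X0) := by
      rw [hπd.fderiv, projectionOntoL_comp_subtypeL]
      rfl
    have h4 := h2.tendsto
    simp only [h3, sub_self, norm_zero] at h4
    exact h4
  obtain ⟨δ2, hδ2, hW⟩ := Metric.eventually_nhds_iff.1 ((hπh.and
    (hπ1.continuousAt.eventually (by rw [hπ0]; exact Metric.ball_mem_nhds 0 hδh))).and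
    (hsub.eventually_lt_const (show (0 : ℝ) < 1 / 2 by norm_num)))
  set ρ' := min (min δ1 δ2) ρ with hρ'
  have hρ'p : 0 < ρ' := lt_min (lt_min hδ1 hδ2) hφ.pos
  have hρ1 : ρ' ≤ δ1 := (min_le_left _ _).trans (min_le_left _ _)
  have hρ2 : ρ' ≤ δ2 := (min_le_left _ _).trans (min_le_right _ _)
  have hW' : ∀ x, ‖x‖ < ρ' → _ := fun x hx =>
    hW (y := x) (by rw [dist_zero_right]; exact hx.trans_le hρ2)
  have hπρ : CbNat 𝕜 r π (Metric.ball 0 ρ') := hπs.mono (Metric.ball_subset_ball hρ1)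
  obtain ⟨s, δ, hδ, hsδ, hs0, hsd, hsright, hsleft⟩ := exists_section_ball hX hr1 hρ'p hπρ hπ0
    (C := ContinuousLinearEquiv.refl 𝕜 X0) hπd
  refine ⟨π, h, s, ρ', δ, hρ'p, min_le_right _ _, ⟨hδ, hπρ, hπ0, hπd, fun x hx => ?_,
    ⟨Metric.ball 0 δh, LeftInvOn.injOn hgh, fun x hx => (hW' x hx).1.2⟩,
    fun x hx => (hW' x hx).1.1, hsδ, hs0, hsd, hsright, hsleft⟩, hlin⟩
  obtain ⟨C, hC, -⟩ := exists_equiv_of_close (a := ContinuousLinearEquiv.refl 𝕜 X0)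
    (L := (fderiv 𝕜 π x) ∘L X0.subtypeL) one_pos ContinuousLinearMap.norm_id_le
    (by rw [mul_one]; exact (hW' x hx).2.le)
  exact ⟨C, hC⟩

/-- The differentials at the fixed point of the maps `φ_t` have the diagonal blocks `exp(tG)`, and
depend nicely on `t` and on the base point along `X₀`. -/
structure IsSlowLinearization (hX : X0.IsTopCompl X1) [CompleteSpace X0] (φ : ℝ → X → X)
    (G : X0 →L[𝕜] X0) : Prop where
  invariant : ∀ t, 0 ≤ t → ∀ x ∈ X1, fderiv 𝕜 (φ t) 0 x ∈ X1
  block : ∀ t, 0 ≤ t → (expGroup G t : X0 →L[𝕜] X0) = diagBlock hX (fderiv 𝕜 (φ t) 0)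
  bounded : ∃ M : ℝ, ∀ t ∈ Icc (0 : ℝ) 1, ‖(fderiv 𝕜 (φ t) 0) ∘L X0.subtypeL‖ ≤ M
  close : ∀ ε > 0, ∃ δ > 0, ∀ t ∈ Icc (0 : ℝ) 1, ∀ y : X0, ‖y‖ < δ →
    ‖fderiv 𝕜 (fun y : X0 => φ t y) y - (fderiv 𝕜 (φ t) 0) ∘L X0.subtypeL‖ ≤ ε

lemma StableSemiflow.hasFDerivAt_zero {φ : ℝ → X → X} {τ ρ : ℝ} (hr1 : 1 ≤ r)
    (hφ : StableSemiflow 𝕜 r φ τ ρ) {t : ℝ} (ht : 0 ≤ t) :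
    HasFDerivAt (φ t) (fderiv 𝕜 (φ t) 0) 0 := by
  have h1 : ContDiffAt 𝕜 (1 : ℕ) (φ t) 0 := (hφ.smooth t ht).contDiffAt Metric.isOpen_ball
    (Metric.mem_ball_self hφ.pos) (by simpa using hr1)
  exact (h1.differentiableAt (by simp)).hasFDerivAt

/-- All maps `φ_t`, not just `φ_τ`, permute the fibres of `π` near `0`: this is the uniqueness of
semiconjugacies, applied to `π` and `π ∘ φ_t`. -/
theorem IsSlowFibration.eventually_fibre [NormedSpace ℝ X] [IsScalarTower ℝ 𝕜 X]
    [CompleteSpace X] [CompleteSpace X0]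
    {hX : X0.IsTopCompl X1} {φ : ℝ → X → X}
    {τ ρ δ : ℝ} (hτ : 0 < τ) {ℓ : ℕ} (hℓ : 1 ≤ ℓ) (hr : ((ℓ + 1 : ℕ) : WithTop ℕ∞) ≤ r)
    (hφ : StableSemiflow 𝕜 r φ τ ρ) {G : X0 →L[𝕜] X0} (hG : IsSlowLinearization hX φ G)
    (hs : SlowSplitting hX (fderiv 𝕜 (φ τ) 0) (expGroup G τ) ℓ)
    {π : X → X0} {h s : X0 → X0} (hπ : IsSlowFibration hX r φ τ π h s ρ δ) {t : ℝ}
    (ht : 0 ≤ t) : ∀ᶠ x in 𝓝 0, π (φ t x) = π (φ t (s (π x))) := by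
  have hr1 : (1 : WithTop ℕ∞) ≤ r := le_trans (by exact_mod_cast Nat.le_add_left 1 ℓ) hr
  have h0 : (0 : X) ∈ Metric.ball (0 : X) ρ := Metric.mem_ball_self hφ.pos
  have hd := fun t ht => hφ.hasFDerivAt_zero (t := t) hr1 ht
  have hcd : ∀ t, 0 ≤ t → ContDiffAt 𝕜 (ℓ + 1 : ℕ) (φ t) 0 := fun t ht =>
    (hφ.smooth t ht).contDiffAt Metric.isOpen_ball h0 hr
  have hcπ : ContDiffAt 𝕜 (ℓ + 1 : ℕ) π 0 := hπ.smooth.contDiffAt Metric.isOpen_ball h0 hr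
  have hsmall : ∀ t, 0 ≤ t → ∀ᶠ x in 𝓝 (0 : X), ‖φ t x‖ < ρ := fun t ht => by
    have h1 : Tendsto (fun x => ‖φ t x‖) (𝓝 0) (𝓝 0) := by
      simpa [hφ.map_fixed t ht] using (hd t ht).continuousAt.norm.tendsto
    exact h1.eventually_lt_const hφ.pos
  have hball : ∀ᶠ x in 𝓝 (0 : X), ‖x‖ < ρ := by
    filter_upwards [Metric.ball_mem_nhds (0 : X) hφ.pos] with x hx using mem_ball_zero_iff.1 hx
  refine semiconjugacy_unique hX hℓ (hcd τ hτ.le) (hφ.map_fixed τ hτ.le) (hd τ hτ.le)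
    hs.invariant hs.nonresonant _ hs.block hs.decay hs.gap (π := π) (π' := fun x => π (φ t x))
    (h := h) (h' := h) (C := ContinuousLinearEquiv.refl 𝕜 X0) (C' := expGroup G t) hcπ ?_
    hπ.map_zero ?_ ?_ ?_ ?_ ?_ hπ.section_zero ?_ hπ.section_left ?_
  · exact ContDiffAt.comp (0 : X) (g := π) (by rwa [hφ.map_fixed t ht]) (hcd t ht)
  · simp only [hφ.map_fixed t ht, hπ.map_zero]
  · exact hπ.hasFDerivAt
  · have h1 : HasFDerivAt (fun x => π (φ t x))
        ((X0.projectionOntoL X1 hX) ∘L (fderiv 𝕜 (φ t) 0)) 0 :=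
      HasFDerivAt.comp (0 : X) (g := π) (by rw [hφ.map_fixed t ht]; exact hπ.hasFDerivAt)
        (hd t ht)
    refine h1.congr_fderiv (ContinuousLinearMap.ext fun x => ?_)
    rw [hG.block t ht]
    exact projectionOntoL_apply_comm hX (hG.invariant t ht) x
  · filter_upwards [hball] with x hx using hπ.semiconj x hx
  · filter_upwards [hball, hsmall t ht, hsmall τ hτ.le] with x hx hxt hxτ
    rw [← hφ.map_add τ t x hτ.le ht hx hxτ, add_comm, hφ.map_add t τ x ht hτ.le hx hxt,
      hπ.semiconj _ hxt]
  · exact hπ.section_smooth.contDiffAt Metric.isOpen_ball (Metric.mem_ball_self hπ.pos) hr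
  · filter_upwards [Metric.ball_mem_nhds (0 : X0) hπ.pos] with y hy
      using (hπ.section_right y (mem_ball_zero_iff.1 hy)).2

lemma IsSlowFibration.exists_section_small {hX : X0.IsTopCompl X1} {φ : ℝ → X → X} {τ ρ δ : ℝ}
    {π : X → X0} {h s : X0 → X0} (hπ : IsSlowFibration hX r φ τ π h s ρ δ) {ε : ℝ} (hε : 0 < ε) :
    ∃ δ' > 0, δ' ≤ δ ∧ ∀ y, ‖y‖ < δ' → ‖s y‖ < ε := by
  have h1 : Tendsto (fun y => ‖s y‖) (𝓝 0) (𝓝 0) := by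
    simpa [hπ.section_zero] using hπ.section_hasFDerivAt.continuousAt.norm.tendsto
  obtain ⟨δ', hδ', h2⟩ := Metric.eventually_nhds_iff.1 (h1.eventually_lt_const hε)
  exact ⟨min δ' δ, lt_min hδ' hπ.pos, min_le_right _ _, fun y hy =>
    h2 (by rw [dist_zero_right]; exact hy.trans_le (min_le_left _ _))⟩

lemma IsSlowFibration.exists_small {hX : X0.IsTopCompl X1} {φ : ℝ → X → X} {τ ρ δ : ℝ}
    {π : X → X0} {h s : X0 → X0} (hπ : IsSlowFibration hX r φ τ π h s ρ δ) {ε : ℝ} (hε : 0 < ε) :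
    ∃ δ' > 0, ∀ x, ‖x‖ < δ' → ‖π x‖ < ε := by
  have h1 : Tendsto (fun y => ‖π y‖) (𝓝 0) (𝓝 0) := by
    simpa [hπ.map_zero] using hπ.hasFDerivAt.continuousAt.norm.tendsto
  obtain ⟨δ', hδ', h2⟩ := Metric.eventually_nhds_iff.1 (h1.eventually_lt_const hε)
  exact ⟨δ', hδ', fun y hy => h2 (by rwa [dist_zero_right])⟩

/-- The reduced maps `ϑ_t(y) = π(φ_t(s(y)))` satisfy `π ∘ φ_t = ϑ_t ∘ π` on one neighbourhood of `0`,
for all `t ≥ 0`. -/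
theorem IsSlowFibration.exists_commutes [NormedSpace ℝ X] [IsScalarTower ℝ 𝕜 X]
    [CompleteSpace X] [CompleteSpace X0]
    {hX : X0.IsTopCompl X1} {φ : ℝ → X → X}
    {τ ρ δ : ℝ} (hτ : 0 < τ) {ℓ : ℕ} (hℓ : 1 ≤ ℓ) (hr : ((ℓ + 1 : ℕ) : WithTop ℕ∞) ≤ r)
    (hφ : StableSemiflow 𝕜 r φ τ ρ) {G : X0 →L[𝕜] X0} (hG : IsSlowLinearization hX φ G)
    (hs : SlowSplitting hX (fderiv 𝕜 (φ τ) 0) (expGroup G τ) ℓ)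
    {π : X → X0} {h s : X0 → X0} (hπ : IsSlowFibration hX r φ τ π h s ρ δ) :
    ∃ δ' > 0, ∀ x, ‖x‖ < δ' → ∀ t, 0 ≤ t → ‖φ t x‖ < ρ ∧ π (φ t x) = π (φ t (s (π x))) := by
  obtain ⟨B, hB, hπB⟩ := hπ.injective
  obtain ⟨δ1, hδ1, hst⟩ := hφ.stable ρ hφ.pos
  obtain ⟨δ2, hδ2, hδ2δ, hs2⟩ := hπ.exists_section_small hδ1
  obtain ⟨δ3, hδ3, hπ3⟩ := hπ.exists_small hδ2
  refine ⟨min δ1 δ3, lt_min hδ1 hδ3, fun x hx t ht => ?_⟩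
  have hx1 := hst x (hx.trans_le (min_le_left _ _))
  have hx3 := hπ3 x (hx.trans_le (min_le_right _ _))
  refine ⟨hx1 t ht, fibre_invariant hτ hφ hB hπB hπ.semiconj ht
    (η := fun y => π (φ t (s y))) (hπ.eventually_fibre hτ hℓ hr hφ hG hs ht) hx1
    (hst _ (hs2 _ hx3)) ?_⟩
  exact (hπ.section_right _ (hx3.trans_le hδ2δ)).2.symm

/-- The reduced maps `ϑ_t(y) = π(φ_t(s(y)))` form a semiflow which is `C¹`-close to the linear group
`exp(tG)` near `0`, uniformly in `t ∈ [0, 1]`. -/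
theorem IsSlowFibration.exists_reducedFlow [NormedSpace ℝ X] [IsScalarTower ℝ 𝕜 X]
    [CompleteSpace X] [CompleteSpace X0]
    {hX : X0.IsTopCompl X1} {φ : ℝ → X → X}
    {τ ρ δ : ℝ} (hτ : 0 < τ) {ℓ : ℕ} (hℓ : 1 ≤ ℓ) (hr : ((ℓ + 1 : ℕ) : WithTop ℕ∞) ≤ r)
    (hφ : StableSemiflow 𝕜 r φ τ ρ) {G : X0 →L[𝕜] X0} (hG : IsSlowLinearization hX φ G)
    (hs : SlowSplitting hX (fderiv 𝕜 (φ τ) 0) (expGroup G τ) ℓ)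
    {π : X → X0} {h s : X0 → X0} (hπ : IsSlowFibration hX r φ τ π h s ρ δ) :
    ∃ ρ', ReducedFlow 𝕜 r (fun t y => π (φ t (s y))) G ρ' ∧ ρ' ≤ δ ∧
      ∀ y, ‖y‖ < ρ' → ‖s y‖ < ρ ∧ ∀ t, 0 ≤ t → ‖φ t (s y)‖ < ρ := by
  have hr1 : (1 : WithTop ℕ∞) ≤ r := le_trans (by exact_mod_cast Nat.le_add_left 1 ℓ) hr
  have h0 : (0 : X) ∈ Metric.ball (0 : X) ρ := Metric.mem_ball_self hφ.pos
  obtain ⟨δ0, hδ0, hcom⟩ := hπ.exists_commutes hτ hℓ hr hφ hG hs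
  obtain ⟨δ1, hδ1, hδ1le, hst⟩ := hφ.exists_stable_le (lt_min hδ0 hφ.pos)
  obtain ⟨ρ', hρ', hρ'δ, hs1⟩ := hπ.exists_section_small hδ1
  have hsρ : ∀ y, ‖y‖ < ρ' → ‖s y‖ < ρ := fun y hy => (hπ.section_right y (hy.trans_le hρ'δ)).1
  have horb : ∀ y, ‖y‖ < ρ' → ∀ t, 0 ≤ t → ‖φ t (s y)‖ < min δ0 ρ := fun y hy t ht =>
    hst _ (hs1 y hy) t ht
  have horbρ : ∀ y, ‖y‖ < ρ' → ∀ t, 0 ≤ t → ‖φ t (s y)‖ < ρ := fun y hy t ht =>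
    (horb y hy t ht).trans_le (min_le_right _ _)
  have hφι : ∀ t, 0 ≤ t → CbNat 𝕜 r (fun y : X0 => φ t y) (Metric.ball 0 ρ) := fun t ht =>
    (hφ.smooth t ht).comp Metric.isOpen_ball Metric.isOpen_ball
      (cbNat_clm X0.subtypeL Metric.isOpen_ball Metric.isBounded_ball) fun y hy => by
        rw [mem_ball_zero_iff] at hy ⊢
        exact hy
  have hφs : ∀ t, 0 ≤ t → CbNat 𝕜 r (fun y => φ t (s y)) (Metric.ball 0 ρ') := fun t ht =>
    (hφι t ht).comp Metric.isOpen_ball Metric.isOpen_ball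
      (hπ.section_smooth.mono (Metric.ball_subset_ball hρ'δ)) fun y hy =>
        mem_ball_zero_iff.2 (hsρ y (mem_ball_zero_iff.1 hy))
  refine ⟨ρ', ⟨hρ', fun t ht => ?_, fun y hy => ?_, fun a t y ha ht hy _ => ?_, fun t ht => ?_,
    fun ε hε => ?_, fun ε hε => ?_⟩, hρ'δ, fun y hy => ⟨hsρ y hy, horbρ y hy⟩⟩
  · simp only [hπ.section_zero, ZeroMemClass.coe_zero, hφ.map_fixed t ht, hπ.map_zero]
  · simp only [hφ.map_zero]
    exact (hπ.section_right y (hy.trans_le hρ'δ)).2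
  · rw [hφ.map_add a t (s y : X) ha ht (hsρ y hy) (horbρ y hy a ha)]
    exact (hcom _ ((horb y hy a ha).trans_le (min_le_left _ _)) t ht).2
  · exact hπ.smooth.comp Metric.isOpen_ball Metric.isOpen_ball (hφs t ht) fun y hy =>
      mem_ball_zero_iff.2 (horbρ y (mem_ball_zero_iff.1 hy) t ht)
  · obtain ⟨a, ha, h1⟩ := hπ.exists_small hε
    obtain ⟨b, hb, h2⟩ := hφ.stable a ha
    obtain ⟨c, hc, -, h3⟩ := hπ.exists_section_small hb
    exact ⟨c, hc, fun y hy t ht => h1 _ (h2 _ (h3 y hy) t ht)⟩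
  · obtain ⟨M, hM⟩ := hG.bounded
    have hM0 : 0 ≤ M := (norm_nonneg _).trans (hM 0 (by simp))
    set P0 := X0.projectionOntoL X1 hX with hP0
    set N := (M + 1) * 2 + ‖P0‖ * 2 + ‖P0‖ * M + 1 with hN
    have hNp : 0 < N := by positivity
    set η := min 1 (ε / N) with hη
    have hηp : 0 < η := by positivity
    have hπ1 : ContDiffAt 𝕜 (1 : ℕ) π 0 := hπ.smooth.contDiffAt Metric.isOpen_ball h0
      (by simpa using hr1)
    have hs1' : ContDiffAt 𝕜 (1 : ℕ) s 0 := hπ.section_smooth.contDiffAt Metric.isOpen_ball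
      (Metric.mem_ball_self hπ.pos) (by simpa using hr1)
    obtain ⟨a, ha, hπa⟩ := Metric.eventually_nhds_iff.1 (Metric.tendsto_nhds.1
      (hπ1.fderiv_right (m := 0) (by simp)).continuousAt.tendsto η hηp)
    obtain ⟨b, hb, hsb⟩ := Metric.eventually_nhds_iff.1 (Metric.tendsto_nhds.1
      (hs1'.fderiv_right (m := 0) (by simp)).continuousAt.tendsto η hηp)
    rw [hπ.hasFDerivAt.fderiv] at hπa
    rw [hπ.section_hasFDerivAt.fderiv] at hsb
    obtain ⟨c, hc, hφc⟩ := hG.close η hηp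
    obtain ⟨a', ha', hst'⟩ := hφ.stable a ha
    obtain ⟨d, hd, hdδ, hsd⟩ := hπ.exists_section_small (lt_min ha' hc)
    refine ⟨min (min d b) ρ', by positivity, fun t ht y hy => ?_⟩
    rw [lt_min_iff, lt_min_iff] at hy
    have hsy := hsd y hy.1.1
    rw [lt_min_iff] at hsy
    have hyρ : y ∈ Metric.ball (0 : X0) ρ' := mem_ball_zero_iff.2 hy.2
    have d1 : HasFDerivAt s (fderiv 𝕜 s y) y := by
      have : ContDiffAt 𝕜 (1 : ℕ) s y := hπ.section_smooth.contDiffAt Metric.isOpen_ball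
        (Metric.ball_subset_ball hρ'δ hyρ) (by simpa using hr1)
      exact (this.differentiableAt (by simp)).hasFDerivAt
    have d2 : HasFDerivAt (fun y : X0 => φ t y) (fderiv 𝕜 (fun y : X0 => φ t y) (s y)) (s y) := by
      have : ContDiffAt 𝕜 (1 : ℕ) (fun y : X0 => φ t y) (s y) :=
        (hφι t ht.1).contDiffAt Metric.isOpen_ball (mem_ball_zero_iff.2 (hsρ y hy.2))
          (by simpa using hr1)
      exact (this.differentiableAt (by simp)).hasFDerivAt
    have d3 : HasFDerivAt π (fderiv 𝕜 π (φ t (s y))) (φ t (s y)) := by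
      have : ContDiffAt 𝕜 (1 : ℕ) π (φ t (s y)) := hπ.smooth.contDiffAt Metric.isOpen_ball
        (mem_ball_zero_iff.2 (horbρ y hy.2 t ht.1)) (by simpa using hr1)
      exact (this.differentiableAt (by simp)).hasFDerivAt
    have d4 : fderiv 𝕜 (fun y => π (φ t (s y))) y =
        (fderiv 𝕜 π (φ t (s y))) ∘L (fderiv 𝕜 (fun y : X0 => φ t y) (s y)) ∘L (fderiv 𝕜 s y) :=
      (HasFDerivAt.comp y (g := π) d3
        (HasFDerivAt.comp y (g := fun y : X0 => φ t y) d2 d1)).fderiv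
    have d5 : (expGroup G t : X0 →L[𝕜] X0) =
        P0 ∘L ((fderiv 𝕜 (φ t) 0) ∘L X0.subtypeL) ∘L ContinuousLinearMap.id 𝕜 X0 := by
      rw [hG.block t ht.1]
      rfl
    have e1 : ‖fderiv 𝕜 π (φ t (s y)) - P0‖ ≤ η := by
      rw [← dist_eq_norm]
      exact (hπa (by rw [dist_zero_right]; exact hst' _ hsy.1 t ht.1)).le
    have e2 := hφc t ht (s y) hsy.2
    have e3 : ‖fderiv 𝕜 s y - ContinuousLinearMap.id 𝕜 X0‖ ≤ η := by
      rw [← dist_eq_norm]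
      exact (hsb (by rw [dist_zero_right]; exact hy.1.2)).le
    rw [d4, d5]
    generalize fderiv 𝕜 π (φ t (s y)) = L1 at e1
    generalize fderiv 𝕜 (fun y : X0 => φ t y) (s y) = L2 at e2
    generalize fderiv 𝕜 s y = L3 at e3
    have hMt := hM t ht
    generalize (fderiv 𝕜 (φ t) 0) ∘L X0.subtypeL = A2 at e2 hMt
    have hη1 : η ≤ 1 := min_le_left _ _
    have n2 : ‖L2‖ ≤ M + 1 := by
      calc ‖L2‖ = ‖(L2 - A2) + A2‖ := by rw [sub_add_cancel]
        _ ≤ η + M := (norm_add_le _ _).trans (add_le_add e2 hMt)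
        _ ≤ M + 1 := by linarith
    have n3 : ‖L3‖ ≤ 2 := by
      calc ‖L3‖ = ‖(L3 - ContinuousLinearMap.id 𝕜 X0) + ContinuousLinearMap.id 𝕜 X0‖ := by
            rw [sub_add_cancel]
        _ ≤ η + 1 := (norm_add_le _ _).trans (add_le_add e3 ContinuousLinearMap.norm_id_le)
        _ ≤ 2 := by linarith
    have hsplit : L1 ∘L L2 ∘L L3 - P0 ∘L A2 ∘L ContinuousLinearMap.id 𝕜 X0 =
        (L1 - P0) ∘L L2 ∘L L3 + P0 ∘L (L2 - A2) ∘L L3 +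
          P0 ∘L A2 ∘L (L3 - ContinuousLinearMap.id 𝕜 X0) := by
      ext v
      simp
    have b1 : ‖(L1 - P0) ∘L L2 ∘L L3‖ ≤ η * ((M + 1) * 2) :=
      (ContinuousLinearMap.opNorm_comp_le _ _).trans (mul_le_mul e1
        ((ContinuousLinearMap.opNorm_comp_le _ _).trans (by gcongr)) (norm_nonneg _) hηp.le)
    have b2 : ‖P0 ∘L (L2 - A2) ∘L L3‖ ≤ ‖P0‖ * (η * 2) :=
      (ContinuousLinearMap.opNorm_comp_le _ _).trans (by
        gcongr
        exact (ContinuousLinearMap.opNorm_comp_le _ _).trans (by gcongr))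
    have b3 : ‖P0 ∘L A2 ∘L (L3 - ContinuousLinearMap.id 𝕜 X0)‖ ≤ ‖P0‖ * (M * η) :=
      (ContinuousLinearMap.opNorm_comp_le _ _).trans (by
        gcongr
        exact (ContinuousLinearMap.opNorm_comp_le _ _).trans (by gcongr))
    rw [hsplit]
    calc _ ≤ η * ((M + 1) * 2) + ‖P0‖ * (η * 2) + ‖P0‖ * (M * η) :=
          norm_add₃_le.trans (add_le_add (add_le_add b1 b2) b3)
      _ ≤ η * N := by rw [hN]; linarith
      _ ≤ ε / N * N := by gcongr; exact min_le_right _ _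
      _ = ε := by field_simp

end

end SlowFoliation

/-! ### The linearized semiflow -/

namespace SlowFoliation

noncomputable section

open Asymptotics

universe u

variable {𝕜 : Type*} [RCLike 𝕜] {X : Type u} [NormedAddCommGroup X]
  [NormedSpace 𝕜 X] {X0 X1 : Submodule 𝕜 X} {r : WithTop ℕ∞}

lemma diagBlock_comp (hX : X0.IsTopCompl X1) {A : X →L[𝕜] X} (hA : ∀ x ∈ X1, A x ∈ X1)
    (B : X →L[𝕜] X) : diagBlock hX (A ∘L B) = diagBlock hX A * diagBlock hX B :=
  ContinuousLinearMap.ext fun y => projectionOntoL_apply_comm hX hA (B y)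

/-- On the slow space, the linearized semiflow is norm continuous, hence is the exponential of a
bounded operator. -/
theorem exists_isSlowLinearization (hX : X0.IsTopCompl X1) [CompleteSpace X0] {D : Set (ℝ × X)}
    {φ : ℝ → X → X} (hT : IsC0Semigroup (fun t => fderiv 𝕜 (φ t) 0))
    (hinv : ∀ t, 0 ≤ t → ∀ x ∈ X1, fderiv 𝕜 (φ t) 0 x ∈ X1)
    (hd : ∀ t, 0 ≤ t → HasFDerivAt (φ t) (fderiv 𝕜 (φ t) 0) 0) {ρ : ℝ} (hρ : 0 < ρ)
    (hD : ∀ x, ‖x‖ < ρ → ∀ t, 0 ≤ t → (t, x) ∈ D)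
    (hc : ∀ t : ℝ, 0 ≤ t → ContinuousWithinAt
      (fun p : ℝ × X0 => fderiv 𝕜 (fun y : X0 => φ p.1 (y : X)) p.2)
      {p : ℝ × X0 | (p.1, (p.2 : X)) ∈ D} (t, 0)) :
    ∃ G : X0 →L[𝕜] X0, IsSlowLinearization hX φ G := by
  have hW : ∀ t, 0 ≤ t → fderiv 𝕜 (fun y : X0 => φ t (y : X)) 0 =
      (fderiv 𝕜 (φ t) 0) ∘L X0.subtypeL := fun t ht =>
    (HasFDerivAt.comp (0 : X0) (g := φ t) (f := X0.subtypeL) (by simpa using hd t ht)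
      X0.subtypeL.hasFDerivAt).fderiv
  have hline : ∀ t, 0 ≤ t → ContinuousWithinAt
      (fun t : ℝ => fderiv 𝕜 (fun y : X0 => φ t (y : X)) 0) (Ici 0) t := fun t ht =>
    (hc t ht).comp (f := fun t : ℝ => (t, (0 : X0)))
      (continuous_id.prodMk continuous_const).continuousWithinAt
      fun s hs => hD 0 (by simpa using hρ) s hs
  have hcont : ContinuousOn (fun t : ℝ => (fderiv 𝕜 (φ t) 0) ∘L X0.subtypeL) (Ici 0) :=
    ContinuousOn.congr (fun t ht => hline t ht) fun t ht => (hW t ht).symm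
  have hblock : ContinuousOn (fun t : ℝ => diagBlock hX (fderiv 𝕜 (φ t) 0)) (Ici 0) :=
    continuousOn_const.clm_comp hcont
  obtain ⟨G, hG⟩ := exists_eq_exp_of_semigroup (𝕜 := 𝕜) hblock
    (by
      rw [hT.map_zero]
      ext y
      simp [diagBlock])
    (fun s t hs ht => by rw [hT.map_add s t hs ht, diagBlock_comp hX (hinv t ht)])
  refine ⟨G, hinv, fun t ht => (hG t ht).symm, ?_, fun ε hε => ?_⟩
  · exact isCompact_Icc.exists_bound_of_continuousOn (hcont.mono Icc_subset_Ici_self)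
  · have hev : ∀ᶠ y : X0 in 𝓝 0, ∀ t ∈ Icc (0 : ℝ) 1, ‖y‖ < ρ →
        ‖fderiv 𝕜 (fun y : X0 => φ t y) y - (fderiv 𝕜 (φ t) 0) ∘L X0.subtypeL‖ ≤ ε := by
      have h2 : ∀ᶠ y : X0 in 𝓝 0, ∀ t ∈ Icc (0 : ℝ) 1, 0 ≤ t → ‖y‖ < ρ →
          ‖fderiv 𝕜 (fun y : X0 => φ t y) y - (fderiv 𝕜 (φ t) 0) ∘L X0.subtypeL‖ ≤ ε := by
        refine isCompact_Icc.eventually_forall_of_forall_eventually fun t0 ht0 => ?_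
        have h3 := Metric.tendsto_nhds.1 (hc t0 ht0.1) (ε / 2) (half_pos hε)
        have h4 := Metric.tendsto_nhds.1 (hline t0 ht0.1) (ε / 2) (half_pos hε)
        rw [eventually_nhdsWithin_iff] at h3 h4
        have h5 : Tendsto (fun z : X0 × ℝ => (z.2, z.1)) (𝓝 (0, t0)) (𝓝 (t0, 0)) :=
          (continuous_snd.prodMk continuous_fst).tendsto' _ _ rfl
        have h6 : Tendsto (fun z : X0 × ℝ => z.2) (𝓝 (0, t0)) (𝓝 t0) :=
          continuous_snd.tendsto' _ _ rfl
        filter_upwards [h5.eventually h3, h6.eventually h4] with z hz hz' hz0 hzρ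
        have k1 := hz (hD _ hzρ _ hz0)
        have k2 := hz' hz0
        rw [← hW _ hz0, ← dist_eq_norm]
        calc _ ≤ ε / 2 + ε / 2 := (dist_triangle_right _ _ _).trans (add_le_add k1.le k2.le)
          _ = ε := add_halves ε
      filter_upwards [h2] with y hy t ht using hy t ht ht.1
    obtain ⟨δ, hδ, h7⟩ := Metric.eventually_nhds_iff.1 hev
    refine ⟨min δ ρ, lt_min hδ hρ, fun t ht y hy => h7 ?_ t ht (hy.trans_le (min_le_right _ _))⟩
    rw [dist_zero_right]
    exact hy.trans_le (min_le_left _ _)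

/-- The spectral conditions imply those on norms of powers and on Sylvester operators. -/
theorem slowSplitting_of_spectrum [NormedSpace ℝ X] [IsScalarTower ℝ 𝕜 X] [CompleteSpace X]
    [CompleteSpace X0] (hX : X0.IsTopCompl X1) {A : X →L[𝕜] X} {e : X0 ≃L[𝕜] X0} {ℓ : ℕ}
    (hA : ∀ x ∈ X1, A x ∈ X1) (he : (e : X0 →L[𝕜] X0) = diagBlock hX A)
    (hspec : cSpectrum 𝕜 A ⊆ Metric.ball (0 : ℂ) 1)
    (hgap : cSpectrum 𝕜 (Ring.inverse (diagBlock hX A)) * cSpectrum 𝕜 A ^ (ℓ + 1) ⊆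
      Metric.ball (0 : ℂ) 1)
    (hnr : ∀ n j : ℕ, 2 ≤ n → n ≤ ℓ → 1 ≤ j → j ≤ n →
      (cSpectrum 𝕜 (diagBlock hX A) ^ (n - j) * cSpectrum 𝕜 (diagBlock hX.symm A) ^ j) ∩
        cSpectrum 𝕜 (diagBlock hX A) = ∅) : SlowSplitting hX A e ℓ where
  invariant := hA
  block := he
  decay := tendsto_norm_pow_zero A hspec
  gap := by
    refine tendsto_gap A _ (Nat.succ_ne_zero ℓ) ?_
    rwa [← he, ContinuousLinearMap.ringInverse_equiv, ContinuousLinearMap.inverse_equiv] at hgap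
  nonresonant n hn hnℓ := blockNonresonant_of_spectrum hX A _ n 1 fun j hj hjn =>
    hnr n j hn hnℓ hj hjn

lemma blockNonresonant_zero [NormedSpace ℝ X] [IsScalarTower ℝ 𝕜 X] [CompleteSpace X]
    [CompleteSpace X0] {hX : X0.IsTopCompl X1} {A : X →L[𝕜] X} {ℓ : ℕ}
    (hnr : ∀ n j : ℕ, 2 ≤ n → n ≤ ℓ → 1 ≤ j → j ≤ n →
      (cSpectrum 𝕜 (diagBlock hX A) ^ (n - j) * cSpectrum 𝕜 (diagBlock hX.symm A) ^ j) ∩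
        cSpectrum 𝕜 (diagBlock hX A) = ∅)
    (hnr0 : ∀ n : ℕ, 2 ≤ n → n ≤ ℓ →
      cSpectrum 𝕜 (diagBlock hX A) ^ n ∩ cSpectrum 𝕜 (diagBlock hX A) = ∅)
    {n : ℕ} (hn : 2 ≤ n) (hnℓ : n ≤ ℓ) : BlockNonresonant hX A (diagBlock hX A) n 0 := by
  refine blockNonresonant_of_spectrum hX A _ n 0 fun j _ hjn => ?_
  rcases Nat.eq_zero_or_pos j with rfl | hj
  · simpa using hnr0 n hn hnℓ
  · exact hnr n j hn hnℓ hj hjn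

/-- Powers of the diagonal block are bounded by powers of the block triangular operator. -/
lemma SlowSplitting.norm_pow_le {hX : X0.IsTopCompl X1} {A : X →L[𝕜] X} {e : X0 ≃L[𝕜] X0}
    {ℓ : ℕ} (hs : SlowSplitting hX A e ℓ) (n : ℕ) :
    ‖(e : X0 →L[𝕜] X0) ^ n‖ ≤ ‖X0.projectionOntoL X1 hX‖ * ‖A ^ n‖ := by
  have h1 : ∀ n : ℕ, ∀ x, X0.projectionOntoL X1 hX ((A ^ n) x) =
      ((e : X0 →L[𝕜] X0) ^ n) (X0.projectionOntoL X1 hX x) := by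
    intro n
    induction n with
    | zero => intro x; rfl
    | succ n ih =>
      intro x
      rw [pow_succ, pow_succ]
      show X0.projectionOntoL X1 hX ((A ^ n) (A x)) = ((e : X0 →L[𝕜] X0) ^ n)
        ((e : X0 →L[𝕜] X0) (X0.projectionOntoL X1 hX x))
      rw [ih, projectionOntoL_apply_comm hX hs.invariant, hs.block]
  refine ContinuousLinearMap.opNorm_le_bound _ (by positivity) fun y => ?_
  have h2 := h1 n y
  rw [Submodule.projectionOntoL_apply_left] at h2
  rw [← h2, mul_assoc]
  refine (ContinuousLinearMap.le_opNorm _ _).trans ?_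
  gcongr
  exact ContinuousLinearMap.le_opNorm (A ^ n) (y : X)

lemma SlowSplitting.decay_block {hX : X0.IsTopCompl X1} {A : X →L[𝕜] X} {e : X0 ≃L[𝕜] X0}
    {ℓ : ℕ} (hs : SlowSplitting hX A e ℓ) :
    Tendsto (fun n => ‖(e : X0 →L[𝕜] X0) ^ n‖) atTop (𝓝 0) :=
  squeeze_zero (fun _ => norm_nonneg _) hs.norm_pow_le
    (by simpa using hs.decay.const_mul ‖X0.projectionOntoL X1 hX‖)

lemma SlowSplitting.gap_block {hX : X0.IsTopCompl X1} {A : X →L[𝕜] X} {e : X0 ≃L[𝕜] X0}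
    {ℓ : ℕ} (hs : SlowSplitting hX A e ℓ) :
    Tendsto (fun n => ‖(e.symm : X0 →L[𝕜] X0) ^ n‖ * ‖(e : X0 →L[𝕜] X0) ^ n‖ ^ (ℓ + 1))
      atTop (𝓝 0) := by
  refine squeeze_zero (fun _ => by positivity) (fun n => ?_)
    (by simpa using hs.gap.const_mul (‖X0.projectionOntoL X1 hX‖ ^ (ℓ + 1)))
  calc _ ≤ ‖(e.symm : X0 →L[𝕜] X0) ^ n‖ *
        (‖X0.projectionOntoL X1 hX‖ * ‖A ^ n‖) ^ (ℓ + 1) := by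
        gcongr
        exact hs.norm_pow_le n
    _ = _ := by rw [mul_pow]; ring

end

end SlowFoliation

/-! ### Existence of solutions -/

namespace SlowFoliation

noncomputable section

open Asymptotics

universe u

variable {𝕜 : Type*} [RCLike 𝕜] {X : Type u} [NormedAddCommGroup X]
  [NormedSpace 𝕜 X] {X0 X1 : Submodule 𝕜 X} {r : WithTop ℕ∞}

lemma isSubmersionOn_of_transverse {π : X → X0} {U : Set X}
    (h : ∀ x ∈ U, ∃ C : X0 ≃L[𝕜] X0, (fderiv 𝕜 π x) ∘L X0.subtypeL = C) :
    IsSubmersionOn (𝕜 := 𝕜) π U := by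
  intro x hx
  obtain ⟨C, hC⟩ := h x hx
  have h1 : Function.RightInverse (X0.subtypeL ∘L (C.symm : X0 →L[𝕜] X0)) (fderiv 𝕜 π x) := by
    intro y
    have := congrArg (fun L : X0 →L[𝕜] X0 => L (C.symm y)) hC
    simpa using this
  exact ⟨h1.surjective, ContinuousLinearMap.closedComplemented_ker_of_rightInverse _ _ h1⟩

/-- The parts of a solution that only concern the map `π`. -/
lemma IsSlowFibration.isSolution {hX : X0.IsTopCompl X1} (hr : (RCLike.I : 𝕜) = 0 ↔ r ≠ ω)
    {D : Set (ℝ × X)} {φ : ℝ → X → X} {τ ρ δ : ℝ}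
    (hD : ∀ x, ‖x‖ < ρ → ∀ t, 0 ≤ t → (t, x) ∈ D)
    {π : X → X0} {h s : X0 → X0} (hπ : IsSlowFibration hX r φ τ π h s ρ δ) {ϑ : ℝ → X0 → X0}
    {V : Set X} (hV : IsOpen V) (h0V : 0 ∈ V) (hVρ : V ⊆ Metric.ball 0 ρ)
    (hcom : ∀ x ∈ V, ∀ t, 0 ≤ t → ‖φ t x‖ < ρ ∧ π (φ t x) = ϑ t (π x))
    (hdif : ∀ t, 0 ≤ t → IsCbDiffeoOn 𝕜 r (ϑ t) (π '' V)) (hϑ0 : ∀ y ∈ π '' V, ϑ 0 y = y)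
    (hadd : ∀ s t, 0 ≤ s → 0 ≤ t → ∀ y ∈ π '' V, ϑ (t + s) y = ϑ t (ϑ s y)) :
    IsSolution X0 X1 D φ r (Metric.ball 0 ρ) V π ϑ where
  isOpen_U := Metric.isOpen_ball
  isOpen_V := hV
  zero_mem := h0V
  subset := hVρ
  smooth := hπ.smooth.cbOn hr Metric.isOpen_ball
  map_zero := hπ.map_zero
  deriv_aut := hπ.transverse 0 (mem_ball_zero_iff.1 (hVρ h0V))
  tangent x := by
    rw [hπ.hasFDerivAt.fderiv]
    exact Submodule.projectionOntoL_apply_eq_zero_iff hX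
  mapsTo t ht x hx := ⟨hD x (mem_ball_zero_iff.1 (hVρ hx)) t ht,
    mem_ball_zero_iff.2 (hcom x hx t ht).1⟩
  commutes t ht x hx := (hcom x hx t ht).2
  diffeo := hdif
  flow_zero := hϑ0
  flow_add s t hs ht y hy _ := hadd s t hs ht y hy

/-- Existence of a solution, with joint smoothness of the local flow which extends the reduced
semiflow. -/
theorem exists_solution [NormedSpace ℝ X] [IsScalarTower ℝ 𝕜 X] [CompleteSpace X]
    [CompleteSpace X0] {hX : X0.IsTopCompl X1} (hr : (RCLike.I : 𝕜) = 0 ↔ r ≠ ω)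
    {D : Set (ℝ × X)} {φ : ℝ → X → X} {τ ρ : ℝ} (hτ : 0 < τ) {ℓ : ℕ} (hℓ : 1 ≤ ℓ)
    (hℓr : ((ℓ + 1 : ℕ) : WithTop ℕ∞) ≤ r) (hφ : StableSemiflow 𝕜 r φ τ ρ)
    (hD : ∀ x, ‖x‖ < ρ → ∀ t, 0 ≤ t → (t, x) ∈ D) {G : X0 →L[𝕜] X0}
    (hG : IsSlowLinearization hX φ G)
    (hs : SlowSplitting hX (fderiv 𝕜 (φ τ) 0) (expGroup G τ) ℓ) :
    ∃ (U V : Set X) (π : X → X0) (ϑ : ℝ → X0 → X0),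
      IsSolution X0 X1 D φ r U V π ϑ ∧ IsSubmersionOn (𝕜 := 𝕜) π U ∧
      (∀ k : WithTop ℕ∞, k ≤ r →
        ContDiffOn ℝ k (fun p : ℝ × X0 => φ p.1 (p.2 : X)) {p : ℝ × X0 | (p.1, (p.2 : X)) ∈ D} →
        ∃ (E : Set (ℝ × X0)) (Θ : ℝ → X0 → X0),
          IsLocalFlowExtension (π '' V) ϑ E Θ ∧
          ContDiffOn ℝ k (fun p : ℝ × X0 => Θ p.1 p.2) E) ∧
      (r ≠ ω → FiniteDimensional 𝕜 X0 →
        (∀ y : X0, ContinuousOn (fun t : ℝ => φ t (y : X)) {t : ℝ | (t, (y : X)) ∈ D}) →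
        ∃ (E : Set (ℝ × X0)) (Θ : ℝ → X0 → X0),
          IsLocalFlowExtension (π '' V) ϑ E Θ ∧
          ContDiffOn ℝ r (fun p : ℝ × X0 => Θ p.1 p.2) E) := by
  have hr1 : (1 : WithTop ℕ∞) ≤ r := le_trans (by exact_mod_cast Nat.le_add_left 1 ℓ) hℓr
  obtain ⟨π, h, s, ρ', δ, hρ', hρ'ρ, hπ, -⟩ := exists_isSlowFibration hτ hℓ hℓr hφ
    (hφ.hasFDerivAt_zero hr1 hτ.le) hs le_rfl hs.nonresonant
  have hφ' := hφ.mono hρ' hρ'ρ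
  have hD' : ∀ x, ‖x‖ < ρ' → ∀ t, 0 ≤ t → (t, x) ∈ D := fun x hx => hD x (hx.trans_le hρ'ρ)
  obtain ⟨δ0, hδ0, hcom⟩ := hπ.exists_commutes hτ hℓ hℓr hφ' hG hs
  obtain ⟨ρ2, hred, hρ2δ, hρ2⟩ := hπ.exists_reducedFlow hτ hℓ hℓr hφ' hG hs
  set ϑ : ℝ → X0 → X0 := fun t y => π (φ t (s y)) with hϑ
  obtain ⟨ε, hε, hclose⟩ := hred.fderiv_close (1 / 4) (by norm_num)
  obtain ⟨P, hP, hPε, hPρ, ⟨δ1, hδ1, hδ1P⟩, a, ha, δ2, hδ2, hδ2P⟩ :=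
    hred.exists_injSemiflow hr1 hε
  obtain ⟨δ3, hδ3, hπ3⟩ := hπ.exists_small (lt_min hδ1 hδ2)
  set V := Metric.ball (0 : X) (min (min δ0 δ3) ρ') with hV
  have hV0 : ∀ x ∈ V, ‖x‖ < δ0 := fun x hx =>
    (mem_ball_zero_iff.1 hx).trans_le ((min_le_left _ _).trans (min_le_left _ _))
  have hπV : ∀ y ∈ π '' V, ‖y‖ < min δ1 δ2 := by
    rintro _ ⟨x, hx, rfl⟩
    exact hπ3 x ((mem_ball_zero_iff.1 hx).trans_le ((min_le_left _ _).trans (min_le_right _ _)))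
  have hVP : π '' V ⊆ P := fun y hy =>
    hδ1P (mem_ball_zero_iff.2 ((hπV y hy).trans_le (min_le_left _ _)))
  have hVa : π '' V ⊆ ϑ a '' P := fun y hy =>
    hδ2P (mem_ball_zero_iff.2 ((hπV y hy).trans_le (min_le_right _ _)))
  have hext := hP.isLocalFlowExtension ha hVa
  have hP2 : ∀ y ∈ P, ‖y‖ < ρ2 := fun y hy => mem_ball_zero_iff.1 (hPρ hy)
  refine ⟨Metric.ball 0 ρ', V, π, ϑ, hπ.isSolution hr hD' Metric.isOpen_ball
    (Metric.mem_ball_self (by positivity)) (Metric.ball_subset_ball (min_le_right _ _))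
    (fun x hx => hcom x (hV0 x hx)) (fun t ht => (hP.diffeo t ht).isCbDiffeoOn hr hP.isOpen hVP)
    (fun y hy => hP.map_zero y (hVP hy)) fun s t hs ht y hy => hP.map_add s t hs ht y (hVP hy),
    isSubmersionOn_of_transverse fun x hx => hπ.transverse x (mem_ball_zero_iff.1 hx),
    fun k hk hφk => ⟨_, _, hext, hP.localFlow_contDiffOn hr hk ?_⟩,
    fun hω hfin hφc => ⟨_, _, hext, hP.localFlow_contDiffOn hr le_rfl ?_⟩⟩
  · have hs1 : ContDiffOn ℝ k s (Metric.ball 0 δ) :=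
      ((hπ.section_smooth.contDiffOn hr Metric.isOpen_ball).restrict_scalars ℝ).of_le hk
    have hπ1 : ContDiffOn ℝ k π (Metric.ball 0 ρ') :=
      ((hπ.smooth.contDiffOn hr Metric.isOpen_ball).restrict_scalars ℝ).of_le hk
    have hs2 : ContDiffOn ℝ k (fun p : ℝ × X0 => (p.1, s p.2)) (Ioi 0 ×ˢ P) :=
      contDiff_fst.contDiffOn.prodMk (hs1.comp contDiff_snd.contDiffOn fun p hp =>
        mem_ball_zero_iff.2 ((hP2 _ hp.2).trans_le hρ2δ))
    have h1 : ContDiffOn ℝ k (fun p : ℝ × X0 => φ p.1 (s p.2)) (Ioi 0 ×ˢ P) :=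
      hφk.comp hs2 fun p hp => hD' _ (hρ2 _ (hP2 _ hp.2)).1 _ (le_of_lt hp.1)
    exact hπ1.comp h1 fun p hp => mem_ball_zero_iff.2
      ((hρ2 _ (hP2 _ hp.2)).2 _ (le_of_lt hp.1))
  · have hfinR : FiniteDimensional ℝ X0 := FiniteDimensional.trans ℝ 𝕜 X0
    obtain ⟨t0, ht0, ht01, hexp⟩ : ∃ t0 > 0, t0 ≤ 1 ∧ ∀ t ∈ Icc (0 : ℝ) t0,
        ‖(expGroup G t : X0 →L[𝕜] X0) - ContinuousLinearMap.id 𝕜 X0‖ ≤ 1 / 4 := by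
      have h0 : (expGroup G 0 : X0 →L[𝕜] X0) = ContinuousLinearMap.id 𝕜 X0 :=
        ContinuousLinearMap.ext fun y => expGroup_zero G y
      have h1 : Tendsto (fun t => ‖(expGroup G t : X0 →L[𝕜] X0) - ContinuousLinearMap.id 𝕜 X0‖)
          (𝓝 0) (𝓝 0) :=
        ((continuous_expGroup G).sub continuous_const).norm.tendsto' 0 0 (by simp [h0])
      obtain ⟨ε', hε', h2⟩ := Metric.eventually_nhds_iff.1
        (h1.eventually_lt_const (show (0 : ℝ) < 1 / 4 by norm_num))
      refine ⟨min (ε' / 2) 1, by positivity, min_le_right _ _, fun t ht => (h2 ?_).le⟩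
      rw [Real.dist_eq, sub_zero, abs_of_nonneg ht.1]
      exact (ht.2.trans (min_le_left _ _)).trans_lt (by linarith)
    have hsm : ∀ n : ℕ, (n : WithTop ℕ∞) ≤ r → ∀ t, 0 ≤ t → ContDiffOn ℝ n (ϑ t) P :=
      fun n hn t ht => ((hP.diffeo t ht).smooth n hn).1.restrict_scalars ℝ
    have hcon : ∀ y ∈ P, ContinuousOn (fun t => ϑ t y) (Ici 0) := by
      intro y hy
      have h1 : ContinuousOn (fun t : ℝ => φ t (s y)) (Ici 0) :=
        (hφc (s y)).mono fun t ht => hD' _ (hρ2 _ (hP2 _ hy)).1 _ ht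
      exact (hπ.smooth 0 (by simp)).1.continuousOn.comp h1 fun t ht =>
        mem_ball_zero_iff.2 ((hρ2 _ (hP2 _ hy)).2 t ht)
    have hcl : ∀ t ∈ Icc 0 t0, ∀ y ∈ P,
        ‖fderiv ℝ (ϑ t) y - ContinuousLinearMap.id ℝ X0‖ ≤ 1 / 2 := by
      intro t ht y hy
      obtain ⟨e, he⟩ := (hP.diffeo t ht.1).invertible y hy
      have h1 : fderiv ℝ (ϑ t) y = (fderiv 𝕜 (ϑ t) y).restrictScalars ℝ :=
        (he.differentiableAt.hasFDerivAt.restrictScalars ℝ).fderiv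
      have h2 : fderiv ℝ (ϑ t) y - ContinuousLinearMap.id ℝ X0 =
          (fderiv 𝕜 (ϑ t) y - ContinuousLinearMap.id 𝕜 X0).restrictScalars ℝ := by
        rw [h1]
        rfl
      rw [h2, ContinuousLinearMap.norm_restrictScalars]
      calc _ = ‖(fderiv 𝕜 (ϑ t) y - expGroup G t) +
            ((expGroup G t : X0 →L[𝕜] X0) - ContinuousLinearMap.id 𝕜 X0)‖ := by
            rw [sub_add_sub_cancel]
        _ ≤ 1 / 4 + 1 / 4 := (norm_add_le _ _).trans (add_le_add
            (hclose t ⟨ht.1, ht.2.trans ht01⟩ y (mem_ball_zero_iff.1 (hPε hy))) (hexp t ht))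
        _ = 1 / 2 := by norm_num
    have hjoint : ∀ n : ℕ, n ≠ 0 → (n : WithTop ℕ∞) ≤ r →
        ContDiffOn ℝ n (fun p : ℝ × X0 => ϑ p.1 p.2) (Ioi 0 ×ˢ P) := fun n hn hnr =>
      contDiffOn_joint hn hP.isOpen hP.map_zero hP.map_add hP.invariant (hsm n hnr) hcon ht0 hcl
    obtain ⟨r', rfl⟩ := WithTop.ne_top_iff_exists.1 hω
    refine contDiffOn_iff_forall_nat_le.2 fun n hn => ?_
    rcases Nat.eq_zero_or_pos n with rfl | hn0
    · exact (hjoint 1 one_ne_zero (by simpa using hr1)).of_le (by simp)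
    · exact hjoint n hn0.ne' (by exact_mod_cast hn)

lemma isCbNatDiffeo_equiv [CompleteSpace X0] (e : X0 ≃L[𝕜] X0) {N : Set X0} (hN : IsOpen N)
    (hb : Bornology.IsBounded N) : IsCbNatDiffeo 𝕜 r e N where
  smooth := cbNat_clm (e : X0 →L[𝕜] X0) hN hb
  isOpen_image := e.toHomeomorph.isOpenMap N hN
  invertible _ _ := ⟨e, (e : X0 →L[𝕜] X0).hasFDerivAt⟩
  inverse := ⟨e.symm, cbNat_clm (e.symm : X0 →L[𝕜] X0) (e.toHomeomorph.isOpenMap N hN)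
    ((e : X0 →L[𝕜] X0).lipschitz.isBounded_image hb), fun x _ => e.symm_apply_apply x⟩

/-- Existence of a solution with linear reduced dynamics, if there are no resonances on `X₀`. -/
theorem exists_linear_solution [NormedSpace ℝ X] [IsScalarTower ℝ 𝕜 X] [CompleteSpace X]
    [CompleteSpace X0] {hX : X0.IsTopCompl X1} (hr : (RCLike.I : 𝕜) = 0 ↔ r ≠ ω)
    {D : Set (ℝ × X)} {φ : ℝ → X → X} {τ ρ : ℝ} (hτ : 0 < τ) {ℓ : ℕ} (hℓ : 1 ≤ ℓ)
    (hℓr : ((ℓ + 1 : ℕ) : WithTop ℕ∞) ≤ r) (hφ : StableSemiflow 𝕜 r φ τ ρ)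
    (hD : ∀ x, ‖x‖ < ρ → ∀ t, 0 ≤ t → (t, x) ∈ D) {G : X0 →L[𝕜] X0}
    (hG : IsSlowLinearization hX φ G)
    (hs : SlowSplitting hX (fderiv 𝕜 (φ τ) 0) (expGroup G τ) ℓ)
    (hnr0 : ∀ n, 2 ≤ n → n ≤ ℓ → BlockNonresonant hX (fderiv 𝕜 (φ τ) 0)
      (diagBlock hX (fderiv 𝕜 (φ τ) 0)) n 0)
    (hnrs : ∀ n : ℕ, 2 ≤ n → n ≤ ℓ → cSpectrum 𝕜 (diagBlock hX (fderiv 𝕜 (φ τ) 0)) ^ n ∩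
      cSpectrum 𝕜 (diagBlock hX (fderiv 𝕜 (φ τ) 0)) = ∅) :
    ∃ (U V : Set X) (π : X → X0),
      IsSolution X0 X1 D φ r U V π (fun t y => expGroup G t y) ∧
        IsSubmersionOn (𝕜 := 𝕜) π U := by
  have hr1 : (1 : WithTop ℕ∞) ≤ r := le_trans (by exact_mod_cast Nat.le_add_left 1 ℓ) hℓr
  obtain ⟨π, h, s, ρ', δ, hρ', hρ'ρ, hπ, hlin⟩ := exists_isSlowFibration hτ hℓ hℓr hφ
    (hφ.hasFDerivAt_zero hr1 hτ.le) hs zero_le_one hnr0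
  have hφ' := hφ.mono hρ' hρ'ρ
  have hD' : ∀ x, ‖x‖ < ρ' → ∀ t, 0 ≤ t → (t, x) ∈ D := fun x hx => hD x (hx.trans_le hρ'ρ)
  obtain ⟨δ0, hδ0, hcom⟩ := hπ.exists_commutes hτ hℓ hℓr hφ' hG hs
  obtain ⟨ρ2, hred, hρ2δ, hρ2⟩ := hπ.exists_reducedFlow hτ hℓ hℓr hφ' hG hs
  set ϑ : ℝ → X0 → X0 := fun t y => π (φ t (s y)) with hϑ
  have hϑτ : ∀ y, ‖y‖ < ρ2 → ϑ τ y = expGroup G τ y := by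
    intro y hy
    rw [← hlin rfl, hϑ]
    simp only
    rw [hπ.semiconj (s y : X) (hρ2 y hy).1, (hπ.section_right y (hy.trans_le hρ2δ)).2]
  -- the reduced maps commute with `exp(τG)`, so their germs are linear
  have hgerm : ∀ t, 0 ≤ t → ϑ t =ᶠ[𝓝 0] (expGroup G t : X0 →L[𝕜] X0) := by
    intro t ht
    obtain ⟨δ1, hδ1, hst⟩ := hred.stable ρ2 hred.pos
    refine eventuallyEq_linear_of_commute hℓ (expGroup G τ) hs.decay_block hs.gap_block
      (by rw [hs.block]; exact hnrs)
      ((hred.smooth t ht).contDiffAt Metric.isOpen_ball (Metric.mem_ball_self hred.pos) hℓr)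
      (hred.map_fixed t ht) ?_ ?_
    · have h1 : HasFDerivAt (fun y : X0 => φ t y) ((fderiv 𝕜 (φ t) 0) ∘L X0.subtypeL) (s 0) := by
        rw [hπ.section_zero]
        exact HasFDerivAt.comp (0 : X0) (g := φ t) (f := X0.subtypeL)
          (by simpa using hφ.hasFDerivAt_zero hr1 ht) X0.subtypeL.hasFDerivAt
      have h2 : HasFDerivAt π (X0.projectionOntoL X1 hX) (φ t (s 0)) := by
        rw [hπ.section_zero, ZeroMemClass.coe_zero, hφ.map_fixed t ht]
        exact hπ.hasFDerivAt
      have h3 : HasFDerivAt (ϑ t) ((X0.projectionOntoL X1 hX) ∘L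
          ((fderiv 𝕜 (φ t) 0) ∘L X0.subtypeL) ∘L ContinuousLinearMap.id 𝕜 X0) 0 :=
        HasFDerivAt.comp (0 : X0) (g := π) h2 (HasFDerivAt.comp (0 : X0)
          (g := fun y : X0 => φ t y) h1 hπ.section_hasFDerivAt)
      rw [hG.block t ht]
      exact h3
    · filter_upwards [Metric.ball_mem_nhds (0 : X0) (lt_min hδ1 hred.pos)] with z hz
      rw [mem_ball_zero_iff, lt_min_iff] at hz
      have h1 := hst z hz.1
      rw [← hϑτ z hz.2, ← hϑτ _ (h1 t ht), ← hred.map_add τ t z hτ.le ht hz.2 (h1 τ hτ.le),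
        add_comm, hred.map_add t τ z ht hτ.le hz.2 (h1 t ht)]
  obtain ⟨δ3, hδ3, hπ3⟩ := hπ.exists_small (zero_lt_one (α := ℝ))
  set V := Metric.ball (0 : X) (min (min δ0 δ3) ρ') with hV
  have hV0 : ∀ x ∈ V, ‖x‖ < δ0 := fun x hx =>
    (mem_ball_zero_iff.1 hx).trans_le ((min_le_left _ _).trans (min_le_left _ _))
  have hπV : π '' V ⊆ Metric.ball 0 1 := by
    rintro _ ⟨x, hx, rfl⟩
    exact mem_ball_zero_iff.2 (hπ3 x ((mem_ball_zero_iff.1 hx).trans_le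
      ((min_le_left _ _).trans (min_le_right _ _))))
  refine ⟨Metric.ball 0 ρ', V, π, hπ.isSolution hr hD' Metric.isOpen_ball
    (Metric.mem_ball_self (by positivity)) (Metric.ball_subset_ball (min_le_right _ _))
    (fun x hx t ht => ⟨(hcom x (hV0 x hx) t ht).1, ?_⟩)
    (fun t _ => (isCbNatDiffeo_equiv (expGroup G t) Metric.isOpen_ball
      Metric.isBounded_ball).isCbDiffeoOn hr Metric.isOpen_ball hπV)
    (fun y _ => expGroup_zero G y) fun s t _ _ y _ => expGroup_add G s t y,
    isSubmersionOn_of_transverse fun x hx => hπ.transverse x (mem_ball_zero_iff.1 hx)⟩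
  refine linear_reduction hτ hφ' (e := expGroup G τ) (M := expGroup G t)
    (fun x hx => by rw [hπ.semiconj x hx, hlin rfl]) ht (fun z => ?_) ?_
    fun t ht => (hcom x (hV0 x hx) t ht).1
  · show expGroup G t (expGroup G τ z) = expGroup G τ (expGroup G t z)
    rw [← expGroup_add, add_comm, expGroup_add]
  · have h1 : Tendsto π (𝓝 0) (𝓝 0) := by
      simpa [hπ.map_zero] using hπ.hasFDerivAt.continuousAt.tendsto
    filter_upwards [hπ.eventually_fibre hτ hℓ hℓr hφ' hG hs ht, h1.eventually (hgerm t ht)]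
      with x hx hx'
    exact hx.trans hx'

end

end SlowFoliation

/-! ### Uniqueness of solutions -/

namespace SlowFoliation

noncomputable section

open Asymptotics

universe u

variable {𝕜 : Type*} [RCLike 𝕜] {X : Type u} [NormedAddCommGroup X]
  [NormedSpace 𝕜 X] {X0 X1 : Submodule 𝕜 X} {k : WithTop ℕ∞}

section

variable {D : Set (ℝ × X)} {φ : ℝ → X → X} {U V : Set X} {π : X → X0} {ϑ : ℝ → X0 → X0}

/-- The kernel condition on `Dπ(0)` forces it to factor through the projection onto `X₀`. -/
lemma isSolution_exists_hasFDerivAt (hX : X0.IsTopCompl X1) (hk1 : 1 ≤ k)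
    (h : IsSolution X0 X1 D φ k U V π ϑ) :
    ∃ C : X0 ≃L[𝕜] X0, HasFDerivAt π ((C : X0 →L[𝕜] X0) ∘L X0.projectionOntoL X1 hX) 0 := by
  obtain ⟨C, hC⟩ := h.deriv_aut
  have h1 : HasFDerivAt π (fderiv 𝕜 π 0) 0 :=
    (((h.smooth.1.of_le hk1).contDiffAt (h.isOpen_U.mem_nhds (h.subset h.zero_mem))
      ).differentiableAt one_ne_zero).hasFDerivAt
  refine ⟨C, h1.congr_fderiv (ContinuousLinearMap.ext fun x => ?_)⟩
  have e := congrArg (fun L : X →L[𝕜] X => L x) (Submodule.projectionL_add_projectionL_eq_id hX)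
  have e' : x = X0.projectionL X1 hX x + X1.projectionL X0 hX.symm x := by simpa using e.symm
  conv_lhs => rw [e', map_add, (h.tangent _).2 (Submodule.projectionL_apply_mem hX.symm x),
    add_zero]
  exact congrArg (fun L : X0 →L[𝕜] X0 => L (X0.projectionOntoL X1 hX x)) hC

lemma isSolution_exists_cbNat (hk : (RCLike.I : 𝕜) = 0 ↔ k ≠ ω)
    (h : IsSolution X0 X1 D φ k U V π ϑ) : ∃ δ > 0, CbNat 𝕜 k π (Metric.ball 0 δ) := by
  obtain ⟨ε, hε, hεU⟩ := Metric.isOpen_iff.1 h.isOpen_U 0 (h.subset h.zero_mem)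
  exact ⟨ε / 2, half_pos hε, cbNat_ball_of_cbOn hk h.isOpen_U h.smooth (half_pos hε)
    (by rwa [mul_div_cancel₀ _ two_ne_zero])⟩

/-- Near `0`, the maps `ϑ_t` with `t ≥ 0` can be inverted. -/
lemma isSolution_eventually_exists_preimage (h : IsSolution X0 X1 D φ k U V π ϑ) {t : ℝ}
    (ht : 0 ≤ t) (hfix : φ t 0 = 0) {M : Set X0} (hM : M ∈ 𝓝 0) :
    ∀ᶠ y in 𝓝 0, ∃ z ∈ M, ϑ t z = y := by
  obtain ⟨N, hN, hVN, hϑ, hNo, g, hg, hgϑ⟩ := h.diffeo t ht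
  have h0V : (0 : X0) ∈ π '' V := ⟨0, h.zero_mem, h.map_zero⟩
  have hϑ0 : ϑ t 0 = 0 := by
    have := h.commutes t ht 0 h.zero_mem
    rwa [hfix, h.map_zero, eq_comm] at this
  have h0 : (0 : X0) ∈ ϑ t '' N := ⟨0, hVN h0V, hϑ0⟩
  have hg0 : g 0 = 0 := by
    have := hgϑ 0 (hVN h0V)
    rwa [hϑ0] at this
  have hgc : Tendsto g (𝓝 0) (𝓝 0) := by
    have := (hg.1.continuousOn.continuousAt (hNo.mem_nhds h0)).tendsto
    rwa [hg0] at this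
  filter_upwards [hNo.mem_nhds h0, hgc hM] with y hy hyM
  obtain ⟨z, hz, rfl⟩ := hy
  rw [mem_preimage, hgϑ z hz] at hyM
  exact ⟨z, hyM, rfl⟩

/-- The derivative at `0` of a linear reduced map. -/
lemma isSolution_linear_eq {hX : X0.IsTopCompl X1} (h : IsSolution X0 X1 D φ k U V π ϑ) {τ : ℝ}
    (hτ : 0 ≤ τ) (hfix : φ τ 0 = 0) {A : X →L[𝕜] X} (hA : HasFDerivAt (φ τ) A 0)
    {e C : X0 ≃L[𝕜] X0} (he : (e : X0 →L[𝕜] X0) = diagBlock hX A)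
    (hπd : HasFDerivAt π ((C : X0 →L[𝕜] X0) ∘L X0.projectionOntoL X1 hX) 0)
    {L : X0 →L[𝕜] X0} (hL : EqOn (ϑ τ) L (π '' V)) (z : X0) : L (C z) = C (e z) := by
  have h1 : HasFDerivAt (fun x => π (φ τ x))
      (((C : X0 →L[𝕜] X0) ∘L X0.projectionOntoL X1 hX) ∘L A) 0 :=
    HasFDerivAt.comp (0 : X) (g := π) (by rwa [hfix]) hA
  have h2 : HasFDerivAt (fun x => L (π x))
      (L ∘L ((C : X0 →L[𝕜] X0) ∘L X0.projectionOntoL X1 hX)) 0 :=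
    L.hasFDerivAt.comp (0 : X) hπd
  have h3 : (fun x => π (φ τ x)) =ᶠ[𝓝 0] fun x => L (π x) := by
    filter_upwards [h.isOpen_V.mem_nhds h.zero_mem] with x hx
    rw [h.commutes τ hτ x hx, hL (mem_image_of_mem π hx)]
  have h4 := congrArg (fun T : X →L[𝕜] X0 => T (z : X)) (h1.unique (h2.congr_of_eventuallyEq h3))
  have h5 : X0.projectionOntoL X1 hX (A z) = e z :=
    (congrArg (fun T : X0 →L[𝕜] X0 => T z) he).symm
  simp only [ContinuousLinearMap.coe_comp, Function.comp_apply, h5,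
    Submodule.projectionOntoL_apply_left] at h4
  exact h4.symm

end

/-- Two solutions differ by a unique germ of a diffeomorphism. -/
theorem solution_unique [NormedSpace ℝ X] [IsScalarTower ℝ 𝕜 X] [CompleteSpace X]
    [CompleteSpace X0] {hX : X0.IsTopCompl X1} {r : WithTop ℕ∞}
    {D : Set (ℝ × X)} {φ : ℝ → X → X} {τ ρ : ℝ} (hτ : 0 < τ) {ℓ : ℕ} (hℓ : 1 ≤ ℓ)
    (hℓr : ((ℓ + 1 : ℕ) : WithTop ℕ∞) ≤ r) (hφ : StableSemiflow 𝕜 r φ τ ρ)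
    {e : X0 ≃L[𝕜] X0} (hs : SlowSplitting hX (fderiv 𝕜 (φ τ) 0) e ℓ)
    (hk : (RCLike.I : 𝕜) = 0 ↔ k ≠ ω) (hℓk : ((ℓ + 1 : ℕ) : WithTop ℕ∞) ≤ k)
    {U V : Set X} {π : X → X0} {ϑ : ℝ → X0 → X0} {U' V' : Set X} {π' : X → X0}
    {ϑ' : ℝ → X0 → X0} (h : IsSolution X0 X1 D φ k U V π ϑ)
    (h' : IsSolution X0 X1 D φ k U' V' π' ϑ') :
    ∃ (θ : X0 → X0) (N : Set X0),
      IsOpen N ∧ (0 : X0) ∈ N ∧ θ 0 = 0 ∧ IsCbDiffeoOn 𝕜 k θ N ∧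
      (∃ W : Set X, IsOpen W ∧ (0 : X) ∈ W ∧ W ⊆ U ∩ U' ∧
        ∀ x ∈ W, π x ∈ N ∧ π' x = θ (π x)) ∧
      (∃ M : Set X0, IsOpen M ∧ (0 : X0) ∈ M ∧ M ⊆ N ∩ π '' V ∧ θ '' M ⊆ π' '' V' ∧
        ∀ t, 0 ≤ t → ∀ y ∈ M, ϑ t y ∈ N ∧ ϑ' t (θ y) = θ (ϑ t y)) ∧
      (∀ (E E' : Set (ℝ × X0)) (Θ Θ' : ℝ → X0 → X0),
        IsLocalFlowExtension (π '' V) ϑ E Θ → IsLocalFlowExtension (π' '' V') ϑ' E' Θ' →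
        ∀ t : ℝ, ∀ᶠ y in 𝓝 (0 : X0), (t, y) ∈ E ∧ (t, θ y) ∈ E' ∧ Θ t y ∈ N ∧
          Θ' t (θ y) = θ (Θ t y)) ∧
      (∀ θ' : X0 → X0, (∀ᶠ x in 𝓝 (0 : X), π' x = θ' (π x)) → θ' =ᶠ[𝓝 0] θ) ∧
      ((∀ n : ℕ, 2 ≤ n → n ≤ ℓ → cSpectrum 𝕜 (e : X0 →L[𝕜] X0) ^ n ∩
          cSpectrum 𝕜 (e : X0 →L[𝕜] X0) = ∅) →
        (∀ t, 0 ≤ t → ∃ L : X0 →L[𝕜] X0, EqOn (ϑ t) L (π '' V)) →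
        (∀ t, 0 ≤ t → ∃ L : X0 →L[𝕜] X0, EqOn (ϑ' t) L (π' '' V')) →
        ∃ L : X0 ≃L[𝕜] X0, θ =ᶠ[𝓝 0] L) := by
  have hk1 : (1 : WithTop ℕ∞) ≤ k := le_trans (by exact_mod_cast Nat.le_add_left 1 ℓ) hℓk
  have hr1 : (1 : WithTop ℕ∞) ≤ r := le_trans (by exact_mod_cast Nat.le_add_left 1 ℓ) hℓr
  obtain ⟨C, hC⟩ := isSolution_exists_hasFDerivAt hX hk1 h
  obtain ⟨C', hC'⟩ := isSolution_exists_hasFDerivAt hX hk1 h'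
  obtain ⟨δ1, hδ1, hπ1⟩ := isSolution_exists_cbNat hk h
  obtain ⟨δ2, hδ2, hπ2⟩ := isSolution_exists_cbNat hk h'
  set δ12 := min δ1 δ2 with hδ12
  have hδ12p : 0 < δ12 := lt_min hδ1 hδ2
  have hd := hφ.hasFDerivAt_zero hr1 hτ.le
  obtain ⟨s, δ3, hδ3, hs3, hs0, hsd, hsright, hsleft⟩ := exists_section_ball hX hk1 hδ12p
    (hπ1.mono (Metric.ball_subset_ball (min_le_left _ _))) h.map_zero hC
  set θ : X0 → X0 := fun y => π' (s y) with hθ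
  have hθ0 : θ 0 = 0 := by
    rw [hθ]
    simp only [hs0, ZeroMemClass.coe_zero, h'.map_zero]
  have hθ3 : CbNat 𝕜 k θ (Metric.ball 0 δ3) := by
    have h1 : CbNat 𝕜 k (fun y : X0 => π' y) (Metric.ball 0 δ12) :=
      hπ2.comp Metric.isOpen_ball Metric.isOpen_ball
        (cbNat_clm X0.subtypeL Metric.isOpen_ball Metric.isBounded_ball) fun y hy => by
          rw [mem_ball_zero_iff] at hy ⊢
          exact hy.trans_le (min_le_right _ _)
    exact h1.comp Metric.isOpen_ball Metric.isOpen_ball hs3 fun y hy =>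
      mem_ball_zero_iff.2 (hsright y (mem_ball_zero_iff.1 hy)).1
  have hθd : HasFDerivAt θ ((C.symm.trans C' : X0 ≃L[𝕜] X0) : X0 →L[𝕜] X0) 0 := by
    have h1 : HasFDerivAt (fun y : X0 => π' y) (C' : X0 →L[𝕜] X0) (s 0) := by
      have h2 : HasFDerivAt (fun y : X0 => π' y)
          (((C' : X0 →L[𝕜] X0) ∘L X0.projectionOntoL X1 hX) ∘L X0.subtypeL) (s 0) := by
        rw [hs0]
        exact HasFDerivAt.comp (0 : X0) (g := π') (f := X0.subtypeL) (by simpa using hC')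
          X0.subtypeL.hasFDerivAt
      rwa [ContinuousLinearMap.comp_assoc, projectionOntoL_comp_subtypeL] at h2
    exact HasFDerivAt.comp (0 : X0) (g := fun y : X0 => π' y) h1 hsd
  obtain ⟨δN, hδN, hδN3, hdif⟩ := exists_isCbNatDiffeo_ball hk1 hδ3 hθ3 hθd
  have hright : ∀ᶠ y : X0 in 𝓝 0, π (s y : X) = y := by
    filter_upwards [Metric.ball_mem_nhds (0 : X0) hδ3] with y hy
      using (hsright y (mem_ball_zero_iff.1 hy)).2
  have hV : ∀ᶠ x in 𝓝 (0 : X), x ∈ V := h.isOpen_V.mem_nhds h.zero_mem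
  have hV' : ∀ᶠ x in 𝓝 (0 : X), x ∈ V' := h'.isOpen_V.mem_nhds h'.zero_mem
  have hπθ : ∀ᶠ x in 𝓝 (0 : X), π' x = θ (π x) :=
    semiconjugacy_unique hX hℓ
      ((hφ.smooth τ hτ.le).contDiffAt Metric.isOpen_ball (Metric.mem_ball_self hφ.pos) hℓr)
      (hφ.map_fixed τ hτ.le) hd hs.invariant hs.nonresonant e hs.block hs.decay hs.gap
      (hπ1.contDiffAt Metric.isOpen_ball (Metric.mem_ball_self hδ1) hℓk)
      (hπ2.contDiffAt Metric.isOpen_ball (Metric.mem_ball_self hδ2) hℓk) h.map_zero h'.map_zero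
      hC hC' (hV.mono fun x hx => h.commutes τ hτ.le x hx)
      (hV'.mono fun x hx => h'.commutes τ hτ.le x hx) hs0
      (hs3.contDiffAt Metric.isOpen_ball (Metric.mem_ball_self hδ3) hℓk) hsleft hright
  have hπN : ∀ᶠ x in 𝓝 (0 : X), π x ∈ Metric.ball (0 : X0) δN := by
    have h1 : Tendsto π (𝓝 0) (𝓝 0) := by simpa [h.map_zero] using hC.continuousAt.tendsto
    exact h1 (Metric.ball_mem_nhds 0 hδN)
  obtain ⟨δg, hδg, hgood⟩ := Metric.eventually_nhds_iff.1 ((hV.and hV').and (hπN.and hπθ))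
  have hgood' : ∀ x : X, ‖x‖ < δg → (x ∈ V ∧ x ∈ V') ∧ π x ∈ Metric.ball (0 : X0) δN ∧
      π' x = θ (π x) := fun x hx => hgood (by rwa [dist_zero_right])
  obtain ⟨δs, hδs, hδsg, hst⟩ := hφ.exists_stable_le hδg
  have hsc : Tendsto (fun y : X0 => (s y : X)) (𝓝 0) (𝓝 0) := by
    have h1 : Tendsto s (𝓝 0) (𝓝 0) := by simpa [hs0] using hsd.continuousAt.tendsto
    exact X0.subtypeL.continuous.tendsto' 0 0 (by simp) |>.comp h1
  obtain ⟨δM, hδM, hM⟩ := Metric.eventually_nhds_iff.1 (hright.and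
    ((hsc.eventually (Metric.ball_mem_nhds (0 : X) hδs)).and
      (show ∀ᶠ y : X0 in 𝓝 0, y ∈ Metric.ball (0 : X0) δN from Metric.ball_mem_nhds 0 hδN)))
  set M := Metric.ball (0 : X0) δM with hMdef
  have hM' : ∀ y ∈ M, π (s y : X) = y ∧ ‖(s y : X)‖ < δs ∧ y ∈ Metric.ball (0 : X0) δN :=
    fun y hy => by
      have h1 := hM hy
      exact ⟨h1.1, mem_ball_zero_iff.1 h1.2.1, h1.2.2⟩
  have hMV : ∀ y ∈ M, y ∈ π '' V := fun y hy =>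
    ⟨s y, (hgood' _ ((hM' y hy).2.1.trans_le hδsg)).1.1, (hM' y hy).1⟩
  have hMV' : ∀ y ∈ M, θ y ∈ π' '' V' := fun y hy =>
    ⟨s y, (hgood' _ ((hM' y hy).2.1.trans_le hδsg)).1.2, rfl⟩
  have hconj : ∀ t, 0 ≤ t → ∀ y ∈ M,
      ϑ t y ∈ Metric.ball (0 : X0) δN ∧ ϑ' t (θ y) = θ (ϑ t y) := by
    intro t ht y hy
    obtain ⟨h1, h2, -⟩ := hM' y hy
    have h3 := hgood' _ (h2.trans_le hδsg)
    have h4 := hgood' _ (hst _ h2 t ht)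
    have h5 : ϑ t y = π (φ t (s y)) := by
      rw [h.commutes t ht _ h3.1.1, h1]
    have h6 : ϑ' t (θ y) = π' (φ t (s y)) := by
      rw [h'.commutes t ht _ h3.1.2]
    rw [h6, h5]
    exact h4.2
  have hM0 : M ∈ 𝓝 (0 : X0) := Metric.ball_mem_nhds 0 hδM
  refine ⟨θ, Metric.ball 0 δN, Metric.isOpen_ball, Metric.mem_ball_self hδN, hθ0,
    hdif.isCbDiffeoOn hk Metric.isOpen_ball Subset.rfl,
    ⟨Metric.ball 0 δg, Metric.isOpen_ball, Metric.mem_ball_self hδg, fun x hx => ?_,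
      fun x hx => (hgood' x (mem_ball_zero_iff.1 hx)).2⟩,
    ⟨M, Metric.isOpen_ball, Metric.mem_ball_self hδM, fun y hy => ⟨(hM' y hy).2.2, hMV y hy⟩,
      ?_, hconj⟩, fun E E' Θ Θ' hE hE' t => ?_, fun θ' hθ' => ?_, fun hnrs hlin hlin' => ?_⟩
  · have h1 := (hgood' x (mem_ball_zero_iff.1 hx)).1
    exact ⟨h.subset h1.1, h'.subset h1.2⟩
  · rintro _ ⟨y, hy, rfl⟩
    exact hMV' y hy
  · rcases le_or_gt 0 t with ht | ht
    · filter_upwards [hM0] with y hy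
      have h1 := hE.forward t ht y (hMV y hy)
      have h2 := hE'.forward t ht _ (hMV' y hy)
      rw [h1.2, h2.2]
      exact ⟨h1.1, h2.1, hconj t ht y hy⟩
    · -- for negative times, start from the point `z` with `ϑ_{-t}(z) = y`
      obtain ⟨u, rfl⟩ : ∃ u, t = -u := ⟨-t, (neg_neg t).symm⟩
      have hu : 0 ≤ u := by linarith
      have hback : ∀ {S : Set X0} {ϑ : ℝ → X0 → X0} {E : Set (ℝ × X0)} {Θ : ℝ → X0 → X0},
          IsLocalFlowExtension S ϑ E Θ → ∀ z ∈ S, Θ (-u) (ϑ u z) = z := by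
        intro S ϑ E Θ hE z hz
        have h1 := hE.forward u hu z hz
        have h2 := hE.backward u hu z hz
        have h3 := (hE.forward 0 le_rfl z hz).1
        have h4 := hE.map_add u (-u) z h1.1 (by rwa [h1.2]) (by rwa [neg_add_cancel])
        rw [neg_add_cancel, hE.map_zero z h3, h1.2] at h4
        exact h4.symm
      filter_upwards [isSolution_eventually_exists_preimage h hu (hφ.map_fixed u hu) hM0] with y hy
      obtain ⟨z, hz, rfl⟩ := hy
      rw [← (hconj u hu z hz).2, hback hE z (hMV z hz), hback hE' _ (hMV' z hz)]
      exact ⟨hE.backward u hu z (hMV z hz), hE'.backward u hu _ (hMV' z hz), (hM' z hz).2.2, rfl⟩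
  · filter_upwards [hsc.eventually hθ', hright] with y hy hy'
    rw [hy'] at hy
    exact hy.symm
  · obtain ⟨L, hL⟩ := hlin τ hτ.le
    obtain ⟨L', hL'⟩ := hlin' τ hτ.le
    have hLC := isSolution_linear_eq h hτ.le (hφ.map_fixed τ hτ.le) hd hs.block hC hL
    have hLC' := isSolution_linear_eq h' hτ.le (hφ.map_fixed τ hτ.le) hd hs.block hC' hL'
    have hCt : Tendsto C (𝓝 0) (𝓝 0) := C.continuous.tendsto' 0 0 (map_zero C)
    have hη : (fun z => C'.symm (θ (C z))) =ᶠ[𝓝 0] ContinuousLinearMap.id 𝕜 X0 := by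
      refine eventuallyEq_linear_of_commute hℓ e hs.decay_block hs.gap_block hnrs ?_ ?_ ?_ ?_
      · have h1 : ContDiffAt 𝕜 (ℓ + 1 : ℕ) θ (C 0) := by
          rw [map_zero]
          exact hθ3.contDiffAt Metric.isOpen_ball (Metric.mem_ball_self hδ3) hℓk
        exact (C'.symm : X0 →L[𝕜] X0).contDiff.contDiffAt.comp 0
          (h1.comp 0 (C : X0 →L[𝕜] X0).contDiff.contDiffAt)
      · simp only [map_zero, hθ0]
      · have h1 : HasFDerivAt θ ((C.symm.trans C' : X0 ≃L[𝕜] X0) : X0 →L[𝕜] X0) (C 0) := by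
          rwa [map_zero]
        have h2 := (C'.symm : X0 →L[𝕜] X0).hasFDerivAt.comp (0 : X0)
          (h1.comp (0 : X0) (C : X0 →L[𝕜] X0).hasFDerivAt)
        refine h2.congr_fderiv (ContinuousLinearMap.ext fun z => ?_)
        simp
      · filter_upwards [hCt hM0] with z hz
        have h1 := (hconj τ hτ.le (C z) hz).2
        rw [hL (hMV _ hz), hL' (hMV' _ hz), hLC] at h1
        rw [← h1]
        have h2 := hLC' (C'.symm (θ (C z)))
        rw [C'.apply_symm_apply] at h2
        rw [h2, C'.symm_apply_apply]
    refine ⟨C.symm.trans C', ?_⟩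
    have hCs : Tendsto C.symm (𝓝 0) (𝓝 0) := C.symm.continuous.tendsto' 0 0 (map_zero C.symm)
    filter_upwards [hCs.eventually hη] with y hy
    simp only [C.apply_symm_apply, ContinuousLinearMap.coe_id', id_eq] at hy
    rw [ContinuousLinearEquiv.trans_apply, ← hy, C'.apply_symm_apply]

end

end SlowFoliation

/-! ### The spectral conditions and the theorem -/

namespace SlowFoliation

universe u

lemma natCast_succ_le_of_lt {ℓ : ℕ} {r : WithTop ℕ∞} (h : (ℓ : WithTop ℕ∞) < r) :
    ((ℓ + 1 : ℕ) : WithTop ℕ∞) ≤ r := by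
  induction r using WithTop.recTopCoe with
  | top => exact le_top
  | coe r =>
    have h1 : (ℓ : ℕ∞) < r := by exact_mod_cast h
    have h2 : ((ℓ + 1 : ℕ) : ℕ∞) ≤ r := by
      push_cast
      exact Order.add_one_le_of_lt h1
    exact_mod_cast h2

/-- Continuity of the first iterated derivative is continuity of the derivative. -/
lemma continuousWithinAt_fderiv_of_iterated {𝕜 : Type*} [RCLike 𝕜] {P E F : Type*}
    [TopologicalSpace P] [NormedAddCommGroup E] [NormedSpace 𝕜 E] [NormedAddCommGroup F]
    [NormedSpace 𝕜 F] {f : P → E → F} {g : P → E} {S : Set P} {p : P}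
    (h : ContinuousWithinAt (fun p => iteratedFDeriv 𝕜 1 (f p) (g p)) S p) :
    ContinuousWithinAt (fun p => fderiv 𝕜 (f p) (g p)) S p := by
  have h1 : (fun p => fderiv 𝕜 (f p) (g p)) = fun p =>
      continuousMultilinearCurryFin1 𝕜 E F (iteratedFDeriv 𝕜 1 (f p) (g p)) := by
    funext p
    ext v
    simp [iteratedFDeriv_one_apply]
  rw [h1]
  exact (continuousMultilinearCurryFin1 𝕜 E F).continuous.continuousAt.comp_continuousWithinAt h

end SlowFoliation

theorem theorem2p5 {𝕜 : Type*} [RCLike 𝕜]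
    {X : Type*} [NormedAddCommGroup X] [NormedSpace ℝ X] [NormedSpace 𝕜 X] [IsScalarTower ℝ 𝕜 X]
    [CompleteSpace X]
    -- the smoothness class: `r ∈ ℕ ∪ {∞}` if `X` is real, `r = ω` if `X` is complex
    (r : WithTop ℕ∞) (hr : (RCLike.I : 𝕜) = 0 ↔ r ≠ ω)
    -- the local semiflow, with a Lyapunov stable fixed point at `0`
    (D : Set (ℝ × X)) (φ : ℝ → X → X) (hφ : IsLocalSemiflow D φ)
    (hstable : IsLyapunovStableZero D φ)
    (O : Set X) (hO : IsOpen O) (h0O : (0 : X) ∈ O)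
    (hsmooth : ∀ t, 0 ≤ t → CbOn 𝕜 r (φ t) ({x | (t, x) ∈ D} ∩ O))
    -- the splitting into closed subspaces and the linearized semiflow
    (X0 X1 : Submodule 𝕜 X) (hX : X0.IsTopCompl X1)
    (hT : IsC0Semigroup (fun t => fderiv 𝕜 (φ t) 0))
    (hdom : (X0 : Set X) ⊆ generatorDomain (fun t => fderiv 𝕜 (φ t) 0))
    (hinv : ∀ t, 0 ≤ t → ∀ x ∈ X1, fderiv 𝕜 (φ t) 0 x ∈ X1)
    -- the spectral conditions at time `τ`
    (τ : ℝ) (hτ : 0 < τ) (ℓ : ℕ) (hℓ : 1 ≤ ℓ) (hℓr : (ℓ : WithTop ℕ∞) < r)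
    (A : X →L[𝕜] X) (hA : A = fderiv 𝕜 (φ τ) 0)
    (A0 : X0 →L[𝕜] X0) (hA0 : A0 = diagBlock hX A)
    (A1 : X1 →L[𝕜] X1) (hA1 : A1 = diagBlock hX.symm A)
    (hspec : cSpectrum 𝕜 A ⊆ Metric.ball (0 : ℂ) 1)
    (hgap : cSpectrum 𝕜 (Ring.inverse A0) * cSpectrum 𝕜 A ^ (ℓ + 1) ⊆ Metric.ball (0 : ℂ) 1)
    (hnonres : ∀ n j : ℕ, 2 ≤ n → n ≤ ℓ → 1 ≤ j → j ≤ n →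
      (cSpectrum 𝕜 A0 ^ (n - j) * cSpectrum 𝕜 A1 ^ j) ∩ cSpectrum 𝕜 A0 = ∅)
    -- joint continuity of the derivatives along `X0`, at the points of `[0,∞) × {0}`
    (hcont : ∀ i : ℕ, i ≤ ℓ + 1 → ∀ t : ℝ, 0 ≤ t →
      ContinuousWithinAt
        (fun p : ℝ × X0 => iteratedFDeriv 𝕜 i (fun y : X0 => φ p.1 (y : X)) p.2)
        {p : ℝ × X0 | (p.1, (p.2 : X)) ∈ D} (t, 0)) :
    -- existence
    (∃ (U V : Set X) (π : X → X0) (ϑ : ℝ → X0 → X0),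
      IsSolution X0 X1 D φ r U V π ϑ ∧ IsSubmersionOn (𝕜 := 𝕜) π U ∧
      -- joint smoothness of the extension of `ϑ` to a local flow
      (∀ k : WithTop ℕ∞, k ≤ r →
        ContDiffOn ℝ k (fun p : ℝ × X0 => φ p.1 (p.2 : X)) {p : ℝ × X0 | (p.1, (p.2 : X)) ∈ D} →
        ∃ (E : Set (ℝ × X0)) (Θ : ℝ → X0 → X0),
          IsLocalFlowExtension (π '' V) ϑ E Θ ∧
          ContDiffOn ℝ k (fun p : ℝ × X0 => Θ p.1 p.2) E) ∧
      (r ≠ ω → FiniteDimensional 𝕜 X0 →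
        (∀ y : X0, ContinuousOn (fun t : ℝ => φ t (y : X)) {t : ℝ | (t, (y : X)) ∈ D}) →
        ∃ (E : Set (ℝ × X0)) (Θ : ℝ → X0 → X0),
          IsLocalFlowExtension (π '' V) ϑ E Θ ∧
          ContDiffOn ℝ r (fun p : ℝ × X0 => Θ p.1 p.2) E)) ∧
    -- linearization, in the absence of internal resonances
    ((∀ n : ℕ, 2 ≤ n → n ≤ ℓ → cSpectrum 𝕜 A0 ^ n ∩ cSpectrum 𝕜 A0 = ∅) →
      ∃ (U V : Set X) (π : X → X0) (T : ℝ → X0 ≃L[𝕜] X0),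
        IsSolution X0 X1 D φ r U V π (fun t y => T t y) ∧ IsSubmersionOn (𝕜 := 𝕜) π U ∧
        (∀ y, T 0 y = y) ∧ (∀ s t y, T (t + s) y = T t (T s y)) ∧
        (∀ k : WithTop ℕ∞, k ≤ r →
          ContDiffOn ℝ k (fun p : ℝ × X0 => φ p.1 (p.2 : X))
            {p : ℝ × X0 | (p.1, (p.2 : X)) ∈ D} →
          ContDiff ℝ k (fun p : ℝ × X0 => T p.1 p.2)) ∧
        (r ≠ ω → FiniteDimensional 𝕜 X0 →
          (∀ y : X0, ContinuousOn (fun t : ℝ => φ t (y : X)) {t : ℝ | (t, (y : X)) ∈ D}) →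
          ContDiff ℝ r (fun p : ℝ × X0 => T p.1 p.2))) ∧
    -- uniqueness
    (∀ k : WithTop ℕ∞, ((ℓ + 1 : ℕ) : WithTop ℕ∞) ≤ k → k ≤ r → (r = ω → k = ω) →
      ∀ (U V : Set X) (π : X → X0) (ϑ : ℝ → X0 → X0)
        (U' V' : Set X) (π' : X → X0) (ϑ' : ℝ → X0 → X0),
        IsSolution X0 X1 D φ k U V π ϑ → IsSolution X0 X1 D φ k U' V' π' ϑ' →
        ∃ (θ : X0 → X0) (N : Set X0),
          IsOpen N ∧ (0 : X0) ∈ N ∧ θ 0 = 0 ∧ IsCbDiffeoOn 𝕜 k θ N ∧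
          -- `π' = θ ∘ π` near `0`
          (∃ W : Set X, IsOpen W ∧ (0 : X) ∈ W ∧ W ⊆ U ∩ U' ∧
            ∀ x ∈ W, π x ∈ N ∧ π' x = θ (π x)) ∧
          -- `ϑ'_t = θ ∘ ϑ_t ∘ θ⁻¹` near `0`, for all `t ≥ 0`
          (∃ M : Set X0, IsOpen M ∧ (0 : X0) ∈ M ∧ M ⊆ N ∩ π '' V ∧ θ '' M ⊆ π' '' V' ∧
            ∀ t, 0 ≤ t → ∀ y ∈ M, ϑ t y ∈ N ∧ ϑ' t (θ y) = θ (ϑ t y)) ∧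
          -- the same for all `t ∈ ℝ`, if both are extended to local flows
          (∀ (E E' : Set (ℝ × X0)) (Θ Θ' : ℝ → X0 → X0),
            IsLocalFlowExtension (π '' V) ϑ E Θ → IsLocalFlowExtension (π' '' V') ϑ' E' Θ' →
            ∀ t : ℝ, ∀ᶠ y in 𝓝 (0 : X0), (t, y) ∈ E ∧ (t, θ y) ∈ E' ∧ Θ t y ∈ N ∧
              Θ' t (θ y) = θ (Θ t y)) ∧
          -- `θ` is unique as a germ at `0`
          (∀ θ' : X0 → X0, (∀ᶠ x in 𝓝 (0 : X), π' x = θ' (π x)) → θ' =ᶠ[𝓝 0] θ) ∧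
          -- linear reduced dynamics are linearly conjugate, in the absence of internal resonances
          ((∀ n : ℕ, 2 ≤ n → n ≤ ℓ → cSpectrum 𝕜 A0 ^ n ∩ cSpectrum 𝕜 A0 = ∅) →
            (∀ t, 0 ≤ t → ∃ L : X0 →L[𝕜] X0, EqOn (ϑ t) L (π '' V)) →
            (∀ t, 0 ≤ t → ∃ L : X0 →L[𝕜] X0, EqOn (ϑ' t) L (π' '' V')) →
            ∃ L : X0 ≃L[𝕜] X0, θ =ᶠ[𝓝 0] L)) := by
  subst hA0 hA1 hA
  have hc0 : CompleteSpace X0 := SlowFoliation.completeSpace_of_isTopCompl hX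
  have hℓr' := SlowFoliation.natCast_succ_le_of_lt hℓr
  have hr1 : (1 : WithTop ℕ∞) ≤ r := le_trans (by exact_mod_cast Nat.le_add_left 1 ℓ) hℓr'
  obtain ⟨ρ, hstab, hD⟩ := SlowFoliation.exists_stableSemiflow hr hr1 hφ hstable hO h0O hsmooth hT
    hτ (SlowFoliation.tendsto_norm_pow_zero _ hspec)
  obtain ⟨G, hG⟩ := SlowFoliation.exists_isSlowLinearization hX hT hinv
    (fun t ht => hstab.hasFDerivAt_zero hr1 ht) hstab.pos hD fun t ht =>
      SlowFoliation.continuousWithinAt_fderiv_of_iterated (f := fun p : ℝ × X0 => fun y : X0 =>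
        φ p.1 (y : X)) (g := fun p => p.2) (hcont 1 (by omega) t ht)
  have hs := SlowFoliation.slowSplitting_of_spectrum hX (hinv τ hτ.le) (hG.block τ hτ.le) hspec
    hgap hnonres
  refine ⟨SlowFoliation.exists_solution hr hτ hℓ hℓr' hstab hD hG hs, fun hres => ?_,
    fun k hℓk hkr hkω U V π ϑ U' V' π' ϑ' h h' => ?_⟩
  · obtain ⟨U, V, π, h1, h2⟩ := SlowFoliation.exists_linear_solution hr hτ hℓ hℓr' hstab hD hG hs
      (fun n hn hnℓ => SlowFoliation.blockNonresonant_zero hnonres hres hn hnℓ) hres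
    exact ⟨U, V, π, SlowFoliation.expGroup G, h1, h2, SlowFoliation.expGroup_zero G,
      SlowFoliation.expGroup_add G, fun _ _ _ => SlowFoliation.contDiff_expGroup G,
      fun _ _ _ => SlowFoliation.contDiff_expGroup G⟩
  · have hk : (RCLike.I : 𝕜) = 0 ↔ k ≠ ω := by
      rw [hr, not_iff_not]
      exact ⟨hkω, fun h => top_le_iff.1 (h ▸ hkr)⟩
    rw [← hG.block τ hτ.le]
    exact SlowFoliation.solution_unique hτ hℓ hℓr' hstab hs hk hℓk h h'
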